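/- **Setting.** Let $\epsilon>0$, let $c_1,\dots,c_P$ be nonzero complex numbers with $\sum_{p=1}^P(c_p+c_p^*)=0$, let $z_1,\dots,z_P\in\mathbb{C}$ satisfy $\mathrm{Im}\,z_p>0$ and $\mathrm{Re}\,z_1<\dots<\mathrm{Re}\,z_P$, and let $$u_0(x)=\sum_{p=1}^P\frac{c_p}{x-z_p}+\mathrm{c.c.},\qquad x\in\mathbb{R}.$$ For $\lambda,w_0\in\mathbb{C}$ consider, for boundary values on $\mathbb{R}$ of functions $w$ analytic in the upper half-plane, the equation $$i\epsilon\frac{dw}{dx}+\lambda(w-w_0)=-\mathcal{C}^+[u_0w],\qquad \mathcal{C}^+[\varphi](x)=\lim_{\delta\downarrow0}\frac1{2\pi i}\int_{\mathbb{R}}\frac{\varphi(y)\,dy}{y-(x+i\delta)}.\tag{1}$$ * For $\lambda>0$, the Jost solution $M(x;\lambda)=W_+(x;\lambda)$ is the solution of (1) with $w_0=1$ that is analytic and bounded for $\mathrm{Im}\,x>0$, continuous for $\mathrm{Im}\,x\ge0$, and tends to $1$ as $x\to-\infty$. * An eigenvalue is a number $\lambda<0$ for which (1) with $w_0=0$ has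 a nontrivial solution in the Hardy space $\mathbb{H}^+(\mathbb{R})$ (an eigenfunction). Let $h(x;\lambda)=\lambda x+f(x)$ with $$f(x)=\sum_{p=1}^P\Big[c_p\big(\mathrm{Log}(i(x-z_p))+\tfrac{\pi i}2\big)+c_p^*\big(\mathrm{Log}(-i(x-z_p^*))-\tfrac{\pi i}2\big)\Big]$$ (principal logarithms), which is analytic on the complement $G$ of the vertical half-lines going up from the $z_p$ and down from the $z_p^*$. For $m=1,\dots,P$ let $U_m^<$ be a contour in $G$ that comes from $i\infty$ to the left of all the cuts and returns to $i\infty$ between the cuts of $z_m$ and $z_{m+1}$ (to the right of all the cuts if $m=P$); let $\ell_0(x)$ be a contour in $G$ from $i\infty$ to the left of all the cuts to $x$. Let $C_m^<=\ell_0(z_m)$ if $ic_m/\epsilon$ is a strictly negative integer, and $C_m^<=U_m^<$ otherwise. For $\lambda<0$ put $$A^<_{mp}(\lambda)=\int_{C_m^<}\frac{e^{-ih(z;\lambda)/\epsilon}}{z-z_p}\,dz,\qquad b^<_m(\lambda)=-\lambda\int_{C_m^<}e^{-ih(z;\lambda)/\epsilon}\,dz .$$ **Statement.** For every $\lambda>0$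 the Jost solution $M(\cdot;\lambda)$ exists and is unique. For every $x$ with $\mathrm{Im}\,x\ge0$ there is a meromorphic function $\lambda\mapsto W(x;\lambda)$ on $\mathbb{C}\setminus[0,\infty)$, unique as a meromorphic function, whose boundary value on $(0,\infty)$ from $\mathrm{Im}\,\lambda>0$ is $M(x;\lambda)$. It is analytic except at the eigenvalues. For each eigenvalue $\lambda_j$: * there is exactly one vector $\boldsymbol\phi=(\phi_1,\dots,\phi_P)^{\mathsf T}$ with $\mathbf{A}^<(\lambda_j)\boldsymbol\phi=\mathbf 0$ and $\sum_p\phi_p=\lambda_j$; * there is an eigenfunction $\Phi_j$ for $\lambda_j$, analytic for $\mathrm{Im}\,x>0$ and continuous for $\mathrm{Im}\,x\ge0$, with $x\Phi_j(x)\to1$ as $|x|\to\infty$ uniformly for $\mathrm{Im}\,x\ge0$, and given for $x\in G$ with $\mathrm{Im}\,x\ge0$ by $$\Phi_j(x)=-\frac i\epsilon e^{ih(x;\lambda_j)/\epsilon}\int_{\ell_0(x)}e^{-ih(z;\lambda_j)/\epsilon}\sum_{p=1}^P\frac{\phi_p}{z-z_p}\,dz;$$ * the matrix $\mathbf{A}^<(\lambda_j)$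 has a nonzero left nullvector $\mathbf m$, every such $\mathbf m$ satisfies $\mathbf m^{\mathsf T}\mathbf b^<(\lambda_j)\ne0$, and for every such $\mathbf m$ and every $x$ with $\mathrm{Im}\,x\ge0$, as $\lambda\to\lambda_j$, $$W(x;\lambda)=-i\epsilon\frac{\Phi_j(x)}{\lambda-\lambda_j}+(x+\gamma_j)\Phi_j(x)+O(\lambda-\lambda_j),$$ where $$\gamma_j=\Gamma_j:=-\frac{i\epsilon}{2\lambda_j}-\frac1{2\lambda_j}\sum_{p=1}^Pz_p\phi_p-\frac{i\epsilon}2\,\frac{\mathbf m^{\mathsf T}{\mathbf b^<}'(\lambda_j)}{\mathbf m^{\mathsf T}\mathbf b^<(\lambda_j)};$$ * in particular $W(x;\cdot)$ has a simple pole at $\lambda_j$ for every such $x$ with $\Phi_j(x)\neq0$. -/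

import Mathlib

open Complex Filter Topology MeasureTheory Set
open scoped ComplexConjugate Matrix

noncomputable section

namespace BOScattering

/-- The open upper half-plane of the space variable. -/
def upper : Set ℂ := {x | 0 < x.im}

/-- The closed upper half-plane of the space variable. -/
def closedUpper : Set ℂ := {x | 0 ≤ x.im}

/-- The spectral plane cut along the closed half-line `[0, ∞)`. -/
def cutPlane : Set ℂ := {μ | μ.im ≠ 0 ∨ μ.re < 0}

/-- The real rational potential `u₀(x) = ∑ₚ cₚ / (x - zₚ) + c.c.` (as a complex number). -/
def potential {P : ℕ} (c z : Fin P → ℂ) (x : ℝ) : ℂ :=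
  (∑ p, c p / ((x : ℂ) - z p)) + conj (∑ p, c p / ((x : ℂ) - z p))

/-- `L` is the value at the real point `x` of the Cauchy operator `𝒞⁺` applied to `φ`: the limit
as `δ ↓ 0` of the Cauchy integral of `φ` at `x + iδ`. -/
def HasCauchyPlus (φ : ℝ → ℂ) (x : ℝ) (L : ℂ) : Prop :=
  Tendsto (fun δ : ℝ => 1 / (2 * (Real.pi : ℂ) * I) *
      ∫ y : ℝ, φ y / ((y : ℂ) - ((x : ℂ) + (δ : ℂ) * I)))
    (𝓝[>] 0) (𝓝 L)

/-- The projected spectral problem `iε w' + μ (w - w₀) = - 𝒞⁺[u₀ w]` on the real line,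
for the boundary values of `w`. -/
def SolvesSpectral {P : ℕ} (ε : ℝ) (c z : Fin P → ℂ) (μ w₀ : ℂ) (w : ℂ → ℂ) : Prop :=
  ∀ x : ℝ, ∃ w' : ℂ, HasDerivAt (fun s : ℝ => w (s : ℂ)) w' x ∧
    HasCauchyPlus (fun y : ℝ => potential c z y * w (y : ℂ)) x
      (-(I * (ε : ℂ) * w' + μ * (w (x : ℂ) - w₀)))

/-- `w` is the Jost solution `M(·; lam) = W₊(·; lam)`: analytic and bounded in the upper half-plane,
continuous up to the real line, a solution with `w₀ = 1`, and tending to `1` as `x → -∞`. -/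
structure IsJostM {P : ℕ} (ε : ℝ) (c z : Fin P → ℂ) (lam : ℝ) (w : ℂ → ℂ) : Prop where
  continuousOn : ContinuousOn w closedUpper
  differentiableOn : DifferentiableOn ℂ w upper
  bounded : ∃ C : ℝ, ∀ x ∈ closedUpper, ‖w x‖ ≤ C
  solves : SolvesSpectral ε c z lam 1 w
  tendsto_one : Tendsto (fun x : ℝ => w (x : ℂ)) atBot (𝓝 1)

/-- `w` belongs to the Hardy space `ℍ⁺` of the upper half-plane. As all members considered here are
solutions of the spectral problem, hence differentiable on the real line, their analytic extensions
are continuous up to the real line, and this is made part of the definition; the elements of `ℍ⁺`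
are thereby honest functions on the closed upper half-plane. -/
structure MemHardy (w : ℂ → ℂ) : Prop where
  continuousOn : ContinuousOn w closedUpper
  differentiableOn : DifferentiableOn ℂ w upper
  bounded : ∃ C : NNReal, ∀ y : ℝ, 0 ≤ y →
    ∫⁻ x : ℝ, ‖w ((x : ℂ) + (y : ℂ) * I)‖ₑ ^ 2 ≤ (C : ENNReal)

/-- `Φ` is an eigenfunction for `lam`: a nontrivial solution in `ℍ⁺` with `w₀ = 0`. -/
structure IsEigenfunction {P : ℕ} (ε : ℝ) (c z : Fin P → ℂ) (lam : ℝ) (Φ : ℂ → ℂ) : Prop where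
  memHardy : MemHardy Φ
  nontrivial : ∃ x ∈ closedUpper, Φ x ≠ 0
  solves : SolvesSpectral ε c z lam 0 Φ

/-- The set of the eigenvalues `λ_j < 0`. -/
def eigenvalues {P : ℕ} (ε : ℝ) (c z : Fin P → ℂ) : Set ℝ :=
  {lam | lam < 0 ∧ ∃ Φ : ℂ → ℂ, IsEigenfunction ε c z lam Φ}

/-- The normalization `x Φ(x) → 1` as `|x| → ∞`, uniformly for `Im x ≥ 0`. -/
def IsNormalized (Φ : ℂ → ℂ) : Prop :=
  Tendsto (fun x : ℂ => x * Φ x) (Bornology.cobounded ℂ ⊓ 𝓟 closedUpper) (𝓝 1)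

/-- The antiderivative `f` of `u₀`, with principal logarithms. The complex conjugate is that of a
function of a real variable, continued analytically, so that `f (conj x) = conj (f x)`. -/
def f {P : ℕ} (c z : Fin P → ℂ) (x : ℂ) : ℂ :=
  ∑ p, (c p * (log (I * (x - z p)) + (Real.pi : ℂ) * I / 2)
    + conj (c p) * (log (-I * (x - conj (z p))) - (Real.pi : ℂ) * I / 2))

/-- The domain of analyticity `G` of `f`: the plane without the vertical half-lines going up from
the points `zₚ` and down from their conjugates. -/
def G {P : ℕ} (z : Fin P → ℂ) : Set ℂ :=
  {x | ∀ p, ¬ (x.re = (z p).re ∧ (z p).im ≤ |x.im|)}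

/-- `h(x; μ) = μ x + f(x)`. -/
def h {P : ℕ} (c z : Fin P → ℂ) (μ x : ℂ) : ℂ := μ * x + f c z x

/-- The integral of `g` along the vertical half-line from the real point `s` up to `s + i∞`. -/
def rayInt (g : ℂ → ℂ) (s : ℝ) : ℂ :=
  ∫ t in Ioi (0 : ℝ), g ((s : ℂ) + (t : ℂ) * I) * I

/-- The integral of `g` along a contour `ℓ₀(x)`: from `s + i∞` down to `s`, along the real line to
`Re x`, and vertically to `x`. For `s < Re z₁` it comes from infinity in `G₀`, and
for `x` in `G` it lies in `G`. -/
def ellInt (g : ℂ → ℂ) (s : ℝ) (x : ℂ) : ℂ :=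
  -rayInt g s + (∫ t in s..x.re, g (t : ℂ)) + ∫ t in (0 : ℝ)..x.im, g ((x.re : ℂ) + (t : ℂ) * I) * I

/-- The integral of `g` along the contour from `s + i∞` down to `s`, along the real line to `t`, and
up to `t + i∞`. It is a contour `U_m^<` when `s + i∞` is in `G₀` and `t + i∞` is in `G_m`. -/
def UInt (g : ℂ → ℂ) (s t : ℝ) : ℂ :=
  -rayInt g s + (∫ r in s..t, g (r : ℂ)) + rayInt g t

open Classical in
/-- The integral along `C_m^<`: the contour `ℓ₀(z_m)` if `i c_m / ε` is a strictly negative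
integer, and `U_m^<` otherwise. The numbers `a` interlace the real parts of the `zₚ`: `a 0` lies
to the left of all of them, and (numbering from `0`) `a m.succ` lies right after that of `z m`. -/
def CInt {P : ℕ} (ε : ℝ) (c z : Fin P → ℂ) (a : Fin (P + 1) → ℝ) (m : Fin P) (g : ℂ → ℂ) : ℂ :=
  if ∃ n : ℕ, 0 < n ∧ I * c m / (ε : ℂ) = -(n : ℂ) then ellInt g (a 0) (z m)
  else UInt g (a 0) (a m.succ)

/-- The matrix `A^<(lam)`, for `lam < 0`. -/
def matA {P : ℕ} (ε : ℝ) (c z : Fin P → ℂ) (a : Fin (P + 1) → ℝ) (lam : ℝ) :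
    Matrix (Fin P) (Fin P) ℂ :=
  Matrix.of fun m p => CInt ε c z a m fun y => exp (-I * h c z lam y / (ε : ℂ)) / (y - z p)

/-- The vector `b^<(lam)`, for `lam < 0`. -/
def vecb {P : ℕ} (ε : ℝ) (c z : Fin P → ℂ) (a : Fin (P + 1) → ℝ) (lam : ℝ) : Fin P → ℂ :=
  fun m => -(lam : ℂ) * CInt ε c z a m fun y => exp (-I * h c z lam y / (ε : ℂ))

/-- The `lam`-derivative of `b^<`. -/
def vecb' {P : ℕ} (ε : ℝ) (c z : Fin P → ℂ) (a : Fin (P + 1) → ℝ) (lam : ℝ) : Fin P → ℂ :=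
  fun m => deriv (fun t : ℝ => vecb ε c z a t m) lam

/-- The explicit formula for `Φ(x; lam)`, `lam < 0`, in terms of the coefficients `φₚ`, for `x` in
`G` with `Im x ≥ 0`; the path of integration from `-∞` is rotated at infinity into the upper
half-plane, which makes the integral absolutely convergent. -/
def PhiFormula {P : ℕ} (ε : ℝ) (c z : Fin P → ℂ) (a : Fin (P + 1) → ℝ) (lam : ℝ) (φ : Fin P → ℂ)
    (x : ℂ) : ℂ :=
  -(I / (ε : ℂ)) * exp (I * h c z lam x / (ε : ℂ)) *
    ellInt (fun y => exp (-I * h c z lam y / (ε : ℂ)) * ∑ p, φ p / (y - z p)) (a 0) x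

/-- The phase constant `Γ_j`, in terms of the right nullvector `φ` and the left nullvector `m`. -/
def phaseConst {P : ℕ} (ε : ℝ) (c z : Fin P → ℂ) (a : Fin (P + 1) → ℝ) (lam : ℝ)
    (φ m : Fin P → ℂ) : ℂ :=
  -(I * (ε : ℂ)) / (2 * (lam : ℂ)) - 1 / (2 * (lam : ℂ)) * (∑ p, z p * φ p)
    - I * (ε : ℂ) / 2 * ((m ⬝ᵥ vecb' ε c z a lam) / (m ⬝ᵥ vecb ε c z a lam))

end BOScattering

end

/-! For `w` analytic in the upper half-plane, the Cauchy projection of `u w` is `u w` minus its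
principal parts at the poles `z p`. The nonlocal equation is therefore the linear first-order
equation `iεw' + (μ + u)w = μw₀ + ∑ φₚ/(x - zₚ)` with the side conditions `φₚ = cₚ w(zₚ)`
(`hasCauchyPlus`, `realSol_of_solvesSpectral`). As the residues of `u` sum to zero, `u` is `O(x⁻²)`
and its antiderivative is bounded, so the integrating factor has size `exp(Im(μx)/ε)` up to
constants. Integration from infinity in a direction `d` with `Im(μd) ≤ 0` selects one solution
`wsol` for each `(w₀, φ)`, off the half-lines below the poles. The directions `-1`, `1` and `I`
serve the upper, lower and left half-planes of the spectral parameter; `-1` also reaches the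
positive half-line.

This solution extends analytically over the half-plane when one linear condition per pole holds, and
then `cₚ w(zₚ) = φₚ` is automatic (`glue`); conversely every solution of the problem satisfies the
conditions (`RealSol.row_eq_zero`). They form a system `Mat d μ *ᵥ φ = w₀ • vec d μ` whose entries
are analytic in `μ`. The kernel is controlled by integrating the derivative of `w w̄` over the real
line: the real potential drops out, and the source terms are evaluated by closing contours in the
upper half-plane. For real `λ` and decaying `w` one finds `∫|w|² = -2π|∑ φₚ|²/(ελ)`
(`GlobalSol.tendsto_norm_sq`). Hence the kernel is trivial for nonreal `μ` and for `μ > 0`, and on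
the negative half-line it is nontrivial precisely at the eigenvalues. Cramer's rule gives `W`, and
uniqueness makes the formulas for the three directions agree.

At an eigenvalue the norm identity shows that a null vector has nonzero sum, so the kernel is a
line; a second identity (`GlobalSol.not_one`) shows that `vec` is not in the range. So the rank-one
perturbation `Mat + vec 1ᵀ` is invertible. The vector `ψ(μ)` that it sends to `vec` satisfies `Mat ψ
= τ vec` with `τ = 1 - ∑ ψₚ`, and `W` is the solution with data `(1, 0)` plus `1/τ` times the one
with data `(0, ψ)`. Differentiation in `μ` multiplies the integrands by `y`, and `y ∑ φₚ/(y - zₚ)`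
is again a source of the same form (`mul_src`), so the derivatives of `Mat` and of the solutions are
expressed by the same objects. Pairing with a left null vector gives `τ' = i/(ελ)` and `τ''`, and
these give both Laurent coefficients. Uniqueness of the continuation is boundary uniqueness for
analytic functions, obtained by multiplying a function with its rotations about the centre of a
square (`eq_zero_of_eq_zero_on_bottom`). -/

noncomputable section
namespace BOScattering

/-! ### Differentiation under the integral sign, primitives and connectedness -/

/-- Differentiation under the integral sign for a dominated holomorphic family. -/
theorem hasDerivAt_integral_of_holomorphic {α : Type*} [MeasurableSpace α] {ν : Measure α}
    {F : ℂ → α → ℂ} {x₀ : ℂ} {r : ℝ} (hr : 0 < r) {bound : α → ℝ} (hint : Integrable bound ν)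
    (hmeas : ∀ x ∈ Metric.ball x₀ r, AEStronglyMeasurable (F x) ν)
    (hdiff : ∀ᵐ t ∂ν, DifferentiableOn ℂ (fun x => F x t) (Metric.ball x₀ r))
    (hb : ∀ᵐ t ∂ν, ∀ x ∈ Metric.ball x₀ r, ‖F x t‖ ≤ bound t) :
    Integrable (fun t => deriv (fun x => F x t) x₀) ν ∧
    HasDerivAt (fun x => ∫ t, F x t ∂ν) (∫ t, deriv (fun x => F x t) x₀ ∂ν) x₀ := by
  have hr2 : 0 < r / 2 := by positivity
  have hsub : ∀ x ∈ Metric.ball x₀ (r/2), Metric.closedBall x (r/4) ⊆ Metric.ball x₀ r := by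
    intro x hx y hy
    rw [Metric.mem_ball] at *
    rw [Metric.mem_closedBall] at hy
    linarith [dist_triangle y x x₀]
  have hd : ∀ᵐ t ∂ν, ∀ x ∈ Metric.ball x₀ (r/2),
      HasDerivAt (fun x => F x t) (deriv (fun x => F x t) x) x := by
    filter_upwards [hdiff] with t ht x hx
    refine (ht.differentiableAt (Metric.isOpen_ball.mem_nhds ?_)).hasDerivAt
    exact Metric.ball_subset_ball (by linarith) hx
  -- Cauchy's estimate on discs of radius `r/4` about points of the ball of radius `r/2` turns the
  -- bound on the family into a bound on its derivative.
  refine hasDerivAt_integral_of_dominated_loc_of_deriv_le (bound := fun t => bound t / (r/4))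
    (Metric.ball_mem_nhds x₀ hr2) ?_ ?_ ?_ ?_ (hint.div_const _) hd
  · filter_upwards [Metric.ball_mem_nhds x₀ hr] with x hx using hmeas x hx
  · refine hint.mono' (hmeas _ (Metric.mem_ball_self hr)) ?_
    filter_upwards [hb] with t ht using ht _ (Metric.mem_ball_self hr)
  -- The derivative is measurable in `t` as the limit of difference quotients along a sequence.
  · have h1 : Tendsto (fun n : ℕ => x₀ + ((r/2) / (n + 1) : ℝ)) atTop (𝓝[≠] x₀) := by
      rw [tendsto_nhdsWithin_iff]
      constructor
      · have : Tendsto (fun n : ℕ => ((r/2) / ((n:ℝ) + 1))) atTop (𝓝 0) := by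
          simpa using (tendsto_one_div_add_atTop_nhds_zero_nat (𝕜 := ℝ)).const_mul (r/2) |>.congr
            (fun n => by ring)
        have h2 := (continuous_ofReal.tendsto 0).comp this
        simpa using h2.const_add x₀
      · refine Eventually.of_forall fun n => ?_
        have : (0:ℝ) < (r/2) / (n + 1) := by positivity
        simp only [mem_compl_iff, mem_singleton_iff, add_eq_left]
        exact_mod_cast this.ne'
    refine aestronglyMeasurable_of_tendsto_ae atTop
      (f := fun n : ℕ => fun t => slope (fun x => F x t) x₀ (x₀ + ((r/2) / (n + 1) : ℝ))) ?_ ?_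
    · intro n
      have hn : x₀ + ((r/2) / (n + 1) : ℝ) ∈ Metric.ball x₀ r := by
        rw [Metric.mem_ball, dist_eq_norm, add_sub_cancel_left, norm_real, Real.norm_eq_abs,
          abs_of_pos (by positivity)]
        have : (r/2) / ((n:ℝ) + 1) ≤ r / 2 := div_le_self hr2.le (by linarith [n.cast_nonneg (α := ℝ)])
        linarith
      simp only [slope_def_field, div_eq_mul_inv]
      exact ((hmeas _ hn).sub (hmeas _ (Metric.mem_ball_self hr))).mul_const _
    · filter_upwards [hd] with t ht
      exact (hasDerivAt_iff_tendsto_slope.mp (ht x₀ (Metric.mem_ball_self hr2))).comp h1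
  · filter_upwards [hb, hdiff] with t ht hdt x hx
    refine Complex.norm_deriv_le_of_forall_mem_sphere_norm_le (by positivity)
      ((hdt.mono (hsub x hx)).diffContOnCl_ball subset_rfl) ?_
    intro y hy
    exact ht y (hsub x hx (Metric.sphere_subset_closedBall hy))

theorem differentiableOn_integral_of_holomorphic {α : Type*} [MeasurableSpace α] {ν : Measure α}
    {F : ℂ → α → ℂ} {U : Set ℂ} (hU : IsOpen U) {bound : α → ℝ} (hint : Integrable bound ν)
    (hmeas : ∀ x ∈ U, AEStronglyMeasurable (F x) ν)
    (hdiff : ∀ᵐ t ∂ν, DifferentiableOn ℂ (fun x => F x t) U)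
    (hb : ∀ᵐ t ∂ν, ∀ x ∈ U, ‖F x t‖ ≤ bound t) :
    DifferentiableOn ℂ (fun x => ∫ t, F x t ∂ν) U := by
  intro x hx
  obtain ⟨r, hr, hs⟩ := Metric.isOpen_iff.mp hU x hx
  refine (hasDerivAt_integral_of_holomorphic hr hint (fun y hy => hmeas y (hs hy)) ?_ ?_
    ).2.differentiableAt.differentiableWithinAt
  · filter_upwards [hdiff] with t ht using ht.mono hs
  · filter_upwards [hb] with t ht y hy using ht y (hs hy)

/-- A holomorphic function on a convex open set has a primitive. -/
theorem exists_primitive_of_convex {U : Set ℂ} (hU : IsOpen U) (hc : Convex ℝ U) {k : ℂ → ℂ}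
    (hk : DifferentiableOn ℂ k U) : ∃ Q : ℂ → ℂ, ∀ x ∈ U, HasDerivAt Q (k x) x := by
  rcases U.eq_empty_or_nonempty with rfl | ⟨p, hp⟩
  · exact ⟨0, fun x hx => hx.elim⟩
  -- The primitive is the integral along the segment from `p` to `x`.
  refine ⟨fun x => (x - p) * ∫ t in Icc (0:ℝ) 1, k (p + t * (x - p)), fun x hx => ?_⟩
  have hmem : ∀ y ∈ U, ∀ t ∈ Icc (0:ℝ) 1, p + t * (y - p) ∈ U := by
    intro y hy t ht
    have := hc.add_smul_sub_mem hp hy ht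
    simpa using this
  obtain ⟨r, hr, hs⟩ := Metric.isOpen_iff.mp hU x hx
  have hsc : Metric.closedBall x (r/2) ⊆ U :=
    (Metric.closedBall_subset_ball (by linarith)).trans hs
  have hK : IsCompact ((fun q : ℂ × ℝ => p + q.2 * (q.1 - p)) ''
      (Metric.closedBall x (r/2) ×ˢ Icc (0:ℝ) 1)) :=
    ((isCompact_closedBall _ _).prod isCompact_Icc).image (by fun_prop)
  have hKU : ((fun q : ℂ × ℝ => p + q.2 * (q.1 - p)) ''
      (Metric.closedBall x (r/2) ×ˢ Icc (0:ℝ) 1)) ⊆ U := by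
    rintro _ ⟨q, hq, rfl⟩
    exact hmem _ (hsc hq.1) _ hq.2
  obtain ⟨C, hC⟩ := hK.exists_bound_of_continuousOn (hk.continuousOn.mono hKU)
  have hbs : Metric.ball x (r/2) ⊆ U := Metric.ball_subset_closedBall.trans hsc
  have hlin : ∀ t : ℝ, ∀ y : ℂ, HasDerivAt (fun y : ℂ => p + t * (y - p)) t y := fun t y => by
    simpa using (((hasDerivAt_id y).sub_const p).const_mul (t:ℂ)).const_add p
  have hdk : ∀ y ∈ U, HasDerivAt k (deriv k y) y := fun y hy =>
    (hk.differentiableAt (hU.mem_nhds hy)).hasDerivAt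
  have key := hasDerivAt_integral_of_holomorphic (ν := volume.restrict (Icc (0:ℝ) 1))
    (F := fun y t => k (p + t * (y - p))) (x₀ := x) (r := r/2) (by positivity)
    (bound := fun _ => C) (integrable_const C) ?_ ?_ ?_
  · have hder : ∀ t ∈ Icc (0:ℝ) 1, deriv (fun y => k (p + t * (y - p))) x
        = deriv k (p + t * (x - p)) * t := fun t ht =>
      ((hdk _ (hmem x hx t ht)).comp x (hlin t x)).deriv
    have h2 := ((hasDerivAt_id x).sub_const p).mul key.2
    refine h2.congr_deriv ?_
    have hik : IntervalIntegrable (fun t : ℝ => k (p + t * (x - p))) volume 0 1 := by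
      apply ContinuousOn.intervalIntegrable
      rw [uIcc_of_le zero_le_one]
      exact hk.continuousOn.comp (by fun_prop) (fun t ht => hmem x hx t ht)
    have hik' : IntervalIntegrable (fun t : ℝ => deriv (fun y => k (p + t * (y - p))) x) volume 0 1 := by
      rw [intervalIntegrable_iff_integrableOn_Icc_of_le zero_le_one]
      exact key.1
    -- The integrand is the `t`-derivative of `t * k (p + t * (x - p))`.
    have hftc : ∫ t in (0:ℝ)..1, (k (p + t * (x - p)) +
        (x - p) * deriv (fun y => k (p + t * (y - p))) x) = k x := by
      have := intervalIntegral.integral_eq_sub_of_hasDerivAt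
        (f := fun t : ℝ => (t:ℂ) * k (p + t * (x - p)))
        (f' := fun t : ℝ => (k (p + t * (x - p)) +
        (x - p) * deriv (fun y => k (p + t * (y - p))) x)) (a := 0) (b := 1) ?_
        (hik.add (hik'.const_mul _))
      · rw [this]; simp
      · intro t ht
        rw [uIcc_of_le zero_le_one] at ht
        rw [hder t ht]
        have h3 : HasDerivAt (fun s : ℝ => p + s * (x - p)) (x - p) t := by
          simpa using ((ofRealCLM.hasDerivAt (x := t)).mul_const (x - p)).const_add p
        have h4 := (hdk _ (hmem x hx t ht)).comp t h3
        have h5 := (ofRealCLM.hasDerivAt (x := t)).mul h4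
        refine h5.congr_deriv ?_
        simp; ring
    rw [intervalIntegral.integral_add hik (hik'.const_mul _),
      intervalIntegral.integral_const_mul, intervalIntegral.integral_of_le zero_le_one,
      intervalIntegral.integral_of_le zero_le_one, ← integral_Icc_eq_integral_Ioc,
      ← integral_Icc_eq_integral_Ioc] at hftc
    rw [← hftc]; simp
  · intro y hy
    refine (ContinuousOn.aestronglyMeasurable ?_ measurableSet_Icc)
    exact hk.continuousOn.comp (by fun_prop) (fun t ht => hmem y (hbs hy) t ht)
  · refine (ae_restrict_iff' measurableSet_Icc).mpr (Eventually.of_forall fun t ht => ?_)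
    exact hk.comp (by fun_prop) (fun y hy => hmem y (hbs hy) t ht)
  · refine (ae_restrict_iff' measurableSet_Icc).mpr (Eventually.of_forall fun t ht y hy => ?_)
    exact hC _ ⟨(y, t), ⟨Metric.ball_subset_closedBall hy, ht⟩, rfl⟩

/-- A set closed under upward translations whose part above some height is convex is
preconnected. -/
theorem isPreconnected_of_up {S : Set ℂ} {H : ℝ} (hconv : Convex ℝ (S ∩ {x | H < x.im}))
    (hup : ∀ x ∈ S, ∀ t : ℝ, 0 ≤ t → x + t * I ∈ S) : IsPreconnected S := by
  rcases S.eq_empty_or_nonempty with rfl | ⟨p, hp⟩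
  · exact isPreconnected_empty
  have hmem : ∀ x ∈ S, x + (max 0 (H - x.im) + 1 : ℝ) * I ∈ S ∩ {x | H < x.im} := by
    intro x hx
    refine ⟨hup x hx _ (by positivity), ?_⟩
    simp only [mem_ofPred_eq, add_im, mul_im, ofReal_re, I_im, mul_one, ofReal_im, I_re, mul_zero,
      add_zero]
    linarith [le_max_right 0 (H - x.im)]
  refine isPreconnected_of_forall (p + (max 0 (H - p.im) + 1 : ℝ) * I) fun y hy => ?_
  -- A vertical segment joins an arbitrary point of `S` to the convex part.
  refine ⟨(S ∩ {x | H < x.im}) ∪ segment ℝ y (y + (max 0 (H - y.im) + 1 : ℝ) * I), ?_,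
    Or.inl (hmem p hp), Or.inr (left_mem_segment _ _ _), ?_⟩
  · refine union_subset inter_subset_left ?_
    rintro _ ⟨α, β, hα, hβ, hαβ, rfl⟩
    have := hup y hy (β * (max 0 (H - y.im) + 1)) (by positivity)
    convert this using 1
    have hα' : (α:ℂ) = 1 - β := by exact_mod_cast eq_sub_of_add_eq hαβ
    simp only [real_smul, hα']
    push_cast; ring
  · exact (hconv.isPreconnected).union _ (hmem y hy) (right_mem_segment _ _ _)
      (convex_segment _ _).isPreconnected

theorem eqOn_of_hasDerivAt_zero {S : Set ℂ} (hS : IsOpen S) (hp : IsPreconnected S) {f : ℂ → ℂ}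
    (hf : ∀ x ∈ S, HasDerivAt f 0 x) {x y : ℂ} (hx : x ∈ S) (hy : y ∈ S) : f x = f y :=
  hS.is_const_of_deriv_eq_zero hp (fun x hx => (hf x hx).differentiableAt.differentiableWithinAt)
    (fun x hx => (hf x hx).deriv) hx hy

end BOScattering
end

/-! ### Boundary uniqueness and contour integrals in the upper half-plane -/

noncomputable section
namespace BOScattering

/-- A function holomorphic in a square, continuous up to the boundary and zero on the bottom side
vanishes at the centre. -/
theorem eq_zero_of_eq_zero_on_bottom {f : ℂ → ℂ} {p : ℂ} {ρ : ℝ} (hρ : 0 < ρ)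
    (hc : ∀ ζ : ℂ, |ζ.re| ≤ ρ → |ζ.im| ≤ ρ → ContinuousWithinAt f
      {x | |(x - p).re| ≤ ρ ∧ |(x - p).im| ≤ ρ} (p + ζ))
    (hd : ∀ ζ : ℂ, |ζ.re| < ρ → |ζ.im| < ρ → DifferentiableAt ℂ f (p + ζ))
    (h0 : ∀ ζ : ℂ, |ζ.re| ≤ ρ → ζ.im = -ρ → f (p + ζ) = 0) : f p = 0 := by
  set U : Set ℂ := Ioo (-ρ) ρ ×ℂ Ioo (-ρ) ρ with hUdef
  have hcl : closure U = Icc (-ρ) ρ ×ℂ Icc (-ρ) ρ := by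
    rw [hUdef, closure_reProdIm, closure_Ioo (by linarith)]
  have hUo : IsOpen U := isOpen_Ioo.reProdIm isOpen_Ioo
  have hUb : Bornology.IsBounded U := Metric.isBounded_Ioo _ _ |>.reProdIm (Metric.isBounded_Ioo _ _)
  have hcc : ∀ ζ ∈ closure U, |ζ.re| ≤ ρ ∧ |ζ.im| ≤ ρ := by
    intro ζ hζ; rw [hcl] at hζ; exact ⟨abs_le.mpr hζ.1, abs_le.mpr hζ.2⟩
  have hco : ∀ ζ ∈ U, |ζ.re| < ρ ∧ |ζ.im| < ρ := by
    intro ζ hζ; exact ⟨abs_lt.mpr hζ.1, abs_lt.mpr hζ.2⟩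
  have main : ∀ (a : ℂ) (ha : a = 1 ∨ a = I ∨ a = -1 ∨ a = -I),
      DiffContOnCl ℂ (fun ζ => f (p + a * ζ)) U := by
    intro a ha
    have hmap : ∀ ζ : ℂ, ∀ r : ℝ, ((|ζ.re| ≤ r ∧ |ζ.im| ≤ r) → |(a * ζ).re| ≤ r ∧ |(a * ζ).im| ≤ r)
      ∧ ((|ζ.re| < r ∧ |ζ.im| < r) → |(a * ζ).re| < r ∧ |(a * ζ).im| < r) := by
      intro ζ r
      rcases ha with rfl | rfl | rfl | rfl <;> simp <;> tauto
    refine ⟨fun ζ hζ => ?_, fun ζ hζ => ?_⟩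
    · obtain ⟨h1, h2⟩ := (hmap ζ ρ).2 (hco ζ hζ)
      exact ((hd _ h1 h2).comp ζ (f := fun ζ => p + a * ζ) (by fun_prop)).differentiableWithinAt
    · obtain ⟨h1, h2⟩ := (hmap ζ ρ).1 (hcc ζ hζ)
      refine (hc _ h1 h2).comp (t := {x | |(x - p).re| ≤ ρ ∧ |(x - p).im| ≤ ρ})
        (f := fun ζ => p + a * ζ) (by fun_prop) ?_
      intro ξ hξ
      have := (hmap ξ ρ).1 (hcc ξ hξ)
      simpa using this
  -- Every side of the square is a rotation of the bottom side, so this product over the four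
  -- rotations vanishes on the whole frontier. The maximum principle then gives `f p ^ 4 = 0`.
  set q : ℂ → ℂ := fun ζ => f (p + 1 * ζ) * f (p + I * ζ) * f (p + -1 * ζ) * f (p + -I * ζ) with hq
  have hqd : DiffContOnCl ℂ q U := by
    have m1 := main 1 (by simp)
    have m2 := main I (by simp)
    have m3 := main (-1) (by simp)
    have m4 := main (-I) (by simp)
    exact ⟨((m1.1.mul m2.1).mul m3.1).mul m4.1, ((m1.2.mul m2.2).mul m3.2).mul m4.2⟩
  have hz : ‖q 0‖ ≤ 0 := by
    refine Complex.norm_le_of_forall_mem_frontier_norm_le hUb hqd (fun ζ hζ => ?_)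
      (subset_closure ?_)
    · have h1 := hcc ζ (frontier_subset_closure hζ)
      have h2 : ζ ∉ U := by rw [hUo.frontier_eq] at hζ; exact hζ.2
      have h3 : ζ.re = ρ ∨ ζ.re = -ρ ∨ ζ.im = ρ ∨ ζ.im = -ρ := by
        by_contra! hcon
        refine h2 ⟨⟨lt_of_le_of_ne (abs_le.mp h1.1).1 (Ne.symm hcon.2.1),
          lt_of_le_of_ne (abs_le.mp h1.1).2 hcon.1⟩,
          ⟨lt_of_le_of_ne (abs_le.mp h1.2).1 (Ne.symm hcon.2.2.2),
          lt_of_le_of_ne (abs_le.mp h1.2).2 hcon.2.2.1⟩⟩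
      rw [norm_le_zero_iff]
      simp only [hq]
      rcases h3 with h | h | h | h
      · rw [h0 (-I * ζ) (by simpa using h1.2) (by simp [h])]; simp
      · rw [h0 (I * ζ) (by simpa using h1.2) (by simp [h])]; simp
      · rw [h0 (-1 * ζ) (by simpa using h1.1) (by simp [h])]; simp
      · rw [h0 (1 * ζ) (by simpa using h1.1) (by simp [h])]; simp
    · exact ⟨⟨by simpa using hρ, by simpa using hρ⟩, ⟨by simpa using hρ, by simpa using hρ⟩⟩
  have h5 : f p * f p * f p * f p = 0 := by simpa [hq] using norm_le_zero_iff.mp hz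
  simpa using h5

theorem upper_subset_closedUpper : upper ⊆ closedUpper := fun x (hx : 0 < x.im) => hx.le

theorem ofReal_mem_closedUpper (x : ℝ) : (x : ℂ) ∈ closedUpper := by simp [closedUpper]

theorem rect_identity {g : ℂ → ℂ} {s : Set ℂ} (hs : s.Countable)
    (hc : ContinuousOn g closedUpper) (hd : ∀ x ∈ upper \ s, DifferentiableAt ℂ g x)
    {X Y : ℝ} (hY : 0 ≤ Y) :
    ∫ x in (-X)..X, g x = (∫ x in (-X)..X, g (x + Y * I)) - I * (∫ y in (0:ℝ)..Y, g (X + y * I))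
      + I * ∫ y in (0:ℝ)..Y, g (((-X : ℝ) : ℂ) + y * I) := by
  have := integral_boundary_rect_eq_zero_of_differentiable_on_off_countable g ((-X : ℝ) : ℂ)
    (X + Y * I) s hs (hc.mono ?_) ?_
  · simp at this
    push_cast
    linear_combination this
  · intro x hx
    have := hx.2
    simp [uIcc_of_le hY] at this
    exact this.1
  · intro x hx
    refine hd x ⟨?_, hx.2⟩
    have := hx.1.2
    simp [min_eq_left hY] at this
    exact this.1

/-- A version of Jordan's lemma. The part of size `o(1/|z|)` contributes little on each of the three
upper sides of a rectangle. The part that decays only with `Im z` is exponentially small on the top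
and integrates to `O(1/R)` along the vertical sides. This second part is what a plane wave
contributes when the spectral parameter is positive. -/
theorem tendsto_integral_of_upper_decay {g : ℂ → ℂ} {s : Set ℂ} (hs : s.Countable)
    (hc : ContinuousOn g closedUpper) (hd : ∀ x ∈ upper \ s, DifferentiableAt ℂ g x)
    {C k : ℝ} (hC : 0 ≤ C) (hk : 0 < k)
    (hb : ∀ δ > 0, ∃ X : ℝ, ∀ z ∈ closedUpper, X ≤ ‖z‖ →
      ‖z‖ * ‖g z‖ ≤ δ + C * Real.exp (-k * z.im)) :
    Tendsto (fun R : ℝ => ∫ x in (-R)..R, g x) atTop (𝓝 0) := by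
  rw [Metric.tendsto_atTop]
  intro δ₀ hδ₀
  -- The top side, of length `2R`, counts twice and the vertical sides once each, so the total is
  -- `δ₀ / 2` plus the remainder bounded in `hR₁`.
  obtain ⟨X, hX⟩ := hb (δ₀ / 8) (by positivity)
  have h1 : Tendsto (fun R : ℝ => 2 * C * Real.exp (-k * R) + 2 * (C / k) * R⁻¹) atTop (𝓝 0) := by
    have e1 : Tendsto (fun R : ℝ => Real.exp (-k * R)) atTop (𝓝 0) :=
      Real.tendsto_exp_atBot.comp (tendsto_id.const_mul_atTop_of_neg (by linarith))
    simpa using (e1.const_mul (2 * C)).add (tendsto_inv_atTop_zero.const_mul (2 * (C / k)))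
  obtain ⟨R₁, hR₁⟩ := (h1.eventually (gt_mem_nhds (show (0:ℝ) < δ₀ / 4 by positivity))).exists_forall_of_atTop
  refine ⟨max (max X 1) R₁, fun R hR => ?_⟩
  have hRX : X ≤ R := (le_max_left _ _).trans ((le_max_left _ _).trans hR)
  have hR1 : 1 ≤ R := (le_max_right _ _).trans ((le_max_left _ _).trans hR)
  have hR2 := hR₁ R ((le_max_right _ _).trans hR)
  have hR0 : 0 < R := by linarith
  have bound : ∀ z ∈ closedUpper, R ≤ ‖z‖ → ‖g z‖ ≤ (δ₀ / 8 + C * Real.exp (-k * z.im)) / R := by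
    intro z hz hzR
    have := hX z hz (hRX.trans hzR)
    rw [le_div_iff₀ hR0]
    nlinarith [norm_nonneg (g z)]
  rw [dist_zero_right, rect_identity hs hc hd hR0.le]
  have htop : ‖∫ x in (-R)..R, g (x + R * I)‖ ≤ (δ₀ / 8 + C * Real.exp (-k * R)) / R * |R - -R| := by
    refine intervalIntegral.norm_integral_le_of_norm_le_const fun x _ => ?_
    have him : ((x:ℂ) + R * I).im = R := by simp
    have := bound (x + R * I) (by simp [closedUpper, hR0.le])
      (by have := abs_im_le_norm ((x:ℂ) + R * I); rw [him, abs_of_pos hR0] at this; exact this)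
    rwa [him] at this
  have hside : ∀ X' : ℝ, |X'| = R → ‖∫ y in (0:ℝ)..R, g ((X':ℂ) + y * I)‖ ≤ δ₀ / 8 + C / k * R⁻¹ := by
    intro X' hX'
    have hint : IntervalIntegrable (fun y : ℝ => (δ₀ / 8 + C * Real.exp (-k * y)) / R) volume 0 R :=
      (by fun_prop : Continuous (fun y : ℝ => (δ₀ / 8 + C * Real.exp (-k * y)) / R)).intervalIntegrable _ _
    have hle : ‖∫ y in (0:ℝ)..R, g ((X':ℂ) + y * I)‖
        ≤ ∫ y in (0:ℝ)..R, (δ₀ / 8 + C * Real.exp (-k * y)) / R := by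
      refine intervalIntegral.norm_integral_le_of_norm_le hR0.le (Eventually.of_forall fun y hy => ?_) hint
      have him : ((X':ℂ) + y * I).im = y := by simp
      have hre : ((X':ℂ) + y * I).re = X' := by simp
      have := bound (X' + y * I) (by simp [closedUpper, hy.1.le])
        (by have := abs_re_le_norm ((X':ℂ) + y * I); rw [hre, hX'] at this; exact this)
      rwa [him] at this
    refine hle.trans ?_
    have hexp : ∫ y in (0:ℝ)..R, Real.exp (-k * y) = (1 - Real.exp (-k * R)) / k := by
      rw [intervalIntegral.integral_eq_sub_of_hasDerivAt (f := fun y => - Real.exp (-k * y) / k)]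
      · simp; field_simp; ring
      · intro y _
        have := ((((hasDerivAt_id y).const_mul (-k)).exp).neg).div_const k
        refine this.congr_deriv ?_
        simp only [id, mul_one]; field_simp
      · exact (by fun_prop : Continuous (fun y : ℝ => Real.exp (-k * y))).intervalIntegrable _ _
    rw [intervalIntegral.integral_div, intervalIntegral.integral_add (by simp)
      ((by fun_prop : Continuous (fun y : ℝ => C * Real.exp (-k * y))).intervalIntegrable _ _),
      intervalIntegral.integral_const_mul, hexp]
    simp only [intervalIntegral.integral_const, sub_zero, smul_eq_mul]
    rw [add_div, mul_comm R, mul_div_assoc, div_self hR0.ne', mul_one, div_eq_mul_inv _ R]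
    gcongr
    rw [div_eq_mul_inv, div_eq_mul_inv, ← mul_assoc]
    have : 0 ≤ Real.exp (-k * R) := (Real.exp_pos _).le
    have hk' : 0 ≤ k⁻¹ := by positivity
    nlinarith [mul_nonneg hC (mul_nonneg this hk')]
  have e1 : (δ₀ / 8 + C * Real.exp (-k * R)) / R * |R - -R| = 2 * (δ₀ / 8 + C * Real.exp (-k * R)) := by
    rw [abs_of_pos (by linarith)]; field_simp; ring
  rw [e1] at htop
  have hs1 := hside R (abs_of_pos hR0)
  have hs2 := hside (-R) (by rw [abs_neg, abs_of_pos hR0])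
  calc _ ≤ ‖∫ x in (-R)..R, g (x + R * I)‖ + ‖I * ∫ y in (0:ℝ)..R, g ((R:ℂ) + y * I)‖
        + ‖I * ∫ y in (0:ℝ)..R, g (((-R:ℝ):ℂ) + y * I)‖ :=
        (norm_add_le _ _).trans (by gcongr; exact norm_sub_le _ _)
    _ ≤ 2 * (δ₀ / 8 + C * Real.exp (-k * R)) + (δ₀ / 8 + C / k * R⁻¹) + (δ₀ / 8 + C / k * R⁻¹) := by
        simp only [norm_mul, norm_I, one_mul]; gcongr
    _ < δ₀ := by linarith

/-- The antiderivative is a logarithm minus `I` times an arctangent. The logarithm is even and drops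
out over symmetric intervals. -/
theorem tendsto_integral_inv_add_I :
    Tendsto (fun R : ℝ => ∫ x in (-R)..R, ((x:ℂ) + I)⁻¹) atTop (𝓝 (-I * Real.pi)) := by
  have h : ∀ R : ℝ, ∫ x in (-R)..R, ((x:ℂ) + I)⁻¹ = -I * (2 * Real.arctan R : ℝ) := by
    intro R
    have hne : ∀ x : ℝ, (x:ℂ) + I ≠ 0 := fun x hx => by simpa using congrArg Complex.im hx
    rw [intervalIntegral.integral_eq_sub_of_hasDerivAt
      (f := fun x : ℝ => ((Real.log (1 + x ^ 2) / 2 : ℝ) : ℂ) - I * (Real.arctan x : ℝ))]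
    · simp [Real.arctan_neg]; ring
    · intro x _
      have h1 : HasDerivAt (fun x : ℝ => Real.log (1 + x ^ 2) / 2) (x / (1 + x ^ 2)) x := by
        have := ((((hasDerivAt_id x).pow 2).const_add 1).log (by simp; positivity)).div_const 2
        refine this.congr_deriv ?_
        have : 1 + x ^ 2 ≠ 0 := by positivity
        simp [id]; field_simp
      have h2 := (h1.ofReal_comp).sub (((Real.hasDerivAt_arctan x).ofReal_comp).const_mul I)
      refine h2.congr_deriv ?_
      have h3 : (1 + (x:ℂ) ^ 2) ≠ 0 := by
        have : (0:ℝ) < 1 + x ^ 2 := by positivity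
        exact_mod_cast this.ne'
      push_cast
      refine eq_inv_of_mul_eq_one_left ?_
      field_simp
      linear_combination (-1 : ℂ) * I_sq
    · refine ContinuousOn.intervalIntegrable fun x _ => ContinuousAt.continuousWithinAt ?_
      exact ContinuousAt.inv₀ (by fun_prop) (hne x)
  simp_rw [h]
  have h1 : Tendsto (fun R : ℝ => 2 * Real.arctan R) atTop (𝓝 Real.pi) := by
    have := (Real.tendsto_arctan_atTop.mono_right nhdsWithin_le_nhds).const_mul 2
    simpa [mul_div_cancel₀] using this
  exact ((continuous_ofReal.tendsto _).comp h1).const_mul (-I)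

/-- The value is half a residue at infinity. Subtracting `K / (z + I)`, whose pole lies outside the
closed half-plane, leaves a function of size `o(1/|z|)`. -/
theorem tendsto_integral_of_upper_tendsto {g : ℂ → ℂ} {s : Set ℂ} (hs : s.Countable)
    (hc : ContinuousOn g closedUpper) (hd : ∀ x ∈ upper \ s, DifferentiableAt ℂ g x) {K : ℂ}
    (hK : Tendsto (fun z => z * g z) (Bornology.cobounded ℂ ⊓ 𝓟 closedUpper) (𝓝 K)) :
    Tendsto (fun R : ℝ => ∫ x in (-R)..R, g x) atTop (𝓝 (-I * Real.pi * K)) := by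
  have hne : ∀ z ∈ closedUpper, z + I ≠ 0 := fun z hz h => by
    have := congrArg Complex.im h
    have h2 : 0 ≤ z.im := hz
    simp at this; linarith
  have hcI : ContinuousOn (fun z : ℂ => K * (z + I)⁻¹) closedUpper :=
    continuousOn_const.mul (ContinuousOn.inv₀ (by fun_prop) hne)
  have hlim : Tendsto (fun z => z * (g z - K * (z + I)⁻¹)) (Bornology.cobounded ℂ ⊓ 𝓟 closedUpper)
      (𝓝 0) := by
    have h1 : Tendsto (fun z : ℂ => (z + I)⁻¹) (Bornology.cobounded ℂ ⊓ 𝓟 closedUpper) (𝓝 0) :=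
      (tendsto_inv₀_cobounded.comp (tendsto_add_const_cobounded I)).mono_left inf_le_left
    have h2 : Tendsto (fun z => z * g z - (K - K * I * (z + I)⁻¹))
        (Bornology.cobounded ℂ ⊓ 𝓟 closedUpper) (𝓝 0) := by
      simpa using hK.sub ((h1.const_mul (K * I)).const_sub K)
    refine h2.congr' ?_
    filter_upwards [mem_inf_of_right (mem_principal_self _)] with z hz
    have := hne z hz
    field_simp; ring
  have h0 := tendsto_integral_of_upper_decay (g := fun z => g z - K * (z + I)⁻¹) hs (hc.sub hcI)
    (fun x hx => (hd x hx).sub (DifferentiableAt.const_mul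
      (DifferentiableAt.inv (h := fun z : ℂ => z + I) (by fun_prop) (hne x (upper_subset_closedUpper hx.1))) K)) (C := 0) (k := 1) le_rfl one_pos ?_
  · have h2 := h0.add (tendsto_integral_inv_add_I.const_mul K)
    rw [zero_add] at h2
    refine (h2.congr fun R => ?_).trans (by rw [show K * (-I * Real.pi) = -I * Real.pi * K by ring])
    have hr : ∀ f : ℂ → ℂ, ContinuousOn f closedUpper → IntervalIntegrable (fun x : ℝ => f x) volume (-R) R := by
      intro f hf
      refine (hf.comp_continuous (f := fun x : ℝ => (x:ℂ)) (by fun_prop) ?_).intervalIntegrable _ _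
      intro x; simp [closedUpper]
    rw [intervalIntegral.integral_sub (hr g hc) (hr _ hcI), intervalIntegral.integral_const_mul]
    ring
  · intro δ hδ
    have h3 := (Metric.tendsto_nhds.mp hlim) δ hδ
    rw [eventually_inf_principal, ← comap_norm_atTop, eventually_comap] at h3
    obtain ⟨X, hX⟩ := h3.exists_forall_of_atTop
    refine ⟨X, fun z hz hzX => ?_⟩
    have := hX ‖z‖ hzX z rfl hz
    rw [dist_zero_right, norm_mul] at this
    linarith

end BOScattering
end

/-! ### First-order equations near a regular singular point -/

noncomputable section
namespace BOScattering

/-- Grönwall's inequality along the radius from the sphere to `x`. In the parameter `τ` with `|γ τ -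
z| = ρ e^(-τ)` the speed of the path cancels the singular factor `1/(x - z)`, so growth at rate `K`
in `τ` is a power of the distance. -/
theorem norm_le_of_radial_ode {w A B : ℂ → ℂ} {z : ℂ} {ρ K M : ℝ} (hρ : 0 < ρ) (hK : 0 < K)
    (hA : ∀ x ∈ Metric.closedBall z ρ, ‖A x‖ ≤ K) (hB : ∀ x ∈ Metric.closedBall z ρ, ‖B x‖ ≤ K)
    (hode : ∀ x ∈ Metric.closedBall z ρ, x ≠ z → HasDerivAt w ((A x * w x + B x) / (x - z)) x)
    (hM : ∀ x ∈ Metric.sphere z ρ, ‖w x‖ ≤ M) {x : ℂ} (hx : x ∈ Metric.closedBall z ρ)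
    (hxz : x ≠ z) : ‖w x‖ ≤ (M + 1) * (ρ / ‖x - z‖) ^ K := by
  have hr : 0 < ‖x - z‖ := norm_pos_iff.mpr (sub_ne_zero.mpr hxz)
  have hrρ : ‖x - z‖ ≤ ρ := by rwa [← dist_eq_norm]
  set ω : ℂ := (x - z) / ‖x - z‖ with hω
  have hrc : (‖x - z‖ : ℂ) ≠ 0 := by exact_mod_cast hr.ne'
  have hωn : ‖ω‖ = 1 := by simp [hω, hr.ne']
  set T := Real.log (ρ / ‖x - z‖) with hT
  have hT0 : 0 ≤ T := Real.log_nonneg (by rw [le_div_iff₀ hr]; linarith)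
  set γ : ℝ → ℂ := fun τ => z + (ρ * Real.exp (-τ) : ℝ) * ω with hγ
  have hγz : ∀ τ, γ τ - z = (ρ * Real.exp (-τ) : ℝ) * ω := fun τ => by simp [hγ]
  have hγn : ∀ τ, ‖γ τ - z‖ = ρ * Real.exp (-τ) := fun τ => by
    rw [hγz, norm_mul, hωn, mul_one, norm_real, Real.norm_eq_abs, abs_of_pos (by positivity)]
  have hγne : ∀ τ, γ τ ≠ z := fun τ h => by
    have := hγn τ
    rw [h, sub_self, norm_zero] at this
    have : 0 < ρ * Real.exp (-τ) := by positivity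
    linarith
  have hγb : ∀ τ, 0 ≤ τ → γ τ ∈ Metric.closedBall z ρ := fun τ hτ => by
    rw [Metric.mem_closedBall, dist_eq_norm, hγn]
    exact mul_le_of_le_one_right hρ.le (Real.exp_le_one_iff.mpr (by linarith))
  have hγd : ∀ τ, HasDerivAt γ (-(γ τ - z)) τ := fun τ => by
    have h1 : HasDerivAt (fun τ : ℝ => ρ * Real.exp (-τ)) (-(ρ * Real.exp (-τ))) τ := by
      have := ((hasDerivAt_neg τ).exp).const_mul ρ
      refine this.congr_deriv (by ring)
    have := (h1.ofReal_comp.mul_const ω).const_add z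
    refine this.congr_deriv ?_
    rw [hγz]; push_cast; ring
  have hwd : ∀ τ, 0 ≤ τ → HasDerivAt (fun τ => w (γ τ)) (-(A (γ τ) * w (γ τ) + B (γ τ))) τ := by
    intro τ hτ
    have := (hode _ (hγb τ hτ) (hγne τ)).comp τ (hγd τ)
    refine this.congr_deriv ?_
    have := sub_ne_zero.mpr (hγne τ)
    field_simp
  have hγT : γ T = x := by
    rw [hγ, hT, hω]
    simp only
    rw [Real.exp_neg, Real.exp_log (by positivity)]
    push_cast
    have : (ρ:ℂ) ≠ 0 := by exact_mod_cast hρ.ne'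
    field_simp; ring
  have hγ0 : γ 0 ∈ Metric.sphere z ρ := by
    rw [mem_sphere_iff_norm, hγn]; simp
  have hgr := norm_le_gronwallBound_of_norm_deriv_right_le (f := fun τ => w (γ τ))
    (f' := fun τ => -(A (γ τ) * w (γ τ) + B (γ τ))) (δ := M) (K := K) (ε := K) (a := 0) (b := T)
    (fun τ hτ => (hwd τ hτ.1).continuousAt.continuousWithinAt)
    (fun τ hτ => (hwd τ hτ.1).hasDerivWithinAt) (hM _ hγ0) (fun τ hτ => by
      rw [norm_neg]
      refine (norm_add_le _ _).trans ?_
      rw [norm_mul]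
      have := hA _ (hγb τ hτ.1)
      have := hB _ (hγb τ hτ.1)
      gcongr) T ⟨hT0, le_rfl⟩
  simp only [hγT, sub_zero] at hgr
  refine hgr.trans ?_
  rw [gronwallBound_of_K_ne_0 hK.ne']
  simp only [div_self hK.ne', one_mul]
  have : Real.exp (K * T) = (ρ / ‖x - z‖) ^ K := by
    rw [Real.rpow_def_of_pos (by positivity), mul_comm]
  rw [this]; linarith

/-- Solutions of a first-order equation near a regular singular point: either the singularity is
removable or it is a pole whose order is read off from the indicial equation. -/
theorem removable_or_pole {w A B : ℂ → ℂ} {z : ℂ} (hA : AnalyticAt ℂ A z) (hB : AnalyticAt ℂ B z)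
    (hode : ∀ᶠ x in 𝓝[≠] z, HasDerivAt w ((A x * w x + B x) / (x - z)) x) :
    (∃ v, AnalyticAt ℂ v z ∧ ∀ᶠ x in 𝓝[≠] z, w x = v x) ∨
    ∃ n : ℕ, 0 < n ∧ A z = -n ∧ ∃ L : ℂ, L ≠ 0 ∧
      Tendsto (fun x => (x - z) ^ n * w x) (𝓝[≠] z) (𝓝 L) := by
  have hmero : MeromorphicAt w z := by
    have e1 : ∀ᶠ x in 𝓝 z, ‖A x‖ ≤ ‖A z‖ + ‖B z‖ + 1 := by
      have hlt : ‖A z‖ < ‖A z‖ + ‖B z‖ + 1 := by linarith [norm_nonneg (B z)]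
      exact (hA.continuousAt.norm.eventually (gt_mem_nhds hlt)).mono fun x hx => le_of_lt hx
    have e2 : ∀ᶠ x in 𝓝 z, ‖B x‖ ≤ ‖A z‖ + ‖B z‖ + 1 := by
      have hlt : ‖B z‖ < ‖A z‖ + ‖B z‖ + 1 := by linarith [norm_nonneg (A z)]
      exact (hB.continuousAt.norm.eventually (gt_mem_nhds hlt)).mono fun x hx => le_of_lt hx
    rw [eventually_nhdsWithin_iff] at hode
    obtain ⟨ρ, hρ, hball⟩ := Metric.eventually_nhds_iff_ball.mp (e1.and (e2.and hode))
    have hsub : Metric.closedBall z (ρ/2) ⊆ Metric.ball z ρ :=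
      Metric.closedBall_subset_ball (by linarith)
    have hcont : ContinuousOn w (Metric.sphere z (ρ/2)) := fun x hx =>
      ((hball x (hsub (Metric.sphere_subset_closedBall hx))).2.2
        (Metric.ne_of_mem_sphere hx (by positivity))).continuousAt.continuousWithinAt
    obtain ⟨M, hM⟩ := (isCompact_sphere z (ρ/2)).exists_bound_of_continuousOn hcont
    have hM0 : 0 ≤ M := (norm_nonneg _).trans (hM (z + (ρ/2 : ℝ)) (by
      rw [mem_sphere_iff_norm, add_sub_cancel_left, norm_real, Real.norm_eq_abs,
        abs_of_pos (by positivity)]))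
    set K := ‖A z‖ + ‖B z‖ + 1
    have hK : 0 < K := by positivity
    -- With an integer exponent above the growth rate, `(x - z) ^ N * w x` is bounded, so its
    -- singularity is removable and `w` is meromorphic.
    obtain ⟨N, hN⟩ := exists_nat_gt K
    have hbd : ∀ x ∈ Metric.ball z (ρ/2) \ {z}, ‖(x - z) ^ N * w x‖ ≤ (M + 1) * (ρ/2) ^ N := by
      intro x hx
      have hx' := Metric.ball_subset_closedBall hx.1
      have hr : 0 < ‖x - z‖ := norm_pos_iff.mpr (sub_ne_zero.mpr hx.2)
      have h1 := norm_le_of_radial_ode (w := w) (A := A) (B := B) (z := z) (ρ := ρ/2) (by positivity) hK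
        (fun y hy => (hball y (hsub hy)).1) (fun y hy => (hball y (hsub hy)).2.1)
        (fun y hy => (hball y (hsub hy)).2.2) hM hx' hx.2
      have h2 : (ρ/2 / ‖x - z‖) ^ K ≤ (ρ/2 / ‖x - z‖) ^ N := by
        rw [← Real.rpow_natCast]
        refine Real.rpow_le_rpow_of_exponent_le ?_ hN.le
        rw [le_div_iff₀ hr, one_mul, ← dist_eq_norm]; exact hx'
      rw [norm_mul, norm_pow]
      calc ‖x - z‖ ^ N * ‖w x‖ ≤ ‖x - z‖ ^ N * ((M + 1) * (ρ/2 / ‖x - z‖) ^ N) := by gcongr; exact h1.trans (by gcongr)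
        _ = (M + 1) * (ρ/2) ^ N := by rw [div_pow]; field_simp
    have hdiff := differentiableOn_update_limUnder_of_bddAbove (f := fun x => (x - z) ^ N * w x)
      (Metric.ball_mem_nhds z (show 0 < ρ/2 by positivity)) (fun x hx => by
        have h3 := (hball x (hsub (Metric.ball_subset_closedBall hx.1))).2.2 hx.2
        exact (DifferentiableAt.mul (by fun_prop) h3.differentiableAt).differentiableWithinAt)
      ⟨(M + 1) * (ρ/2) ^ N, by rintro _ ⟨x, hx, rfl⟩; exact hbd x hx⟩
    have han := hdiff.analyticAt (Metric.ball_mem_nhds z (show 0 < ρ/2 by positivity))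
    have hm1 : MeromorphicAt (fun x => (x - z) ^ N * w x) z := by
      refine han.meromorphicAt.congr ?_
      filter_upwards [self_mem_nhdsWithin] with x hx
      rw [Function.update_of_ne hx]
    have hm2 : MeromorphicAt (fun x => ((x - z) ^ N)⁻¹ * ((x - z) ^ N * w x)) z :=
      MeromorphicAt.mul (MeromorphicAt.inv
        (((analyticAt_id.sub analyticAt_const).pow N).meromorphicAt)) hm1
    refine hm2.congr ?_
    filter_upwards [self_mem_nhdsWithin] with x hx
    have : x - z ≠ 0 := sub_ne_zero.mpr hx
    field_simp
  by_cases hord : 0 ≤ meromorphicOrderAt w z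
  · left
    refine ⟨toMeromorphicNFAt w z, ?_, hmero.eq_nhdsNE_toMeromorphicNFAt⟩
    rw [← (meromorphicNFAt_toMeromorphicNFAt (f := w) (x := z)).meromorphicOrderAt_nonneg_iff_analyticAt]
    rwa [← meromorphicOrderAt_congr hmero.eq_nhdsNE_toMeromorphicNFAt]
  · right
    push Not at hord
    obtain ⟨j, hj⟩ := WithTop.ne_top_iff_exists.mp (ne_top_of_lt hord)
    have hj0 : j < 0 := by rw [← hj] at hord; exact_mod_cast hord
    obtain ⟨g, hg, hgz, hgw⟩ := (meromorphicOrderAt_eq_int_iff hmero).mp hj.symm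
    obtain ⟨n, rfl⟩ : ∃ n : ℕ, j = -(n : ℤ) := ⟨j.natAbs, by omega⟩
    have hn : 0 < n := by omega
    have hgw' : ∀ᶠ x in 𝓝[≠] z, (x - z) ^ n * w x = g x := by
      filter_upwards [hgw, self_mem_nhdsWithin] with x hx hxz
      have : x - z ≠ 0 := sub_ne_zero.mpr hxz
      rw [hx, zpow_neg, zpow_natCast, smul_eq_mul]; field_simp
    -- The equation for `g = (x - z) ^ n * w`. In the limit `x → z` it becomes `0 = (n + A z) * g
    -- z`, the indicial equation.
    have hder : ∀ᶠ x in 𝓝[≠] z, (x - z) * deriv g x = n * g x + A x * g x + (x - z) ^ n * B x := by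
      have h1 := eventually_eventually_nhdsWithin.mpr hgw'
      filter_upwards [h1, hgw', hode, self_mem_nhdsWithin] with x hx hgx hox hxz
      rw [nhdsWithin_eq_nhds.mpr (isOpen_compl_singleton.mem_nhds hxz)] at hx
      have h2 : HasDerivAt (fun x => (x - z) ^ n * w x) _ x :=
        (((hasDerivAt_id x).sub_const z).pow n).mul hox
      have h3 := (h2.congr_of_eventuallyEq (hx.mono fun y hy => hy.symm)).deriv
      rw [h3, ← hgx]
      have : x - z ≠ 0 := sub_ne_zero.mpr hxz
      obtain ⟨m, rfl⟩ : ∃ m, n = m + 1 := ⟨n - 1, by omega⟩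
      simp only [id, Nat.add_sub_cancel, Pi.pow_apply]
      field_simp
      ring
    have hlim1 : Tendsto (fun x => (x - z) * deriv g x) (𝓝[≠] z) (𝓝 ((z - z) * deriv g z)) :=
      (ContinuousAt.mul (by fun_prop) hg.deriv.continuousAt).tendsto.mono_left nhdsWithin_le_nhds
    have hlim2 : Tendsto (fun x => n * g x + A x * g x + (x - z) ^ n * B x) (𝓝[≠] z)
        (𝓝 (n * g z + A z * g z + (z - z) ^ n * B z)) := by
      have hg' := hg.continuousAt
      have hA' := hA.continuousAt
      have hB' := hB.continuousAt
      exact (ContinuousAt.tendsto (by fun_prop)).mono_left nhdsWithin_le_nhds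
    have := tendsto_nhds_unique (hlim1.congr' hder) hlim2
    rw [sub_self, zero_pow hn.ne', zero_mul, zero_mul, add_zero, ← add_mul] at this
    refine ⟨n, hn, ?_, g z, hgz, ?_⟩
    · have h5 := (mul_eq_zero.mp this.symm).resolve_right hgz
      linear_combination h5
    · exact (hg.continuousAt.tendsto.mono_left nhdsWithin_le_nhds).congr' (hgw'.mono fun x hx => hx.symm)

end BOScattering
end

/-! ### The potential, its antiderivatives and their bounds -/

noncomputable section
namespace BOScattering

/-- The data of the scattering problem: a rational potential together with abscissae interlacing
its branch cuts. -/
structure Datum (P : ℕ) where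
  ε : ℝ
  c : Fin P → ℂ
  z : Fin P → ℂ
  a : Fin (P + 1) → ℝ
  hε : 0 < ε
  hc : ∀ p, c p ≠ 0
  hz : ∀ p, 0 < (z p).im
  hre : StrictMono fun p => (z p).re
  hsum : ∑ p, (c p + conj (c p)) = 0
  ha : ∀ p : Fin P, a p.castSucc < (z p).re ∧ (z p).re < a p.succ

namespace Datum
variable {P : ℕ} (D : Datum P)

theorem exists_margin : ∃ b : ℝ, 0 < b ∧ b ≤ 1 ∧ ∀ p, 2 * b ≤ (D.z p).im := by
  have h : ∃ b : ℝ, 0 < b ∧ ∀ p, b ≤ (D.z p).im := by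
    rcases isEmpty_or_nonempty (Fin P) with h | h
    · exact ⟨1, one_pos, fun p => h.elim p⟩
    · obtain ⟨p, hp⟩ := Finite.exists_min fun p => (D.z p).im
      exact ⟨_, D.hz p, hp⟩
  obtain ⟨b, hb, hp⟩ := h
  refine ⟨min 1 (b / 2), by positivity, min_le_left _ _, fun p => ?_⟩
  linarith [hp p, min_le_right 1 (b / 2)]

/-- The width of a strip below the real line that is free of singularities. -/
def b : ℝ := D.exists_margin.choose
theorem b_pos : 0 < D.b := D.exists_margin.choose_spec.1
theorem b_le_one : D.b ≤ 1 := D.exists_margin.choose_spec.2.1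
theorem b_le (p : Fin P) : 2 * D.b ≤ (D.z p).im := D.exists_margin.choose_spec.2.2 p

/-- A height above all the poles. -/
def H : ℝ := 1 + ∑ p, (D.z p).im
theorem im_le_H (p : Fin P) : (D.z p).im + 1 ≤ D.H := by
  have := Finset.single_le_sum (f := fun p => (D.z p).im) (fun p _ => (D.hz p).le) (Finset.mem_univ p)
  simp only [H]; linarith
theorem one_le_H : 1 ≤ D.H := by
  have := Finset.sum_nonneg (s := Finset.univ) (f := fun p => (D.z p).im) (fun p _ => (D.hz p).le)
  simp only [H]; linarith

/-- The rational potential as a function of a complex variable. -/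
def u (x : ℂ) : ℂ := ∑ p, (D.c p / (x - D.z p) + conj (D.c p) / (x - conj (D.z p)))

/-- A half-plane in which the real line is interior. The factor 2 in the choice of `b` keeps the
conjugate poles at distance at least `b` from it. -/
def dom : Set ℂ := {x | -D.b < x.im}

/-- The part of the domain that does not lie on the half-lines going down from the poles. -/
def Gd : Set ℂ := {x | -D.b < x.im ∧ ∀ p, x.re ≠ (D.z p).re ∨ (D.z p).im < x.im}

/-- The part of the domain that does not lie on the half-lines going up from the poles. -/
def Gu : Set ℂ := {x | -D.b < x.im ∧ ∀ p, x.re ≠ (D.z p).re ∨ x.im < (D.z p).im}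

theorem isOpen_dom : IsOpen D.dom := isOpen_lt continuous_const continuous_im
theorem convex_dom : Convex ℝ D.dom := convex_halfSpace_im_gt _
theorem isOpen_Gd : IsOpen D.Gd := by
  have : D.Gd = D.dom ∩ ⋂ p, ({x | x.re ≠ (D.z p).re} ∪ {x | (D.z p).im < x.im}) := by
    ext x; simp [Gd, dom]
  rw [this]
  exact D.isOpen_dom.inter (isOpen_iInter_of_finite fun p =>
    (isOpen_ne_fun continuous_re continuous_const).union (isOpen_lt continuous_const continuous_im))
theorem Gd_subset_dom : D.Gd ⊆ D.dom := fun _ hx => hx.1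
theorem closedUpper_subset_dom : closedUpper ⊆ D.dom := fun x (hx : 0 ≤ x.im) => by
  show -D.b < x.im
  linarith [D.b_pos]

theorem ne_pole_of_mem_Gd {x : ℂ} (hx : x ∈ D.Gd) (p : Fin P) : x ≠ D.z p := by
  rintro rfl
  rcases hx.2 p with h | h
  · exact h rfl
  · exact lt_irrefl _ h
theorem ne_pole_of_mem_Gu {x : ℂ} (hx : x ∈ D.Gu) (p : Fin P) : x ≠ D.z p := by
  rintro rfl
  rcases hx.2 p with h | h
  · exact h rfl
  · exact lt_irrefl _ h
theorem ofReal_ne_pole (x : ℝ) (p : Fin P) : (x : ℂ) ≠ D.z p := fun h => by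
  have := D.hz p
  rw [← h] at this
  simp at this

theorem ofReal_mem_Gu (x : ℝ) : (x : ℂ) ∈ D.Gu :=
  ⟨by simpa using D.b_pos, fun p => Or.inr (by simpa using D.hz p)⟩

theorem add_mem_Gd {x : ℂ} (hx : x ∈ D.Gd) {t : ℝ} (ht : 0 ≤ t) : x + t * I ∈ D.Gd := by
  refine ⟨by simp; linarith [hx.1], fun p => ?_⟩
  rcases hx.2 p with h | h
  · exact Or.inl (by simpa using h)
  · right; simp; linarith

theorem conj_pole_im_lt {x : ℂ} (hx : x ∈ D.dom) (p : Fin P) : D.b ≤ (x - conj (D.z p)).im := by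
  have h1 : -D.b < x.im := hx
  simp; linarith [D.b_le p]

theorem ne_conj_pole {x : ℂ} (hx : x ∈ D.dom) (p : Fin P) : x - conj (D.z p) ≠ 0 := fun h => by
  have := D.conj_pole_im_lt hx p
  rw [h] at this
  simp at this; linarith [D.b_pos]

theorem b_le_norm_sub_conj {x : ℂ} (hx : x ∈ D.dom) (p : Fin P) : D.b ≤ ‖x - conj (D.z p)‖ :=
  (D.conj_pole_im_lt hx p).trans ((le_abs_self _).trans (abs_im_le_norm _))

theorem εc_ne : (D.ε : ℂ) ≠ 0 := by exact_mod_cast D.hε.ne'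

/-- The source term of the differential equation. -/
def src (μ w₀ : ℂ) (φ : Fin P → ℂ) (x : ℂ) : ℂ := μ * w₀ + ∑ p, φ p / (x - D.z p)

/-- The differential equation `iεw' + (μ + u)w = μw₀ + ∑ φₚ/(x - zₚ)` at the point `x`. -/
def SolvesAt (μ w₀ : ℂ) (φ : Fin P → ℂ) (w : ℂ → ℂ) (x : ℂ) : Prop :=
  HasDerivAt w ((I / D.ε) * ((μ + D.u x) * w x - D.src μ w₀ φ x)) x

/-- An integrating factor built from an antiderivative `L` of the potential. -/
def fac (L : ℂ → ℂ) (μ x : ℂ) : ℂ := exp (-(I / D.ε) * (μ * x + L x))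

theorem fac_ne_zero (L : ℂ → ℂ) (μ x : ℂ) : D.fac L μ x ≠ 0 := exp_ne_zero _

theorem hasDerivAt_fac {L : ℂ → ℂ} {x : ℂ} (hL : HasDerivAt L (D.u x) x) (μ : ℂ) :
    HasDerivAt (D.fac L μ) (-(I / D.ε) * (μ + D.u x) * D.fac L μ x) x := by
  have := ((((hasDerivAt_id x).const_mul μ).add hL).const_mul (-(I / D.ε))).cexp
  refine this.congr_deriv ?_
  simp [fac]; ring

theorem hasDerivAt_fac_mul {L w : ℂ → ℂ} {x μ w₀ : ℂ} {φ : Fin P → ℂ}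
    (hL : HasDerivAt L (D.u x) x) (hw : D.SolvesAt μ w₀ φ w x) :
    HasDerivAt (fun x => D.fac L μ x * w x) (-(I / D.ε) * (D.fac L μ x * D.src μ w₀ φ x)) x := by
  refine ((D.hasDerivAt_fac hL μ).mul hw).congr_deriv ?_
  ring

/-- Two solutions with the same data differ, on a connected set, by a constant multiple of the
reciprocal of the integrating factor. -/
theorem hasDerivAt_fac_mul_sub {L w v : ℂ → ℂ} {x μ w₀ : ℂ} {φ : Fin P → ℂ}
    (hL : HasDerivAt L (D.u x) x) (hw : D.SolvesAt μ w₀ φ w x) (hv : D.SolvesAt μ w₀ φ v x) :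
    HasDerivAt (fun x => D.fac L μ x * (w x - v x)) 0 x := by
  have := (D.hasDerivAt_fac_mul hL hw).sub (D.hasDerivAt_fac_mul hL hv)
  rw [sub_self] at this
  refine this.congr_of_eventuallyEq (Eventually.of_forall fun y => ?_)
  simp [mul_sub]

/-- The antiderivative of the potential with branch cuts going down. -/
def Ld (x : ℂ) : ℂ :=
  ∑ p, (D.c p * log (-I * (x - D.z p)) + conj (D.c p) * log (-I * (x - conj (D.z p))))

theorem hasDerivAt_log_mul {ω x y : ℂ} (hω : ω ≠ 0) (h : ω * (x - y) ∈ slitPlane) :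
    HasDerivAt (fun x => log (ω * (x - y))) (1 / (x - y)) x := by
  have := (((hasDerivAt_id x).sub_const y).const_mul ω).clog h
  refine this.congr_deriv ?_
  have h2 : x - y ≠ 0 := fun h3 => by simp [h3] at h
  simp; field_simp

theorem conj_pole_mem_slitPlane {x : ℂ} (hx : x ∈ D.dom) (p : Fin P) :
    -I * (x - conj (D.z p)) ∈ slitPlane := by
  left
  have := D.conj_pole_im_lt hx p
  simp at this ⊢
  linarith [D.b_pos]

theorem hasDerivAt_Ld {x : ℂ} (hx : x ∈ D.Gd) : HasDerivAt D.Ld (D.u x) x := by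
  have : HasDerivAt (fun x => ∑ p, (D.c p * log (-I * (x - D.z p))
      + conj (D.c p) * log (-I * (x - conj (D.z p)))))
      (∑ p, (D.c p * (1 / (x - D.z p)) + conj (D.c p) * (1 / (x - conj (D.z p))))) x := by
    refine HasDerivAt.fun_sum fun p _ => ?_
    refine (HasDerivAt.const_mul _ (hasDerivAt_log_mul (by simp) ?_)).add
      (HasDerivAt.const_mul _ (hasDerivAt_log_mul (by simp) (D.conj_pole_mem_slitPlane hx.1 p)))
    rcases hx.2 p with h | h
    · right
      have h' : ¬ (D.z p).re = x.re := fun e => h e.symm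
      simpa [sub_eq_zero] using h'
    · left; simpa using h
  refine this.congr_deriv ?_
  simp [u, div_eq_mul_inv]

theorem hasDerivAt_f {x : ℂ} (hx : x ∈ D.Gu) : HasDerivAt (f D.c D.z) (D.u x) x := by
  have : HasDerivAt (fun x => ∑ p, (D.c p * (log (I * (x - D.z p)) + (Real.pi : ℂ) * I / 2)
    + conj (D.c p) * (log (-I * (x - conj (D.z p))) - (Real.pi : ℂ) * I / 2)))
      (∑ p, (D.c p * (1 / (x - D.z p)) + conj (D.c p) * (1 / (x - conj (D.z p))))) x := by
    refine HasDerivAt.fun_sum fun p _ => ?_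
    refine (HasDerivAt.const_mul _ ((hasDerivAt_log_mul (by simp) ?_).add_const _)).add
      (HasDerivAt.const_mul _ ((hasDerivAt_log_mul (by simp)
        (D.conj_pole_mem_slitPlane hx.1 p)).sub_const _))
    rcases hx.2 p with h | h
    · right; simpa [sub_eq_zero] using h
    · left; simpa using h
  refine this.congr_deriv ?_
  simp [u, div_eq_mul_inv]

theorem differentiableAt_div_sub {x y : ℂ} (k : ℂ) (h : x - y ≠ 0) :
    DifferentiableAt ℂ (fun x => k / (x - y)) x := by
  fun_prop (disch := exact h)

theorem differentiableAt_u {x : ℂ} (hx : x ∈ D.dom) (h : ∀ p, x ≠ D.z p) :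
    DifferentiableAt ℂ D.u x := by
  unfold u
  exact DifferentiableAt.fun_sum fun p _ =>
    (differentiableAt_div_sub _ (sub_ne_zero.mpr (h p))).add
      (differentiableAt_div_sub _ (D.ne_conj_pole hx p))

theorem differentiableAt_src {x : ℂ} (μ w₀ : ℂ) (φ : Fin P → ℂ) (h : ∀ p, x ≠ D.z p) :
    DifferentiableAt ℂ (D.src μ w₀ φ) x := by
  unfold src
  exact (differentiableAt_const _).add (DifferentiableAt.fun_sum fun p _ =>
    differentiableAt_div_sub _ (sub_ne_zero.mpr (h p)))

/-! ### Bounds -/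

theorem one_add_norm_le {x y : ℂ} {η : ℝ} (hη : 0 < η) (h : η ≤ ‖x - y‖) :
    1 + ‖x‖ ≤ (1 + (1 + ‖y‖) / η) * ‖x - y‖ := by
  have h1 : ‖x‖ ≤ ‖x - y‖ + ‖y‖ := by simpa using norm_add_le (x - y) y
  have h2 : 1 + ‖y‖ ≤ (1 + ‖y‖) / η * ‖x - y‖ := by
    rw [div_mul_eq_mul_div, le_div_iff₀ hη]
    have : 0 ≤ 1 + ‖y‖ := by positivity
    nlinarith
  nlinarith

theorem norm_inv_sub_le {x y : ℂ} {η : ℝ} (hη : 0 < η) (h : η ≤ ‖x - y‖) :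
    ‖(x - y)⁻¹‖ ≤ (1 + (1 + ‖y‖) / η) / (1 + ‖x‖) := by
  have h0 : 0 < ‖x - y‖ := hη.trans_le h
  rw [norm_inv, inv_le_iff_one_le_mul₀ h0, div_mul_eq_mul_div, le_div_iff₀ (by positivity), one_mul]
  exact one_add_norm_le hη h

/-- Away from its branch point each logarithm is `log (1 + |x|)` up to a bounded error. This common
term is then removed by `norm_weighted_sum_le`. -/
theorem norm_log_sub_le {x y ω : ℂ} {η : ℝ} (hη : 0 < η) (h : η ≤ ‖x - y‖) (hω : ‖ω‖ = 1) :
    ‖log (ω * (x - y)) - Real.log (1 + ‖x‖)‖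
      ≤ Real.log (1 + (1 + ‖y‖) / η) + Real.log (1 + ‖y‖) + Real.pi := by
  have h0 : 0 < ‖x - y‖ := hη.trans_le h
  have e1 : Real.log (1 + ‖x‖) ≤ Real.log (1 + (1 + ‖y‖) / η) + Real.log ‖x - y‖ := by
    rw [← Real.log_mul (by positivity) h0.ne']
    exact Real.log_le_log (by positivity) (one_add_norm_le hη h)
  have e2 : Real.log ‖x - y‖ ≤ Real.log (1 + ‖y‖) + Real.log (1 + ‖x‖) := by
    rw [← Real.log_mul (by positivity) (by positivity)]
    refine Real.log_le_log h0 ((norm_sub_le _ _).trans ?_)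
    nlinarith [norm_nonneg x, norm_nonneg y]
  have e3 : 0 ≤ Real.log (1 + (1 + ‖y‖) / η) := Real.log_nonneg (by simp; positivity)
  have e4 : 0 ≤ Real.log (1 + ‖y‖) := Real.log_nonneg (by simp)
  have : log (ω * (x - y)) - Real.log (1 + ‖x‖)
      = ((Real.log ‖x - y‖ - Real.log (1 + ‖x‖) : ℝ) : ℂ) + (arg (ω * (x - y)) : ℝ) * I := by
    rw [Complex.log, norm_mul, hω, one_mul]; push_cast; ring
  rw [this]
  refine (norm_add_le _ _).trans (add_le_add ?_ ?_)
  · rw [norm_real, Real.norm_eq_abs, abs_le]; constructor <;> linarith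
  · rw [norm_mul, norm_I, mul_one, norm_real]; exact abs_arg_le_pi _

/-- The weights sum to zero, so `l` may be subtracted from all terms. In this form the vanishing of
the total residue enters the bounds on the antiderivatives and on the potential. -/
theorem norm_weighted_sum_le {A B : Fin P → ℂ} {l : ℂ} {C : Fin P → ℝ}
    (hA : ∀ p, ‖A p - l‖ ≤ C p) (hB : ∀ p, ‖B p - l‖ ≤ C p) :
    ‖∑ p, (D.c p * A p + conj (D.c p) * B p)‖ ≤ ∑ p, 2 * ‖D.c p‖ * C p := by
  have : ∑ p, (D.c p * A p + conj (D.c p) * B p)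
      = ∑ p, (D.c p * (A p - l) + conj (D.c p) * (B p - l)) := by
    rw [← sub_eq_zero, ← Finset.sum_sub_distrib, ← mul_zero l, ← D.hsum, Finset.mul_sum]
    exact Finset.sum_congr rfl fun p _ => by ring
  rw [this]
  refine (norm_sum_le _ _).trans (Finset.sum_le_sum fun p _ => (norm_add_le _ _).trans ?_)
  rw [norm_mul, norm_mul, RCLike.norm_conj]
  nlinarith [hA p, hB p, norm_nonneg (D.c p)]

theorem exists_bound_Ld {η : ℝ} (hη : 0 < η) : ∃ C : ℝ, ∀ x ∈ D.dom, (∀ p, η ≤ ‖x - D.z p‖) →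
    ‖D.Ld x‖ ≤ C := by
  refine ⟨_, fun x hx h => D.norm_weighted_sum_le (l := Real.log (1 + ‖x‖)) (C := fun p =>
    max (Real.log (1 + (1 + ‖D.z p‖) / η) + Real.log (1 + ‖D.z p‖) + Real.pi)
    (Real.log (1 + (1 + ‖conj (D.z p)‖) / D.b) + Real.log (1 + ‖conj (D.z p)‖) + Real.pi))
    (fun p => (norm_log_sub_le hη (h p) (by simp)).trans (le_max_left _ _))
    (fun p => (norm_log_sub_le D.b_pos (D.b_le_norm_sub_conj hx p) (by simp)).trans
      (le_max_right _ _))⟩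

theorem exists_bound_f {η : ℝ} (hη : 0 < η) : ∃ C : ℝ, ∀ x ∈ D.dom, (∀ p, η ≤ ‖x - D.z p‖) →
    ‖f D.c D.z x‖ ≤ C := by
  refine ⟨_, fun x hx h => D.norm_weighted_sum_le (l := Real.log (1 + ‖x‖)) (C := fun p =>
    max (Real.log (1 + (1 + ‖D.z p‖) / η) + Real.log (1 + ‖D.z p‖) + Real.pi + ‖(Real.pi : ℂ) * I / 2‖)
    (Real.log (1 + (1 + ‖conj (D.z p)‖) / D.b) + Real.log (1 + ‖conj (D.z p)‖) + Real.pi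
      + ‖(Real.pi : ℂ) * I / 2‖))
    (fun p => le_trans ?_ (le_max_left _ _)) (fun p => le_trans ?_ (le_max_right _ _))⟩
  · rw [add_sub_right_comm]
    exact (norm_add_le _ _).trans (by gcongr; exact norm_log_sub_le hη (h p) (by simp))
  · rw [sub_right_comm]
    exact (norm_sub_le _ _).trans (by
      gcongr; exact norm_log_sub_le D.b_pos (D.b_le_norm_sub_conj hx p) (by simp))

theorem norm_fac (L : ℂ → ℂ) (μ x : ℂ) :
    ‖D.fac L μ x‖ = Real.exp ((μ * x).im / D.ε) * Real.exp ((L x).im / D.ε) := by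
  rw [fac, norm_exp, ← Real.exp_add]
  congr 1
  have : -(I / (D.ε : ℂ)) * (μ * x + L x) = ((D.ε⁻¹ : ℝ) : ℂ) * (-I * (μ * x + L x)) := by
    push_cast; ring
  rw [this, re_ofReal_mul]
  simp; ring

/-- With a bounded antiderivative, only the exponential of `Im(μx)/ε` matters for the size of the
integrating factor; `le_norm_fac` is the bound from below. -/
theorem norm_fac_le {L : ℂ → ℂ} {C : ℝ} {x : ℂ} (hL : ‖L x‖ ≤ C) (μ : ℂ) :
    ‖D.fac L μ x‖ ≤ Real.exp (C / D.ε) * Real.exp ((μ * x).im / D.ε) := by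
  have := D.hε
  rw [norm_fac, mul_comm]
  gcongr
  exact (le_abs_self _).trans ((abs_im_le_norm _).trans hL)

theorem le_norm_fac {L : ℂ → ℂ} {C : ℝ} {x : ℂ} (hL : ‖L x‖ ≤ C) (μ : ℂ) :
    Real.exp (-(C / D.ε)) * Real.exp ((μ * x).im / D.ε) ≤ ‖D.fac L μ x‖ := by
  have := D.hε
  rw [norm_fac, mul_comm, ← neg_div]
  gcongr
  have h1 := (abs_im_le_norm (L x)).trans hL
  linarith [(abs_le.mp h1).1]

theorem exists_bound_u {η : ℝ} (hη : 0 < η) : ∃ C : ℝ, 0 ≤ C ∧ ∀ x ∈ D.dom,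
    (∀ p, η ≤ ‖x - D.z p‖) → ‖D.u x‖ ≤ C / (1 + ‖x‖) ^ 2 := by
  -- A reference point at distance at least 1 from the domain, as `b ≤ 1`. The difference of `1/(x -
  -- y)` and `1/(x - y₀)` decays quadratically.
  set y₀ : ℂ := -2 * I with hy₀
  set Kp : Fin P → ℝ := fun p => max ((1 + (1 + ‖D.z p‖) / η) * ((1 + (1 + ‖y₀‖) / 1) * ‖D.z p - y₀‖))
    ((1 + (1 + ‖conj (D.z p)‖) / D.b) * ((1 + (1 + ‖y₀‖) / 1) * ‖conj (D.z p) - y₀‖)) with hK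
  have hb := D.b_pos
  have hKp : ∀ p, 0 ≤ Kp p := fun p => le_max_of_le_left (by positivity)
  refine ⟨∑ p, 2 * ‖D.c p‖ * Kp p,
    Finset.sum_nonneg fun p _ => mul_nonneg (by positivity) (hKp p), fun x hx h => ?_⟩
  have hxy : 1 ≤ ‖x - y₀‖ := by
    have h1 : -D.b < x.im := hx
    have h2 : (x - y₀).im = x.im + 2 := by simp [hy₀]
    have h3 := abs_im_le_norm (x - y₀)
    rw [h2] at h3
    linarith [le_abs_self (x.im + 2), D.b_le_one]
  have aux : ∀ y : ℂ, ∀ η' > 0, η' ≤ ‖x - y‖ → ‖(x - y)⁻¹ - (x - y₀)⁻¹‖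
      ≤ ((1 + (1 + ‖y‖) / η') * ((1 + (1 + ‖y₀‖) / 1) * ‖y - y₀‖)) / (1 + ‖x‖) ^ 2 := by
    intro y η' hη' hy
    have n1 : x - y ≠ 0 := norm_pos_iff.mp (hη'.trans_le hy)
    have n2 : x - y₀ ≠ 0 := norm_pos_iff.mp (one_pos.trans_le hxy)
    have e : (x - y)⁻¹ - (x - y₀)⁻¹ = (x - y)⁻¹ * (x - y₀)⁻¹ * (y - y₀) := by field_simp; ring
    rw [e, norm_mul, norm_mul]
    have b1 := norm_inv_sub_le hη' hy
    have b2 := norm_inv_sub_le one_pos hxy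
    calc _ ≤ (1 + (1 + ‖y‖) / η') / (1 + ‖x‖) * ((1 + (1 + ‖y₀‖) / 1) / (1 + ‖x‖)) * ‖y - y₀‖ := by gcongr
      _ = _ := by rw [pow_two]; field_simp
  have := D.norm_weighted_sum_le (A := fun p => (x - D.z p)⁻¹) (B := fun p => (x - conj (D.z p))⁻¹)
    (l := (x - y₀)⁻¹) (C := fun p => Kp p / (1 + ‖x‖) ^ 2)
    (fun p => (aux _ η hη (h p)).trans (by gcongr; exact le_max_left _ _))
    (fun p => (aux _ D.b hb (D.b_le_norm_sub_conj hx p)).trans (by gcongr; exact le_max_right _ _))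
  have e2 : D.u x = ∑ p, (D.c p * (x - D.z p)⁻¹ + conj (D.c p) * (x - conj (D.z p))⁻¹) := by
    simp [u, div_eq_mul_inv]
  rw [e2]
  refine this.trans (le_of_eq ?_)
  rw [Finset.sum_div]
  exact Finset.sum_congr rfl fun p _ => by ring

end Datum
end BOScattering
end

/-! ### Contour integrals to infinity and inversion of the differential equation -/

noncomputable section
namespace BOScattering

/-- The integral of `k` along the half-line from `x` in the direction `d`. -/
def tailInt (k : ℂ → ℂ) (d x : ℂ) : ℂ := ∫ s in Ioi (0 : ℝ), k (x + s * d) * d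

/-- The integral of `k` along the vertical segment from `x` to `x + iR`. -/
def vertInt (R : ℝ) (k : ℂ → ℂ) (x : ℂ) : ℂ := ∫ t in Icc (0 : ℝ) R, k (x + t * I) * I

/-- Along the half-line the derivative of the integrand in the starting point is its derivative in
`s`, so the fundamental theorem leaves only the end at `x`. The quadratic decay is required
uniformly near `x` for domination. -/
theorem hasDerivAt_tailInt {k : ℂ → ℂ} {d x : ℂ} {r C : ℝ} (hr : 0 < r)
    (hk : ∀ y ∈ Metric.ball x r, ∀ s : ℝ, 0 ≤ s → DifferentiableAt ℂ k (y + s * d))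
    (hb : ∀ y ∈ Metric.ball x r, ∀ s : ℝ, 0 ≤ s → ‖k (y + s * d)‖ ≤ C * (1 + s ^ 2)⁻¹) :
    HasDerivAt (tailInt k d) (-k x) x := by
  have hlin : ∀ s : ℝ, ∀ y : ℂ, HasDerivAt (fun y : ℂ => y + s * d) 1 y := fun s y =>
    (hasDerivAt_id y).add_const _
  have hd : ∀ y ∈ Metric.ball x r, ∀ s : ℝ, 0 ≤ s →
      HasDerivAt (fun y => k (y + s * d) * d) (deriv k (y + s * d) * d) y := by
    intro y hy s hs
    have := ((hk y hy s hs).hasDerivAt.comp y (hlin s y)).mul_const d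
    simpa using this
  have hs0 : ∀ y : ℂ, ∀ s : ℝ, HasDerivAt (fun s : ℝ => y + s * d) d s := fun y s => by
    simpa using ((ofRealCLM.hasDerivAt (x := s)).mul_const d).const_add y
  have hcs : ∀ y ∈ Metric.ball x r, ContinuousOn (fun s : ℝ => k (y + s * d)) (Ici 0) :=
    fun y hy s hs => ((hk y hy s hs).hasDerivAt.comp s (hs0 y s)).continuousAt.continuousWithinAt
  have key := hasDerivAt_integral_of_holomorphic (ν := volume.restrict (Ioi (0:ℝ)))
    (F := fun y s => k (y + s * d) * d) (x₀ := x) hr (bound := fun s => C * (1 + s ^ 2)⁻¹ * ‖d‖)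
    ((integrable_inv_one_add_sq.const_mul C).mul_const _).integrableOn ?_ ?_ ?_
  · refine key.2.congr_deriv ?_
    have hx := Metric.mem_ball_self hr (x := x)
    have h0 : ∀ s : ℝ, 0 ≤ s → HasDerivAt (fun s : ℝ => k (x + s * d))
        (deriv (fun y => k (y + s * d) * d) x) s := by
      intro s hs
      rw [(hd x hx s hs).deriv]
      exact (hk x hx s hs).hasDerivAt.comp s (hs0 x s)
    rw [integral_Ioi_of_hasDerivAt_of_tendsto' (f := fun s : ℝ => k (x + s * d)) (m := 0)
      (fun s hs => h0 s hs) key.1]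
    · simp
    · have h1 : Tendsto (fun s : ℝ => C * (1 + s ^ 2)⁻¹) atTop (𝓝 0) := by
        have : Tendsto (fun s : ℝ => 1 + s ^ 2) atTop atTop :=
          tendsto_atTop_add_const_left _ _ (tendsto_pow_atTop two_ne_zero)
        simpa using (tendsto_inv_atTop_zero.comp this).const_mul C
      refine squeeze_zero_norm' ?_ h1
      filter_upwards [eventually_ge_atTop 0] with s hs using hb x hx s hs
  · intro y hy
    exact (((hcs y hy).mono Ioi_subset_Ici_self).mul continuousOn_const).aestronglyMeasurable
      measurableSet_Ioi
  · refine (ae_restrict_iff' measurableSet_Ioi).mpr (Eventually.of_forall fun s hs y hy => ?_)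
    exact (hd y hy s (le_of_lt hs)).differentiableAt.differentiableWithinAt
  · refine (ae_restrict_iff' measurableSet_Ioi).mpr (Eventually.of_forall fun s hs y hy => ?_)
    rw [norm_mul]
    gcongr
    exact hb y hy s (le_of_lt hs)

theorem hasDerivAt_vertInt {k : ℂ → ℂ} {R : ℝ} (hR : 0 ≤ R) {U : Set ℂ} (hU : IsOpen U)
    (hup : ∀ x ∈ U, ∀ t : ℝ, 0 ≤ t → x + t * I ∈ U) (hk : DifferentiableOn ℂ k U) {x : ℂ}
    (hx : x ∈ U) : HasDerivAt (vertInt R k) (k (x + R * I) - k x) x := by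
  obtain ⟨r, hr, hs⟩ := Metric.isOpen_iff.mp hU x hx
  have hsc : Metric.closedBall x (r/2) ⊆ U :=
    (Metric.closedBall_subset_ball (by linarith)).trans hs
  have hbs : Metric.ball x (r/2) ⊆ U := Metric.ball_subset_closedBall.trans hsc
  have hK : IsCompact ((fun q : ℂ × ℝ => q.1 + q.2 * I) ''
      (Metric.closedBall x (r/2) ×ˢ Icc (0:ℝ) R)) :=
    ((isCompact_closedBall _ _).prod isCompact_Icc).image (by fun_prop)
  obtain ⟨C, hC⟩ := hK.exists_bound_of_continuousOn (hk.continuousOn.mono (by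
    rintro _ ⟨q, hq, rfl⟩
    exact hup _ (hsc hq.1) _ hq.2.1))
  have hkd : ∀ y ∈ U, HasDerivAt k (deriv k y) y := fun y hy =>
    (hk.differentiableAt (hU.mem_nhds hy)).hasDerivAt
  have hlin : ∀ s : ℝ, ∀ y : ℂ, HasDerivAt (fun y : ℂ => y + s * I) 1 y := fun s y =>
    (hasDerivAt_id y).add_const _
  have hd : ∀ y ∈ U, ∀ s : ℝ, 0 ≤ s →
      HasDerivAt (fun y => k (y + s * I) * I) (deriv k (y + s * I) * I) y := by
    intro y hy s hs
    have := ((hkd _ (hup y hy s hs)).comp y (hlin s y)).mul_const I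
    simpa using this
  have hs0 : ∀ y : ℂ, ∀ s : ℝ, HasDerivAt (fun s : ℝ => y + s * I) I s := fun y s => by
    simpa using ((ofRealCLM.hasDerivAt (x := s)).mul_const I).const_add y
  have hds : ∀ y ∈ U, ∀ s : ℝ, 0 ≤ s → HasDerivAt (fun s : ℝ => k (y + s * I))
      (deriv k (y + s * I) * I) s := fun y hy s hs => (hkd _ (hup y hy s hs)).comp s (hs0 y s)
  have key := hasDerivAt_integral_of_holomorphic (ν := volume.restrict (Icc (0:ℝ) R))
    (F := fun y s => k (y + s * I) * I) (x₀ := x) (r := r/2) (by positivity) (bound := fun s => C)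
    (integrable_const C) ?_ ?_ ?_
  · refine key.2.congr_deriv ?_
    rw [integral_Icc_eq_integral_Ioc, ← intervalIntegral.integral_of_le hR,
      intervalIntegral.integral_eq_sub_of_hasDerivAt (f := fun s : ℝ => k (x + s * I))]
    · simp
    · intro s hs
      rw [uIcc_of_le hR] at hs
      rw [(hd x hx s hs.1).deriv]
      exact hds x hx s hs.1
    · rw [intervalIntegrable_iff_integrableOn_Icc_of_le hR]
      exact key.1
  · intro y hy
    refine ContinuousOn.aestronglyMeasurable (fun s hs => ?_) measurableSet_Icc
    exact ((hds y (hbs hy) s hs.1).mul_const I).continuousAt.continuousWithinAt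
  · refine (ae_restrict_iff' measurableSet_Icc).mpr (Eventually.of_forall fun s hs y hy => ?_)
    exact (hd y (hbs hy) s hs.1).differentiableAt.differentiableWithinAt
  · refine (ae_restrict_iff' measurableSet_Icc).mpr (Eventually.of_forall fun s hs y hy => ?_)
    rw [norm_mul, norm_I, mul_one]
    exact hC _ ⟨(y, s), ⟨Metric.ball_subset_closedBall hy, hs⟩, rfl⟩

namespace Datum
variable {P : ℕ} (D : Datum P)

/-- A length of vertical paths that makes them end above all poles. -/
def R : ℝ := D.H + 2
theorem R_pos : 0 < D.R := by have := D.one_le_H; simp only [R]; linarith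

/-- Directions in which the contours go to infinity. -/
def IsDir (d : ℂ) : Prop := d = I ∨ d = 1 ∨ d = -1

theorem _root_.BOScattering.Datum.IsDir.norm {d : ℂ} (hd : IsDir d) : ‖d‖ = 1 := by
  rcases hd with rfl | rfl | rfl <;> simp
theorem _root_.BOScattering.Datum.IsDir.im {d : ℂ} (hd : IsDir d) : 0 ≤ d.im := by
  rcases hd with rfl | rfl | rfl <;> simp

/-- Holomorphic functions with poles at the `zₚ` only and quadratic decay. -/
structure Decays (q : ℂ → ℂ) : Prop where
  diff : ∀ x ∈ D.dom, (∀ p, x ≠ D.z p) → DifferentiableAt ℂ q x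
  bound : ∀ η > 0, ∃ C : ℝ, 0 ≤ C ∧ ∀ x ∈ D.dom, (∀ p, η ≤ ‖x - D.z p‖) → ‖q x‖ ≤ C / (1 + ‖x‖) ^ 2

theorem high_of_H_le {x : ℂ} (hx : D.H ≤ x.im) : x ∈ D.Gd ∧ ∀ p, 1 ≤ ‖x - D.z p‖ := by
  refine ⟨⟨by linarith [D.b_pos, D.one_le_H], fun p => Or.inr (by linarith [D.im_le_H p])⟩,
    fun p => ?_⟩
  have := (le_abs_self _).trans (abs_im_le_norm (x - D.z p))
  rw [sub_im] at this
  linarith [D.im_le_H p]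

theorem H_le_add {x : ℂ} (hx : x ∈ D.dom) : D.H + 1 ≤ (x + D.R * I).im := by
  have h1 : -D.b < x.im := hx
  simp [R]; linarith [D.b_le_one]

theorem H_le_add_dir {x d : ℂ} (hx : D.H ≤ x.im) (hd : IsDir d) {s : ℝ} (hs : 0 ≤ s) :
    D.H ≤ (x + s * d).im := by
  have := mul_nonneg hs hd.im
  simp; linarith

/-- The integral operator inverting the differential equation on sources of quadratic decay. -/
def invOp (q : ℂ → ℂ) (d μ x : ℂ) : ℂ :=
  (I / D.ε) * ((D.fac D.Ld μ x)⁻¹ * (vertInt D.R (fun y => D.fac D.Ld μ y * q y) x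
    + tailInt (fun y => D.fac D.Ld μ y * q y) d (x + D.R * I)))

theorem differentiableAt_fac_mul {q : ℂ → ℂ} (hq : D.Decays q) (μ : ℂ) {x : ℂ} (hx : x ∈ D.Gd) :
    DifferentiableAt ℂ (fun y => D.fac D.Ld μ y * q y) x :=
  (D.hasDerivAt_fac (D.hasDerivAt_Ld hx) μ).differentiableAt.mul
    (hq.diff x hx.1 fun p => D.ne_pole_of_mem_Gd hx p)

theorem exists_bound_fac_mul {q : ℂ → ℂ} (hq : D.Decays q) : ∃ C : ℝ, 0 ≤ C ∧ ∀ μ : ℂ, ∀ x ∈ D.dom,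
    (∀ p, 1 ≤ ‖x - D.z p‖) →
    ‖D.fac D.Ld μ x * q x‖ ≤ C * (Real.exp ((μ * x).im / D.ε) / (1 + ‖x‖) ^ 2) := by
  obtain ⟨C₁, h₁⟩ := D.exists_bound_Ld one_pos
  obtain ⟨C₂, h₀, h₂⟩ := hq.bound 1 one_pos
  refine ⟨Real.exp (C₁ / D.ε) * C₂, by positivity, fun μ x hx h => ?_⟩
  rw [norm_mul]
  calc _ ≤ (Real.exp (C₁ / D.ε) * Real.exp ((μ * x).im / D.ε)) * (C₂ / (1 + ‖x‖) ^ 2) := by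
        gcongr
        · exact D.norm_fac_le (h₁ x hx h) μ
        · exact h₂ x hx h
    _ = _ := by ring

theorem one_add_sq_le {y d : ℂ} (hd : ‖d‖ = 1) {s : ℝ} (hs : 0 ≤ s) :
    1 + s ≤ (1 + ‖y‖) * (1 + ‖y + s * d‖) := by
  have h1 : s ≤ ‖y + s * d‖ + ‖y‖ := by
    have : ‖(s:ℂ) * d‖ = s := by rw [norm_mul, hd, mul_one, norm_real, Real.norm_of_nonneg hs]
    calc s = ‖y + s * d - y‖ := by rw [add_sub_cancel_left, this]
      _ ≤ _ := norm_sub_le _ _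
  nlinarith [norm_nonneg y, norm_nonneg (y + s * d)]

theorem inv_sq_le {y d : ℂ} (hd : ‖d‖ = 1) {s : ℝ} (hs : 0 ≤ s) :
    1 / (1 + ‖y + s * d‖) ^ 2 ≤ (1 + ‖y‖) ^ 2 * (1 + s ^ 2)⁻¹ := by
  have h1 := one_add_sq_le (y := y) hd hs
  rw [div_le_iff₀ (by positivity), mul_assoc, mul_comm _ ((1 + ‖y + s * d‖) ^ 2), ← mul_assoc,
    ← mul_pow, ← div_eq_mul_inv, le_div_iff₀ (by positivity), one_mul]
  calc 1 + s ^ 2 ≤ (1 + s) ^ 2 := by nlinarith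
    _ ≤ _ := by gcongr

theorem im_mul_dir_le {μ y d : ℂ} (hμ : (μ * d).im ≤ 0) {s : ℝ} (hs : 0 ≤ s) :
    (μ * (y + s * d)).im ≤ (μ * y).im := by
  have : (μ * (y + s * d)).im = (μ * y).im + s * (μ * d).im := by
    rw [mul_add, add_im]; congr 1
    rw [show μ * (s * d) = s * (μ * d) by ring, im_ofReal_mul]
  rw [this]; nlinarith

/-- As `Im(μd) ≤ 0`, the exponential does not grow along the half-line. In the borderline case
`Im(μd) = 0` the quadratic decay of `q` alone gives integrability, and so positive spectral
parameters are included for `d = -1`. -/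
theorem tail_bound {q : ℂ → ℂ} (hq : D.Decays q) {d : ℂ} (hd : IsDir d) :
    ∃ C : ℝ, 0 ≤ C ∧ ∀ μ y : ℂ, (μ * d).im ≤ 0 → D.H ≤ y.im → ∀ s : ℝ, 0 ≤ s →
    ‖D.fac D.Ld μ (y + s * d) * q (y + s * d)‖
      ≤ C * Real.exp ((μ * y).im / D.ε) * (1 + ‖y‖) ^ 2 * (1 + s ^ 2)⁻¹ := by
  obtain ⟨C, hC, h⟩ := D.exists_bound_fac_mul hq
  refine ⟨C, hC, fun μ y hμ hy s hs => ?_⟩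
  obtain ⟨h1, h2⟩ := D.high_of_H_le (D.H_le_add_dir hy hd hs)
  refine (h μ _ h1.1 h2).trans ?_
  rw [mul_assoc, mul_assoc]
  have hε := D.hε
  gcongr
  rw [div_eq_mul_one_div]
  gcongr
  · exact im_mul_dir_le hμ hs
  · exact inv_sq_le hd.norm hs

/-- The contour rises vertically above all poles before it turns in the direction `d`, so it avoids
the poles and the cuts of `Ld`. The contributions of the corner `x + iR` to the two derivatives
cancel, and the end at `x` produces the source. -/
theorem hasDerivAt_invOp {q : ℂ → ℂ} (hq : D.Decays q) {d : ℂ} (hd : IsDir d) {μ : ℂ}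
    (hμ : (μ * d).im ≤ 0) {x : ℂ} (hx : x ∈ D.Gd) :
    HasDerivAt (D.invOp q d μ) ((I / D.ε) * ((μ + D.u x) * D.invOp q d μ x - q x)) x := by
  set k : ℂ → ℂ := fun y => D.fac D.Ld μ y * q y with hk
  have h1 : HasDerivAt (vertInt D.R k) (k (x + D.R * I) - k x) x :=
    hasDerivAt_vertInt D.R_pos.le D.isOpen_Gd (fun y hy t ht => D.add_mem_Gd hy ht)
      (fun y hy => (D.differentiableAt_fac_mul hq μ hy).differentiableWithinAt) hx
  have h2 : HasDerivAt (tailInt k d) (-k (x + D.R * I)) (x + D.R * I) := by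
    obtain ⟨C, hC, hb⟩ := D.tail_bound hq hd
    set y₀ := x + D.R * I with hy₀
    have hy₀im : D.H + 1 ≤ y₀.im := D.H_le_add hx.1
    have him : ∀ y ∈ Metric.ball y₀ 1, D.H ≤ y.im := by
      intro y hy
      rw [Metric.mem_ball, dist_eq_norm] at hy
      have := (abs_im_le_norm (y - y₀)).trans hy.le
      rw [sub_im, abs_le] at this
      linarith [this.1]
    refine hasDerivAt_tailInt (C := C * Real.exp (‖μ‖ * (‖y₀‖ + 1) / D.ε) * (1 + (‖y₀‖ + 1)) ^ 2)
      one_pos (fun y hy s hs => D.differentiableAt_fac_mul hq μ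
        (D.high_of_H_le (D.H_le_add_dir (him y hy) hd hs)).1) (fun y hy s hs => ?_)
    refine (hb μ y hμ (him y hy) s hs).trans ?_
    have hyn : ‖y‖ ≤ ‖y₀‖ + 1 := by
      rw [Metric.mem_ball, dist_eq_norm] at hy
      have := norm_add_le (y - y₀) y₀
      rw [sub_add_cancel] at this; linarith
    have hε := D.hε
    gcongr
    refine ((le_abs_self _).trans (abs_im_le_norm _)).trans ?_
    rw [norm_mul]; gcongr
  have h3 : HasDerivAt (fun x => tailInt k d (x + D.R * I)) (-k (x + D.R * I)) x := by
    have := h2.comp x ((hasDerivAt_id x).add_const (D.R * I))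
    rw [mul_one] at this
    exact this
  have hE := D.hasDerivAt_fac (D.hasDerivAt_Ld hx) μ
  have hE0 := D.fac_ne_zero D.Ld μ x
  refine (((hE.inv hE0).mul (h1.add h3)).const_mul (I / D.ε)).congr_deriv ?_
  simp only [invOp, hk, Pi.inv_apply, Pi.add_apply]
  field_simp
  ring

end Datum
end BOScattering
end

/-! ### Solutions selected at infinity and their dependence on the spectral parameter -/

noncomputable section
namespace BOScattering
namespace Datum
variable {P : ℕ} (D : Datum P)

/-- The decaying remainder left by the approximate solution `1 / (x - zₚ)`. -/
def q (p : Fin P) (x : ℂ) : ℂ := D.u x * (x - D.z p)⁻¹ - I * D.ε * ((x - D.z p)⁻¹) ^ 2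

theorem decays_u : D.Decays D.u :=
  ⟨fun _ hx h => D.differentiableAt_u hx h, fun _ hη => D.exists_bound_u hη⟩

theorem decays_q (p : Fin P) : D.Decays (D.q p) := by
  refine ⟨fun x hx h => ?_, fun η hη => ?_⟩
  · have h1 := D.differentiableAt_u hx h
    have h2 : x - D.z p ≠ 0 := sub_ne_zero.mpr (h p)
    have h3 : DifferentiableAt ℂ (fun x => (x - D.z p)⁻¹) x := by fun_prop (disch := exact h2)
    exact (h1.mul h3).sub ((h3.pow 2).const_mul _)
  · obtain ⟨C, hC, h⟩ := D.exists_bound_u hη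
    set K := 1 + (1 + ‖D.z p‖) / η
    have hK : 0 ≤ K := by positivity
    refine ⟨C * K + D.ε * K ^ 2, by have := D.hε; positivity, fun x hx hp => ?_⟩
    have h1 := h x hx hp
    have h2 : ‖(x - D.z p)⁻¹‖ ≤ K / (1 + ‖x‖) := norm_inv_sub_le hη (hp p)
    have h3 : K / (1 + ‖x‖) ≤ K := div_le_self hK (by linarith [norm_nonneg x])
    refine (norm_sub_le _ _).trans ?_
    have hε : ‖(D.ε:ℂ)‖ = D.ε := by rw [norm_real, Real.norm_of_nonneg D.hε.le]
    rw [norm_mul, norm_mul, norm_pow, norm_mul, norm_I, one_mul, hε, add_div]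
    have hε := D.hε
    refine add_le_add ?_ ?_
    · calc _ ≤ C / (1 + ‖x‖) ^ 2 * K := by gcongr; exact h2.trans h3
        _ = _ := by ring
    · calc _ ≤ D.ε * (K / (1 + ‖x‖)) ^ 2 := by gcongr
        _ = _ := by rw [div_pow]; ring

/-- The solution of the differential equation off the half-lines going down from the poles that is
selected by its behaviour at infinity in the direction `d`. -/
def wsol (d μ w₀ : ℂ) (φ : Fin P → ℂ) (x : ℂ) : ℂ :=
  w₀ * (1 - D.invOp D.u d μ x) + ∑ p, φ p * (μ⁻¹ * ((x - D.z p)⁻¹ - D.invOp (D.q p) d μ x))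

/-- The constant 1 and the fractions `μ⁻¹/(x - zₚ)` solve the equation for their parts of the source
up to the remainders `u` and `μ⁻¹ qₚ`. These decay quadratically, unlike the source, so `invOp` can
remove them. -/
theorem solvesAt_wsol {d : ℂ} (hd : IsDir d) {μ : ℂ} (hμ : (μ * d).im ≤ 0) (hμ0 : μ ≠ 0) (w₀ : ℂ)
    (φ : Fin P → ℂ) {x : ℂ} (hx : x ∈ D.Gd) : D.SolvesAt μ w₀ φ (D.wsol d μ w₀ φ) x := by
  have h0 := ((D.hasDerivAt_invOp D.decays_u hd hμ hx).const_sub 1).const_mul w₀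
  have hp : ∀ p, HasDerivAt (fun x => φ p * (μ⁻¹ * ((x - D.z p)⁻¹ - D.invOp (D.q p) d μ x)))
      ((I / D.ε) * ((μ + D.u x) * (φ p * (μ⁻¹ * ((x - D.z p)⁻¹ - D.invOp (D.q p) d μ x)))
        - φ p * (x - D.z p)⁻¹)) x := by
    intro p
    have hne : x - D.z p ≠ 0 := sub_ne_zero.mpr (D.ne_pole_of_mem_Gd hx p)
    have h1 := (((hasDerivAt_id x).sub_const (D.z p)).inv hne)
    have h2 := ((h1.sub (D.hasDerivAt_invOp (D.decays_q p) hd hμ hx)).const_mul μ⁻¹).const_mul (φ p)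
    refine h2.congr_deriv ?_
    have := D.εc_ne
    simp only [q, id]
    field_simp
    linear_combination (-φ p * D.ε) * I_sq
  have hs := h0.add (HasDerivAt.fun_sum (u := Finset.univ) fun p _ => hp p)
  refine hs.congr_deriv ?_
  simp only [wsol, src, ← Finset.mul_sum, Finset.sum_sub_distrib, div_eq_mul_inv]
  ring

theorem wsol_linear (d μ w₀ : ℂ) (φ : Fin P → ℂ) (x : ℂ) :
    D.wsol d μ w₀ φ x = w₀ * D.wsol d μ 1 0 x + ∑ p, φ p * D.wsol d μ 0 (Pi.single p 1) x := by
  simp only [wsol, Pi.zero_apply, zero_mul, Finset.sum_const_zero, add_zero, one_mul, zero_add,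
    Pi.single_apply, ite_mul, Finset.sum_ite_eq', Finset.mem_univ, if_true]

/-! ### Dependence on the spectral parameter -/

/-- Functions of the spectral parameter that are analytic where the contours in the direction `d`
give exponential decay and continuous up to the boundary of that region. -/
def Nice (d : ℂ) (F : ℂ → ℂ) : Prop :=
  DifferentiableOn ℂ F {μ | (μ * d).im < 0} ∧ ContinuousOn F {μ | (μ * d).im ≤ 0 ∧ μ ≠ 0}

theorem isOpen_region (d : ℂ) : IsOpen {μ : ℂ | (μ * d).im < 0} :=
  isOpen_lt (by fun_prop) continuous_const

variable {d : ℂ}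

theorem _root_.BOScattering.Datum.Nice.add {F F' : ℂ → ℂ} (h : Nice d F) (h' : Nice d F') :
    Nice d (fun μ => F μ + F' μ) := ⟨h.1.add h'.1, h.2.add h'.2⟩
theorem _root_.BOScattering.Datum.Nice.sub {F F' : ℂ → ℂ} (h : Nice d F) (h' : Nice d F') :
    Nice d (fun μ => F μ - F' μ) := ⟨h.1.sub h'.1, h.2.sub h'.2⟩
theorem _root_.BOScattering.Datum.Nice.mul {F F' : ℂ → ℂ} (h : Nice d F) (h' : Nice d F') :
    Nice d (fun μ => F μ * F' μ) := ⟨h.1.mul h'.1, h.2.mul h'.2⟩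
theorem nice_of_differentiable {F : ℂ → ℂ} (h : Differentiable ℂ F) : Nice d F :=
  ⟨h.differentiableOn, h.continuous.continuousOn⟩
theorem nice_const (k : ℂ) : Nice d (fun _ => k) := nice_of_differentiable (by fun_prop)
theorem nice_inv : Nice d (fun μ => μ⁻¹) := by
  refine ⟨fun μ hμ => ?_, fun μ hμ => ?_⟩
  · have : μ ≠ 0 := by rintro rfl; simp at hμ
    exact (differentiableAt_inv this).differentiableWithinAt
  · exact (continuousAt_inv₀ hμ.2).continuousWithinAt
theorem nice_sum {ι : Type*} (s : Finset ι) {F : ι → ℂ → ℂ} (h : ∀ i ∈ s, Nice d (F i)) :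
    Nice d (fun μ => ∑ i ∈ s, F i μ) :=
  ⟨DifferentiableOn.fun_sum fun i hi => (h i hi).1, continuousOn_finsetSum _ fun i hi => (h i hi).2⟩
theorem nice_prod {ι : Type*} (s : Finset ι) {F : ι → ℂ → ℂ} (h : ∀ i ∈ s, Nice d (F i)) :
    Nice d (fun μ => ∏ i ∈ s, F i μ) :=
  ⟨DifferentiableOn.fun_finsetProd fun i hi => (h i hi).1, continuousOn_finsetProd _ fun i hi => (h i hi).2⟩

theorem differentiable_fac_param (L : ℂ → ℂ) (x : ℂ) : Differentiable ℂ (fun μ => D.fac L μ x) := by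
  unfold fac; fun_prop

theorem differentiable_fac_inv_param (L : ℂ → ℂ) (x : ℂ) :
    Differentiable ℂ (fun μ => (D.fac L μ x)⁻¹) := by
  unfold fac; simp_rw [← exp_neg]; fun_prop

/-- Integrals over bounded paths of integrating factors times bounded functions are entire in the
spectral parameter. -/
theorem differentiable_integral_fac {ν : Measure ℝ} [IsFiniteMeasure ν] {γ : ℝ → ℂ} {L k : ℂ → ℂ}
    {C ρ : ℝ} (hγ : Measurable γ) (hρ : ∀ᵐ t ∂ν, ‖γ t‖ ≤ ρ)
    (hm : AEStronglyMeasurable (fun t => D.fac L 0 (γ t) * k (γ t)) ν)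
    (hb : ∀ᵐ t ∂ν, ‖D.fac L 0 (γ t) * k (γ t)‖ ≤ C) :
    Differentiable ℂ (fun μ => ∫ t, D.fac L μ (γ t) * k (γ t) ∂ν) := by
  -- The spectral parameter enters only through an entire exponential, so measurability and
  -- boundedness are needed at `μ = 0` only.
  have hsplit : ∀ μ x, D.fac L μ x = exp (-(I / D.ε) * (μ * x)) * D.fac L 0 x := by
    intro μ x; rw [fac, fac, ← exp_add]; congr 1; ring
  intro μ₀
  have := differentiableOn_integral_of_holomorphic (ν := ν)
    (F := fun μ t => D.fac L μ (γ t) * k (γ t)) (Metric.isOpen_ball : IsOpen (Metric.ball (0:ℂ) (‖μ₀‖ + 1)))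
    (bound := fun _ => Real.exp (‖(I / (D.ε:ℂ))‖ * ((‖μ₀‖ + 1) * ρ)) * C) (integrable_const _)
    (fun μ _ => ?_) ?_ ?_
  · exact this.differentiableAt (Metric.isOpen_ball.mem_nhds (by simp))
  · have : (fun t => D.fac L μ (γ t) * k (γ t)) = fun t => exp (-(I / (D.ε:ℂ)) * (μ * γ t)) *
        (D.fac L 0 (γ t) * k (γ t)) := by funext t; rw [hsplit, mul_assoc]
    rw [this]
    refine AEStronglyMeasurable.mul ?_ hm
    exact (by fun_prop : Measurable fun t => exp (-(I / (D.ε:ℂ)) * (μ * γ t))).aestronglyMeasurable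
  · refine Eventually.of_forall fun t => ?_
    exact ((D.differentiable_fac_param L (γ t)).mul_const _).differentiableOn
  · filter_upwards [hb, hρ] with t ht hρt μ hμ
    rw [hsplit, mul_assoc, norm_mul]
    gcongr
    rw [norm_exp]
    refine Real.exp_le_exp.mpr ((le_abs_self _).trans ((abs_re_le_norm _).trans ?_))
    rw [norm_mul, norm_neg, norm_mul]
    rw [mem_ball_zero_iff] at hμ
    gcongr

/-- On bounded sets of `μ` the integrand is dominated by a multiple of `(1 + s²)⁻¹`, uniformly up to
the boundary of the region. Thus the same bound gives analyticity inside and continuity up to the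
boundary. -/
theorem nice_tailInt {q : ℂ → ℂ} (hq : D.Decays q) (hd : IsDir d) {y : ℂ} (hy : D.H ≤ y.im) :
    Nice d (fun μ => tailInt (fun x => D.fac D.Ld μ x * q x) d y) := by
  obtain ⟨C, hC, hb⟩ := D.tail_bound hq hd
  have hcont : ∀ μ : ℂ, AEStronglyMeasurable (fun s : ℝ => D.fac D.Ld μ (y + s * d) * q (y + s * d) * d)
      (volume.restrict (Ioi 0)) := by
    intro μ
    refine ContinuousOn.aestronglyMeasurable (fun s hs => ?_) measurableSet_Ioi
    have h1 := (D.differentiableAt_fac_mul hq μ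
      (D.high_of_H_le (D.H_le_add_dir hy hd (le_of_lt hs))).1).continuousAt
    have h2 : ContinuousAt (fun s : ℝ => y + s * d) s := by fun_prop
    exact ((ContinuousAt.comp (f := fun s : ℝ => y + s * d) h1 h2).mul_const d).continuousWithinAt
  have hbound : ∀ ρ : ℝ, ∀ μ : ℂ, ‖μ‖ ≤ ρ → (μ * d).im ≤ 0 → ∀ s : ℝ, 0 < s →
      ‖D.fac D.Ld μ (y + s * d) * q (y + s * d) * d‖
        ≤ C * Real.exp (ρ * ‖y‖ / D.ε) * (1 + ‖y‖) ^ 2 * (1 + s ^ 2)⁻¹ := by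
    intro ρ μ hρ hμ s hs
    rw [norm_mul, hd.norm, mul_one]
    refine (hb μ y hμ hy s hs.le).trans ?_
    have hε := D.hε
    gcongr
    refine ((le_abs_self _).trans (abs_im_le_norm _)).trans ?_
    rw [norm_mul]; gcongr
  have hdiff : ∀ s : ℝ, Differentiable ℂ (fun μ => D.fac D.Ld μ (y + s * d) * q (y + s * d) * d) :=
    fun s => ((D.differentiable_fac_param _ _).mul_const _).mul_const _
  have hint : ∀ ρ : ℝ, Integrable (fun s : ℝ => C * Real.exp (ρ * ‖y‖ / D.ε) * (1 + ‖y‖) ^ 2 * (1 + s ^ 2)⁻¹)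
      (volume.restrict (Ioi 0)) := fun ρ =>
    (integrable_inv_one_add_sq.const_mul _).integrableOn
  constructor
  · intro μ₀ hμ₀
    have := differentiableOn_integral_of_holomorphic (ν := volume.restrict (Ioi (0:ℝ)))
      (F := fun μ s => D.fac D.Ld μ (y + s * d) * q (y + s * d) * d)
      ((isOpen_region d).inter (Metric.isOpen_ball : IsOpen (Metric.ball (0:ℂ) (‖μ₀‖ + 1))))
      (hint (‖μ₀‖ + 1)) (fun μ _ => hcont μ) (Eventually.of_forall fun s => (hdiff s).differentiableOn)
      ((ae_restrict_iff' measurableSet_Ioi).mpr (Eventually.of_forall fun s hs μ hμ =>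
        hbound _ μ (mem_ball_zero_iff.mp hμ.2).le (le_of_lt hμ.1) s hs))
    exact (this.differentiableAt (((isOpen_region d).inter Metric.isOpen_ball).mem_nhds
      ⟨hμ₀, by simp⟩)).differentiableWithinAt
  · intro μ₀ hμ₀
    refine continuousWithinAt_of_dominated (bound := fun s : ℝ =>
      C * Real.exp ((‖μ₀‖ + 1) * ‖y‖ / D.ε) * (1 + ‖y‖) ^ 2 * (1 + s ^ 2)⁻¹)
      (Eventually.of_forall hcont) ?_ (hint _)
      (Eventually.of_forall fun s => (hdiff s).continuous.continuousWithinAt)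
    have h1 : ∀ᶠ μ in 𝓝[{μ | (μ * d).im ≤ 0 ∧ μ ≠ 0}] μ₀, ‖μ‖ < ‖μ₀‖ + 1 :=
      nhdsWithin_le_nhds (continuous_norm.continuousAt.eventually (gt_mem_nhds (lt_add_one _)))
    filter_upwards [h1, self_mem_nhdsWithin] with μ h1 h2
    exact (ae_restrict_iff' measurableSet_Ioi).mpr (Eventually.of_forall fun s hs =>
      hbound _ μ h1.le h2.1 s hs)

theorem nice_invOp {q : ℂ → ℂ} (hq : D.Decays q) (hd : IsDir d) {x : ℂ} (hx : x ∈ D.Gd) :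
    Nice d (fun μ => D.invOp q d μ x) := by
  unfold invOp
  refine (nice_const _).mul ((nice_of_differentiable (D.differentiable_fac_inv_param _ _)).mul
    (Nice.add (nice_of_differentiable ?_) (D.nice_tailInt hq hd (by linarith [D.H_le_add hx.1]))))
  have hc : ContinuousOn (fun t : ℝ => D.fac D.Ld 0 (x + t * I) * q (x + t * I) * I) (Icc 0 D.R) := by
    intro t ht
    have h1 := (D.differentiableAt_fac_mul hq 0 (D.add_mem_Gd hx ht.1)).continuousAt
    have h2 : ContinuousAt (fun s : ℝ => x + s * I) t := by fun_prop
    exact ((ContinuousAt.comp (f := fun s : ℝ => x + s * I) h1 h2).mul_const I).continuousWithinAt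
  obtain ⟨C, hC⟩ := isCompact_Icc.exists_bound_of_continuousOn hc
  have := D.differentiable_integral_fac (ν := volume.restrict (Icc 0 D.R)) (L := D.Ld)
    (γ := fun t => x + t * I) (k := fun y => q y * I) (C := C) (ρ := ‖x‖ + D.R) (by fun_prop)
    ((ae_restrict_iff' measurableSet_Icc).mpr (Eventually.of_forall fun t ht => ?_))
    (by simpa [mul_assoc] using hc.aestronglyMeasurable measurableSet_Icc)
    ((ae_restrict_iff' measurableSet_Icc).mpr (Eventually.of_forall fun t ht => by
      simpa [mul_assoc] using hC t ht))
  · simpa [vertInt, mul_assoc] using this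
  · refine (norm_add_le _ _).trans ?_
    rw [norm_mul, norm_I, mul_one, norm_real, Real.norm_of_nonneg ht.1]
    linarith [ht.2]

theorem nice_wsol (hd : IsDir d) (w₀ : ℂ) (φ : Fin P → ℂ) {x : ℂ} (hx : x ∈ D.Gd) :
    Nice d (fun μ => D.wsol d μ w₀ φ x) := by
  unfold wsol
  refine Nice.add ((nice_const _).mul ((nice_const _).sub (D.nice_invOp D.decays_u hd hx)))
    (nice_sum _ fun p _ => (nice_const _).mul (nice_inv.mul
      ((nice_const _).sub (D.nice_invOp (D.decays_q p) hd hx))))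

end Datum
end BOScattering
end

/-! ### Asymptotics of the selected solutions -/

noncomputable section
namespace BOScattering

theorem exists_sq_mul_exp_le {κ : ℝ} (hκ : 0 < κ) : ∃ K : ℝ, 0 ≤ K ∧ ∀ s : ℝ, 0 ≤ s →
    (1 + s) ^ 2 * Real.exp (-κ * s) ≤ K * Real.exp (-(κ / 2) * s) := by
  -- The constant comes from `y ≤ e^y` at `y = κ(1 + s)/4`, squared.
  refine ⟨(4 / κ) ^ 2 * Real.exp (κ / 2), by positivity, fun s hs => ?_⟩
  have h1 : 1 + s ≤ 4 / κ * Real.exp (κ / 4 * (1 + s)) := by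
    have := Real.add_one_le_exp (κ / 4 * (1 + s))
    calc 1 + s = 4 / κ * (κ / 4 * (1 + s)) := by field_simp
      _ ≤ _ := by gcongr; linarith
  calc (1 + s) ^ 2 * Real.exp (-κ * s)
      ≤ (4 / κ * Real.exp (κ / 4 * (1 + s))) ^ 2 * Real.exp (-κ * s) := by gcongr
    _ = (4 / κ) ^ 2 * (Real.exp (κ / 4 * (1 + s)) ^ 2 * Real.exp (-κ * s)) := by ring
    _ = (4 / κ) ^ 2 * (Real.exp (κ / 2) * Real.exp (-(κ / 2) * s)) := by
        rw [← Real.exp_nat_mul, ← Real.exp_add, ← Real.exp_add]; congr 2; push_cast; ring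
    _ = _ := by ring

theorem integrableOn_inv_sq {A : ℝ} (hA : 0 < A) :
    IntegrableOn (fun s : ℝ => 1 / (A + s) ^ 2) (Ioi 0) ∧ ∫ s in Ioi (0:ℝ), 1 / (A + s) ^ 2 = 1 / A := by
  have hd : ∀ s ∈ Ici (0:ℝ), HasDerivAt (fun s : ℝ => -(A + s)⁻¹) (1 / (A + s) ^ 2) s := by
    intro s hs
    have hne : A + s ≠ 0 := by have : 0 ≤ s := hs; positivity
    have := (((hasDerivAt_id s).const_add A).inv hne).neg
    refine this.congr_deriv ?_
    simp; field_simp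
  have hl : Tendsto (fun s : ℝ => -(A + s)⁻¹) atTop (𝓝 0) := by
    have := (tendsto_inv_atTop_zero.comp (tendsto_atTop_add_const_left atTop A tendsto_id)).neg
    simpa using this
  have hi := integrableOn_Ioi_deriv_of_nonneg' hd (fun s _ => by positivity) hl
  refine ⟨hi, ?_⟩
  rw [integral_Ioi_of_hasDerivAt_of_tendsto' hd hi hl]
  simp

namespace Datum
variable {P : ℕ} (D : Datum P) {d : ℂ}

/-- A radius of a disc containing all poles. -/
def X₀ : ℝ := 1 + ∑ p, ‖D.z p‖

theorem X₀_pos : 0 < D.X₀ := by unfold X₀; positivity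

theorem one_le_of_X₀_le {x : ℂ} (h : D.X₀ ≤ ‖x‖) (p : Fin P) : 1 ≤ ‖x - D.z p‖ := by
  have h1 := Finset.single_le_sum (f := fun p => ‖D.z p‖) (fun p _ => norm_nonneg _) (Finset.mem_univ p)
  have h2 := norm_sub_norm_le x (D.z p)
  simp only [X₀] at h h1
  linarith

theorem mem_Gd_of_X₀_le {x : ℂ} (hx : x ∈ closedUpper) (h : D.X₀ ≤ ‖x‖) : x ∈ D.Gd := by
  have hx0 : 0 ≤ x.im := hx
  refine ⟨D.closedUpper_subset_dom hx, fun p => ?_⟩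
  by_contra! hcon
  have h1 := Finset.single_le_sum (f := fun p => ‖D.z p‖) (fun p _ => norm_nonneg _) (Finset.mem_univ p)
  have : ‖x‖ ≤ ‖D.z p‖ := by
    rw [← sq_le_sq₀ (norm_nonneg _) (norm_nonneg _), ← normSq_eq_norm_sq, ← normSq_eq_norm_sq,
      normSq_apply, normSq_apply, hcon.1]
    nlinarith [hcon.2]
  simp only [X₀] at h h1
  linarith

theorem norm_le_norm_add {x : ℂ} (hx : x ∈ closedUpper) {t : ℝ} (ht : 0 ≤ t) : ‖x‖ ≤ ‖x + t * I‖ := by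
  have hx0 : 0 ≤ x.im := hx
  rw [← sq_le_sq₀ (norm_nonneg _) (norm_nonneg _), ← normSq_eq_norm_sq, ← normSq_eq_norm_sq,
    normSq_apply, normSq_apply]
  simp
  nlinarith

theorem add_mem_closedUpper {x : ℂ} (hx : x ∈ closedUpper) {t : ℝ} (ht : 0 ≤ t) :
    x + t * I ∈ closedUpper := by
  have hx0 : 0 ≤ x.im := hx
  simp [closedUpper]; linarith

/-- The general estimate of the remainder in terms of the integral along the horizontal part of
the contour. -/
theorem exists_invOp_bound {q : ℂ → ℂ} (hq : D.Decays q) (hd : IsDir d) (μ : ℂ) :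
    ∃ C : ℝ, 0 ≤ C ∧ ∀ x ∈ closedUpper, D.X₀ ≤ ‖x‖ → ∀ m : ℝ → ℝ, IntegrableOn m (Ioi 0) →
      (∀ s : ℝ, 0 ≤ s → Real.exp (s * (μ * d).im / D.ε) / (1 + ‖x + D.R * I + s * d‖) ^ 2 ≤ m s) →
      ‖D.invOp q d μ x‖ ≤ C * (1 / (1 + ‖x‖) ^ 2 + ∫ s in Ioi (0:ℝ), m s) := by
  obtain ⟨C₁, h₁⟩ := D.exists_bound_Ld one_pos
  obtain ⟨C₂, hC₂, h₂⟩ := D.exists_bound_fac_mul hq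
  have hε := D.hε
  have hR := D.R_pos
  set K := Real.exp (C₁ / D.ε) * (C₂ * Real.exp (‖μ‖ * D.R / D.ε)) with hK
  refine ⟨D.ε⁻¹ * (K * D.R + K), by positivity, fun x hx hX m hm hle => ?_⟩
  -- The quotient of the integrating factors at `y` and `x` is at most a constant times the
  -- exponential of `(Im(μy) - Im(μx))/ε`. The rise by at most `R` costs `‖μ‖ R`, and `δ` accounts
  -- for the horizontal or upward tail.
  have hE : ∀ y ∈ D.dom, (∀ p, 1 ≤ ‖y - D.z p‖) → ∀ δ : ℝ,
      (μ * y).im ≤ (μ * x).im + ‖μ‖ * D.R + δ →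
      ‖(D.fac D.Ld μ x)⁻¹‖ * ‖D.fac D.Ld μ y * q y‖ ≤ K * (Real.exp (δ / D.ε) / (1 + ‖y‖) ^ 2) := by
    intro y hy hyp δ hδ
    have h3 := D.le_norm_fac (h₁ x (D.closedUpper_subset_dom hx) (D.one_le_of_X₀_le hX)) μ
    have h4 := h₂ μ y hy hyp
    have h5 : ‖(D.fac D.Ld μ x)⁻¹‖ ≤ Real.exp (C₁ / D.ε) * Real.exp (-((μ * x).im / D.ε)) := by
      rw [norm_inv]
      refine (inv_anti₀ (by positivity) h3).trans (le_of_eq ?_)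
      rw [mul_inv, ← Real.exp_neg, neg_neg, ← Real.exp_neg]
    calc _ ≤ (Real.exp (C₁ / D.ε) * Real.exp (-((μ * x).im / D.ε)))
          * (C₂ * (Real.exp (((μ * x).im + ‖μ‖ * D.R + δ) / D.ε) / (1 + ‖y‖) ^ 2)) := by
          gcongr
          refine h4.trans ?_
          gcongr
      _ = Real.exp (C₁ / D.ε) * C₂ * (Real.exp (-((μ * x).im / D.ε))
          * Real.exp (((μ * x).im + ‖μ‖ * D.R + δ) / D.ε)) / (1 + ‖y‖) ^ 2 := by ring
      _ = Real.exp (C₁ / D.ε) * C₂ * (Real.exp (‖μ‖ * D.R / D.ε) * Real.exp (δ / D.ε)) / (1 + ‖y‖) ^ 2 := by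
          rw [← Real.exp_add, ← Real.exp_add]; congr 3; ring
      _ = _ := by rw [hK]; ring
  have hsplit : D.invOp q d μ x = (I / D.ε) * ((D.fac D.Ld μ x)⁻¹ *
      vertInt D.R (fun y => D.fac D.Ld μ y * q y) x) + (I / D.ε) * ((D.fac D.Ld μ x)⁻¹ *
      tailInt (fun y => D.fac D.Ld μ y * q y) d (x + D.R * I)) := by rw [invOp]; ring
  have hIε : ‖I / (D.ε : ℂ)‖ = D.ε⁻¹ := by
    rw [norm_div, norm_I, norm_real, Real.norm_of_nonneg hε.le, one_div]
  have hv : ‖(D.fac D.Ld μ x)⁻¹ * vertInt D.R (fun y => D.fac D.Ld μ y * q y) x‖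
      ≤ K * D.R * (1 / (1 + ‖x‖) ^ 2) := by
    rw [vertInt, ← integral_const_mul]
    have := norm_setIntegral_le_of_norm_le_const (μ := volume) (s := Icc 0 D.R)
      (C := K * (1 / (1 + ‖x‖) ^ 2)) (f := fun t : ℝ => (D.fac D.Ld μ x)⁻¹ *
        (D.fac D.Ld μ (x + t * I) * q (x + t * I) * I)) (by simp) (fun t ht => ?_)
    · refine this.trans (le_of_eq ?_)
      rw [Real.volume_real_Icc_of_le hR.le]; ring
    · rw [norm_mul, norm_mul _ I, norm_I, mul_one]
      have hn := norm_le_norm_add hx ht.1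
      refine (hE _ (D.closedUpper_subset_dom (add_mem_closedUpper hx ht.1))
        (D.one_le_of_X₀_le (hX.trans hn)) 0 ?_).trans ?_
      · rw [mul_add, add_im]
        have : (μ * (t * I)).im ≤ ‖μ‖ * D.R := by
          refine (le_abs_self _).trans ((abs_im_le_norm _).trans ?_)
          rw [norm_mul, norm_mul, norm_I, mul_one, norm_real, Real.norm_of_nonneg ht.1]
          gcongr; exact ht.2
        linarith
      · rw [zero_div, Real.exp_zero]; gcongr
  have ht : ‖(D.fac D.Ld μ x)⁻¹ * tailInt (fun y => D.fac D.Ld μ y * q y) d (x + D.R * I)‖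
      ≤ K * ∫ s in Ioi (0:ℝ), m s := by
    rw [tailInt, ← integral_const_mul, ← integral_const_mul]
    refine norm_integral_le_of_norm_le (hm.const_mul K)
      ((ae_restrict_iff' measurableSet_Ioi).mpr (Eventually.of_forall fun s hs => ?_))
    have hs0 : (0:ℝ) ≤ s := le_of_lt hs
    rw [norm_mul, norm_mul _ d, hd.norm, mul_one]
    obtain ⟨g1, g2⟩ := D.high_of_H_le (D.H_le_add_dir
      (by linarith [D.H_le_add (D.closedUpper_subset_dom hx)] : D.H ≤ (x + D.R * I).im) hd hs0)
    refine (hE _ g1.1 g2 (s * (μ * d).im) ?_).trans (mul_le_mul_of_nonneg_left (hle s hs0) (by positivity))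
    have e : (μ * (x + D.R * I + s * d)).im = (μ * x).im + (μ * (D.R * I)).im + s * (μ * d).im := by
      rw [mul_add, mul_add, add_im, add_im, show μ * (s * d) = s * (μ * d) by ring, im_ofReal_mul]
    rw [e]
    have : (μ * (D.R * I)).im ≤ ‖μ‖ * D.R := by
      refine (le_abs_self _).trans ((abs_im_le_norm _).trans ?_)
      rw [norm_mul, norm_mul, norm_I, mul_one, norm_real, Real.norm_of_nonneg hR.le]
    linarith
  rw [hsplit]
  refine (norm_add_le _ _).trans ?_
  rw [norm_mul, norm_mul (I / (D.ε:ℂ)), hIε, ← mul_add, mul_assoc]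
  have hm0 : 0 ≤ ∫ s in Ioi (0:ℝ), m s := setIntegral_nonneg measurableSet_Ioi fun s hs =>
    le_trans (by positivity) (hle s (le_of_lt hs))
  have hx0 : 0 ≤ 1 / (1 + ‖x‖) ^ 2 := by positivity
  have hKR : 0 ≤ K * D.R := by positivity
  have hK0 : 0 ≤ K := by positivity
  gcongr
  nlinarith [mul_nonneg hKR hm0, mul_nonneg hK0 hx0]

/-- Replacing the weight at the running point by the weight at `x` costs a factor `(1 + s)²`, which
the exponential decay along the tail absorbs. The estimate holds in all directions of `x`. -/
theorem exists_invOp_bound_strict {q : ℂ → ℂ} (hq : D.Decays q) (hd : IsDir d) {μ : ℂ}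
    (hμ : (μ * d).im < 0) : ∃ C : ℝ, 0 ≤ C ∧ ∀ x ∈ closedUpper, D.X₀ ≤ ‖x‖ →
      ‖D.invOp q d μ x‖ ≤ C / (1 + ‖x‖) ^ 2 := by
  have hε := D.hε
  obtain ⟨C, hC, h⟩ := D.exists_invOp_bound hq hd μ
  have hκ : 0 < -(μ * d).im / D.ε := div_pos (neg_pos.mpr hμ) hε
  obtain ⟨K, hK, hexp⟩ := exists_sq_mul_exp_le hκ
  set κ := -(μ * d).im / D.ε with hκd
  have hint := integrableOn_exp_mul_Ioi (a := -(κ / 2)) (by linarith) 0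
  refine ⟨C * (1 + K * ∫ s in Ioi (0:ℝ), Real.exp (-(κ / 2) * s)), ?_, fun x hx hX => ?_⟩
  · have : 0 ≤ ∫ s in Ioi (0:ℝ), Real.exp (-(κ / 2) * s) := integral_nonneg fun s => by positivity
    positivity
  · refine (h x hx hX (fun s => 1 / (1 + ‖x‖) ^ 2 * (K * Real.exp (-(κ / 2) * s)))
      ((hint.const_mul K).const_mul _) (fun s hs => ?_)).trans (le_of_eq ?_)
    · have h1 := norm_le_norm_add hx D.R_pos.le
      have h2 : 1 + ‖x‖ ≤ (1 + s) * (1 + ‖x + D.R * I + s * d‖) := by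
        have : ‖x + D.R * I‖ ≤ ‖x + D.R * I + s * d‖ + s := by
          have h3 := norm_sub_le (x + D.R * I + s * d) (s * d)
          rw [add_sub_cancel_right, norm_mul, hd.norm, mul_one, norm_real, Real.norm_of_nonneg hs] at h3
          exact h3
        nlinarith [norm_nonneg (x + D.R * I + s * d)]
      have h4 : s * (μ * d).im / D.ε = -κ * s := by rw [hκd]; ring
      rw [h4, div_mul_eq_mul_div, one_mul, div_le_div_iff₀ (by positivity) (by positivity)]
      calc Real.exp (-κ * s) * (1 + ‖x‖) ^ 2
          ≤ Real.exp (-κ * s) * ((1 + s) * (1 + ‖x + D.R * I + s * d‖)) ^ 2 := by gcongr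
        _ = ((1 + s) ^ 2 * Real.exp (-κ * s)) * (1 + ‖x + D.R * I + s * d‖) ^ 2 := by ring
        _ ≤ _ := mul_le_mul_of_nonneg_right (hexp s hs) (by positivity)
    · rw [integral_const_mul, integral_const_mul]; ring

/-- Exponential decay may be absent. If `x` lies on the side to which `d` points, however, the tail
moves away from the origin: its points have norm at least `‖x‖` and at least `s`, and the quadratic
decay integrates to `O(1/‖x‖)`. -/
theorem exists_invOp_bound_outward {q : ℂ → ℂ} (hq : D.Decays q) (hd : d = 1 ∨ d = -1) {μ : ℂ}
    (hμ : (μ * d).im ≤ 0) : ∃ C : ℝ, 0 ≤ C ∧ ∀ x ∈ closedUpper, D.X₀ ≤ ‖x‖ → 0 ≤ x.re * d.re →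
      ‖D.invOp q d μ x‖ ≤ C / (1 + ‖x‖) := by
  have hε := D.hε
  obtain ⟨C, hC, h⟩ := D.exists_invOp_bound hq (d := d) (Or.inr hd) μ
  refine ⟨C * 5, by positivity, fun x hx hX hxd => ?_⟩
  obtain ⟨i1, i2⟩ := integrableOn_inv_sq (A := 1 + ‖x‖) (by positivity)
  refine (h x hx hX (fun s => 4 * (1 / (1 + ‖x‖ + s) ^ 2)) (i1.const_mul 4) (fun s hs => ?_)).trans ?_
  · have h1 := norm_le_norm_add hx D.R_pos.le
    have him : (x + D.R * I + s * d).im = (x + D.R * I).im := by rcases hd with rfl | rfl <;> simp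
    have hdr : d.re = 1 ∨ d.re = -1 := by rcases hd with rfl | rfl <;> simp
    have hre : (x + D.R * I + s * d).re = x.re + s * d.re := by simp
    have hre' : (x + D.R * I).re = x.re := by simp
    have h2 : ‖x + D.R * I‖ ≤ ‖x + D.R * I + s * d‖ := by
      rw [← sq_le_sq₀ (norm_nonneg _) (norm_nonneg _), ← normSq_eq_norm_sq, ← normSq_eq_norm_sq,
        normSq_apply, normSq_apply, him, hre, hre']
      rcases hdr with h | h <;> rw [h] at hxd ⊢ <;> nlinarith
    have h3 : s ≤ ‖x + D.R * I + s * d‖ := by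
      refine le_trans ?_ (abs_re_le_norm _)
      rw [hre]
      rcases hdr with h | h <;> rw [h] at hxd ⊢
      · exact le_trans (by linarith) (le_abs_self _)
      · exact le_trans (by linarith) (neg_le_abs _)
    calc _ ≤ 1 / (1 + ‖x + D.R * I + s * d‖) ^ 2 := by
          gcongr
          rw [← Real.exp_zero]
          refine Real.exp_le_exp.mpr (div_nonpos_of_nonpos_of_nonneg ?_ hε.le)
          nlinarith
      _ ≤ 1 / ((1 + ‖x‖ + s) / 2) ^ 2 := by gcongr; linarith
      _ = _ := by field_simp; norm_num
  · rw [integral_const_mul, i2]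
    have h0 : 0 < 1 + ‖x‖ := by positivity
    have : 1 / (1 + ‖x‖) ^ 2 ≤ 1 / (1 + ‖x‖) := by
      gcongr
      nlinarith [norm_nonneg x]
    calc _ ≤ C * (1 / (1 + ‖x‖) + 4 * (1 / (1 + ‖x‖))) := by gcongr
      _ = _ := by ring

theorem wsol_sub_eq (d μ w₀ : ℂ) (φ : Fin P → ℂ) (x : ℂ) :
    D.wsol d μ w₀ φ x - w₀ - μ⁻¹ * ∑ p, φ p * (x - D.z p)⁻¹
      = -(w₀ * D.invOp D.u d μ x) - ∑ p, φ p * (μ⁻¹ * D.invOp (D.q p) d μ x) := by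
  simp only [wsol, mul_sub, Finset.sum_sub_distrib, Finset.mul_sum]
  have : ∀ p, φ p * (μ⁻¹ * (x - D.z p)⁻¹) = μ⁻¹ * (φ p * (x - D.z p)⁻¹) := fun p => by ring
  simp only [this]; ring

theorem norm_wsol_sub_le {d μ w₀ : ℂ} {φ : Fin P → ℂ} {x : ℂ} {B C₀ : ℝ} {C : Fin P → ℝ}
    (h0 : ‖D.invOp D.u d μ x‖ ≤ C₀ * B) (h : ∀ p, ‖D.invOp (D.q p) d μ x‖ ≤ C p * B) :
    ‖D.wsol d μ w₀ φ x - w₀ - μ⁻¹ * ∑ p, φ p * (x - D.z p)⁻¹‖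
      ≤ (‖w₀‖ * C₀ + ∑ p, ‖φ p‖ * (‖μ⁻¹‖ * C p)) * B := by
  rw [wsol_sub_eq]
  refine (norm_sub_le _ _).trans ?_
  rw [norm_neg, norm_mul, add_mul, Finset.sum_mul]
  refine add_le_add (by rw [mul_assoc]; gcongr) ((norm_sum_le _ _).trans (Finset.sum_le_sum fun p _ => ?_))
  rw [norm_mul, norm_mul, mul_assoc, mul_assoc]
  gcongr
  exact h p

theorem exists_wsol_bound_strict (hd : IsDir d) {μ : ℂ} (hμ : (μ * d).im < 0) (w₀ : ℂ)
    (φ : Fin P → ℂ) : ∃ C : ℝ, 0 ≤ C ∧ ∀ x ∈ closedUpper, D.X₀ ≤ ‖x‖ →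
      ‖D.wsol d μ w₀ φ x - w₀ - μ⁻¹ * ∑ p, φ p * (x - D.z p)⁻¹‖ ≤ C / (1 + ‖x‖) ^ 2 := by
  obtain ⟨C₀, hC₀, h0⟩ := D.exists_invOp_bound_strict D.decays_u hd hμ
  choose C hC h using fun p => D.exists_invOp_bound_strict (D.decays_q p) hd hμ
  refine ⟨‖w₀‖ * C₀ + ∑ p, ‖φ p‖ * (‖μ⁻¹‖ * C p), ?_, fun x hx hX => ?_⟩
  · have := Finset.sum_nonneg (s := Finset.univ) fun p _ =>
      mul_nonneg (norm_nonneg (φ p)) (mul_nonneg (norm_nonneg μ⁻¹) (hC p))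
    positivity
  · rw [div_eq_mul_inv]
    exact D.norm_wsol_sub_le (by rw [← div_eq_mul_inv]; exact h0 x hx hX)
      (fun p => by rw [← div_eq_mul_inv]; exact h p x hx hX)

theorem exists_wsol_bound_outward (hd : d = 1 ∨ d = -1) {μ : ℂ} (hμ : (μ * d).im ≤ 0) (w₀ : ℂ)
    (φ : Fin P → ℂ) : ∃ C : ℝ, 0 ≤ C ∧ ∀ x ∈ closedUpper, D.X₀ ≤ ‖x‖ → 0 ≤ x.re * d.re →
      ‖D.wsol d μ w₀ φ x - w₀ - μ⁻¹ * ∑ p, φ p * (x - D.z p)⁻¹‖ ≤ C / (1 + ‖x‖) := by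
  obtain ⟨C₀, hC₀, h0⟩ := D.exists_invOp_bound_outward D.decays_u hd hμ
  choose C hC h using fun p => D.exists_invOp_bound_outward (D.decays_q p) hd hμ
  refine ⟨‖w₀‖ * C₀ + ∑ p, ‖φ p‖ * (‖μ⁻¹‖ * C p), ?_, fun x hx hX hxd => ?_⟩
  · have := Finset.sum_nonneg (s := Finset.univ) fun p _ =>
      mul_nonneg (norm_nonneg (φ p)) (mul_nonneg (norm_nonneg μ⁻¹) (hC p))
    positivity
  · rw [div_eq_mul_inv]
    exact D.norm_wsol_sub_le (by rw [← div_eq_mul_inv]; exact h0 x hx hX hxd)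
      (fun p => by rw [← div_eq_mul_inv]; exact h p x hx hX hxd)

theorem exists_sum_inv_bound (φ : Fin P → ℂ) : ∃ C : ℝ, 0 ≤ C ∧ ∀ x : ℂ, D.X₀ ≤ ‖x‖ →
    ‖∑ p, φ p * (x - D.z p)⁻¹‖ ≤ C / (1 + ‖x‖) := by
  refine ⟨∑ p, ‖φ p‖ * (1 + (1 + ‖D.z p‖) / 1), by positivity, fun x hX => ?_⟩
  refine (norm_sum_le _ _).trans ?_
  rw [Finset.sum_div]
  refine Finset.sum_le_sum fun p _ => ?_
  rw [norm_mul, mul_div_assoc]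
  gcongr
  exact norm_inv_sub_le one_pos (D.one_le_of_X₀_le hX p)

end Datum
end BOScattering
end

/-! ### Vertical rays and the factorization at poles with negative integer exponent -/

noncomputable section
namespace BOScattering

theorem exists_pos_le_of_finite {ι : Type*} [Finite ι] {g : ι → ℝ} (hg : ∀ i, 0 < g i) :
    ∃ η : ℝ, 0 < η ∧ ∀ i, η ≤ g i := by
  rcases isEmpty_or_nonempty ι with h | h
  · exact ⟨1, one_pos, fun i => h.elim i⟩
  · obtain ⟨i, hi⟩ := Finite.exists_min g
    exact ⟨g i, hg i, hi⟩

namespace Datum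
variable {P : ℕ} (D : Datum P)

theorem a_strictMono : StrictMono D.a :=
  Fin.strictMono_iff_lt_succ.mpr fun p => (D.ha p).1.trans (D.ha p).2

theorem a_lt_re {i : Fin (P + 1)} {p : Fin P} (h : i ≤ p.castSucc) : D.a i < (D.z p).re :=
  (D.a_strictMono.monotone h).trans_lt (D.ha p).1

theorem re_lt_a {i : Fin (P + 1)} {p : Fin P} (h : p.succ ≤ i) : (D.z p).re < D.a i :=
  (D.ha p).2.trans_le (D.a_strictMono.monotone h)

theorem a_ne_re (i : Fin (P + 1)) (p : Fin P) : D.a i ≠ (D.z p).re := by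
  rcases le_or_gt i p.castSucc with h | h
  · exact (D.a_lt_re h).ne
  · exact (D.re_lt_a (Fin.castSucc_lt_iff_succ_le.mp h)).ne'

theorem ofReal_mem_Gd {s : ℝ} (hs : ∀ p, s ≠ (D.z p).re) : (s : ℂ) ∈ D.Gd :=
  ⟨by simpa using D.b_pos, fun p => Or.inl (by simpa using hs p)⟩

theorem a_mem_Gd (i : Fin (P + 1)) : (D.a i : ℂ) ∈ D.Gd := D.ofReal_mem_Gd (D.a_ne_re i)

/-- The integrating factor with branch cuts going up. -/
def Eu (μ x : ℂ) : ℂ := D.fac (f D.c D.z) μ x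

theorem exp_eq_Eu (μ x : ℂ) : exp (-I * h D.c D.z μ x / D.ε) = D.Eu μ x := by
  rw [Eu, fac, h]; congr 1; ring

theorem Eu_ne_zero (μ x : ℂ) : D.Eu μ x ≠ 0 := exp_ne_zero _

theorem hasDerivAt_Eu {x : ℂ} (hx : x ∈ D.Gu) (μ : ℂ) :
    HasDerivAt (D.Eu μ) (-(I / D.ε) * (μ + D.u x) * D.Eu μ x) x :=
  D.hasDerivAt_fac (D.hasDerivAt_f hx) μ

/-! ### Integrals along rays going up -/

/-- `L` is a bounded antiderivative of the potential along the ray going up from `x`. -/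
structure RayPrimitive (L : ℂ → ℂ) (x : ℂ) : Prop where
  deriv : ∀ t : ℝ, 0 ≤ t → HasDerivAt L (D.u (x + t * I)) (x + t * I)
  bound : ∃ C : ℝ, ∀ t : ℝ, 0 ≤ t → ‖L (x + t * I)‖ ≤ C

theorem exists_ray_margin {x : ℂ} (hx : x ∈ D.Gd) : ∃ η : ℝ, 0 < η ∧ ∀ p, ∀ t : ℝ, 0 ≤ t →
    η ≤ ‖x + t * I - D.z p‖ := by
  have : ∀ p, ∃ η : ℝ, 0 < η ∧ ∀ t : ℝ, 0 ≤ t → η ≤ ‖x + t * I - D.z p‖ := by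
    intro p
    rcases hx.2 p with h | h
    · refine ⟨|x.re - (D.z p).re|, abs_pos.mpr (sub_ne_zero.mpr h), fun t _ => ?_⟩
      simpa using abs_re_le_norm (x + t * I - D.z p)
    · refine ⟨x.im - (D.z p).im, by linarith, fun t ht => ?_⟩
      have := (le_abs_self _).trans (abs_im_le_norm (x + t * I - D.z p))
      simp at this
      linarith
  choose g hg h using this
  obtain ⟨η, h0, hη⟩ := exists_pos_le_of_finite hg
  exact ⟨η, h0, fun p t ht => (hη p).trans (h p t ht)⟩

theorem rayPrimitive_Ld {x : ℂ} (hx : x ∈ D.Gd) : D.RayPrimitive D.Ld x := by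
  obtain ⟨η, h0, hη⟩ := D.exists_ray_margin hx
  obtain ⟨C, hC⟩ := D.exists_bound_Ld h0
  exact ⟨fun t ht => D.hasDerivAt_Ld (D.add_mem_Gd hx ht), C, fun t ht =>
    hC _ (D.Gd_subset_dom (D.add_mem_Gd hx ht)) fun p => hη p t ht⟩

theorem add_mem_Gu {s : ℝ} (hs : ∀ p, s ≠ (D.z p).re) {t : ℝ} (ht : 0 ≤ t) :
    (s : ℂ) + t * I ∈ D.Gu :=
  ⟨by simp; linarith [D.b_pos], fun p => Or.inl (by simpa using hs p)⟩

theorem rayPrimitive_f {s : ℝ} (hs : ∀ p, s ≠ (D.z p).re) : D.RayPrimitive (f D.c D.z) s := by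
  have hx := D.ofReal_mem_Gd hs
  obtain ⟨η, h0, hη⟩ := D.exists_ray_margin hx
  obtain ⟨C, hC⟩ := D.exists_bound_f h0
  exact ⟨fun t ht => D.hasDerivAt_f (D.add_mem_Gu hs ht), C, fun t ht =>
    hC _ (D.Gd_subset_dom (D.add_mem_Gd hx ht)) fun p => hη p t ht⟩

theorem hasDerivAt_ray (x : ℂ) (t : ℝ) : HasDerivAt (fun t : ℝ => x + t * I) I t := by
  simpa using ((ofRealCLM.hasDerivAt (x := t)).mul_const I).const_add x

theorem exists_ray_bound_src {x : ℂ} (hx : x ∈ D.Gd) (μ w₀ : ℂ) (φ : Fin P → ℂ) : ∃ C : ℝ, 0 ≤ C ∧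
    ∀ t : ℝ, 0 ≤ t → ‖D.src μ w₀ φ (x + t * I)‖ ≤ C := by
  obtain ⟨η, h0, hη⟩ := D.exists_ray_margin hx
  refine ⟨‖μ * w₀‖ + ∑ p, ‖φ p‖ / η, by positivity, fun t ht => ?_⟩
  refine (norm_add_le _ _).trans ?_
  gcongr
  refine (norm_sum_le _ _).trans (Finset.sum_le_sum fun p _ => ?_)
  rw [norm_div]
  gcongr
  exact hη p t ht

theorem ray_fac_le {L : ℂ → ℂ} {x : ℂ} (hL : D.RayPrimitive L x) : ∃ C : ℝ, 0 ≤ C ∧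
    ∀ μ : ℂ, ∀ t : ℝ, 0 ≤ t →
    ‖D.fac L μ (x + t * I)‖ ≤ C * Real.exp (‖μ‖ * ‖x‖ / D.ε) * Real.exp (μ.re / D.ε * t) := by
  obtain ⟨C, hC⟩ := hL.bound
  have hε := D.hε
  refine ⟨Real.exp (C / D.ε), by positivity, fun μ t ht => ?_⟩
  refine (D.norm_fac_le (hC t ht) μ).trans ?_
  rw [mul_assoc]
  refine mul_le_mul_of_nonneg_left ?_ (by positivity)
  rw [← Real.exp_add, Real.exp_le_exp]
  have : (μ * (x + t * I)).im = (μ * x).im + μ.re * t := by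
    rw [mul_add, add_im]; congr 1
    simp [mul_im]
  rw [this, add_div, div_mul_eq_mul_div]
  gcongr
  exact (le_abs_self _).trans ((abs_im_le_norm _).trans (norm_mul_le _ _))

theorem continuousOn_ray {k : ℂ → ℂ} {x : ℂ} (hk : ∀ t : ℝ, 0 ≤ t → ContinuousAt k (x + t * I)) :
    ContinuousOn (fun t : ℝ => k (x + t * I)) (Ici 0) := fun t ht =>
  (ContinuousAt.comp (f := fun s : ℝ => x + s * I) (hk t ht)
    (hasDerivAt_ray x t).continuousAt).continuousWithinAt

theorem integrableOn_ray {L k : ℂ → ℂ} {x μ : ℂ} (hL : D.RayPrimitive L x) (hμ : μ.re < 0)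
    (hk : ∀ t : ℝ, 0 ≤ t → ContinuousAt k (x + t * I)) {K : ℝ}
    (hK : ∀ t : ℝ, 0 ≤ t → ‖k (x + t * I)‖ ≤ K) :
    IntegrableOn (fun t : ℝ => D.fac L μ (x + t * I) * k (x + t * I) * I) (Ioi 0) := by
  obtain ⟨C, hC, h⟩ := D.ray_fac_le hL
  have hκ : μ.re / D.ε < 0 := div_neg_of_neg_of_pos hμ D.hε
  have hint := ((integrableOn_exp_mul_Ioi hκ 0).const_mul (C * Real.exp (‖μ‖ * ‖x‖ / D.ε))).mul_const K
  refine Integrable.mono' hint ?_ ((ae_restrict_iff' measurableSet_Ioi).mpr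
    (Eventually.of_forall fun t ht => ?_))
  · refine (ContinuousOn.mono (ContinuousOn.mul (continuousOn_ray (k := fun y => D.fac L μ y * k y)
      fun t ht => ?_) continuousOn_const) Ioi_subset_Ici_self).aestronglyMeasurable measurableSet_Ioi
    exact (D.hasDerivAt_fac (hL.deriv t ht) μ).continuousAt.mul (hk t ht)
  · have h0 : (0:ℝ) ≤ t := le_of_lt ht
    rw [norm_mul, norm_I, mul_one, norm_mul]
    gcongr
    · exact h μ t h0
    · exact hK t h0

theorem continuousAt_src_ray {x : ℂ} (hx : x ∈ D.Gd) (μ w₀ : ℂ) (φ : Fin P → ℂ) (t : ℝ) (ht : 0 ≤ t) :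
    ContinuousAt (D.src μ w₀ φ) (x + t * I) :=
  (D.differentiableAt_src μ w₀ φ fun p => D.ne_pole_of_mem_Gd (D.add_mem_Gd hx ht) p).continuousAt

theorem tendsto_norm_ray (x : ℂ) : Tendsto (fun t : ℝ => ‖x + t * I‖) atTop atTop := by
  refine tendsto_atTop_mono (fun t => ?_) (tendsto_atTop_add_const_left atTop x.im tendsto_id)
  have := (le_abs_self _).trans (abs_im_le_norm (x + t * I))
  simpa using this

theorem im_mul_I (μ : ℂ) : (μ * I).im = μ.re := by simp

/-- Both sides have the same derivative along the ray upwards and tend to zero there, because `Re μ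
< 0`. This identifies the solution built with `invOp` with the plain contour integral of the source,
for any bounded antiderivative on the ray. -/
theorem fac_mul_wsol {L : ℂ → ℂ} {x μ : ℂ} (hL : D.RayPrimitive L x) (hx : x ∈ D.Gd)
    (hμ : μ.re < 0) (w₀ : ℂ) (φ : Fin P → ℂ) :
    D.fac L μ x * D.wsol I μ w₀ φ x
      = (I / D.ε) * tailInt (fun y => D.fac L μ y * D.src μ w₀ φ y) I x := by
  have hd : IsDir I := Or.inl rfl
  have hμI : (μ * I).im < 0 := by rwa [im_mul_I]
  have hμ0 : μ ≠ 0 := by rintro rfl; simp at hμ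
  obtain ⟨C, hC, hb⟩ := D.exists_wsol_bound_strict hd hμI w₀ φ
  obtain ⟨C₁, hC₁, hb₁⟩ := D.exists_sum_inv_bound φ
  obtain ⟨C₂, hC₂, hb₂⟩ := D.ray_fac_le hL
  obtain ⟨K, hK, hbK⟩ := D.exists_ray_bound_src hx μ w₀ φ
  have hd' : ∀ t ∈ Ici (0:ℝ), HasDerivAt (fun t : ℝ => D.fac L μ (x + t * I) * D.wsol I μ w₀ φ (x + t * I))
      (-(I / D.ε) * (D.fac L μ (x + t * I) * D.src μ w₀ φ (x + t * I) * I)) t := by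
    intro t ht
    have := (D.hasDerivAt_fac_mul (hL.deriv t ht) (D.solvesAt_wsol hd hμI.le hμ0 w₀ φ
      (D.add_mem_Gd hx ht))).comp t (hasDerivAt_ray x t)
    refine this.congr_deriv ?_
    ring
  have hlim : Tendsto (fun t : ℝ => D.fac L μ (x + t * I) * D.wsol I μ w₀ φ (x + t * I)) atTop (𝓝 0) := by
    have hκ : μ.re / D.ε < 0 := div_neg_of_neg_of_pos hμ D.hε
    have he : Tendsto (fun t : ℝ => C₂ * Real.exp (‖μ‖ * ‖x‖ / D.ε) * Real.exp (μ.re / D.ε * t)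
        * (C + ‖w₀‖ + ‖μ⁻¹‖ * C₁)) atTop (𝓝 0) := by
      have h1 : Tendsto (fun t : ℝ => Real.exp (μ.re / D.ε * t)) atTop (𝓝 0) :=
        Real.tendsto_exp_atBot.comp (tendsto_id.const_mul_atTop_of_neg hκ)
      simpa using (h1.const_mul _).mul_const _
    refine squeeze_zero_norm' ?_ he
    filter_upwards [eventually_ge_atTop 0, (tendsto_norm_ray x).eventually_ge_atTop D.X₀,
      eventually_ge_atTop (-x.im)] with t ht hX him
    have hcu : x + t * I ∈ closedUpper := by simp [closedUpper]; linarith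
    rw [norm_mul]
    gcongr
    · exact hb₂ μ t ht
    · have e : D.wsol I μ w₀ φ (x + t * I) = (D.wsol I μ w₀ φ (x + t * I) - w₀
        - μ⁻¹ * ∑ p, φ p * (x + t * I - D.z p)⁻¹) + w₀ + μ⁻¹ * ∑ p, φ p * (x + t * I - D.z p)⁻¹ := by ring
      rw [e]
      refine (norm_add_le _ _).trans (add_le_add ((norm_add_le _ _).trans (add_le_add ?_ le_rfl)) ?_)
      · refine (hb _ hcu hX).trans (div_le_self hC ?_)
        nlinarith [norm_nonneg (x + t * I)]
      · rw [norm_mul]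
        gcongr
        exact (hb₁ _ hX).trans (div_le_self hC₁ (by linarith [norm_nonneg (x + t * I)]))
  have hint := (D.integrableOn_ray hL hμ (D.continuousAt_src_ray hx μ w₀ φ) hbK).const_mul (-(I / (D.ε:ℂ)))
  have key := integral_Ioi_of_hasDerivAt_of_tendsto' hd' hint hlim
  rw [integral_const_mul] at key
  rw [tailInt]
  simp only [ofReal_zero, zero_mul, add_zero, zero_sub] at key
  linear_combination key

/-! ### The factorization at a pole -/

/-- The exponent at the pole `z m` is a negative integer. -/
def IsNeg (m : Fin P) : Prop := ∃ n : ℕ, 0 < n ∧ I * D.c m / (D.ε : ℂ) = -(n : ℂ)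

/-- The vertical strip that contains the pole `z m` only. -/
def col (m : Fin P) : Set ℂ :=
  {x | -D.b < x.im ∧ ∀ p, (p < m → (D.z p).re < x.re) ∧ (m < p → x.re < (D.z p).re)}

theorem isOpen_col (m : Fin P) : IsOpen (D.col m) := by
  have : D.col m = D.dom ∩ ⋂ p, ({x | p < m → (D.z p).re < x.re} ∩ {x | m < p → x.re < (D.z p).re}) := by
    ext x; simp [col, dom]
  rw [this]
  refine D.isOpen_dom.inter (isOpen_iInter_of_finite fun p => IsOpen.inter ?_ ?_)
  · by_cases h : p < m
    · simpa [h] using isOpen_lt continuous_const continuous_re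
    · simp [h]
  · by_cases h : m < p
    · simpa [h] using isOpen_lt continuous_re continuous_const
    · simp [h]

theorem convex_col (m : Fin P) : Convex ℝ (D.col m) := by
  have : D.col m = D.dom ∩ ⋂ p, ({x | p < m → (D.z p).re < x.re} ∩ {x | m < p → x.re < (D.z p).re}) := by
    ext x; simp [col, dom]
  rw [this]
  refine D.convex_dom.inter (convex_iInter fun p => Convex.inter ?_ ?_)
  · by_cases h : p < m
    · simpa [h] using convex_halfSpace_re_gt _
    · simpa [h] using convex_univ
  · by_cases h : m < p
    · simpa [h] using convex_halfSpace_re_lt _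
    · simpa [h] using convex_univ

theorem re_ne_of_mem_col {m p : Fin P} (hp : p ≠ m) {x : ℂ} (hx : x ∈ D.col m) : x.re ≠ (D.z p).re := by
  rcases lt_or_gt_of_ne hp with h | h
  · exact ((hx.2 p).1 h).ne'
  · exact ((hx.2 p).2 h).ne

theorem pole_mem_col (m : Fin P) : D.z m ∈ D.col m :=
  ⟨by linarith [D.b_pos, D.hz m], fun _ => ⟨fun h => D.hre h, fun h => D.hre h⟩⟩

/-- The regular part at `z m` of the antiderivative of the potential. -/
def rest (m : Fin P) (x : ℂ) : ℂ :=
  ∑ p, ((if p = m then 0 else D.c p * log (I * (x - D.z p))) + D.c p * ((Real.pi : ℂ) * I / 2)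
    + conj (D.c p) * (log (-I * (x - conj (D.z p))) - (Real.pi : ℂ) * I / 2))

theorem f_eq_add_rest (m : Fin P) (x : ℂ) :
    f D.c D.z x = D.c m * log (I * (x - D.z m)) + D.rest m x := by
  have : D.c m * log (I * (x - D.z m)) = ∑ p, if p = m then D.c p * log (I * (x - D.z p)) else 0 := by
    simp
  rw [this, rest, f, ← Finset.sum_add_distrib]
  refine Finset.sum_congr rfl fun p _ => ?_
  split_ifs <;> ring

theorem differentiableAt_rest {m : Fin P} {x : ℂ} (hx : x ∈ D.col m) :
    DifferentiableAt ℂ (D.rest m) x := by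
  unfold rest
  refine DifferentiableAt.fun_sum fun p _ => DifferentiableAt.add (DifferentiableAt.add ?_
    (differentiableAt_const _)) ?_
  · split_ifs with h
    · exact differentiableAt_const _
    · refine ((hasDerivAt_log_mul (by simp) ?_).differentiableAt).const_mul _
      right
      have := D.re_ne_of_mem_col h hx
      simpa [sub_eq_zero] using this
  · exact (((hasDerivAt_log_mul (by simp) (D.conj_pole_mem_slitPlane hx.1 p)).differentiableAt).sub_const
      _).const_mul _

/-- The source multiplied by `x - z m`. -/
def srcReg (m : Fin P) (μ w₀ : ℂ) (φ : Fin P → ℂ) (x : ℂ) : ℂ :=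
  (x - D.z m) * (μ * w₀ + ∑ p, if p = m then 0 else φ p / (x - D.z p)) + φ m

theorem srcReg_eq {m : Fin P} (μ w₀ : ℂ) (φ : Fin P → ℂ) {x : ℂ} (hx : x ≠ D.z m) :
    D.srcReg m μ w₀ φ x = (x - D.z m) * D.src μ w₀ φ x := by
  have h0 := sub_ne_zero.mpr hx
  have : ∑ p, φ p / (x - D.z p) = (∑ p, if p = m then 0 else φ p / (x - D.z p)) + φ m / (x - D.z m) := by
    have : φ m / (x - D.z m) = ∑ p, if p = m then φ p / (x - D.z p) else 0 := by simp
    rw [this, ← Finset.sum_add_distrib]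
    exact Finset.sum_congr rfl fun p _ => by split_ifs <;> simp
  rw [srcReg, src, this]
  field_simp
  ring

theorem differentiableAt_srcReg {m : Fin P} (μ w₀ : ℂ) (φ : Fin P → ℂ) {x : ℂ} (hx : x ∈ D.col m) :
    DifferentiableAt ℂ (D.srcReg m μ w₀ φ) x := by
  unfold srcReg
  refine ((differentiableAt_id.sub_const _).mul ((differentiableAt_const _).add
    (DifferentiableAt.fun_sum fun p _ => ?_))).add_const _
  split_ifs with h
  · exact differentiableAt_const _
  · refine differentiableAt_div_sub _ (sub_ne_zero.mpr fun e => D.re_ne_of_mem_col h hx (by rw [e]))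

/-- The factor of the integrating factor that is analytic and nonzero at `z m`. -/
def facReg (m : Fin P) (μ x : ℂ) : ℂ := exp (-(I / D.ε) * (μ * x + D.rest m x))

theorem differentiableAt_facReg {m : Fin P} (μ : ℂ) {x : ℂ} (hx : x ∈ D.col m) :
    DifferentiableAt ℂ (D.facReg m μ) x := by
  have := D.differentiableAt_rest hx
  unfold facReg
  fun_prop

/-- The coefficient of the logarithm in the exponent is `-(I/ε) c m = n`, so this factor is an
integer power. The branch cut at `z m` disappears and the integrating factor has a zero of order
`n`. -/
theorem Eu_eq {m : Fin P} {n : ℕ} (hn : I * D.c m / (D.ε : ℂ) = -(n : ℂ)) (μ : ℂ) {x : ℂ}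
    (hx : x ≠ D.z m) : D.Eu μ x = (I * (x - D.z m)) ^ n * D.facReg m μ x := by
  have h0 : I * (x - D.z m) ≠ 0 := mul_ne_zero I_ne_zero (sub_ne_zero.mpr hx)
  have : -(I / D.ε) * (μ * x + f D.c D.z x) = n * log (I * (x - D.z m))
      + -(I / D.ε) * (μ * x + D.rest m x) := by
    rw [D.f_eq_add_rest m]
    have : (n : ℂ) = -(I * D.c m / D.ε) := by rw [hn, neg_neg]
    rw [this]; ring
  rw [Eu, fac, this, exp_add, exp_nat_mul, exp_log h0, facReg]

/-- The integrating factor times the source, continued analytically to `z m`. -/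
def facSrc (m : Fin P) (n : ℕ) (μ w₀ : ℂ) (φ : Fin P → ℂ) (x : ℂ) : ℂ :=
  I * (I * (x - D.z m)) ^ (n - 1) * D.facReg m μ x * D.srcReg m μ w₀ φ x

/-- One of the `n ≥ 1` zeros cancels the simple pole of the source; hence the exponent `n - 1` and
the extra factor `I` in `facSrc`. -/
theorem Eu_mul_src {m : Fin P} {n : ℕ} (h0 : 0 < n) (hn : I * D.c m / (D.ε : ℂ) = -(n : ℂ))
    (μ w₀ : ℂ) (φ : Fin P → ℂ) {x : ℂ} (hx : x ≠ D.z m) :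
    D.Eu μ x * D.src μ w₀ φ x = D.facSrc m n μ w₀ φ x := by
  obtain ⟨k, rfl⟩ : ∃ k, n = k + 1 := ⟨n - 1, by omega⟩
  rw [D.Eu_eq hn μ hx, facSrc, D.srcReg_eq _ _ _ hx, Nat.add_sub_cancel]
  ring

theorem differentiableAt_facSrc {m : Fin P} (n : ℕ) (μ w₀ : ℂ) (φ : Fin P → ℂ) {x : ℂ}
    (hx : x ∈ D.col m) : DifferentiableAt ℂ (D.facSrc m n μ w₀ φ) x := by
  have h1 := D.differentiableAt_facReg μ hx
  have h2 := D.differentiableAt_srcReg μ w₀ φ hx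
  unfold facSrc
  fun_prop

end Datum
end BOScattering
end

/-! ### Finite paths and the linear system -/

noncomputable section
namespace BOScattering

theorem hasDerivAt_exp_integral {γ g : ℝ → ℂ} {a b : ℝ} (hγ : Continuous γ)
    (hg : ContinuousOn g (uIcc a b)) (κ μ : ℂ) :
    HasDerivAt (fun μ => ∫ t in a..b, exp (κ * (μ * γ t)) * g t)
      (∫ t in a..b, exp (κ * (μ * γ t)) * (κ * γ t * g t)) μ := by
  simp_rw [intervalIntegral.intervalIntegral_eq_integral_uIoc]
  refine HasDerivAt.const_smul _ ?_
  obtain ⟨C, hC⟩ := isCompact_uIcc.exists_bound_of_continuousOn hg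
  obtain ⟨ρ, hρ⟩ := (isCompact_uIcc (a := a) (b := b)).exists_bound_of_continuousOn hγ.continuousOn
  have hfin : IsFiniteMeasure (volume.restrict (uIoc a b)) := ⟨by
    rw [Measure.restrict_apply_univ, uIoc]; exact measure_Ioc_lt_top⟩
  have hd : ∀ t : ℝ, ∀ ν : ℂ, HasDerivAt (fun μ => exp (κ * (μ * γ t)) * g t)
      (exp (κ * (ν * γ t)) * (κ * γ t * g t)) ν := by
    intro t ν
    have := ((((hasDerivAt_id ν).mul_const (γ t)).const_mul κ).cexp).mul_const (g t)
    refine this.congr_deriv ?_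
    simp; ring
  have key := hasDerivAt_integral_of_holomorphic (ν := volume.restrict (uIoc a b))
    (F := fun μ t => exp (κ * (μ * γ t)) * g t) (x₀ := μ) one_pos
    (bound := fun _ => Real.exp (‖κ‖ * ((‖μ‖ + 1) * ρ)) * C) (integrable_const _) ?_ ?_ ?_
  · refine key.2.congr_deriv (integral_congr_ae (Eventually.of_forall fun t => ?_))
    exact (hd t μ).deriv
  · intro ν _
    refine ContinuousOn.aestronglyMeasurable (ContinuousOn.mul ?_ (hg.mono uIoc_subset_uIcc))
      measurableSet_uIoc
    exact (by fun_prop : Continuous fun t => exp (κ * (ν * γ t))).continuousOn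
  · exact Eventually.of_forall fun t ν _ => (hd t ν).differentiableAt.differentiableWithinAt
  · refine (ae_restrict_iff' measurableSet_uIoc).mpr (Eventually.of_forall fun t ht ν hν => ?_)
    have ht' := uIoc_subset_uIcc ht
    have hν' : ‖ν‖ ≤ ‖μ‖ + 1 := by
      rw [Metric.mem_ball, dist_eq_norm] at hν
      have := norm_add_le (ν - μ) μ
      rw [sub_add_cancel] at this; linarith
    rw [norm_mul]
    gcongr
    · rw [norm_exp]
      refine Real.exp_le_exp.mpr ((le_abs_self _).trans ((abs_re_le_norm _).trans ?_))
      rw [norm_mul, norm_mul]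
      gcongr
      exact hρ t ht'
    · exact hC t ht'

namespace Datum
variable {P : ℕ} (D : Datum P)

/-- The integral along the real line from `a 0` to `Re x` and vertically to `x`. -/
def pathInt (g : ℂ → ℂ) (x : ℂ) : ℂ :=
  (∫ t in D.a 0..x.re, g (t : ℂ)) + ∫ t in (0 : ℝ)..x.im, g ((x.re : ℂ) + (t : ℂ) * I) * I

theorem ellInt_eq (g : ℂ → ℂ) (x : ℂ) : ellInt g (D.a 0) x = -rayInt g (D.a 0) + D.pathInt g x := by
  rw [ellInt, pathInt, add_assoc]

theorem pathInt_ofReal (g : ℂ → ℂ) (s : ℝ) : D.pathInt g s = ∫ t in D.a 0..s, g (t : ℂ) := by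
  simp [pathInt]

theorem UInt_eq (g : ℂ → ℂ) (s : ℝ) :
    UInt g (D.a 0) s = -rayInt g (D.a 0) + D.pathInt g s + rayInt g s := by
  rw [UInt, pathInt_ofReal]

/-- The product of `k` with the integrating factor is continuous along the path of integration,
up to a removable singularity at its end. -/
structure PathReg (k : ℂ → ℂ) (x : ℂ) : Prop where
  real : ∀ t : ℝ, ContinuousAt k t
  vert : ∃ g : ℝ → ℂ, ContinuousOn g (uIcc 0 x.im) ∧
    ∀ t ∈ uIcc 0 x.im, t ≠ x.im → D.Eu 0 (x.re + t * I) * k (x.re + t * I) = g t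

theorem Eu_split (μ x : ℂ) : D.Eu μ x = exp (-(I / D.ε) * (μ * x)) * D.Eu 0 x := by
  rw [Eu, Eu, fac, fac, ← exp_add]; congr 1; ring

/-- A path may end at a pole, where `log` and division take default values that differ from the
continued integrand. The end is a null set for the integral. -/
theorem ae_ne_end {a b : ℝ} {p : ℝ → Prop} (h : ∀ t ∈ uIcc a b, t ≠ b → p t) :
    ∀ᵐ t : ℝ, t ∈ uIoc a b → p t := by
  filter_upwards [(measure_eq_zero_iff_ae_notMem (μ := volume)).mp (measure_singleton b)] with t ht hab
  exact h t (uIoc_subset_uIcc hab) ht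

theorem continuousAt_Eu_real (μ : ℂ) (t : ℝ) : ContinuousAt (D.Eu μ) t :=
  (D.hasDerivAt_Eu (D.ofReal_mem_Gu t) μ).continuousAt

theorem continuous_real {k : ℂ → ℂ} (hk : ∀ t : ℝ, ContinuousAt k t) :
    Continuous fun t : ℝ => k t := continuous_iff_continuousAt.mpr fun t =>
  ContinuousAt.comp (f := fun t : ℝ => (t : ℂ)) (hk t) continuous_ofReal.continuousAt

variable {D} in
theorem PathReg.hasDerivAt {k : ℂ → ℂ} {x : ℂ} (h : D.PathReg k x) (μ : ℂ) :
    HasDerivAt (fun μ => D.pathInt (fun y => D.Eu μ y * k y) x)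
      (D.pathInt (fun y => D.Eu μ y * (-(I / D.ε) * y * k y)) x) μ := by
  obtain ⟨g, hg, e⟩ := h.vert
  unfold pathInt
  refine HasDerivAt.add ?_ ?_
  · have := hasDerivAt_exp_integral (γ := fun t : ℝ => (t : ℂ)) (g := fun t => D.Eu 0 t * k t)
      (a := D.a 0) (b := x.re) continuous_ofReal (((continuous_real (D.continuousAt_Eu_real 0)).mul
        (continuous_real h.real)).continuousOn) (-(I / D.ε)) μ
    simp only [D.Eu_split μ]
    refine (this.congr_of_eventuallyEq (Eventually.of_forall fun ν => ?_)).congr_deriv ?_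
    · simp only [D.Eu_split ν, mul_assoc]
    · congr 1; funext t; ring
  · have := hasDerivAt_exp_integral (γ := fun t : ℝ => x.re + t * I) (g := fun t => g t * I)
      (a := 0) (b := x.im) (by fun_prop) (hg.mul continuousOn_const) (-(I / D.ε)) μ
    refine (this.congr_of_eventuallyEq (Eventually.of_forall fun ν => ?_)).congr_deriv ?_
    · refine intervalIntegral.integral_congr_ae (ae_ne_end fun t ht hne => ?_)
      beta_reduce; rw [D.Eu_split ν, ← e t ht hne]; ring
    · refine intervalIntegral.integral_congr_ae (ae_ne_end fun t ht hne => ?_)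
      beta_reduce; rw [D.Eu_split μ, ← e t ht hne]; ring

variable {D} in
theorem PathReg.intervalIntegrable {k : ℂ → ℂ} {x : ℂ} (h : D.PathReg k x) (μ : ℂ) :
    IntervalIntegrable (fun t : ℝ => D.Eu μ t * k t) volume (D.a 0) x.re ∧
    IntervalIntegrable (fun t : ℝ => D.Eu μ (x.re + t * I) * k (x.re + t * I) * I) volume 0 x.im := by
  obtain ⟨g, hg, e⟩ := h.vert
  refine ⟨(((continuous_real (D.continuousAt_Eu_real μ)).mul
        (continuous_real h.real)).intervalIntegrable _ _), ?_⟩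
  have : ContinuousOn (fun t : ℝ => exp (-(I / D.ε) * (μ * (x.re + t * I))) * g t * I) (uIcc 0 x.im) :=
    (((by fun_prop : Continuous fun t : ℝ => exp (-(I / D.ε) * (μ * (x.re + t * I)))).continuousOn).mul
      hg).mul continuousOn_const
  refine this.intervalIntegrable.congr_ae ?_
  refine (ae_restrict_iff' measurableSet_uIoc).mpr (ae_ne_end fun t ht hne => ?_)
  beta_reduce; rw [D.Eu_split μ, ← e t ht hne]; ring

theorem pathInt_add {k k' : ℂ → ℂ} {x μ : ℂ} (h : D.PathReg k x) (h' : D.PathReg k' x) :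
    D.pathInt (fun y => D.Eu μ y * (k y + k' y)) x
      = D.pathInt (fun y => D.Eu μ y * k y) x + D.pathInt (fun y => D.Eu μ y * k' y) x := by
  have i := h.intervalIntegrable μ
  have i' := h'.intervalIntegrable μ
  simp only [pathInt, mul_add, add_mul]
  rw [intervalIntegral.integral_add i.1 i'.1, intervalIntegral.integral_add i.2 i'.2]
  ring

theorem pathInt_smul {k : ℂ → ℂ} {x μ : ℂ} (r : ℂ) :
    D.pathInt (fun y => D.Eu μ y * (r * k y)) x = r * D.pathInt (fun y => D.Eu μ y * k y) x := by
  have e : ∀ y, D.Eu μ y * (r * k y) = r * (D.Eu μ y * k y) := fun y => by ring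
  simp only [pathInt, e, mul_assoc r, intervalIntegral.integral_const_mul, mul_add]

variable {D} in
theorem PathReg.add {k k' : ℂ → ℂ} {x : ℂ} (h : D.PathReg k x) (h' : D.PathReg k' x) :
    D.PathReg (fun y => k y + k' y) x := by
  obtain ⟨g, hg, e⟩ := h.vert
  obtain ⟨g', hg', e'⟩ := h'.vert
  refine ⟨fun t => (h.real t).add (h'.real t), fun t => g t + g' t, hg.add hg', fun t ht hne => ?_⟩
  beta_reduce; rw [← e t ht hne, ← e' t ht hne]; ring

variable {D} in
theorem PathReg.smul {k : ℂ → ℂ} {x : ℂ} (h : D.PathReg k x) (r : ℂ) :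
    D.PathReg (fun y => r * k y) x := by
  obtain ⟨g, hg, e⟩ := h.vert
  refine ⟨fun t => continuousAt_const.mul (h.real t), fun t => r * g t, continuousOn_const.mul hg,
    fun t ht hne => ?_⟩
  beta_reduce; rw [← e t ht hne]; ring

theorem vert_mem_Gu {x : ℂ} (hx : x ∈ D.Gu) {t : ℝ} (ht : t ∈ uIcc 0 x.im) :
    (x.re : ℂ) + t * I ∈ D.Gu := by
  have hb := D.b_pos
  have hxb := hx.1
  have ht1 : min 0 x.im ≤ t := ht.1
  have ht2 : t ≤ max 0 x.im := ht.2
  refine ⟨?_, fun p => ?_⟩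
  · simp
    rcases min_le_iff.mp ht1 with h | h <;> linarith
  · rcases hx.2 p with h | h
    · exact Or.inl (by simpa using h)
    · right
      simp
      rcases le_max_iff.mp ht2 with h' | h' <;> linarith [D.hz p]

theorem pathReg_src_of_mem {x : ℂ} (hx : x ∈ D.Gu) (μ w₀ : ℂ) (φ : Fin P → ℂ) :
    D.PathReg (D.src μ w₀ φ) x := by
  refine ⟨fun t => (D.differentiableAt_src _ _ _ fun p => D.ofReal_ne_pole t p).continuousAt,
    fun t => D.Eu 0 (x.re + t * I) * D.src μ w₀ φ (x.re + t * I), fun t ht => ?_, fun _ _ _ => rfl⟩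
  have hm := D.vert_mem_Gu hx ht
  have h1 : ContinuousAt (fun y => D.Eu 0 y * D.src μ w₀ φ y) (x.re + t * I) :=
    (D.hasDerivAt_Eu hm 0).continuousAt.mul
      (D.differentiableAt_src _ _ _ fun p => D.ne_pole_of_mem_Gu hm p).continuousAt
  exact (ContinuousAt.comp (f := fun t : ℝ => (x.re : ℂ) + t * I) h1
    (hasDerivAt_ray _ t).continuousAt).continuousWithinAt

theorem vert_mem_col (m : Fin P) {t : ℝ} (ht : t ∈ uIcc 0 (D.z m).im) :
    ((D.z m).re : ℂ) + t * I ∈ D.col m := by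
  rw [uIcc_of_le (D.hz m).le] at ht
  refine ⟨by simp; linarith [D.b_pos, ht.1], fun p => ⟨fun h => ?_, fun h => ?_⟩⟩
  · simpa using D.hre h
  · simpa using D.hre h

theorem vert_ne_pole (m : Fin P) {t : ℝ} (ht : t ≠ (D.z m).im) : ((D.z m).re : ℂ) + t * I ≠ D.z m :=
  fun h => ht (by simpa using congrArg Complex.im h)

/-- The zero of the integrating factor at `z m` outweighs the simple pole of the source, so the
integrand has a continuous continuation to the end of the path. -/
theorem pathReg_src_of_isNeg {m : Fin P} (hm : D.IsNeg m) (μ w₀ : ℂ) (φ : Fin P → ℂ) :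
    D.PathReg (D.src μ w₀ φ) (D.z m) := by
  obtain ⟨n, h0, hn⟩ := hm
  refine ⟨fun t => (D.differentiableAt_src _ _ _ fun p => D.ofReal_ne_pole t p).continuousAt,
    fun t => I * (I * ((D.z m).re + t * I - D.z m)) ^ (n - 1) * D.facReg m 0 ((D.z m).re + t * I)
      * D.srcReg m μ w₀ φ ((D.z m).re + t * I), fun t ht => ?_, fun t ht hne => ?_⟩
  · have hc := D.vert_mem_col m ht
    have h1 := (D.differentiableAt_facReg 0 hc).continuousAt
    have h2 := (D.differentiableAt_srcReg μ w₀ φ hc).continuousAt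
    have h3 : ContinuousAt (fun y => I * (I * (y - D.z m)) ^ (n - 1) * D.facReg m 0 y
      * D.srcReg m μ w₀ φ y) ((D.z m).re + t * I) := by fun_prop
    exact (ContinuousAt.comp (f := fun t : ℝ => ((D.z m).re : ℂ) + t * I) h3
      (hasDerivAt_ray _ t).continuousAt).continuousWithinAt
  · have hp := D.vert_ne_pole m hne
    obtain ⟨k, rfl⟩ : ∃ k, n = k + 1 := ⟨n - 1, by omega⟩
    beta_reduce; rw [D.Eu_eq hn 0 hp, D.srcReg_eq _ _ _ hp, Nat.add_sub_cancel]
    ring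

open Classical in
/-- The end of the finite part of the contour `C_m`. -/
def endPt (m : Fin P) : ℂ := if D.IsNeg m then D.z m else (D.a m.succ : ℂ)

theorem endPt_of_isNeg {m : Fin P} (h : D.IsNeg m) : D.endPt m = D.z m := by simp [endPt, h]
theorem endPt_of_not_isNeg {m : Fin P} (h : ¬ D.IsNeg m) : D.endPt m = (D.a m.succ : ℂ) := by
  simp [endPt, h]

theorem pathReg_src (m : Fin P) (μ w₀ : ℂ) (φ : Fin P → ℂ) : D.PathReg (D.src μ w₀ φ) (D.endPt m) := by
  by_cases h : D.IsNeg m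
  · rw [D.endPt_of_isNeg h]; exact D.pathReg_src_of_isNeg h _ _ _
  · rw [D.endPt_of_not_isNeg h]; exact D.pathReg_src_of_mem (D.ofReal_mem_Gu _) _ _ _

theorem src_one_eq : D.src 1 1 0 = fun _ => 1 := by funext y; simp [src]
theorem src_single_eq (p : Fin P) : D.src 0 0 (Pi.single p 1) = fun y => (y - D.z p)⁻¹ := by
  funext y; simp [src, Pi.single_apply, ite_div]

theorem pathInt_src {x : ℂ} (h : ∀ μ w₀ φ, D.PathReg (D.src μ w₀ φ) x) (ν μ w₀ : ℂ) (φ : Fin P → ℂ) :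
    D.pathInt (fun y => D.Eu ν y * D.src μ w₀ φ y) x = μ * w₀ * D.pathInt (fun y => D.Eu ν y * 1) x
      + ∑ p, φ p * D.pathInt (fun y => D.Eu ν y * (y - D.z p)⁻¹) x := by
  have hs : ∀ s : Finset (Fin P), D.PathReg (fun y => ∑ p ∈ s, φ p * (y - D.z p)⁻¹) x ∧
      D.pathInt (fun y => D.Eu ν y * ∑ p ∈ s, φ p * (y - D.z p)⁻¹) x
        = ∑ p ∈ s, φ p * D.pathInt (fun y => D.Eu ν y * (y - D.z p)⁻¹) x := by
    intro s
    induction s using Finset.cons_induction with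
    | empty => exact ⟨by
        have := h 0 0 0
        rwa [show D.src 0 0 0 = fun _ => 0 by funext y; simp [src]] at this, by simp [pathInt]⟩
    | cons p s hp ih =>
      have h1 : D.PathReg (fun y => φ p * (y - D.z p)⁻¹) x := by
        have := (h 0 0 (Pi.single p 1)).smul (φ p)
        rwa [src_single_eq] at this
      refine ⟨by simpa only [Finset.sum_cons] using h1.add ih.1, ?_⟩
      simp only [Finset.sum_cons]
      rw [D.pathInt_add h1 ih.1, D.pathInt_smul, ih.2]
  have h1 : D.PathReg (fun _ => μ * w₀ * 1) x := by
    have := (h 1 1 0).smul (μ * w₀)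
    rwa [src_one_eq] at this
  have := D.pathInt_add (μ := ν) h1 (hs Finset.univ).1
  rw [D.pathInt_smul, (hs Finset.univ).2] at this
  rw [← this]
  simp only [src, mul_one, div_eq_mul_inv]

open Classical in
/-- The conditions for the solution to continue analytically to the half-plane. -/
def row (d μ w₀ : ℂ) (φ : Fin P → ℂ) (m : Fin P) : ℂ :=
  -(D.Eu μ (D.a 0) * D.wsol d μ w₀ φ (D.a 0))
    + (I / D.ε) * (μ * w₀ * D.pathInt (fun y => D.Eu μ y * 1) (D.endPt m)
      + ∑ p, φ p * D.pathInt (fun y => D.Eu μ y * (y - D.z p)⁻¹) (D.endPt m))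
    + if D.IsNeg m then 0 else D.Eu μ (D.a m.succ) * D.wsol d μ w₀ φ (D.a m.succ)

/-- In this case the condition is the vanishing of the integral from infinity to the pole, with the
value at `a 0` standing for the part of the contour that comes from infinity. -/
theorem row_of_isNeg {m : Fin P} (h : D.IsNeg m) (d μ w₀ : ℂ) (φ : Fin P → ℂ) :
    D.row d μ w₀ φ m = -(D.Eu μ (D.a 0) * D.wsol d μ w₀ φ (D.a 0))
      + (I / D.ε) * D.pathInt (fun y => D.Eu μ y * D.src μ w₀ φ y) (D.z m) := by
  rw [D.pathInt_src (D.pathReg_src_of_isNeg h), row, if_pos h, D.endPt_of_isNeg h, add_zero]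

/-- In this case the condition says that continuation along the real line from `a 0` reproduces the
value of the solution at `a m.succ`, beyond the cut of `z m`. -/
theorem row_of_not_isNeg {m : Fin P} (h : ¬ D.IsNeg m) (d μ w₀ : ℂ) (φ : Fin P → ℂ) :
    D.row d μ w₀ φ m = -(D.Eu μ (D.a 0) * D.wsol d μ w₀ φ (D.a 0))
      + (I / D.ε) * (∫ t in D.a 0..D.a m.succ, D.Eu μ t * D.src μ w₀ φ t)
      + D.Eu μ (D.a m.succ) * D.wsol d μ w₀ φ (D.a m.succ) := by
  have := D.pathInt_src (D.pathReg_src_of_mem (D.ofReal_mem_Gu (D.a m.succ))) μ μ w₀ φ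
  rw [pathInt_ofReal] at this
  rw [this, row, if_neg h, D.endPt_of_not_isNeg h]

/-- The matrix of the conditions. -/
def Mat (d μ : ℂ) : Matrix (Fin P) (Fin P) ℂ := Matrix.of fun m p => D.row d μ 0 (Pi.single p 1) m
/-- The right-hand side of the conditions. -/
def vec (d μ : ℂ) : Fin P → ℂ := fun m => -D.row d μ 1 0 m

/-- Each condition is linear in `(w₀, φ)`, because `wsol` is; the conditions become a linear system
for the coefficients. -/
theorem row_eq (d μ w₀ : ℂ) (φ : Fin P → ℂ) (m : Fin P) :
    D.row d μ w₀ φ m = (D.Mat d μ *ᵥ φ) m - w₀ * D.vec d μ m := by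
  simp only [Matrix.mulVec, dotProduct, Mat, vec, Matrix.of_apply]
  unfold row
  rw [D.wsol_linear d μ w₀ φ (D.a 0), D.wsol_linear d μ w₀ φ (D.a m.succ)]
  simp only [Pi.single_apply, Pi.zero_apply, ite_mul, zero_mul, one_mul, mul_zero, mul_one,
    Finset.sum_ite_eq', Finset.mem_univ, if_true, Finset.sum_const_zero, add_zero, zero_add]
  split_ifs
  · simp only [add_mul, Finset.sum_add_distrib, mul_add, Finset.mul_sum, add_zero]
    simp only [mul_comm, mul_left_comm, mul_neg, Finset.sum_neg_distrib, mul_assoc]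
    ring
  · simp only [add_mul, Finset.sum_add_distrib, mul_add, Finset.mul_sum]
    simp only [mul_comm, mul_left_comm, mul_neg, Finset.sum_neg_distrib, mul_assoc]
    ring

theorem differentiable_Eu_param (x : ℂ) : Differentiable ℂ (fun μ => D.Eu μ x) :=
  D.differentiable_fac_param _ x

theorem nice_row {d : ℂ} (hd : IsDir d) (w₀ : ℂ) (φ : Fin P → ℂ) (m : Fin P) :
    Nice d (fun μ => D.row d μ w₀ φ m) := by
  have hE : ∀ i, Nice d (fun μ => D.Eu μ (D.a i) * D.wsol d μ w₀ φ (D.a i)) := fun i =>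
    (nice_of_differentiable (D.differentiable_Eu_param _)).mul (D.nice_wsol hd w₀ φ (D.a_mem_Gd i))
  have h1 : Nice d (fun μ => D.pathInt (fun y => D.Eu μ y * 1) (D.endPt m)) := by
    have := D.pathReg_src m 1 1 0
    rw [src_one_eq] at this
    exact nice_of_differentiable fun μ => (this.hasDerivAt μ).differentiableAt
  have hp : ∀ p, Nice d (fun μ => D.pathInt (fun y => D.Eu μ y * (y - D.z p)⁻¹) (D.endPt m)) := by
    intro p
    have := D.pathReg_src m 0 0 (Pi.single p 1)
    rw [src_single_eq] at this
    exact nice_of_differentiable fun μ => (this.hasDerivAt μ).differentiableAt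
  unfold row
  refine Nice.add (Nice.add ?_ ((nice_const _).mul (Nice.add
    (((nice_of_differentiable differentiable_id).mul (nice_const _)).mul h1)
    (nice_sum _ fun p _ => (nice_const _).mul (hp p))))) ?_
  · have := (nice_const (d := d) (-1)).mul (hE 0)
    simpa using this
  · split_ifs
    · exact nice_const _
    · exact hE _

theorem nice_Mat {d : ℂ} (hd : IsDir d) (m p : Fin P) : Nice d (fun μ => D.Mat d μ m p) :=
  D.nice_row hd _ _ m

theorem nice_vec {d : ℂ} (hd : IsDir d) (m : Fin P) : Nice d (fun μ => D.vec d μ m) := by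
  have := (nice_const (d := d) (-1)).mul (D.nice_row hd 1 0 m)
  simpa [vec] using this

/-- For `Re μ < 0` the values of the solution at the abscissae `a i` are integrals along the rays
going up, which complete the finite paths to the contours of the statement. -/
theorem row_I {μ : ℂ} (hμ : μ.re < 0) (w₀ : ℂ) (φ : Fin P → ℂ) (m : Fin P) :
    D.row I μ w₀ φ m
      = (I / D.ε) * CInt D.ε D.c D.z D.a m (fun y => D.Eu μ y * D.src μ w₀ φ y) := by
  have hray : ∀ i, D.Eu μ (D.a i) * D.wsol I μ w₀ φ (D.a i)
      = (I / D.ε) * rayInt (fun y => D.Eu μ y * D.src μ w₀ φ y) (D.a i) := fun i =>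
    D.fac_mul_wsol (D.rayPrimitive_f (D.a_ne_re i)) (D.a_mem_Gd i) hμ w₀ φ
  by_cases h : D.IsNeg m
  · rw [D.row_of_isNeg h, hray, CInt, if_pos (by exact h), ellInt_eq]; ring
  · rw [D.row_of_not_isNeg h, hray, hray, CInt, if_neg (by exact h), UInt_eq, pathInt_ofReal]; ring

end Datum
end BOScattering
end

/-! ### Gluing the selected solution to a solution in the half-plane -/

noncomputable section
namespace BOScattering
namespace Datum
variable {P : ℕ} (D : Datum P)

/-- The regular part of the potential at the pole `z m`. -/
def uReg (m : Fin P) (x : ℂ) : ℂ :=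
  ∑ p, ((if p = m then 0 else D.c p / (x - D.z p)) + conj (D.c p) / (x - conj (D.z p)))

theorem u_eq (m : Fin P) (x : ℂ) : D.u x = D.uReg m x + D.c m / (x - D.z m) := by
  have : D.c m / (x - D.z m) = ∑ p, if p = m then D.c p / (x - D.z p) else 0 := by simp
  rw [this, uReg, u, ← Finset.sum_add_distrib]
  refine Finset.sum_congr rfl fun p _ => ?_
  split_ifs <;> ring

theorem hasDerivAt_rest {m : Fin P} {x : ℂ} (hx : x ∈ D.col m) :
    HasDerivAt (D.rest m) (D.uReg m x) x := by
  have : HasDerivAt (D.rest m) (∑ p, ((if p = m then 0 else D.c p * (1 / (x - D.z p))) + 0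
      + conj (D.c p) * (1 / (x - conj (D.z p))))) x := by
    unfold rest
    refine HasDerivAt.fun_sum fun p _ => HasDerivAt.add (HasDerivAt.add ?_ (hasDerivAt_const _ _)) ?_
    · split_ifs with h
      · exact hasDerivAt_const _ _
      · refine (hasDerivAt_log_mul (by simp) ?_).const_mul _
        right
        have := D.re_ne_of_mem_col h hx
        simpa [sub_eq_zero] using this
    · exact ((hasDerivAt_log_mul (by simp) (D.conj_pole_mem_slitPlane hx.1 p)).sub_const _).const_mul _
  refine this.congr_deriv ?_
  simp [uReg, div_eq_mul_inv]

theorem differentiableAt_uReg {m : Fin P} {x : ℂ} (hx : x ∈ D.col m) :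
    DifferentiableAt ℂ (D.uReg m) x := by
  unfold uReg
  refine DifferentiableAt.fun_sum fun p _ => DifferentiableAt.add ?_
    (differentiableAt_div_sub _ (D.ne_conj_pole hx.1 p))
  split_ifs with h
  · exact differentiableAt_const _
  · exact differentiableAt_div_sub _ (sub_ne_zero.mpr fun e => D.re_ne_of_mem_col h hx (by rw [e]))

/-- The integrating factor in the strip around a pole with negative integer exponent. -/
def EuReg (m : Fin P) (n : ℕ) (μ x : ℂ) : ℂ := (I * (x - D.z m)) ^ n * D.facReg m μ x

theorem hasDerivAt_EuReg {m : Fin P} {n : ℕ} (hn : I * D.c m / (D.ε : ℂ) = -(n : ℂ)) (μ : ℂ) {x : ℂ}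
    (hx : x ∈ D.col m) (hxz : x ≠ D.z m) :
    HasDerivAt (D.EuReg m n μ) (-(I / D.ε) * (μ + D.u x) * D.EuReg m n μ x) x := by
  have h0 := sub_ne_zero.mpr hxz
  have h1 : HasDerivAt (fun x => (I * (x - D.z m)) ^ n) (n * (I * (x - D.z m)) ^ (n - 1) * I) x := by
    have := (((hasDerivAt_id x).sub_const (D.z m)).const_mul I).pow n
    refine this.congr_deriv ?_
    simp
  have h2 : HasDerivAt (D.facReg m μ)
      (D.facReg m μ x * (-(I / D.ε) * (μ + D.uReg m x))) x := by
    have := ((((hasDerivAt_id x).const_mul μ).add (D.hasDerivAt_rest hx)).const_mul (-(I / D.ε))).cexp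
    refine this.congr_deriv ?_
    simp [facReg]
  refine (h1.mul h2).congr_deriv ?_
  have e : (n : ℂ) = -(I / D.ε) * D.c m := by
    rw [← neg_neg (n : ℂ), ← hn]; ring
  have e2 : (n : ℂ) * (I * (x - D.z m)) ^ (n - 1) * I * (x - D.z m) = n * (I * (x - D.z m)) ^ n := by
    rcases Nat.eq_zero_or_pos n with rfl | hp
    · simp
    · obtain ⟨k, rfl⟩ : ∃ k, n = k + 1 := ⟨n - 1, by omega⟩
      rw [Nat.add_sub_cancel, pow_succ (I * (x - D.z m))]; ring
  rw [D.u_eq m, EuReg]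
  have e3 : (n : ℂ) * (I * (x - D.z m)) ^ (n - 1) * I = n * (I * (x - D.z m)) ^ n / (x - D.z m) := by
    rw [eq_div_iff h0, e2]
  rw [e3, e]
  ring

theorem ne_pole_of_mem_col {m : Fin P} {x : ℂ} (hx : x ∈ D.col m) (hxz : x ≠ D.z m) (p : Fin P) :
    x ≠ D.z p := by
  by_cases h : p = m
  · rwa [h]
  · exact fun e => D.re_ne_of_mem_col h hx (by rw [e])

/-- The strip around a pole without the half-line going down from the pole. -/
def colSlit (m : Fin P) : Set ℂ := {x ∈ D.col m | x.re ≠ (D.z m).re ∨ (D.z m).im < x.im}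

theorem colSlit_subset_Gd (m : Fin P) : D.colSlit m ⊆ D.Gd := fun x hx => ⟨hx.1.1, fun p => by
  by_cases h : p = m
  · rw [h]; exact hx.2
  · exact Or.inl (D.re_ne_of_mem_col h hx.1)⟩

theorem ne_of_mem_colSlit {m : Fin P} {x : ℂ} (hx : x ∈ D.colSlit m) : x ≠ D.z m :=
  D.ne_pole_of_mem_Gd (D.colSlit_subset_Gd m hx) m

theorem isOpen_colSlit (m : Fin P) : IsOpen (D.colSlit m) :=
  (D.isOpen_col m).inter ((isOpen_ne_fun continuous_re continuous_const).union
    (isOpen_lt continuous_const continuous_im))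

theorem isPreconnected_colSlit (m : Fin P) : IsPreconnected (D.colSlit m) := by
  refine isPreconnected_of_up (H := (D.z m).im) ?_ fun x hx t ht => ?_
  · have : D.colSlit m ∩ {x | (D.z m).im < x.im} = D.col m ∩ {x | (D.z m).im < x.im} := by
      ext x
      exact ⟨fun h => ⟨h.1.1, h.2⟩, fun h => ⟨⟨h.1, Or.inr h.2⟩, h.2⟩⟩
    rw [this]
    exact (D.convex_col m).inter (convex_halfSpace_im_gt _)
  · refine ⟨⟨by simp; linarith [hx.1.1], fun p => by simpa using hx.1.2 p⟩, ?_⟩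
    rcases hx.2 with h | h
    · exact Or.inl (by simpa using h)
    · right; simp; linarith

theorem castSucc_mem_col (m : Fin P) : (D.a m.castSucc : ℂ) ∈ D.col m :=
  ⟨by simpa using D.b_pos, fun p => ⟨fun h => D.re_lt_a (Fin.succ_le_castSucc_iff.mpr h),
    fun h => D.a_lt_re (Fin.castSucc_le_castSucc_iff.mpr h.le)⟩⟩

theorem succ_mem_col (m : Fin P) : (D.a m.succ : ℂ) ∈ D.col m :=
  ⟨by simpa using D.b_pos, fun p => ⟨fun h => D.re_lt_a (Fin.succ_le_succ_iff.mpr h.le),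
    fun h => D.a_lt_re (Fin.succ_le_castSucc_iff.mpr h)⟩⟩

theorem castSucc_mem_colSlit (m : Fin P) : (D.a m.castSucc : ℂ) ∈ D.colSlit m :=
  ⟨D.castSucc_mem_col m, Or.inl (by simpa using D.a_ne_re _ _)⟩
theorem succ_mem_colSlit (m : Fin P) : (D.a m.succ : ℂ) ∈ D.colSlit m :=
  ⟨D.succ_mem_col m, Or.inl (by simpa using D.a_ne_re _ _)⟩

theorem ofReal_mem_col {m : Fin P} {t : ℝ} (ht : t ∈ uIcc (D.a m.castSucc) (D.a m.succ)) :
    (t : ℂ) ∈ D.col m := by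
  rw [uIcc_of_le (D.a_strictMono Fin.castSucc_lt_succ).le] at ht
  have h1 := D.castSucc_mem_col m
  have h2 := D.succ_mem_col m
  refine ⟨by simpa using D.b_pos, fun p => ⟨fun h => ?_, fun h => ?_⟩⟩
  · exact ((h1.2 p).1 h).trans_le ht.1
  · exact lt_of_le_of_lt ht.2 ((h2.2 p).2 h)

variable {W : ℂ → ℂ} {μ w₀ : ℂ} {φ : Fin P → ℂ}

theorem exists_primitive_facSrc (m : Fin P) (n : ℕ) (μ w₀ : ℂ) (φ : Fin P → ℂ) : ∃ Q : ℂ → ℂ,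
    ∀ x ∈ D.col m, HasDerivAt Q (D.facSrc m n μ w₀ φ x) x :=
  exists_primitive_of_convex (D.isOpen_col m) (D.convex_col m) fun _ hx =>
    (D.differentiableAt_facSrc n μ w₀ φ hx).differentiableWithinAt

/-- The strip without the half-line below the pole is connected over the top of the pole, and
`EuReg` has no cut there. So the two sides of the half-line are compared without any condition. -/
theorem EuReg_mul_eq (hW : ∀ x ∈ D.Gd, D.SolvesAt μ w₀ φ W x) {m : Fin P} {n : ℕ} (h0 : 0 < n)
    (hn : I * D.c m / (D.ε : ℂ) = -(n : ℂ)) {Q : ℂ → ℂ}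
    (hQ : ∀ x ∈ D.col m, HasDerivAt Q (D.facSrc m n μ w₀ φ x) x) {x y : ℂ} (hx : x ∈ D.colSlit m)
    (hy : y ∈ D.colSlit m) :
    D.EuReg m n μ x * W x + (I / D.ε) * Q x = D.EuReg m n μ y * W y + (I / D.ε) * Q y := by
  refine eqOn_of_hasDerivAt_zero (f := fun x => D.EuReg m n μ x * W x + (I / D.ε) * Q x)
    (D.isOpen_colSlit m) (D.isPreconnected_colSlit m) (fun x hx => ?_) hx hy
  have hne := D.ne_of_mem_colSlit hx
  have h1 := D.hasDerivAt_EuReg hn μ hx.1 hne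
  have h2 := hW x (D.colSlit_subset_Gd m hx)
  refine ((h1.mul h2).add ((hQ x hx.1).const_mul (I / D.ε))).congr_deriv ?_
  rw [← D.Eu_mul_src h0 hn μ w₀ φ hne, D.Eu_eq hn μ hne, EuReg]
  ring

theorem integral_facSrc {m : Fin P} {n : ℕ} (h0 : 0 < n) (hn : I * D.c m / (D.ε : ℂ) = -(n : ℂ))
    {Q : ℂ → ℂ} (hQ : ∀ x ∈ D.col m, HasDerivAt Q (D.facSrc m n μ w₀ φ x) x) {s t : ℝ}
    (hst : ∀ r ∈ uIcc s t, (r : ℂ) ∈ D.col m) :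
    ∫ r in s..t, D.Eu μ r * D.src μ w₀ φ r = Q t - Q s := by
  have e : ∀ r : ℝ, D.Eu μ r * D.src μ w₀ φ r = D.facSrc m n μ w₀ φ r := fun r =>
    D.Eu_mul_src h0 hn μ w₀ φ (D.ofReal_ne_pole r m)
  simp only [e]
  refine intervalIntegral.integral_eq_sub_of_hasDerivAt (f := fun r : ℝ => Q r) (fun r hr => ?_)
    (ContinuousOn.intervalIntegrable fun r hr => ?_)
  · simpa using (hQ r (hst r hr)).comp_ofReal
  · exact (ContinuousAt.comp (f := fun r : ℝ => (r : ℂ)) (D.differentiableAt_facSrc n μ w₀ φ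
      (hst r hr)).continuousAt continuous_ofReal.continuousAt).continuousWithinAt

theorem integral_facSrc_vert {m : Fin P} {n : ℕ} (h0 : 0 < n)
    (hn : I * D.c m / (D.ε : ℂ) = -(n : ℂ)) {Q : ℂ → ℂ}
    (hQ : ∀ x ∈ D.col m, HasDerivAt Q (D.facSrc m n μ w₀ φ x) x) :
    ∫ t in (0:ℝ)..(D.z m).im, D.Eu μ ((D.z m).re + t * I) * D.src μ w₀ φ ((D.z m).re + t * I) * I
      = Q (D.z m) - Q (D.z m).re := by
  have : ∫ t in (0:ℝ)..(D.z m).im, D.Eu μ ((D.z m).re + t * I) * D.src μ w₀ φ ((D.z m).re + t * I) * I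
      = ∫ t in (0:ℝ)..(D.z m).im, D.facSrc m n μ w₀ φ ((D.z m).re + t * I) * I :=
    intervalIntegral.integral_congr_ae (ae_ne_end fun t ht hne => by
      rw [D.Eu_mul_src h0 hn μ w₀ φ (D.vert_ne_pole m hne)])
  rw [this, intervalIntegral.integral_eq_sub_of_hasDerivAt
    (f := fun t : ℝ => Q ((D.z m).re + t * I)) (fun t ht => ?_)
    (ContinuousOn.intervalIntegrable fun t ht => ?_)]
  · simp
  · exact (hQ _ (D.vert_mem_col m ht)).comp t (hasDerivAt_ray _ t)
  · exact ((ContinuousAt.comp (f := fun t : ℝ => ((D.z m).re : ℂ) + t * I)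
      (D.differentiableAt_facSrc n μ w₀ φ (D.vert_mem_col m ht)).continuousAt
      (hasDerivAt_ray _ t).continuousAt).mul continuousAt_const).continuousWithinAt

theorem intervalIntegrable_Eu_src (μ w₀ : ℂ) (φ : Fin P → ℂ) (s t : ℝ) :
    IntervalIntegrable (fun r : ℝ => D.Eu μ r * D.src μ w₀ φ r) volume s t :=
  ((continuous_real (D.continuousAt_Eu_real μ)).mul (continuous_real fun t =>
    (D.differentiableAt_src _ _ _ fun p => D.ofReal_ne_pole t p).continuousAt)).intervalIntegrable _ _

/-- The defect of the solution between `a 0` and `a i`. -/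
def defect (W : ℂ → ℂ) (μ w₀ : ℂ) (φ : Fin P → ℂ) (i : Fin (P + 1)) : ℂ :=
  -(D.Eu μ (D.a 0) * W (D.a 0)) + (I / D.ε) * (∫ t in D.a 0..D.a i, D.Eu μ t * D.src μ w₀ φ t)
    + D.Eu μ (D.a i) * W (D.a i)

theorem defect_succ_sub (m : Fin P) : D.defect W μ w₀ φ m.succ - D.defect W μ w₀ φ m.castSucc
    = (I / D.ε) * (∫ t in D.a m.castSucc..D.a m.succ, D.Eu μ t * D.src μ w₀ φ t)
      + D.Eu μ (D.a m.succ) * W (D.a m.succ) - D.Eu μ (D.a m.castSucc) * W (D.a m.castSucc) := by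
  rw [defect, defect, ← intervalIntegral.integral_add_adjacent_intervals
    (D.intervalIntegrable_Eu_src μ w₀ φ (D.a 0) (D.a m.castSucc))
    (D.intervalIntegrable_Eu_src μ w₀ φ (D.a m.castSucc) (D.a m.succ))]
  ring

/-- Induction from left to right. Passing a pole with negative integer exponent leaves the defect
unchanged, by `EuReg_mul_eq`; at the other poles it vanishes by assumption. -/
theorem defect_eq_zero (hW : ∀ x ∈ D.Gd, D.SolvesAt μ w₀ φ W x)
    (h : ∀ m, ¬ D.IsNeg m → D.defect W μ w₀ φ m.succ = 0) (i : Fin (P + 1)) :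
    D.defect W μ w₀ φ i = 0 := by
  induction i using Fin.induction with
  | zero => simp [defect]
  | succ m ih =>
    by_cases hm : D.IsNeg m
    · obtain ⟨n, h0, hn⟩ := hm
      obtain ⟨Q, hQ⟩ := D.exists_primitive_facSrc m n μ w₀ φ
      have e := D.EuReg_mul_eq hW h0 hn hQ (D.succ_mem_colSlit m) (D.castSucc_mem_colSlit m)
      rw [EuReg, EuReg, ← D.Eu_eq hn μ (D.ofReal_ne_pole _ m), ← D.Eu_eq hn μ (D.ofReal_ne_pole _ m)] at e
      have := D.defect_succ_sub (W := W) (μ := μ) (w₀ := w₀) (φ := φ) m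
      rw [D.integral_facSrc h0 hn hQ fun r hr => D.ofReal_mem_col hr, ih, sub_zero] at this
      rw [this]
      linear_combination e
    · exact h m hm

/-- The part of the strip around a pole that lies below the pole. -/
def colBelow (m : Fin P) : Set ℂ := D.col m ∩ {x | x.im < (D.z m).im}

theorem colBelow_subset_Gu (m : Fin P) : D.colBelow m ⊆ D.Gu := fun x hx => ⟨hx.1.1, fun p => by
  by_cases h : p = m
  · rw [h]; exact Or.inr hx.2
  · exact Or.inl (D.re_ne_of_mem_col h hx.1)⟩

/-- With a primitive `Q` of the integrand below the pole, `Eu W + (I/ε) Q` is constant on either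
side of the removed half-line. Equal defects make the two constants equal, and solving for `W` gives
the extension across. -/
theorem exists_extension_below (hW : ∀ x ∈ D.Gd, D.SolvesAt μ w₀ φ W x) (m : Fin P)
    (hT : ∀ i, D.defect W μ w₀ φ i = 0) :
    ∃ v : ℂ → ℂ, ∀ x ∈ D.colBelow m, D.SolvesAt μ w₀ φ v x ∧ (x ∈ D.Gd → v x = W x) := by
  have hN : IsOpen (D.colBelow m) := (D.isOpen_col m).inter (isOpen_lt continuous_im continuous_const)
  have hNc : Convex ℝ (D.colBelow m) := (D.convex_col m).inter (convex_halfSpace_im_lt _)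
  have hsrc : ∀ x ∈ D.colBelow m, DifferentiableAt ℂ (fun x => D.Eu μ x * D.src μ w₀ φ x) x :=
    fun x hx => (D.hasDerivAt_Eu (D.colBelow_subset_Gu m hx) μ).differentiableAt.mul
      (D.differentiableAt_src _ _ _ fun p => D.ne_pole_of_mem_Gu (D.colBelow_subset_Gu m hx) p)
  obtain ⟨Q, hQ⟩ := exists_primitive_of_convex hN hNc fun x hx => (hsrc x hx).differentiableWithinAt
  have hloc : ∀ x ∈ D.colBelow m, x ∈ D.Gd →
      HasDerivAt (fun x => D.Eu μ x * W x + (I / D.ε) * Q x) 0 x := by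
    intro x hx hxd
    refine ((D.hasDerivAt_fac_mul (D.hasDerivAt_f (D.colBelow_subset_Gu m hx)) (hW x hxd)).add
      ((hQ x hx).const_mul _)).congr_deriv ?_
    simp only [Eu]; ring
  have hre : ∀ x ∈ D.colBelow m, x.re ≠ (D.z m).re → x ∈ D.Gd := fun x hx h =>
    D.colSlit_subset_Gd m ⟨hx.1, Or.inl h⟩
  have hmem : ∀ s : ℝ, (s : ℂ) ∈ D.col m → (s : ℂ) ∈ D.colBelow m := fun s hs =>
    ⟨hs, by simpa using D.hz m⟩
  have hL : ∀ x ∈ D.colBelow m, x.re < (D.z m).re → D.Eu μ x * W x + (I / D.ε) * Q x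
      = D.Eu μ (D.a m.castSucc) * W (D.a m.castSucc) + (I / D.ε) * Q (D.a m.castSucc) := by
    intro x hx h
    refine eqOn_of_hasDerivAt_zero (f := fun x => D.Eu μ x * W x + (I / D.ε) * Q x)
      (hN.inter (isOpen_lt continuous_re continuous_const : IsOpen {x : ℂ | x.re < (D.z m).re}))
      (hNc.inter (convex_halfSpace_re_lt _)).isPreconnected (fun y hy => ?_) ⟨hx, h⟩
      ⟨hmem _ (D.castSucc_mem_col m), (D.ha m).1⟩
    exact hloc y hy.1 (hre y hy.1 (ne_of_lt hy.2))
  have hR : ∀ x ∈ D.colBelow m, (D.z m).re < x.re → D.Eu μ x * W x + (I / D.ε) * Q x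
      = D.Eu μ (D.a m.succ) * W (D.a m.succ) + (I / D.ε) * Q (D.a m.succ) := by
    intro x hx h
    refine eqOn_of_hasDerivAt_zero (f := fun x => D.Eu μ x * W x + (I / D.ε) * Q x)
      (hN.inter (isOpen_lt continuous_const continuous_re : IsOpen {x : ℂ | (D.z m).re < x.re}))
      (hNc.inter (convex_halfSpace_re_gt _)).isPreconnected (fun y hy => ?_) ⟨hx, h⟩
      ⟨hmem _ (D.succ_mem_col m), (D.ha m).2⟩
    exact hloc y hy.1 (hre y hy.1 (ne_of_gt hy.2))
  set C := D.Eu μ (D.a m.castSucc) * W (D.a m.castSucc) + (I / D.ε) * Q (D.a m.castSucc) with hC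
  have hCR : D.Eu μ (D.a m.succ) * W (D.a m.succ) + (I / D.ε) * Q (D.a m.succ) = C := by
    have h1 := D.defect_succ_sub (W := W) (μ := μ) (w₀ := w₀) (φ := φ) m
    have h2 : ∫ t in D.a m.castSucc..D.a m.succ, D.Eu μ t * D.src μ w₀ φ t
        = Q (D.a m.succ) - Q (D.a m.castSucc) := by
      refine intervalIntegral.integral_eq_sub_of_hasDerivAt (f := fun r : ℝ => Q r) (fun r hr => ?_)
        (D.intervalIntegrable_Eu_src _ _ _ _ _)
      simpa using (hQ r (hmem _ (D.ofReal_mem_col hr))).comp_ofReal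
    rw [hT, hT, h2] at h1
    rw [hC]
    linear_combination -h1
  refine ⟨fun x => (D.Eu μ x)⁻¹ * (C - (I / D.ε) * Q x), fun x hx => ⟨?_, fun hxd => ?_⟩⟩
  · have h0 := D.Eu_ne_zero μ x
    have hE := D.hasDerivAt_Eu (D.colBelow_subset_Gu m hx) μ
    refine ((hE.inv h0).mul (((hQ x hx).const_mul (I / D.ε)).const_sub C)).congr_deriv ?_
    simp only [Pi.inv_apply]
    field_simp
    ring
  · have h0 := D.Eu_ne_zero μ x
    have hne : x.re ≠ (D.z m).re := by
      rcases hxd.2 m with h | h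
      · exact h
      · exact absurd hx.2 (not_lt.mpr h.le)
    have : D.Eu μ x * W x + (I / D.ε) * Q x = C := by
      rcases lt_or_gt_of_ne hne with h | h
      · exact hL x hx h
      · rw [← hCR]; exact hR x hx h
    beta_reduce
    rw [← this]
    field_simp
    ring

theorem eventually_add_mem_Gd {x : ℂ} (hx : x ∈ D.dom) : ∀ᶠ t : ℝ in 𝓝[>] 0, x + t ∈ D.Gd := by
  have h1 : ∀ p, ∀ᶠ t : ℝ in 𝓝[>] 0, x.re + t ≠ (D.z p).re := by
    intro p
    have : ∀ᶠ t : ℝ in 𝓝[≠] 0, t ∈ ({(D.z p).re - x.re} \ {0} : Set ℝ)ᶜ :=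
      nhdsWithin_le_nhds (((finite_singleton _).sdiff).isClosed.isOpen_compl.mem_nhds (by simp))
    filter_upwards [this.filter_mono (nhdsWithin_mono _ fun t (ht : 0 < t) => ht.ne'),
      self_mem_nhdsWithin] with t ht h0 e
    have h0' : t ≠ 0 := ne_of_gt h0
    exact ht ⟨by rw [mem_singleton_iff]; linarith, by simpa using h0'⟩
  filter_upwards [eventually_all.mpr h1] with t ht
  exact ⟨by have : -D.b < x.im := hx; simpa using this, fun p => Or.inl (by simpa using ht p)⟩

theorem tendsto_add_ofReal (x : ℂ) : Tendsto (fun t : ℝ => x + t) (𝓝[>] 0) (𝓝 x) := by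
  have : ContinuousAt (fun t : ℝ => x + t) 0 := by fun_prop
  simpa using this.tendsto.mono_left nhdsWithin_le_nhds

/-- The extension of a function on `Gd` by its limits from the right. -/
def glued (W : ℂ → ℂ) (x : ℂ) : ℂ := limUnder (𝓝[>] (0:ℝ)) fun t : ℝ => W (x + t)

theorem glued_eq {x : ℂ} (hx : x ∈ D.dom) {v : ℂ → ℂ} (hv : ContinuousAt v x)
    (h : ∀ᶠ y in 𝓝 x, y ∈ D.Gd → v y = W y) : glued W x = v x := by
  refine Tendsto.limUnder_eq ((hv.tendsto.comp (tendsto_add_ofReal x)).congr' ?_)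
  filter_upwards [D.eventually_add_mem_Gd hx, (tendsto_add_ofReal x).eventually h] with t h1 h2
  exact h2 h1

theorem glued_eventuallyEq {x : ℂ} (hx : x ∈ D.dom) {v : ℂ → ℂ}
    (hv : ∀ᶠ y in 𝓝 x, ContinuousAt v y) (h : ∀ᶠ y in 𝓝 x, y ∈ D.Gd → v y = W y) :
    glued W =ᶠ[𝓝 x] v := by
  filter_upwards [D.isOpen_dom.mem_nhds hx, hv, h.eventually_nhds] with y h1 h2 h3
  exact D.glued_eq h1 h2 h3

/-- Solutions of the differential equation in the whole domain. -/
structure GlobalSol (μ w₀ : ℂ) (φ : Fin P → ℂ) (w : ℂ → ℂ) : Prop where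
  diff : DifferentiableOn ℂ w D.dom
  solves : ∀ x ∈ D.dom, (∀ p, x ≠ D.z p) → D.SolvesAt μ w₀ φ w x
  value : ∀ p, D.c p * w (D.z p) = φ p

variable {D} in
theorem SolvesAt.congr {w v : ℂ → ℂ} {x : ℂ} (hv : D.SolvesAt μ w₀ φ v x) (h : w =ᶠ[𝓝 x] v) :
    D.SolvesAt μ w₀ φ w x := by
  unfold SolvesAt at hv ⊢
  rw [h.eq_of_nhds]
  exact hv.congr_of_eventuallyEq h

theorem exists_local_extension (hW : ∀ x ∈ D.Gd, D.SolvesAt μ w₀ φ W x)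
    (hT : ∀ i, D.defect W μ w₀ φ i = 0) {x : ℂ} (hx : x ∈ D.dom) (hne : ∀ p, x ≠ D.z p) :
    ∃ v : ℂ → ℂ, ∀ᶠ y in 𝓝 x, D.SolvesAt μ w₀ φ v y ∧ (y ∈ D.Gd → v y = W y) := by
  by_cases hd : x ∈ D.Gd
  · exact ⟨W, by filter_upwards [D.isOpen_Gd.mem_nhds hd] with y hy using ⟨hW y hy, fun _ => rfl⟩⟩
  · obtain ⟨m, hm⟩ : ∃ m, x.re = (D.z m).re ∧ x.im ≤ (D.z m).im := by
      by_contra! hcon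
      exact hd ⟨hx, fun p => by
        by_cases h : x.re = (D.z p).re
        · exact Or.inr (hcon p h)
        · exact Or.inl h⟩
    have hlt : x.im < (D.z m).im := lt_of_le_of_ne hm.2 fun e => hne m (Complex.ext hm.1 e)
    have hxN : x ∈ D.colBelow m := ⟨⟨hx, fun p => ⟨fun h => by rw [hm.1]; exact D.hre h,
      fun h => by rw [hm.1]; exact D.hre h⟩⟩, hlt⟩
    obtain ⟨v, hv⟩ := D.exists_extension_below hW m hT
    exact ⟨v, by
      filter_upwards [((D.isOpen_col m).inter
        (isOpen_lt continuous_im continuous_const)).mem_nhds hxN] with y hy using hv y hy⟩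

theorem solvesAt_glued (hW : ∀ x ∈ D.Gd, D.SolvesAt μ w₀ φ W x)
    (hT : ∀ i, D.defect W μ w₀ φ i = 0) {x : ℂ} (hx : x ∈ D.dom) (hne : ∀ p, x ≠ D.z p) :
    D.SolvesAt μ w₀ φ (glued W) x := by
  obtain ⟨v, hv⟩ := D.exists_local_extension hW hT hx hne
  refine hv.self_of_nhds.1.congr (D.glued_eventuallyEq hx ?_ (hv.mono fun y hy => hy.2))
  exact hv.mono fun y hy => hy.1.continuousAt

theorem glued_eq_of_mem_Gd (hW : ∀ x ∈ D.Gd, D.SolvesAt μ w₀ φ W x) {x : ℂ} (hx : x ∈ D.Gd) :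
    glued W x = W x :=
  D.glued_eq hx.1 (hW x hx).continuousAt (Eventually.of_forall fun _ _ => rfl)

theorem eventually_col_punctured (m : Fin P) : ∀ᶠ x in 𝓝[≠] D.z m, x ∈ D.col m ∧ x ≠ D.z m :=
  Filter.Eventually.and (nhdsWithin_le_nhds ((D.isOpen_col m).mem_nhds (D.pole_mem_col m)))
    self_mem_nhdsWithin

/-- The condition at the pole says `EuReg W = (I/ε)(Q (z m) - Q x)`, which tends to zero at `z m`.
The left side is a factor with nonzero limit times `(x - z m) ^ n W`. The limit is taken along `x =
z m + t` with `t > 0`, inside the set where `W` is defined by its formula. -/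
theorem no_pole (hW : ∀ x ∈ D.Gd, D.SolvesAt μ w₀ φ W x) (hT : ∀ i, D.defect W μ w₀ φ i = 0)
    {m : Fin P} {n : ℕ} (h0 : 0 < n) (hn : I * D.c m / (D.ε : ℂ) = -(n : ℂ))
    (hrow : -(D.Eu μ (D.a 0) * W (D.a 0))
      + (I / D.ε) * D.pathInt (fun y => D.Eu μ y * D.src μ w₀ φ y) (D.z m) = 0) {L : ℂ}
    (hL : Tendsto (fun x => (x - D.z m) ^ n * W x) (map (fun t : ℝ => D.z m + t) (𝓝[>] 0)) (𝓝 L)) :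
    L = 0 := by
  obtain ⟨Q, hQ⟩ := D.exists_primitive_facSrc m n μ w₀ φ
  have hc := D.castSucc_mem_colSlit m
  have hseg : ∀ r ∈ uIcc (D.a m.castSucc) (D.z m).re, (r : ℂ) ∈ D.col m := fun r hr =>
    D.ofReal_mem_col (by
      rw [uIcc_of_le (D.ha m).1.le] at hr
      rw [uIcc_of_le ((D.ha m).1.trans (D.ha m).2).le]
      exact ⟨hr.1, hr.2.trans (D.ha m).2.le⟩)
  have hpath : D.pathInt (fun y => D.Eu μ y * D.src μ w₀ φ y) (D.z m)
      = (∫ t in D.a 0..D.a m.castSucc, D.Eu μ t * D.src μ w₀ φ t)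
        + (Q (D.z m) - Q (D.a m.castSucc)) := by
    rw [pathInt, D.integral_facSrc_vert h0 hn hQ, ← intervalIntegral.integral_add_adjacent_intervals
      (D.intervalIntegrable_Eu_src μ w₀ φ (D.a 0) (D.a m.castSucc))
      (D.intervalIntegrable_Eu_src μ w₀ φ (D.a m.castSucc) _), D.integral_facSrc h0 hn hQ hseg]
    ring
  have hcon : ∀ x ∈ D.colSlit m, D.EuReg m n μ x * W x = (I / D.ε) * (Q (D.z m) - Q x) := by
    intro x hx
    have e := D.EuReg_mul_eq hW h0 hn hQ hx hc
    have hd := hT m.castSucc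
    rw [defect] at hd
    rw [hpath] at hrow
    have e2 : D.EuReg m n μ (D.a m.castSucc) = D.Eu μ (D.a m.castSucc) :=
      (D.Eu_eq hn μ (D.ofReal_ne_pole _ m)).symm
    rw [e2] at e
    linear_combination e + hd - hrow
  have hz := D.pole_mem_col m
  have l1 : Tendsto (fun x => (I / D.ε) * (Q (D.z m) - Q x)) (map (fun t : ℝ => D.z m + t) (𝓝[>] 0))
      (𝓝 0) := by
    have h1 : ContinuousAt (fun x => (I / D.ε) * (Q (D.z m) - Q x)) (D.z m) :=
      continuousAt_const.mul (continuousAt_const.sub (hQ _ hz).continuousAt)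
    have h2 := h1.tendsto.mono_left (tendsto_add_ofReal (D.z m))
    simpa using h2
  have l2 : Tendsto (fun x => D.facReg m μ x) (map (fun t : ℝ => D.z m + t) (𝓝[>] 0))
      (𝓝 (D.facReg m μ (D.z m))) :=
    (D.differentiableAt_facReg μ hz).continuousAt.tendsto.mono_left (tendsto_add_ofReal (D.z m))
  have l3 := (l2.mul hL).const_mul (I ^ n)
  have l4 : Tendsto (fun x => (I / D.ε) * (Q (D.z m) - Q x)) (map (fun t : ℝ => D.z m + t) (𝓝[>] 0))
      (𝓝 (I ^ n * (D.facReg m μ (D.z m) * L))) := by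
    refine l3.congr' ?_
    have : ∀ᶠ t : ℝ in 𝓝[>] 0, D.z m + t ∈ D.colSlit m := by
      filter_upwards [(tendsto_add_ofReal (D.z m)).eventually ((D.isOpen_col m).mem_nhds hz),
        self_mem_nhdsWithin] with t ht h0
      have h0' : t ≠ 0 := ne_of_gt h0
      exact ⟨ht, Or.inl (by simpa using h0')⟩
    have this' : ∀ᶠ x in map (fun t : ℝ => D.z m + t) (𝓝[>] 0), x ∈ D.colSlit m := this
    filter_upwards [this'] with x hx
    rw [← hcon x hx, EuReg, mul_pow]; ring
  have e := tendsto_nhds_unique l1 l4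
  have hf : D.facReg m μ (D.z m) ≠ 0 := exp_ne_zero _
  have hI : I ^ n ≠ 0 := pow_ne_zero _ I_ne_zero
  rcases mul_eq_zero.mp e.symm with h | h
  · exact absurd h hI
  · exact (mul_eq_zero.mp h).resolve_left hf

/-- Vanishing defects make the pieces fit off the poles. At `z m` the equation has a regular
singular point with indicial value `I c m / ε`, so a pole of the solution is possible only for a
negative integer value, and then the condition in `h2` excludes it. -/
theorem glue (hW : ∀ x ∈ D.Gd, D.SolvesAt μ w₀ φ W x)
    (h1 : ∀ m, ¬ D.IsNeg m → D.defect W μ w₀ φ m.succ = 0)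
    (h2 : ∀ m, D.IsNeg m → -(D.Eu μ (D.a 0) * W (D.a 0))
      + (I / D.ε) * D.pathInt (fun y => D.Eu μ y * D.src μ w₀ φ y) (D.z m) = 0) :
    D.GlobalSol μ w₀ φ (glued W) ∧ EqOn (glued W) W D.Gd := by
  have hT := D.defect_eq_zero hW h1
  have hpole : ∀ m, DifferentiableAt ℂ (glued W) (D.z m) ∧ D.c m * glued W (D.z m) = φ m := by
    intro m
    have hz := D.pole_mem_col m
    have hA : AnalyticAt ℂ (fun x => (I / D.ε) * ((x - D.z m) * (μ + D.uReg m x) + D.c m)) (D.z m) := by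
      refine DifferentiableOn.analyticAt (s := D.col m) (fun x hx => ?_)
        ((D.isOpen_col m).mem_nhds hz)
      have := D.differentiableAt_uReg hx
      exact DifferentiableAt.differentiableWithinAt (by fun_prop)
    have hB : AnalyticAt ℂ (fun x => -(I / D.ε) * D.srcReg m μ w₀ φ x) (D.z m) := by
      refine DifferentiableOn.analyticAt (s := D.col m) (fun x hx => ?_)
        ((D.isOpen_col m).mem_nhds hz)
      have := D.differentiableAt_srcReg μ w₀ φ hx
      exact DifferentiableAt.differentiableWithinAt (by fun_prop)
    have hode : ∀ᶠ x in 𝓝[≠] D.z m, HasDerivAt (glued W)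
        (((I / D.ε) * ((x - D.z m) * (μ + D.uReg m x) + D.c m) * glued W x
          + -(I / D.ε) * D.srcReg m μ w₀ φ x) / (x - D.z m)) x := by
      filter_upwards [D.eventually_col_punctured m] with x hx
      refine HasDerivAt.congr_deriv
        (D.solvesAt_glued hW hT hx.1.1 fun p => D.ne_pole_of_mem_col hx.1 hx.2 p) ?_
      have h0 := sub_ne_zero.mpr hx.2
      rw [D.srcReg_eq _ _ _ hx.2, D.u_eq m]
      field_simp
      ring
    rcases removable_or_pole hA hB hode with ⟨v, hv, hwv⟩ | ⟨n, hn0, hAn, L, hL0, hL⟩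
    · have heq : glued W (D.z m) = v (D.z m) := by
        refine D.glued_eq hz.1 hv.continuousAt ?_
        rw [eventually_nhdsWithin_iff] at hwv
        filter_upwards [hwv] with y hy hyd
        rw [← D.glued_eq_of_mem_Gd hW hyd, hy (D.ne_pole_of_mem_Gd hyd m)]
      have hev : glued W =ᶠ[𝓝 (D.z m)] v := by
        rw [eventually_nhdsWithin_iff] at hwv
        filter_upwards [hwv] with y hy
        by_cases h : y = D.z m
        · rw [h, heq]
        · exact hy h
      refine ⟨hv.differentiableAt.congr_of_eventuallyEq hev, ?_⟩
      have hvd : ContinuousAt (deriv v) (D.z m) := hv.deriv.continuousAt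
      -- The equation multiplied by `x - z m` is passed to the limit; what remains is `c m * v (z m)
      -- = φ m`.
      have t1 : Tendsto (fun x => (x - D.z m) * deriv v x) (𝓝[≠] D.z m) (𝓝 0) := by
        have : ContinuousAt (fun x => (x - D.z m) * deriv v x) (D.z m) := by fun_prop
        simpa using this.tendsto.mono_left (nhdsWithin_le_nhds (s := {D.z m}ᶜ))
      have t2 : Tendsto (fun x => (I / D.ε) * ((x - D.z m) * (μ + D.uReg m x) + D.c m) * v x
          + -(I / D.ε) * D.srcReg m μ w₀ φ x) (𝓝[≠] D.z m)
          (𝓝 ((I / D.ε) * D.c m * v (D.z m) + -(I / D.ε) * φ m)) := by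
        have h3 : ContinuousAt (fun x => (I / D.ε) * ((x - D.z m) * (μ + D.uReg m x) + D.c m) * v x
          + -(I / D.ε) * D.srcReg m μ w₀ φ x) (D.z m) :=
          (hA.continuousAt.mul hv.continuousAt).add hB.continuousAt
        have := h3.tendsto.mono_left (nhdsWithin_le_nhds (s := {D.z m}ᶜ))
        simpa [srcReg] using this
      have e := tendsto_nhds_unique t1 (t2.congr' (by
        filter_upwards [hode, hev.eventuallyEq_nhds.filter_mono nhdsWithin_le_nhds, self_mem_nhdsWithin] with x hx hxe hxz
        have h0 : x - D.z m ≠ 0 := sub_ne_zero.mpr hxz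
        rw [← hxe.deriv_eq, hx.deriv, hxe.eq_of_nhds]
        field_simp))
      have hI : I / (D.ε : ℂ) ≠ 0 := div_ne_zero I_ne_zero D.εc_ne
      rw [heq]
      have : (I / (D.ε : ℂ)) * (D.c m * v (D.z m) - φ m) = 0 := by linear_combination -e
      exact sub_eq_zero.mp ((mul_eq_zero.mp this).resolve_left hI)
    · exfalso
      have hn : I * D.c m / (D.ε : ℂ) = -(n : ℂ) := by
        rw [← hAn]; simp; ring
      refine hL0 (D.no_pole hW hT hn0 hn (h2 m ⟨n, hn0, hn⟩) ?_)
      have hle : map (fun t : ℝ => D.z m + t) (𝓝[>] 0) ≤ 𝓝[≠] D.z m := by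
        refine le_inf (tendsto_add_ofReal _) (le_principal_iff.mpr ?_)
        rw [mem_map]
        filter_upwards [self_mem_nhdsWithin] with t ht
        have h0' : t ≠ 0 := ne_of_gt ht
        simpa using h0'
      refine (hL.mono_left hle).congr' ?_
      have : ∀ᶠ x in map (fun t : ℝ => D.z m + t) (𝓝[>] 0), x ∈ D.Gd := D.eventually_add_mem_Gd hz.1
      filter_upwards [this] with x hx
      rw [D.glued_eq_of_mem_Gd hW hx]
  refine ⟨⟨fun x hx => ?_, fun x hx hne => D.solvesAt_glued hW hT hx hne, fun p => (hpole p).2⟩,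
    fun x hx => D.glued_eq_of_mem_Gd hW hx⟩
  by_cases hne : ∀ p, x ≠ D.z p
  · exact (D.solvesAt_glued hW hT hx hne).differentiableAt.differentiableWithinAt
  · push Not at hne
    obtain ⟨p, rfl⟩ := hne
    exact (hpole p).1.differentiableWithinAt

theorem exists_globalSol {d : ℂ} (hd : IsDir d) (hμ : (μ * d).im ≤ 0) (hμ0 : μ ≠ 0)
    (hrow : ∀ m, D.row d μ w₀ φ m = 0) :
    ∃ w, D.GlobalSol μ w₀ φ w ∧ EqOn w (D.wsol d μ w₀ φ) D.Gd :=
  ⟨_, D.glue (fun _ hx => D.solvesAt_wsol hd hμ hμ0 w₀ φ hx)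
    (fun m hm => by rw [defect, ← D.row_of_not_isNeg hm, hrow m])
    (fun m hm => by rw [← D.row_of_isNeg hm, hrow m])⟩

end Datum
end BOScattering
end

/-! ### Integral identities and uniqueness -/

noncomputable section
namespace BOScattering

/-- The filter of neighbourhoods of infinity in the closed upper half-plane. -/
def atInf : Filter ℂ := Bornology.cobounded ℂ ⊓ 𝓟 closedUpper

theorem tendsto_norm_atInf : Tendsto (fun x : ℂ => ‖x‖) atInf atTop :=
  tendsto_norm_cobounded_atTop.mono_left inf_le_left

theorem eventually_atInf {p : ℂ → Prop} {X : ℝ} (h : ∀ x ∈ closedUpper, X ≤ ‖x‖ → p x) :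
    ∀ᶠ x in atInf, p x := by
  have h2 : ∀ᶠ x in atInf, x ∈ closedUpper := mem_inf_of_right (mem_principal_self _)
  filter_upwards [tendsto_norm_atInf.eventually_ge_atTop X, h2] with x h1 h2 using h x h2 h1

theorem tendsto_ofReal_atInf : Tendsto (fun R : ℝ => (R : ℂ)) atTop atInf := by
  refine tendsto_inf.mpr ⟨?_, tendsto_principal.mpr (Eventually.of_forall ofReal_mem_closedUpper)⟩
  rw [← tendsto_norm_atTop_iff_cobounded]
  simpa using tendsto_abs_atTop_atTop

theorem tendsto_neg_ofReal_atInf : Tendsto (fun R : ℝ => (-R : ℂ)) atTop atInf := by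
  refine tendsto_inf.mpr ⟨?_, tendsto_principal.mpr (Eventually.of_forall fun R => by
    simp [closedUpper])⟩
  rw [← tendsto_norm_atTop_iff_cobounded]
  simpa using tendsto_abs_atTop_atTop

theorem tendsto_zero_of_bound {g : ℂ → ℂ} {X C : ℝ}
    (h : ∀ x ∈ closedUpper, X ≤ ‖x‖ → ‖g x‖ ≤ C / (1 + ‖x‖)) : Tendsto g atInf (𝓝 0) := by
  have h1 : Tendsto (fun x : ℂ => C / (1 + ‖x‖)) atInf (𝓝 0) :=
    (tendsto_atTop_add_const_left _ 1 tendsto_norm_atInf).const_div_atTop C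
  exact squeeze_zero_norm' (eventually_atInf h) h1

theorem tendsto_div_sub (y : ℂ) : Tendsto (fun x : ℂ => x / (x - y)) (Bornology.cobounded ℂ) (𝓝 1) := by
  have h1 : Tendsto (fun x : ℂ => x - y) (Bornology.cobounded ℂ) (Bornology.cobounded ℂ) := by
    rw [← tendsto_norm_atTop_iff_cobounded]
    refine tendsto_atTop_mono (fun x => norm_sub_norm_le x y) ?_
    exact tendsto_atTop_add_const_right _ _ tendsto_norm_cobounded_atTop
  have h2 : Tendsto (fun x : ℂ => 1 + y * (x - y)⁻¹) (Bornology.cobounded ℂ) (𝓝 1) := by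
    have := ((tendsto_inv₀_cobounded (α := ℂ)).comp h1).const_mul y
    simpa using this.const_add 1
  refine h2.congr' ?_
  have h3 : ∀ᶠ x in Bornology.cobounded ℂ, x ≠ y := by
    have := (tendsto_norm_cobounded_atTop (E := ℂ)).eventually_gt_atTop ‖y‖
    filter_upwards [this] with x hx e
    rw [e] at hx; exact lt_irrefl _ hx
  filter_upwards [h3] with x hx
  have := sub_ne_zero.mpr hx
  field_simp
  ring

theorem tendsto_mul_sum_div {ι : Type*} [Fintype ι] (k y : ι → ℂ) :
    Tendsto (fun x : ℂ => x * ∑ p, k p / (x - y p)) (Bornology.cobounded ℂ) (𝓝 (∑ p, k p)) := by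
  have : Tendsto (fun x : ℂ => ∑ p, k p * (x / (x - y p))) (Bornology.cobounded ℂ) (𝓝 (∑ p, k p * 1)) :=
    tendsto_finsetSum _ fun p _ => (tendsto_div_sub (y p)).const_mul _
  simp only [mul_one] at this
  refine this.congr fun x => ?_
  rw [Finset.mul_sum]
  exact Finset.sum_congr rfl fun p _ => by ring

theorem tendsto_sum_div {ι : Type*} [Fintype ι] (k y : ι → ℂ) :
    Tendsto (fun x : ℂ => ∑ p, k p / (x - y p)) (Bornology.cobounded ℂ) (𝓝 0) := by
  have h1 := (tendsto_inv₀_cobounded (α := ℂ)).mul (tendsto_mul_sum_div k y)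
  rw [zero_mul] at h1
  refine h1.congr' ?_
  filter_upwards [(tendsto_norm_cobounded_atTop (E := ℂ)).eventually_gt_atTop 0] with x hx
  have hx0 : x ≠ 0 := norm_pos_iff.mp hx
  field_simp

theorem exists_le_integral_norm_sq {w : ℝ → ℂ} (hw : Continuous w) {t : ℝ} (ht : w t ≠ 0) :
    ∃ δ > 0, ∀ᶠ R : ℝ in atTop, δ ≤ ∫ x in (-R)..R, ‖w x‖ ^ 2 := by
  have hc : Continuous fun x => ‖w x‖ ^ 2 := by fun_prop
  refine ⟨_, intervalIntegral.integral_pos (f := fun x => ‖w x‖ ^ 2) (a := -(|t| + 1)) (b := |t| + 1)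
    (by linarith [abs_nonneg t]) hc.continuousOn (fun x _ => by positivity)
    ⟨t, ⟨by linarith [neg_abs_le t], by linarith [le_abs_self t]⟩, by positivity⟩, ?_⟩
  filter_upwards [eventually_ge_atTop (|t| + 1)] with R hR
  exact intervalIntegral.integral_mono_interval (by linarith) (by linarith [abs_nonneg t]) hR
    (Eventually.of_forall fun x => by positivity) (hc.intervalIntegrable _ _)

namespace Datum
variable {P : ℕ} (D : Datum P)

/-- The conjugate of the rational source on the real line, as an analytic function. -/
def Sbar (φ : Fin P → ℂ) (x : ℂ) : ℂ := ∑ p, conj (φ p) / (x - conj (D.z p))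

theorem differentiableAt_Sbar (φ : Fin P → ℂ) {x : ℂ} (hx : x ∈ D.dom) :
    DifferentiableAt ℂ (D.Sbar φ) x :=
  DifferentiableAt.fun_sum fun p _ => differentiableAt_div_sub _ (D.ne_conj_pole hx p)

theorem conj_src (μ w₀ : ℂ) (φ : Fin P → ℂ) (t : ℝ) :
    conj (D.src μ w₀ φ t) = conj (μ * w₀) + D.Sbar φ t := by
  simp [src, Sbar]

theorem conj_u (t : ℝ) : conj (D.u t) = D.u t := by
  simp only [u, map_sum, map_add, map_div₀, map_sub, conj_ofReal, conj_conj]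
  exact Finset.sum_congr rfl fun p _ => by ring

theorem tendsto_mul_Sbar (φ : Fin P → ℂ) :
    Tendsto (fun x => x * D.Sbar φ x) atInf (𝓝 (conj (∑ p, φ p))) := by
  rw [map_sum]
  exact (tendsto_mul_sum_div _ _).mono_left inf_le_left

theorem tendsto_mul_u : Tendsto (fun x => x * D.u x) atInf (𝓝 0) := by
  have h1 := (tendsto_mul_sum_div D.c D.z).add (tendsto_mul_sum_div (fun p => conj (D.c p))
    (fun p => conj (D.z p)))
  rw [← Finset.sum_add_distrib, D.hsum] at h1
  refine (h1.mono_left inf_le_left).congr fun x => ?_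
  rw [u, Finset.sum_add_distrib]; ring

variable {D} {μ ν w₀ : ℂ} {φ ψ : Fin P → ℂ} {w v : ℂ → ℂ}

theorem real_mem_dom (t : ℝ) : (t : ℂ) ∈ D.dom :=
  D.closedUpper_subset_dom (ofReal_mem_closedUpper t)

theorem GlobalSol.differentiableAt (hw : D.GlobalSol μ w₀ φ w) {x : ℂ} (hx : x ∈ D.dom) :
    DifferentiableAt ℂ w x := hw.diff.differentiableAt (D.isOpen_dom.mem_nhds hx)

theorem GlobalSol.continuousOn (hw : D.GlobalSol μ w₀ φ w) : ContinuousOn w closedUpper :=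
  hw.diff.continuousOn.mono D.closedUpper_subset_dom

theorem GlobalSol.continuous_real (hw : D.GlobalSol μ w₀ φ w) : Continuous fun t : ℝ => w t :=
  Datum.continuous_real fun t => (hw.differentiableAt (real_mem_dom t)).continuousAt

theorem continuous_Sbar_real (φ : Fin P → ℂ) : Continuous fun t : ℝ => D.Sbar φ t :=
  Datum.continuous_real fun t => (D.differentiableAt_Sbar φ (real_mem_dom t)).continuousAt

theorem GlobalSol.hasDerivAt_real (hw : D.GlobalSol μ w₀ φ w) (t : ℝ) :
    HasDerivAt (fun t : ℝ => w t) ((I / D.ε) * ((μ + D.u t) * w t - D.src μ w₀ φ t)) t := by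
  have := (hw.solves t (real_mem_dom t) (D.ofReal_ne_pole t)).comp_ofReal
  simpa using this

/-- The potential is real on the real line and cancels. Only the difference of the spectral
parameters and the sources remain. -/
theorem hasDerivAt_mul_conj (hw : D.GlobalSol μ w₀ φ w) (hv : D.GlobalSol ν 0 ψ v) (t : ℝ) :
    HasDerivAt (fun t : ℝ => w t * conj (v t)) ((I / D.ε) * ((μ - conj ν) * (w t * conj (v t))
      - (μ * w₀ * conj (v t) + conj (D.Sbar φ t * v t)) + D.Sbar ψ t * w t)) t := by
  have h1 := hw.hasDerivAt_real t
  have h2 := (hv.hasDerivAt_real t).star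
  refine (h1.mul h2).congr_deriv ?_
  have e1 := D.conj_src ν 0 ψ t
  have e2 : D.src μ w₀ φ t = μ * w₀ + conj (D.Sbar φ t) := by
    have := congrArg conj (D.conj_src 0 0 φ t)
    simp [src] at this
    simp [src, ← this]
  simp only [mul_zero, map_zero, zero_add] at e1
  simp only [star_def, map_mul, map_sub, map_add, map_div₀, conj_I, conj_ofReal, D.conj_u, e1, e2]
  ring

theorem ode_integral (hw : D.GlobalSol μ w₀ φ w) (hv : D.GlobalSol ν 0 ψ v) (R : ℝ) :
    w R * conj (v R) - w (-R) * conj (v (-R)) = (I / D.ε) * ((μ - conj ν) *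
      (∫ t in (-R)..R, w t * conj (v t)) - (μ * w₀ * conj (∫ t in (-R)..R, v t)
      + conj (∫ t in (-R)..R, D.Sbar φ t * v t)) + ∫ t in (-R)..R, D.Sbar ψ t * w t) := by
  have cw := hw.continuous_real
  have cv := hv.continuous_real
  have cv' : Continuous fun t : ℝ => conj (v t) := continuous_conj.comp cv
  have c1 := continuous_Sbar_real (D := D) φ
  have c2 := continuous_Sbar_real (D := D) ψ
  have c3 : Continuous fun t : ℝ => conj (D.Sbar φ t * v t) := continuous_conj.comp (c1.mul cv)
  have d1 : Continuous fun t : ℝ => (μ - conj ν) * (w t * conj (v t)) :=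
    continuous_const.mul (cw.mul cv')
  have d2 : Continuous fun t : ℝ => μ * w₀ * conj (v t) := continuous_const.mul cv'
  have d3 : Continuous fun t : ℝ => D.Sbar ψ t * w t := c2.mul cw
  have d4 : Continuous fun t : ℝ => μ * w₀ * conj (v t) + conj (D.Sbar φ t * v t) := d2.add c3
  have d5 : Continuous fun t : ℝ => (μ - conj ν) * (w t * conj (v t))
    - (μ * w₀ * conj (v t) + conj (D.Sbar φ t * v t)) := d1.sub d4
  have key := intervalIntegral.integral_eq_sub_of_hasDerivAt (a := -R) (b := R)
    (fun t _ => hasDerivAt_mul_conj hw hv t)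
    ((continuous_const.mul (d5.add d3)).intervalIntegrable _ _)
  rw [ofReal_neg] at key
  rw [← key, intervalIntegral.integral_const_mul, intervalIntegral.integral_add
    (d5.intervalIntegrable _ _) (d3.intervalIntegrable _ _),
    intervalIntegral.integral_sub (d1.intervalIntegrable _ _)
    (d4.intervalIntegrable _ _), intervalIntegral.integral_add
    (d2.intervalIntegrable _ _) (c3.intervalIntegrable _ _),
    intervalIntegral.integral_const_mul, intervalIntegral.integral_const_mul]
  have e : ∀ g : ℝ → ℂ, ∫ t in (-R)..R, conj (g t) = conj (∫ t in (-R)..R, g t) := by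
    intro g
    simp only [intervalIntegral, map_sub, integral_conj]
  rw [e, e]

theorem upper_subset_dom {x : ℂ} (hx : x ∈ upper) : x ∈ D.dom :=
  D.closedUpper_subset_dom (upper_subset_closedUpper hx)

/-- The conjugated source continues analytically to the upper half-plane, its poles being the
conjugates of the `z p`. With the tail `conj (∑ ψₚ) / x` the integral is half a residue at infinity.
-/
theorem tendsto_integral_Sbar (hw : D.GlobalSol μ w₀ φ w) (ψ : Fin P → ℂ) {K : ℂ}
    (hK : Tendsto w atInf (𝓝 K)) : Tendsto (fun R : ℝ => ∫ t in (-R)..R, D.Sbar ψ t * w t) atTop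
      (𝓝 (-I * Real.pi * (conj (∑ p, ψ p) * K))) := by
  refine tendsto_integral_of_upper_tendsto (g := fun x => D.Sbar ψ x * w x) countable_empty ?_ ?_ ?_
  · exact ContinuousOn.mul (fun x hx => (D.differentiableAt_Sbar ψ
      (D.closedUpper_subset_dom hx)).continuousAt.continuousWithinAt) hw.continuousOn
  · exact fun x hx => (D.differentiableAt_Sbar ψ (upper_subset_dom hx.1)).mul
      (hw.differentiableAt (upper_subset_dom hx.1))
  · refine ((D.tendsto_mul_Sbar ψ).mul hK).congr fun x => ?_
    ring

theorem GlobalSol.eqOn_zero_of_real (hw : D.GlobalSol μ 0 φ w) (h : ∀ t : ℝ, w t = 0) :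
    EqOn w 0 D.dom := by
  refine AnalyticOnNhd.eqOn_zero_of_preconnected_of_frequently_eq_zero
    (hw.diff.analyticOnNhd D.isOpen_dom) D.convex_dom.isPreconnected (z₀ := 0)
    (by simpa using real_mem_dom (D := D) 0) ?_
  have : Tendsto (fun t : ℝ => (t : ℂ)) (𝓝[≠] 0) (𝓝[≠] 0) := by
    refine tendsto_nhdsWithin_of_tendsto_nhds_of_eventually_within _ ?_ ?_
    · simpa using (continuous_ofReal.tendsto (0:ℝ)).mono_left nhdsWithin_le_nhds
    · filter_upwards [self_mem_nhdsWithin] with t ht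
      simpa using ht
  exact this.frequently (Eventually.of_forall h).frequently

theorem GlobalSol.eq_zero_of_eqOn (hw : D.GlobalSol μ 0 φ w) (hz : EqOn w 0 D.dom) : φ = 0 := by
  funext p
  have hp : D.z p ∈ D.dom := D.closedUpper_subset_dom (D.hz p).le
  rw [← hw.value p, hz hp]; simp

/-- Decay at infinity in the closed upper half-plane. -/
def Dec (w : ℂ → ℂ) : Prop := ∃ X C : ℝ, ∀ x ∈ closedUpper, X ≤ ‖x‖ → ‖w x‖ ≤ C / (1 + ‖x‖)

theorem Dec.tendsto (h : Dec w) : Tendsto w atInf (𝓝 0) := by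
  obtain ⟨X, C, h⟩ := h
  exact tendsto_zero_of_bound h

theorem integral_mul_conj (w : ℂ → ℂ) (R : ℝ) :
    ∫ t in (-R)..R, w t * conj (w t) = ((∫ t in (-R)..R, ‖w t‖ ^ 2 : ℝ) : ℂ) := by
  rw [← intervalIntegral.integral_ofReal]
  refine intervalIntegral.integral_congr fun t _ => ?_
  simp [mul_conj, normSq_eq_norm_sq]

theorem GlobalSol.eqOn_zero_of_tendsto (hw : D.GlobalSol μ 0 φ w) {r : ℝ} (hr : r ≤ 0)
    (h : Tendsto (fun R : ℝ => ∫ t in (-R)..R, w t * conj (w t)) atTop (𝓝 r)) : EqOn w 0 D.dom := by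
  refine hw.eqOn_zero_of_real fun t => ?_
  by_contra ht
  obtain ⟨δ, hδ, hR⟩ := exists_le_integral_norm_sq hw.continuous_real ht
  simp only [integral_mul_conj] at h
  have h2 : Tendsto (fun R : ℝ => ∫ t in (-R)..R, ‖w t‖ ^ 2) atTop (𝓝 r) := by
    have h3 := (continuous_re.tendsto _).comp h
    simpa only [Function.comp_def, ofReal_re] using h3
  linarith [ge_of_tendsto h2 hR]

theorem tendsto_real {w : ℂ → ℂ} {K : ℂ} (h : Tendsto w atInf (𝓝 K)) :
    Tendsto (fun R : ℝ => w R) atTop (𝓝 K) ∧ Tendsto (fun R : ℝ => w (-R)) atTop (𝓝 K) :=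
  ⟨h.comp tendsto_ofReal_atInf, h.comp tendsto_neg_ofReal_atInf⟩

/-- Uniqueness for nonreal spectral parameters. -/
theorem GlobalSol.eqOn_zero_of_im_ne_zero (hw : D.GlobalSol μ 0 φ w) (hd : Tendsto w atInf (𝓝 0))
    (hμ : μ.im ≠ 0) : EqOn w 0 D.dom := by
  refine hw.eqOn_zero_of_tendsto le_rfl ?_
  obtain ⟨t1, t2⟩ := tendsto_real hd
  -- The source terms and the boundary terms vanish in the limit, leaving `(μ - conj μ) ∫|w|²`.
  have tS := tendsto_integral_Sbar hw φ hd
  rw [mul_zero, mul_zero] at tS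
  have tL := (t1.mul ((continuous_conj.tendsto 0).comp t1)).sub
    (t2.mul ((continuous_conj.tendsto 0).comp t2))
  have hne : μ - conj μ ≠ 0 := by
    rw [sub_conj]; simpa using hμ
  have tI := ((tL.const_mul (D.ε / I)).add ((continuous_conj.tendsto 0).comp tS)).sub tS
  have := tI.const_mul (μ - conj μ)⁻¹
  rw [ofReal_zero]
  simp only [map_zero, mul_zero, sub_zero, add_zero] at this
  refine this.congr fun R => ?_
  have key := ode_integral hw hw R
  have := D.εc_ne
  simp only [Function.comp]
  rw [key]
  field_simp
  ring

theorem GlobalSol.eq_zero_of_im_ne_zero (hw : D.GlobalSol μ 0 φ w) (hd : Tendsto w atInf (𝓝 0))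
    (hμ : μ.im ≠ 0) : φ = 0 := hw.eq_zero_of_eqOn (hw.eqOn_zero_of_im_ne_zero hd hμ)

/-- For real spectral parameters, the integral of a decaying solution. -/
theorem GlobalSol.tendsto_integral (hw : D.GlobalSol μ 0 φ w) (hd : Tendsto w atInf (𝓝 0))
    (hμ : μ ≠ 0) : Tendsto (fun R : ℝ => ∫ t in (-R)..R, w t) atTop
      (𝓝 (-I * Real.pi * ((∑ p, φ p) / μ))) := by
  obtain ⟨t1, t2⟩ := tendsto_real hd
  have hdw : DifferentiableOn ℂ (deriv w) D.dom := hw.diff.deriv D.isOpen_dom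
  -- By the equation, `w + (iε/μ) w'` equals the source minus `u w`, divided by `μ`. Its tail is `(∑
  -- φₚ)/(μx)`, while the derivative integrates to boundary values that vanish.
  have hA : Tendsto (fun R : ℝ => ∫ t in (-R)..R, (w t + (I * D.ε / μ) * deriv w t)) atTop
      (𝓝 (-I * Real.pi * ((∑ p, φ p) / μ))) := by
    refine tendsto_integral_of_upper_tendsto (g := fun x => w x + (I * D.ε / μ) * deriv w x)
      countable_empty ?_ ?_ ?_
    · exact hw.continuousOn.add (continuousOn_const.mul
        (hdw.continuousOn.mono D.closedUpper_subset_dom))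
    · intro x hx
      exact (hw.differentiableAt (upper_subset_dom hx.1)).add
        ((hdw.differentiableAt (D.isOpen_dom.mem_nhds (upper_subset_dom hx.1))).const_mul _)
    · have l1 : Tendsto (fun x => x * ∑ p, φ p / (x - D.z p)) atInf (𝓝 (∑ p, φ p)) :=
        (tendsto_mul_sum_div _ _).mono_left inf_le_left
      have l2 := ((l1.sub (D.tendsto_mul_u.mul hd)).div_const μ)
      simp only [mul_zero, sub_zero] at l2
      refine l2.congr' (eventually_atInf (X := D.X₀) fun x hx hX => ?_)
      beta_reduce
      rw [(hw.solves x (D.closedUpper_subset_dom hx)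
        (D.ne_pole_of_mem_Gd (D.mem_Gd_of_X₀_le hx hX))).deriv, src]
      have := D.εc_ne
      field_simp
      linear_combination (-x * (μ * w x + D.u x * w x - ∑ p, φ p / (x - D.z p))) * I_sq
  have hB := (t1.sub t2).const_mul (I * D.ε / μ)
  have := hA.sub hB
  simp only [sub_zero, mul_zero] at this
  refine this.congr fun R => ?_
  have cd : Continuous fun t : ℝ => deriv w t := Datum.continuous_real fun t =>
    (hdw.differentiableAt (D.isOpen_dom.mem_nhds (real_mem_dom t))).continuousAt
  have e : ∫ t in (-R)..R, deriv w t = w R - w (-R) := by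
    have := intervalIntegral.integral_eq_sub_of_hasDerivAt (a := -R) (b := R)
      (f := fun t : ℝ => w t) (f' := fun t : ℝ => deriv w t)
      (fun t _ => (hw.differentiableAt (real_mem_dom t)).hasDerivAt.comp_ofReal)
      (cd.intervalIntegrable _ _)
    rw [this, ofReal_neg]
  rw [intervalIntegral.integral_add (hw.continuous_real.intervalIntegrable _ _)
    ((cd.const_mul _).intervalIntegrable _ _), intervalIntegral.integral_const_mul, e]
  ring

/-- The square-norm of a decaying solution for real spectral parameters. -/
theorem GlobalSol.tendsto_norm_sq {lam : ℝ} (hw : D.GlobalSol lam 0 φ w) (hd : Dec w)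
    (hμ : lam ≠ 0) : Tendsto (fun R : ℝ => ∫ t in (-R)..R, w t * conj (w t)) atTop
      (𝓝 ((-(2 * Real.pi * ‖∑ p, φ p‖ ^ 2 / (D.ε * lam)) : ℝ) : ℂ)) := by
  have hμ' : (lam : ℂ) ≠ 0 := by exact_mod_cast hμ
  have hd0 := hd.tendsto
  have tI := hw.tendsto_integral hd0 hμ'
  have tS' := tendsto_integral_Sbar hw (fun p => D.z p * φ p) hd0
  rw [mul_zero, mul_zero] at tS'
  have cw := hw.continuous_real
  have cS := continuous_Sbar_real (D := D) φ
  have cS' := continuous_Sbar_real (D := D) (fun p => D.z p * φ p)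
  -- Division with remainder: `t` times the conjugated source is a constant plus a source with
  -- coefficients `zₚ φₚ`. The constant meets the known integral of `w`.
  have exS : ∀ t : ℝ, t * D.Sbar φ t = conj (∑ p, φ p) + D.Sbar (fun p => D.z p * φ p) t := by
    intro t
    simp only [Sbar, map_sum, map_mul, Finset.mul_sum, ← Finset.sum_add_distrib]
    refine Finset.sum_congr rfl fun p _ => ?_
    have := D.ne_conj_pole (real_mem_dom t) p
    field_simp
    ring
  have tQ : Tendsto (fun R : ℝ => ∫ t in (-R)..R, t * D.Sbar φ t * w t) atTop
      (𝓝 (conj (∑ p, φ p) * (-I * Real.pi * ((∑ p, φ p) / lam)))) := by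
    have := (tI.const_mul (conj (∑ p, φ p))).add tS'
    rw [add_zero] at this
    refine this.congr fun R => ?_
    have d1 : Continuous fun t : ℝ => conj (∑ p, φ p) * w t := continuous_const.mul cw
    have d2 : Continuous fun t : ℝ => D.Sbar (fun p => D.z p * φ p) t * w t := cS'.mul cw
    rw [← intervalIntegral.integral_const_mul, ← intervalIntegral.integral_add
      (d1.intervalIntegrable _ _) (d2.intervalIntegrable _ _)]
    refine intervalIntegral.integral_congr fun t _ => ?_
    rw [exS]; ring
  -- For a real spectral parameter `∫|w|²` drops out of the plain identity. Multiplication by `t`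
  -- before integrating brings it back, as in a virial identity.
  have hder : ∀ t : ℝ, HasDerivAt (fun t : ℝ => t * (w t * conj (w t)))
      (w t * conj (w t) + (I / D.ε) * (t * D.Sbar φ t * w t - conj (t * D.Sbar φ t * w t))) t := by
    intro t
    have := (ofRealCLM.hasDerivAt (x := t)).mul (hasDerivAt_mul_conj hw hw t)
    refine this.congr_deriv ?_
    simp
    ring
  have hint : ∀ R : ℝ, R * (w R * conj (w R)) - (-R) * (w (-R) * conj (w (-R)))
      = (∫ t in (-R)..R, w t * conj (w t)) + (I / D.ε) * ((∫ t in (-R)..R, t * D.Sbar φ t * w t)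
        - conj (∫ t in (-R)..R, t * D.Sbar φ t * w t)) := by
    intro R
    have c1 : Continuous fun t : ℝ => w t * conj (w t) := cw.mul (continuous_conj.comp cw)
    have c2 : Continuous fun t : ℝ => t * D.Sbar φ t * w t := (continuous_ofReal.mul cS).mul cw
    have c3 : Continuous fun t : ℝ => conj (t * D.Sbar φ t * w t) := continuous_conj.comp c2
    have d1 : Continuous fun t : ℝ => (I / D.ε) * (t * D.Sbar φ t * w t - conj (t * D.Sbar φ t * w t)) :=
      continuous_const.mul (c2.sub c3)
    have key := intervalIntegral.integral_eq_sub_of_hasDerivAt (a := -R) (b := R)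
      (fun t _ => hder t) ((c1.add d1).intervalIntegrable _ _)
    rw [ofReal_neg] at key
    have e : ∀ g : ℝ → ℂ, ∫ t in (-R)..R, conj (g t) = conj (∫ t in (-R)..R, g t) := by
      intro g
      simp only [intervalIntegral, map_sub, integral_conj]
    rw [← key, intervalIntegral.integral_add (c1.intervalIntegrable _ _)
      (d1.intervalIntegrable _ _), intervalIntegral.integral_const_mul,
      intervalIntegral.integral_sub (c2.intervalIntegrable _ _) (c3.intervalIntegrable _ _), e]
  have hbd : Tendsto (fun x => x * w x * conj (w x)) atInf (𝓝 0) := by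
    obtain ⟨X, C, hC⟩ := hd
    refine tendsto_zero_of_bound (X := X) (C := |C| * |C|) fun x hx hX => ?_
    have h1 := hC x hx hX
    have h3 : ‖w x‖ ≤ |C| / (1 + ‖x‖) := h1.trans (by gcongr; exact le_abs_self C)
    have h4 : ‖x‖ * ‖w x‖ ≤ |C| := by
      calc ‖x‖ * ‖w x‖ ≤ (1 + ‖x‖) * (|C| / (1 + ‖x‖)) := by gcongr; linarith
        _ = |C| := by field_simp
    rw [norm_mul, norm_mul, RCLike.norm_conj, mul_div_assoc]
    gcongr
  have hb1 := hbd.comp tendsto_ofReal_atInf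
  have hb2 := hbd.comp tendsto_neg_ofReal_atInf
  have hfin := (hb1.sub hb2).sub ((tQ.sub ((continuous_conj.tendsto _).comp tQ)).const_mul (I / D.ε))
  have hval : (0:ℂ) - 0 - I / D.ε * (conj (∑ p, φ p) * (-I * Real.pi * ((∑ p, φ p) / lam))
      - conj (conj (∑ p, φ p) * (-I * Real.pi * ((∑ p, φ p) / lam))))
      = ((-(2 * Real.pi * ‖∑ p, φ p‖ ^ 2 / (D.ε * lam)) : ℝ) : ℂ) := by
    have e : (∑ p, φ p) * conj (∑ p, φ p) = ((‖∑ p, φ p‖ ^ 2 : ℝ) : ℂ) := by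
      rw [mul_conj, normSq_eq_norm_sq]
    have := D.εc_ne
    push_cast at e ⊢
    rw [mul_comm (2 * (Real.pi:ℂ)), ← e]
    simp only [map_mul, map_div₀, conj_conj, map_neg, conj_I, conj_ofReal]
    field_simp
    linear_combination (2 * Real.pi * (∑ p, φ p) * conj (∑ p, φ p)) * I_sq
  rw [hval] at hfin
  refine hfin.congr fun R => ?_
  have := hint R
  simp only [Function.comp]
  linear_combination this

/-- For `λ > 0` the norm identity equates `∫|w|²` with a number that is not positive. -/
theorem GlobalSol.eq_zero_of_pos {lam : ℝ} (hw : D.GlobalSol lam 0 φ w) (hd : Dec w)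
    (hμ : 0 < lam) : φ = 0 := by
  refine hw.eq_zero_of_eqOn <| hw.eqOn_zero_of_tendsto ?_ (hw.tendsto_norm_sq hd hμ.ne')
  have := D.hε
  rw [neg_nonpos]
  positivity

/-- The norm identity depends on `φ` only through its sum. Applied to null vectors it shows that
eigenvalues are simple. -/
theorem GlobalSol.eq_zero_of_sum {lam : ℝ} (hw : D.GlobalSol lam 0 φ w) (hd : Dec w)
    (hμ : lam ≠ 0) (hs : ∑ p, φ p = 0) : φ = 0 := by
  refine hw.eq_zero_of_eqOn <| hw.eqOn_zero_of_tendsto (r := 0) le_rfl ?_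
  have := hw.tendsto_norm_sq hd hμ
  simpa [hs] using this

/-- There is no solution with limit one at an eigenvalue. -/
theorem GlobalSol.not_one {lam : ℝ} (hw : D.GlobalSol lam 1 φ w) (hd : Tendsto w atInf (𝓝 1))
    (hv : D.GlobalSol lam 0 ψ v) (hvd : Tendsto v atInf (𝓝 0)) (hμ : lam ≠ 0) : ∑ p, ψ p = 0 := by
  have hμ' : (lam : ℂ) ≠ 0 := by exact_mod_cast hμ
  obtain ⟨t1, t2⟩ := tendsto_real hd
  obtain ⟨s1, s2⟩ := tendsto_real hvd
  have hL := (t1.mul ((continuous_conj.tendsto 0).comp s1)).sub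
    (t2.mul ((continuous_conj.tendsto 0).comp s2))
  have h1 := hv.tendsto_integral hvd hμ'
  have h2 := tendsto_integral_Sbar hv φ hvd
  have h3 := tendsto_integral_Sbar hw ψ hd
  -- The integral of `v` and the source of `v` contribute the same multiple of `conj (∑ ψₚ)`; they
  -- add up instead of cancelling.
  have h4 := ((((continuous_conj.tendsto _).comp h1).const_mul (lam:ℂ)).add
    ((continuous_conj.tendsto _).comp h2)).neg.add h3
  have h5 := h4.const_mul (I / (D.ε:ℂ))
  have e := tendsto_nhds_unique hL (h5.congr fun R => by
    have := ode_integral hw hv R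
    simp only [Function.comp]
    rw [this, conj_ofReal]
    ring)
  have := D.εc_ne
  have hpi : (Real.pi : ℂ) ≠ 0 := by exact_mod_cast Real.pi_ne_zero
  simp only [map_mul, map_zero, mul_zero, sub_zero, map_neg, conj_I, conj_ofReal, map_div₀] at e
  field_simp at e
  have e2 : conj (∑ p, ψ p) = 0 := by
    have h6 : (2 * Real.pi) * conj (∑ p, ψ p) = 0 := by
      simp only [map_sum] at e ⊢
      linear_combination -e + (2 * Real.pi * ∑ p, conj (ψ p)) * I_sq
    exact (mul_eq_zero.mp h6).resolve_left (by simp [hpi])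
  simpa using congrArg conj e2

end Datum
end BOScattering
end

/-! ### Triviality of the kernel off the negative half-line -/

noncomputable section
namespace BOScattering
namespace Datum
variable {P : ℕ} (D : Datum P)

theorem isPreconnected_Gd : IsPreconnected D.Gd := by
  refine isPreconnected_of_up (H := D.H) ?_ fun x hx t ht => D.add_mem_Gd hx ht
  have : D.Gd ∩ {x | D.H < x.im} = {x | D.H < x.im} := by
    ext x
    exact ⟨fun h => h.2, fun h => ⟨(D.high_of_H_le (le_of_lt h)).1, h⟩⟩
  rw [this]
  exact convex_halfSpace_im_gt _

variable {D} {d μ w₀ : ℂ} {φ : Fin P → ℂ} {w : ℂ → ℂ}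

theorem ne_zero_of_strict (hμ : (μ * d).im < 0) : μ ≠ 0 := by rintro rfl; simp at hμ

theorem tendsto_wsol (hd : IsDir d) (hμ : (μ * d).im < 0)
    (he : EqOn w (D.wsol d μ w₀ φ) D.Gd) : Tendsto w atInf (𝓝 w₀) := by
  obtain ⟨C, hC, h⟩ := D.exists_wsol_bound_strict hd hμ w₀ φ
  obtain ⟨C', hC', h'⟩ := D.exists_sum_inv_bound φ
  have : Tendsto (fun x => w x - w₀) atInf (𝓝 0) := by
    refine tendsto_zero_of_bound (X := D.X₀) (C := C + ‖μ⁻¹‖ * C') fun x hx hX => ?_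
    rw [he (D.mem_Gd_of_X₀_le hx hX)]
    have e : D.wsol d μ w₀ φ x - w₀ = (D.wsol d μ w₀ φ x - w₀ - μ⁻¹ * ∑ p, φ p * (x - D.z p)⁻¹)
      + μ⁻¹ * ∑ p, φ p * (x - D.z p)⁻¹ := by ring
    rw [e]
    refine (norm_add_le _ _).trans ?_
    rw [add_div, norm_mul, mul_div_assoc]
    refine add_le_add ((h x hx hX).trans ?_) (by gcongr; exact h' x hX)
    gcongr
    nlinarith [norm_nonneg x]
  simpa using this.add_const w₀

theorem dec_wsol (hd : IsDir d) (hμ : (μ * d).im < 0)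
    (he : EqOn w (D.wsol d μ 0 φ) D.Gd) : Dec w := by
  obtain ⟨C, hC, h⟩ := D.exists_wsol_bound_strict hd hμ 0 φ
  obtain ⟨C', hC', h'⟩ := D.exists_sum_inv_bound φ
  refine ⟨D.X₀, C + ‖μ⁻¹‖ * C', fun x hx hX => ?_⟩
  rw [he (D.mem_Gd_of_X₀_le hx hX)]
  have e : D.wsol d μ 0 φ x = (D.wsol d μ 0 φ x - 0 - μ⁻¹ * ∑ p, φ p * (x - D.z p)⁻¹)
    + μ⁻¹ * ∑ p, φ p * (x - D.z p)⁻¹ := by ring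
  rw [e]
  refine (norm_add_le _ _).trans ?_
  rw [add_div, norm_mul, mul_div_assoc]
  refine add_le_add ((h x hx hX).trans ?_) (by gcongr; exact h' x hX)
  gcongr
  nlinarith [norm_nonneg x]

theorem tendsto_mul_wsol (hd : IsDir d) (hμ : (μ * d).im < 0)
    (he : EqOn w (D.wsol d μ 0 φ) D.Gd) :
    Tendsto (fun x => x * w x) atInf (𝓝 ((∑ p, φ p) / μ)) := by
  obtain ⟨C, hC, h⟩ := D.exists_wsol_bound_strict hd hμ 0 φ
  have h1 : Tendsto (fun x => x * (w x - μ⁻¹ * ∑ p, φ p * (x - D.z p)⁻¹)) atInf (𝓝 0) := by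
    refine tendsto_zero_of_bound (X := D.X₀) (C := C) fun x hx hX => ?_
    rw [he (D.mem_Gd_of_X₀_le hx hX), norm_mul]
    have := h x hx hX
    rw [sub_zero] at this
    calc _ ≤ (1 + ‖x‖) * (C / (1 + ‖x‖) ^ 2) := by gcongr; linarith
      _ = C / (1 + ‖x‖) := by field_simp
  have h2 : Tendsto (fun x => x * ∑ p, φ p / (x - D.z p)) atInf (𝓝 (∑ p, φ p)) :=
    (tendsto_mul_sum_div _ _).mono_left inf_le_left
  have := h1.add (h2.const_mul μ⁻¹)
  rw [zero_add, mul_comm, ← div_eq_mul_inv] at this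
  refine this.congr fun x => ?_
  simp only [div_eq_mul_inv]
  ring

theorem row_eq_zero_of_mulVec (h : D.Mat d μ *ᵥ φ = w₀ • D.vec d μ) (m : Fin P) :
    D.row d μ w₀ φ m = 0 := by
  rw [D.row_eq, h]; simp

theorem exists_globalSol_of_mulVec (hd : IsDir d) (hμ : (μ * d).im ≤ 0) (hμ0 : μ ≠ 0)
    (h : D.Mat d μ *ᵥ φ = w₀ • D.vec d μ) :
    ∃ w, D.GlobalSol μ w₀ φ w ∧ EqOn w (D.wsol d μ w₀ φ) D.Gd :=
  D.exists_globalSol hd hμ hμ0 (row_eq_zero_of_mulVec h)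

theorem ker_eq_zero_of_im_ne_zero (hd : IsDir d) (hμ : (μ * d).im < 0) (him : μ.im ≠ 0)
    (h : D.Mat d μ *ᵥ φ = 0) : φ = 0 := by
  obtain ⟨w, hw, he⟩ := exists_globalSol_of_mulVec (w₀ := 0) hd hμ.le (ne_zero_of_strict hμ)
    (by rw [h, zero_smul])
  exact hw.eq_zero_of_im_ne_zero (tendsto_wsol hd hμ he) him

/-! ### Positive spectral parameters -/

/-- For real parameters both horizontal directions are admissible, and the two solutions satisfy the
same equation on a connected set. The constant `C₀` measures the oscillating part at `+∞` of the
solution normalized at `-∞`. -/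
theorem exists_wsol_neg_one_eq {lam : ℝ} (hl : lam ≠ 0) (w₀ : ℂ) (φ : Fin P → ℂ) : ∃ C₀ : ℂ,
    ∀ x ∈ D.Gd, D.wsol (-1) lam w₀ φ x = D.wsol 1 lam w₀ φ x + C₀ * (D.fac D.Ld lam x)⁻¹ := by
  have hl' : (lam : ℂ) ≠ 0 := by exact_mod_cast hl
  have h0 : ∀ x ∈ D.Gd, HasDerivAt (fun x => D.fac D.Ld lam x *
      (D.wsol (-1) lam w₀ φ x - D.wsol 1 lam w₀ φ x)) 0 x := fun x hx =>
    D.hasDerivAt_fac_mul_sub (D.hasDerivAt_Ld hx)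
      (D.solvesAt_wsol (Or.inr (Or.inr rfl)) (by simp) hl' w₀ φ hx)
      (D.solvesAt_wsol (Or.inr (Or.inl rfl)) (by simp) hl' w₀ φ hx)
  refine ⟨D.fac D.Ld lam (D.a 0) * (D.wsol (-1) lam w₀ φ (D.a 0) - D.wsol 1 lam w₀ φ (D.a 0)),
    fun x hx => ?_⟩
  have := eqOn_of_hasDerivAt_zero D.isOpen_Gd D.isPreconnected_Gd h0 hx (D.a_mem_Gd 0)
  rw [← this]
  have := D.fac_ne_zero D.Ld lam x
  field_simp
  ring

/-- The behaviour at infinity of the solutions for positive spectral parameters. -/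
theorem exists_wsol_neg_one_bound {lam : ℝ} (hl : 0 < lam) (w₀ : ℂ) (φ : Fin P → ℂ) :
    ∃ (C C₁ : ℝ) (C₀ : ℂ), 0 ≤ C ∧ 0 ≤ C₁ ∧
      (∀ x ∈ closedUpper, D.X₀ ≤ ‖x‖ → x.re ≤ 0 → ‖D.wsol (-1) lam w₀ φ x - w₀‖ ≤ C / (1 + ‖x‖)) ∧
      (∀ x ∈ closedUpper, D.X₀ ≤ ‖x‖ → 0 ≤ x.re →
        ‖D.wsol (-1) lam w₀ φ x - w₀ - C₀ * (D.fac D.Ld lam x)⁻¹‖ ≤ C / (1 + ‖x‖)) ∧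
      (∀ x ∈ closedUpper, D.X₀ ≤ ‖x‖ → ‖(D.fac D.Ld lam x)⁻¹‖ ≤ C₁ * Real.exp (-(lam / D.ε) * x.im) ∧
        1 ≤ C₁ * (‖(D.fac D.Ld lam x)⁻¹‖ * Real.exp (lam / D.ε * x.im))) := by
  obtain ⟨B₁, hB₁, h₁⟩ := D.exists_wsol_bound_outward (d := -1) (μ := lam) (Or.inr rfl) (by simp) w₀ φ
  obtain ⟨B₂, hB₂, h₂⟩ := D.exists_wsol_bound_outward (d := 1) (μ := lam) (Or.inl rfl) (by simp) w₀ φ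
  obtain ⟨B₃, hB₃, h₃⟩ := D.exists_sum_inv_bound φ
  obtain ⟨C₀, hC₀⟩ := D.exists_wsol_neg_one_eq hl.ne' w₀ φ
  obtain ⟨L, hL⟩ := D.exists_bound_Ld one_pos
  have hsum : ∀ (d x : ℂ) (B : ℝ), D.X₀ ≤ ‖x‖ →
      ‖D.wsol d lam w₀ φ x - w₀ - (lam:ℂ)⁻¹ * ∑ p, φ p * (x - D.z p)⁻¹‖ ≤ B / (1 + ‖x‖) →
      B ≤ B₁ + B₂ → ‖D.wsol d lam w₀ φ x - w₀‖ ≤ (B₁ + B₂ + ‖(lam:ℂ)⁻¹‖ * B₃) / (1 + ‖x‖) := by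
    intro d x B hX h hB
    have e : D.wsol d lam w₀ φ x - w₀ = (D.wsol d lam w₀ φ x - w₀
      - (lam:ℂ)⁻¹ * ∑ p, φ p * (x - D.z p)⁻¹) + (lam:ℂ)⁻¹ * ∑ p, φ p * (x - D.z p)⁻¹ := by ring
    rw [e]
    refine (norm_add_le _ _).trans ?_
    rw [add_div, norm_mul, mul_div_assoc]
    exact add_le_add (h.trans (by gcongr)) (by gcongr; exact h₃ x hX)
  refine ⟨B₁ + B₂ + ‖(lam:ℂ)⁻¹‖ * B₃, Real.exp (L / D.ε), C₀, by positivity, by positivity, ?_, ?_, ?_⟩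
  · intro x hx hX hre
    exact hsum _ _ B₁ hX (h₁ x hx hX (by simpa using hre)) (by linarith)
  · intro x hx hX hre
    rw [hC₀ x (D.mem_Gd_of_X₀_le hx hX)]
    have := hsum _ _ B₂ hX (h₂ x hx hX (by simpa using hre)) (by linarith)
    refine le_trans (le_of_eq ?_) this
    congr 1; ring
  · intro x hx hX
    have hb := hL x (D.closedUpper_subset_dom hx) (D.one_le_of_X₀_le hX)
    have e1 := D.norm_fac_le hb lam
    have e2 := D.le_norm_fac hb lam
    have him : ((lam : ℂ) * x).im / D.ε = lam / D.ε * x.im := by rw [im_ofReal_mul]; ring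
    rw [him] at e1 e2
    have hpos : 0 < ‖D.fac D.Ld lam x‖ := norm_pos_iff.mpr (D.fac_ne_zero _ _ _)
    rw [norm_inv]
    constructor
    · refine (inv_anti₀ (by positivity) e2).trans (le_of_eq ?_)
      rw [mul_inv, ← Real.exp_neg, neg_neg, ← Real.exp_neg, neg_mul]
    · rw [← mul_assoc, mul_comm (Real.exp _), mul_assoc, ← div_eq_inv_mul, le_div_iff₀ hpos, one_mul]
      exact e1

theorem exists_div_le {C : ℝ} : ∀ δ > 0, ∃ X : ℝ, ∀ z : ℂ, X ≤ ‖z‖ → C / (1 + ‖z‖) ≤ δ := by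
  intro δ hδ
  refine ⟨|C| / δ, fun z hz => ?_⟩
  rw [div_le_iff₀ (by positivity)]
  rw [div_le_iff₀ hδ] at hz
  nlinarith [le_abs_self C, norm_nonneg z]

/-- For `Re x ≤ 0` the solution is `O(1/‖x‖)`, and for `Re x ≥ 0` it is `O(1/‖x‖)` plus `C₀` times a
plane wave. Conservation of flux shows that `|w|` tends to zero at `+∞`, which forces `C₀ = 0`. -/
theorem dec_of_pos {lam : ℝ} (hl : 0 < lam) (hw : D.GlobalSol lam 0 φ w)
    (he : EqOn w (D.wsol (-1) lam 0 φ) D.Gd) : Dec w := by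
  obtain ⟨C, C₁, C₀, hC, hC₁, h1, h2, h3⟩ := D.exists_wsol_neg_one_bound hl 0 φ
  simp only [sub_zero] at h1 h2
  have hε := D.hε
  have heq : ∀ x ∈ closedUpper, D.X₀ ≤ ‖x‖ → w x = D.wsol (-1) lam 0 φ x := fun x hx hX =>
    he (D.mem_Gd_of_X₀_le hx hX)
  have hbd : ∀ x ∈ closedUpper, D.X₀ ≤ ‖x‖ →
      ‖w x‖ ≤ C / (1 + ‖x‖) + ‖C₀‖ * C₁ * Real.exp (-(lam / D.ε) * x.im) := by
    intro x hx hX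
    rw [heq x hx hX]
    rcases le_total x.re 0 with h | h
    · exact (h1 x hx hX h).trans (by simp; positivity)
    · have e : D.wsol (-1) lam 0 φ x = (D.wsol (-1) lam 0 φ x - C₀ * (D.fac D.Ld lam x)⁻¹)
        + C₀ * (D.fac D.Ld lam x)⁻¹ := by ring
      rw [e]
      refine (norm_add_le _ _).trans (add_le_add (h2 x hx hX h) ?_)
      rw [norm_mul, mul_assoc]
      gcongr
      exact (h3 x hx hX).1
  have hSb : ∃ K : ℝ, 0 ≤ K ∧ ∀ x ∈ closedUpper, ‖x‖ * ‖D.Sbar φ x‖ ≤ K := by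
    refine ⟨∑ p, ‖φ p‖ * (1 + (1 + ‖conj (D.z p)‖) / D.b), by have := D.b_pos; positivity, fun x hx => ?_⟩
    have hx' := D.closedUpper_subset_dom hx
    calc ‖x‖ * ‖D.Sbar φ x‖ ≤ (1 + ‖x‖) * ∑ p, ‖conj (φ p) / (x - conj (D.z p))‖ := by
          gcongr
          · linarith
          · exact norm_sum_le _ _
      _ ≤ (1 + ‖x‖) * ∑ p, ‖φ p‖ * ((1 + (1 + ‖conj (D.z p)‖) / D.b) / (1 + ‖x‖)) := by
          gcongr with p
          rw [div_eq_mul_inv, norm_mul, RCLike.norm_conj]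
          gcongr
          exact norm_inv_sub_le D.b_pos (D.b_le_norm_sub_conj hx' p)
      _ = _ := by
          rw [Finset.mul_sum]
          refine Finset.sum_congr rfl fun p _ => ?_
          field_simp
  obtain ⟨K, hK, hKb⟩ := hSb
  -- The plane wave decays exponentially in `Im x`, so the version of Jordan's lemma with an
  -- exponential term applies before `C₀ = 0` is known.
  have tQ : Tendsto (fun R : ℝ => ∫ t in (-R)..R, D.Sbar φ t * w t) atTop (𝓝 0) := by
    refine tendsto_integral_of_upper_decay (g := fun x => D.Sbar φ x * w x) countable_empty ?_ ?_
      (C := K * (‖C₀‖ * C₁)) (k := lam / D.ε) (by positivity) (by positivity) ?_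
    · exact ContinuousOn.mul (fun x hx => (D.differentiableAt_Sbar φ
        (D.closedUpper_subset_dom hx)).continuousAt.continuousWithinAt) hw.continuousOn
    · exact fun x hx => (D.differentiableAt_Sbar φ (upper_subset_dom hx.1)).mul
        (hw.differentiableAt (upper_subset_dom hx.1))
    · intro δ hδ
      obtain ⟨X, hX⟩ := exists_div_le (C := K * C) δ hδ
      refine ⟨max X D.X₀, fun x hx hxX => ?_⟩
      have hX1 := hX x ((le_max_left _ _).trans hxX)
      have hX2 := hbd x hx ((le_max_right _ _).trans hxX)
      calc ‖x‖ * ‖D.Sbar φ x * w x‖ = (‖x‖ * ‖D.Sbar φ x‖) * ‖w x‖ := by rw [norm_mul]; ring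
        _ ≤ K * (C / (1 + ‖x‖) + ‖C₀‖ * C₁ * Real.exp (-(lam / D.ε) * x.im)) := by
            gcongr
            exact hKb x hx
        _ = K * C / (1 + ‖x‖) + K * (‖C₀‖ * C₁) * Real.exp (-(lam / D.ε) * x.im) := by ring
        _ ≤ _ := by gcongr
  have tneg : Tendsto (fun R : ℝ => w (-R)) atTop (𝓝 0) := by
    have hb : Tendsto (fun R : ℝ => C / (1 + R)) atTop (𝓝 0) :=
      (tendsto_atTop_add_const_left _ 1 tendsto_id).const_div_atTop C
    refine squeeze_zero_norm' ?_ hb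
    filter_upwards [eventually_ge_atTop D.X₀] with R hR
    have hR0 : 0 ≤ R := D.X₀_pos.le.trans hR
    have hm : (-R : ℂ) ∈ closedUpper := by simp [closedUpper]
    have hn : ‖(-R : ℂ)‖ = R := by rw [norm_neg, norm_real, Real.norm_of_nonneg hR0]
    have := h1 (-R) hm (by rw [hn]; exact hR) (by simpa using hR0)
    rw [heq _ hm (by rw [hn]; exact hR)]
    rwa [hn] at this
  -- With equal real parameters the term with `∫|w|²` is absent, so `|w R|² - |w (-R)|²` is given by
  -- the source integrals alone.
  have tpos : Tendsto (fun R : ℝ => w R * conj (w R)) atTop (𝓝 0) := by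
    have t1 := (tQ.sub ((continuous_conj.tendsto _).comp tQ)).const_mul (I / (D.ε:ℂ))
    have t2 := t1.add (tneg.mul ((continuous_conj.tendsto _).comp tneg))
    simp only [map_zero, sub_zero, mul_zero, add_zero] at t2
    refine t2.congr fun R => ?_
    have := ode_integral hw hw R
    simp only [Function.comp]
    rw [conj_ofReal] at this
    linear_combination -this
  have tpos' : Tendsto (fun R : ℝ => ‖w R‖) atTop (𝓝 0) := by
    have h := tpos.norm
    simp only [norm_mul, RCLike.norm_conj, norm_zero, ← sq] at h
    have h4 := h.sqrt
    simpa [Real.sqrt_sq (norm_nonneg _)] using h4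
  -- On the real line the plane wave has modulus bounded below, so a nonzero `C₀` would contradict
  -- `tpos'`.
  have hzero : C₀ = 0 := by
    have hb : Tendsto (fun R : ℝ => C₁ * (C / (1 + R) + ‖w R‖)) atTop (𝓝 0) := by
      have hb : Tendsto (fun R : ℝ => C / (1 + R)) atTop (𝓝 0) :=
        (tendsto_atTop_add_const_left _ 1 tendsto_id).const_div_atTop C
      simpa using (hb.add tpos').const_mul C₁
    have hle : ‖C₀‖ ≤ 0 := by
      refine ge_of_tendsto hb ?_
      filter_upwards [eventually_ge_atTop D.X₀] with R hR
      have hR0 : 0 ≤ R := D.X₀_pos.le.trans hR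
      have hm := ofReal_mem_closedUpper R
      have hn : ‖(R : ℂ)‖ = R := by rw [norm_real, Real.norm_of_nonneg hR0]
      have g2 := h2 R hm (by rw [hn]; exact hR) (by simpa using hR0)
      have g3 := (h3 R hm (by rw [hn]; exact hR)).2
      rw [← heq _ hm (by rw [hn]; exact hR), hn] at g2
      simp only [ofReal_im, mul_zero, Real.exp_zero, mul_one] at g3
      have g4 : ‖C₀‖ * ‖(D.fac D.Ld lam R)⁻¹‖ ≤ C / (1 + R) + ‖w R‖ := by
        rw [← norm_mul]
        have := norm_sub_le (w R) (w R - C₀ * (D.fac D.Ld lam R)⁻¹)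
        rw [sub_sub_cancel] at this
        linarith
      calc ‖C₀‖ ≤ ‖C₀‖ * (C₁ * ‖(D.fac D.Ld lam R)⁻¹‖) := le_mul_of_one_le_right (norm_nonneg _) g3
        _ = C₁ * (‖C₀‖ * ‖(D.fac D.Ld lam R)⁻¹‖) := by ring
        _ ≤ _ := by gcongr
    exact norm_le_zero_iff.mp hle
  refine ⟨D.X₀, C, fun x hx hX => ?_⟩
  have := hbd x hx hX
  simpa [hzero] using this

theorem ker_eq_zero_of_pos {lam : ℝ} (hl : 0 < lam) (h : D.Mat (-1) lam *ᵥ φ = 0) : φ = 0 := by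
  have hl' : (lam : ℂ) ≠ 0 := by exact_mod_cast hl.ne'
  obtain ⟨w, hw, he⟩ := exists_globalSol_of_mulVec (w₀ := 0) (d := -1) (μ := lam)
    (Or.inr (Or.inr rfl)) (by simp) hl' (by rw [h, zero_smul])
  exact hw.eq_zero_of_pos (dec_of_pos hl hw he) hl

theorem det_ne_zero_of_ker {A : Matrix (Fin P) (Fin P) ℂ} (h : ∀ φ, A *ᵥ φ = 0 → φ = 0) :
    A.det ≠ 0 := fun h0 => by
  obtain ⟨v, hv, hv0⟩ := Matrix.exists_mulVec_eq_zero_iff.mpr h0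
  exact hv (h v hv0)

end Datum
end BOScattering
end

/-! ### Functions with tame mean squares and their contour integrals -/

noncomputable section
namespace BOScattering

/-- Analytic functions in the upper half-plane whose mean squares grow at most linearly. -/
structure Tame (w : ℂ → ℂ) : Prop where
  cont : ContinuousOn w closedUpper
  diff : DifferentiableOn ℂ w upper
  bound : ∃ C : ℝ, 0 ≤ C ∧ ∀ y N : ℝ, 0 ≤ y → 1 ≤ N →
    ∫⁻ x : ℝ in Icc (-(2 * N)) (2 * N), ‖w (x + y * I)‖ₑ ^ 2 ≤ ENNReal.ofReal (C * N)

theorem isOpen_upper : IsOpen upper := isOpen_lt continuous_const continuous_im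

theorem closedUpper_mem_nhds {ζ : ℂ} (hζ : ζ ∈ upper) : closedUpper ∈ 𝓝 ζ :=
  mem_of_superset (isOpen_upper.mem_nhds hζ) upper_subset_closedUpper

theorem add_mul_I_mem_closedUpper (x : ℝ) {y : ℝ} (hy : 0 ≤ y) : (x : ℂ) + y * I ∈ closedUpper := by
  simpa [closedUpper] using hy

theorem MemHardy.tame {w : ℂ → ℂ} (h : MemHardy w) : Tame w := by
  obtain ⟨C, hC⟩ := h.bounded
  refine ⟨h.continuousOn, h.differentiableOn, C, C.2, fun y N hy hN => ?_⟩
  refine (setLIntegral_le_lintegral _ _).trans ((hC y hy).trans ?_)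
  rw [← ENNReal.ofReal_coe_nnreal]
  exact ENNReal.ofReal_le_ofReal (le_mul_of_one_le_right C.2 hN)

theorem tame_of_bounded {w : ℂ → ℂ} (hc : ContinuousOn w closedUpper) (hd : DifferentiableOn ℂ w upper)
    {C : ℝ} (hC : ∀ x ∈ closedUpper, ‖w x‖ ≤ C) : Tame w := by
  have hC0 : 0 ≤ C := (norm_nonneg _).trans (hC 0 (by simp [closedUpper]))
  refine ⟨hc, hd, 4 * C ^ 2, by positivity, fun y N hy hN => ?_⟩
  have : ∀ x ∈ Icc (-(2 * N)) (2 * N), ‖w ((x:ℝ) + y * I)‖ₑ ^ 2 ≤ ENNReal.ofReal (C ^ 2) := by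
    intro x _
    rw [ENNReal.ofReal_pow hC0, ← ofReal_norm]
    gcongr
    exact hC _ (add_mul_I_mem_closedUpper x hy)
  refine (setLIntegral_mono measurable_const this).trans ?_
  rw [setLIntegral_const, Real.volume_Icc, ← ENNReal.ofReal_mul (by positivity)]
  exact ENNReal.ofReal_le_ofReal (by nlinarith [sq_nonneg C])

/-- By Tonelli's theorem the average over `X` in `(N, 2N]` of the integrals on both vertical sides
is at most `2CN`; some `X` does not exceed the average. Pointwise bounds are not available for
functions of the Hardy space. -/
theorem exists_good_side {w : ℂ → ℂ} (hc : ContinuousOn w closedUpper) {C N : ℝ} (hC : 0 ≤ C)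
    (hN : 1 ≤ N) (hb : ∀ y : ℝ, 0 ≤ y →
      ∫⁻ x : ℝ in Icc (-(2 * N)) (2 * N), ‖w (x + y * I)‖ₑ ^ 2 ≤ ENNReal.ofReal (C * N)) :
    ∃ X ∈ Ioc N (2 * N), ∫⁻ y in Ioc 0 N, ‖w ((X : ℝ) + (y : ℝ) * I)‖ₑ ^ 2 ≤ ENNReal.ofReal (2 * C * N) ∧
      ∫⁻ y in Ioc 0 N, ‖w (((-X : ℝ) : ℂ) + (y : ℝ) * I)‖ₑ ^ 2 ≤ ENNReal.ofReal (2 * C * N) := by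
  have hN0 : 0 < N := by linarith
  -- The maximum with 0 only makes `g` continuous on the whole plane, hence measurable.
  set g : ℝ × ℝ → ENNReal := fun q => ‖w ((q.1 : ℂ) + (max q.2 0 : ℝ) * I)‖ₑ ^ 2
    + ‖w (((-q.1 : ℝ) : ℂ) + (max q.2 0 : ℝ) * I)‖ₑ ^ 2 with hg
  have hcont : ∀ γ : ℝ → ℝ, Continuous γ →
      Continuous fun q : ℝ × ℝ => ‖w ((γ q.1 : ℂ) + (max q.2 0 : ℝ) * I)‖ₑ ^ 2 := by
    intro γ hγ
    have h1 : Continuous fun q : ℝ × ℝ => (γ q.1 : ℂ) + (max q.2 0 : ℝ) * I := by fun_prop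
    have h2 : Continuous fun q : ℝ × ℝ => w ((γ q.1 : ℂ) + (max q.2 0 : ℝ) * I) :=
      hc.comp_continuous h1 fun q => add_mul_I_mem_closedUpper _ (le_max_right _ _)
    exact (ENNReal.continuous_pow 2).comp (continuous_enorm.comp h2)
  have hgc : Continuous g := (hcont id continuous_id).add (hcont (fun x => -x) continuous_neg)
  have hgm : Measurable g := hgc.measurable
  have hvol : volume (Ioc N (2 * N)) = ENNReal.ofReal N := by rw [Real.volume_Ioc]; congr 1; ring
  have htot : ∫⁻ X in Ioc N (2 * N), ∫⁻ y in Ioc 0 N, g (X, y) ≤ ENNReal.ofReal (2 * C * N * N) := by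
    rw [lintegral_lintegral_swap hgm.aemeasurable]
    have hinner : ∀ y ∈ Ioc 0 N, ∫⁻ X in Ioc N (2 * N), g (X, y) ≤ ENNReal.ofReal (2 * C * N) := by
      intro y hy
      have hy0 : max y 0 = y := max_eq_left hy.1.le
      simp only [hg, hy0]
      rw [lintegral_add_left]
      · have hsub : Ioc N (2 * N) ⊆ Icc (-(2 * N)) (2 * N) := fun x hx => ⟨by linarith [hx.1], hx.2⟩
        have e1 := (lintegral_mono_set (μ := volume)
          (f := fun x : ℝ => ‖w ((x:ℂ) + y * I)‖ₑ ^ 2) hsub).trans (hb y hy.1.le)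
        have e2 : ∫⁻ x in Ioc N (2 * N), ‖w (((-x : ℝ) : ℂ) + y * I)‖ₑ ^ 2 ≤ ENNReal.ofReal (C * N) := by
          have hsub' : Ioc N (2 * N) ⊆ Neg.neg ⁻¹' (Icc (-(2 * N)) (2 * N)) := fun x hx => by
            constructor <;> linarith [hx.1, hx.2]
          refine (lintegral_mono_set hsub').trans ?_
          rw [(Measure.measurePreserving_neg (volume : Measure ℝ)).setLIntegral_comp_preimage_emb
            (MeasurableEquiv.neg ℝ).measurableEmbedding (fun x : ℝ => ‖w ((x:ℂ) + y * I)‖ₑ ^ 2)]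
          exact hb y hy.1.le
        refine (add_le_add e1 e2).trans (le_of_eq ?_)
        rw [← ENNReal.ofReal_add (by positivity) (by positivity)]
        congr 1; ring
      · have := (hcont id continuous_id).comp (Continuous.prodMk_left y)
        simp only [Function.comp_def, id, hy0] at this
        exact this.measurable
    refine (setLIntegral_mono measurable_const hinner).trans ?_
    rw [setLIntegral_const, Real.volume_Ioc, sub_zero, ← ENNReal.ofReal_mul (by positivity)]
  have hm : AEMeasurable (fun X => ∫⁻ y in Ioc 0 N, g (X, y)) (volume.restrict (Ioc N (2 * N))) :=
    hgm.lintegral_prod_right'.aemeasurable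
  obtain ⟨X, hX, hle⟩ := exists_le_setLAverage (by rw [hvol]; simpa using hN0)
    (by rw [hvol]; exact ENNReal.ofReal_ne_top) hm
  have hle2 : ∫⁻ y in Ioc 0 N, g (X, y) ≤ ENNReal.ofReal (2 * C * N) := by
    refine hle.trans ?_
    rw [setLAverage_eq, hvol]
    refine (ENNReal.div_le_div_right htot _).trans ?_
    rw [← ENNReal.ofReal_div_of_pos hN0]
    refine ENNReal.ofReal_le_ofReal (le_of_eq ?_)
    field_simp
  have hs : ∀ γ : ℝ, (∀ y ∈ Ioc 0 N, ‖w ((γ : ℂ) + (y : ℝ) * I)‖ₑ ^ 2 ≤ g (X, y)) →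
      ∫⁻ y in Ioc 0 N, ‖w ((γ : ℂ) + (y : ℝ) * I)‖ₑ ^ 2 ≤ ENNReal.ofReal (2 * C * N) := fun γ h =>
    (setLIntegral_mono (hgm.comp measurable_prodMk_left) h).trans hle2
  refine ⟨X, hX, hs X fun y hy => ?_, hs (-X) fun y hy => ?_⟩
  · simp only [hg, max_eq_left hy.1.le]; exact le_self_add
  · simp only [hg, max_eq_left hy.1.le]; exact le_add_self

/-- From `1 + r ≤ 2 + r²`, so that the mean square alone controls the integral. -/
theorem norm_integral_le_of_sq {w g : ℂ → ℂ} {γ : ℝ → ℂ} {s : Set ℝ} (hs : MeasurableSet s)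
    {κ B V : ℝ} (hκ : 0 ≤ κ) (hB : 0 ≤ B) (hV : 0 ≤ V) (hg : ∀ y ∈ s, ‖g (γ y)‖ ≤ κ * (1 + ‖w (γ y)‖))
    (hw : ∫⁻ y in s, ‖w (γ y)‖ₑ ^ 2 ≤ ENNReal.ofReal B) (hvol : volume s ≤ ENNReal.ofReal V) :
    ‖∫ y in s, g (γ y)‖ ≤ κ * (2 * V + B) := by
  have h1 : ‖∫ y in s, g (γ y)‖ₑ ≤ ENNReal.ofReal (κ * (2 * V + B)) := by
    refine (enorm_integral_le_lintegral_enorm _).trans ?_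
    have h2 : ∀ y ∈ s, ‖g (γ y)‖ₑ ≤ ENNReal.ofReal κ * (2 + ‖w (γ y)‖ₑ ^ 2) := by
      intro y hy
      rw [← ofReal_norm, ← ofReal_norm, ← ENNReal.ofReal_pow (norm_nonneg _),
        ← ENNReal.ofReal_ofNat 2, ← ENNReal.ofReal_add (by norm_num) (by positivity),
        ← ENNReal.ofReal_mul hκ]
      refine ENNReal.ofReal_le_ofReal ((hg y hy).trans ?_)
      refine mul_le_mul_of_nonneg_left ?_ hκ
      nlinarith [sq_nonneg (‖w (γ y)‖ - 1), norm_nonneg (w (γ y))]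
    refine (setLIntegral_mono' hs h2).trans ?_
    rw [lintegral_const_mul' _ _ ENNReal.ofReal_ne_top, lintegral_add_left measurable_const,
      setLIntegral_const, ENNReal.ofReal_mul hκ, ENNReal.ofReal_add (by positivity) hB,
      ENNReal.ofReal_mul (by norm_num), ENNReal.ofReal_ofNat]
    gcongr
  rw [← ofReal_norm] at h1
  exact (ENNReal.ofReal_le_ofReal_iff (by positivity)).mp h1

/-- Integrals over suitable symmetric intervals of functions that decay quadratically relative to a
tame function tend to zero. -/
theorem Tame.exists_seq {w g : ℂ → ℂ} (hw : Tame w) (hc : ContinuousOn g closedUpper)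
    (hd : DifferentiableOn ℂ g upper) {A X₀ : ℝ} (hA : 0 ≤ A)
    (hb : ∀ x ∈ closedUpper, X₀ ≤ ‖x‖ → ‖g x‖ ≤ A / ‖x‖ ^ 2 * (1 + ‖w x‖)) :
    ∃ X : ℕ → ℝ, Tendsto X atTop atTop ∧
      Tendsto (fun n => ∫ x in (-(X n))..X n, g x) atTop (𝓝 0) := by
  obtain ⟨C, hC, hwb⟩ := hw.bound
  have hN1 : ∀ n : ℕ, (1:ℝ) ≤ n + 1 := fun n => by
    have : (0:ℝ) ≤ n := n.cast_nonneg
    linarith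
  choose X hX h1 h2 using fun n : ℕ => exists_good_side hw.cont hC (hN1 n)
    fun y hy => hwb y (n + 1) hy (hN1 n)
  have htop : Tendsto (fun n : ℕ => (n : ℝ) + 1) atTop atTop :=
    tendsto_atTop_add_const_right _ _ tendsto_natCast_atTop_atTop
  refine ⟨X, tendsto_atTop_mono (fun n => (hX n).1.le) htop, ?_⟩
  -- The top side contributes `8N + CN` and each vertical side `2N + 2CN`, all multiplied by `A/N²`.
  have hlim : Tendsto (fun n : ℕ => A * (12 + 5 * C) / ((n : ℝ) + 1)) atTop (𝓝 0) :=
    htop.const_div_atTop _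
  refine squeeze_zero_norm' ?_ hlim
  filter_upwards [htop.eventually_ge_atTop X₀] with n hn
  set N : ℝ := n + 1 with hNdef
  have hN : 1 ≤ N := hN1 n
  have hN0 : 0 < N := by linarith
  have hXN := hX n
  have key := rect_identity (g := g) countable_empty hc
    (fun x hx => hd.differentiableAt (isOpen_upper.mem_nhds hx.1)) (X := X n) (Y := N) hN0.le
  have hκ : ∀ x ∈ closedUpper, N ≤ ‖x‖ → ‖g x‖ ≤ A / N ^ 2 * (1 + ‖w x‖) := by
    intro x hx hNx
    refine (hb x hx (hn.trans hNx)).trans ?_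
    gcongr
  have hside : ∀ x : ℝ, N ≤ |x| →
      ∫⁻ y in Ioc 0 N, ‖w ((x : ℂ) + (y : ℝ) * I)‖ₑ ^ 2 ≤ ENNReal.ofReal (2 * C * N) →
      ‖∫ y in (0:ℝ)..N, g (x + y * I)‖ ≤ A / N ^ 2 * (2 * N + 2 * C * N) := by
    intro x hx h
    rw [intervalIntegral.integral_of_le hN0.le]
    refine norm_integral_le_of_sq (w := w) (γ := fun y => x + y * I) measurableSet_Ioc (by positivity)
      (by positivity) hN0.le (fun y hy => hκ _ (add_mul_I_mem_closedUpper x hy.1.le) ?_) h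
      (by rw [Real.volume_Ioc, sub_zero])
    refine hx.trans ?_
    simpa using abs_re_le_norm ((x : ℂ) + y * I)
  have htopb : ‖∫ x in (-(X n))..X n, g (x + N * I)‖ ≤ A / N ^ 2 * (2 * (4 * N) + C * N) := by
    rw [intervalIntegral.integral_of_le (by linarith [hXN.1])]
    refine norm_integral_le_of_sq (w := w) (γ := fun x : ℝ => (x:ℂ) + N * I) measurableSet_Ioc
      (by positivity) (by positivity) (by positivity)
      (fun y hy => hκ _ (add_mul_I_mem_closedUpper y hN0.le) ?_) ?_ ?_
    · have := abs_im_le_norm ((y : ℂ) + N * I)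
      simp [abs_of_pos hN0] at this
      exact this
    · refine (lintegral_mono_set fun x hx => ?_).trans (hwb N N hN0.le hN)
      exact ⟨by linarith [hx.1, hXN.2], hx.2.trans hXN.2⟩
    · rw [Real.volume_Ioc]
      exact ENNReal.ofReal_le_ofReal (by linarith [hXN.2])
  have hs1 := hside (X n) (by rw [abs_of_pos (by linarith [hXN.1])]; exact hXN.1.le) (h1 n)
  have hs2 := hside (-(X n)) (by rw [abs_neg, abs_of_pos (by linarith [hXN.1])]; exact hXN.1.le) (h2 n)
  rw [key]
  refine (norm_add_le _ _).trans ?_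
  have := norm_sub_le (∫ x in (-(X n))..X n, g (x + N * I)) (I * ∫ y in (0:ℝ)..N, g (X n + y * I))
  rw [norm_mul, norm_I, one_mul] at this
  rw [norm_mul, norm_I, one_mul]
  refine (add_le_add (this.trans (add_le_add htopb hs1)) hs2).trans (le_of_eq ?_)
  field_simp
  ring

theorem conj_integral (g : ℝ → ℂ) (a b : ℝ) :
    ∫ t in a..b, conj (g t) = conj (∫ t in a..b, g t) := by
  simp only [intervalIntegral, map_sub, integral_conj]

theorem conj_sub_ne_zero {ζ x : ℂ} (hζ : ζ ∈ upper) (hx : x ∈ closedUpper) : x - conj ζ ≠ 0 := by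
  intro h
  have h1 : 0 < ζ.im := hζ
  have h2 : 0 ≤ x.im := hx
  have := congrArg Complex.im h
  simp at this
  linarith

theorem differentiableAt_inv_sub {x y : ℂ} (h : x - y ≠ 0) :
    DifferentiableAt ℂ (fun x : ℂ => (x - y)⁻¹) x := by
  fun_prop (disch := exact h)

/-- Conjugation on the real line moves the pole to the lower half-plane, where
`tendsto_integral_of_upper_tendsto` applies. -/
theorem tendsto_integral_inv_sub {ζ : ℂ} (hζ : ζ ∈ upper) :
    Tendsto (fun R : ℝ => ∫ t in (-R)..R, ((t:ℂ) - ζ)⁻¹) atTop (𝓝 (I * Real.pi)) := by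
  have h : Tendsto (fun R : ℝ => ∫ t in (-R)..R, ((t:ℂ) - conj ζ)⁻¹) atTop (𝓝 (-I * Real.pi * 1)) := by
    refine tendsto_integral_of_upper_tendsto (g := fun x => (x - conj ζ)⁻¹) countable_empty ?_ ?_ ?_
    · exact fun x hx => (differentiableAt_inv_sub (conj_sub_ne_zero hζ hx)).continuousAt.continuousWithinAt
    · exact fun x hx => differentiableAt_inv_sub
        (conj_sub_ne_zero hζ (upper_subset_closedUpper hx.1))
    · exact (tendsto_div_sub (conj ζ)).mono_left inf_le_left
  have h2 := (continuous_conj.tendsto _).comp h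
  simp only [Function.comp_def, ← conj_integral] at h2
  simpa using h2

theorem tendsto_integral_inv_mul {ζ ξ : ℂ} (hζ : ζ ∈ upper) (hξ : ξ ∈ upper) :
    Tendsto (fun R : ℝ => ∫ t in (-R)..R, ((t:ℂ) - ξ)⁻¹ * ((t:ℂ) - ζ)⁻¹) atTop (𝓝 0) := by
  have h : Tendsto (fun R : ℝ => ∫ t in (-R)..R, ((t:ℂ) - conj ξ)⁻¹ * ((t:ℂ) - conj ζ)⁻¹) atTop
      (𝓝 (-I * Real.pi * 0)) := by
    refine tendsto_integral_of_upper_tendsto (g := fun x => (x - conj ξ)⁻¹ * (x - conj ζ)⁻¹)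
      countable_empty ?_ ?_ ?_
    · exact fun x hx => ((differentiableAt_inv_sub (conj_sub_ne_zero hξ hx)).mul
        (differentiableAt_inv_sub (conj_sub_ne_zero hζ hx))).continuousAt.continuousWithinAt
    · exact fun x hx => (differentiableAt_inv_sub
        (conj_sub_ne_zero hξ (upper_subset_closedUpper hx.1))).mul (differentiableAt_inv_sub
        (conj_sub_ne_zero hζ (upper_subset_closedUpper hx.1)))
    · have h1 : Tendsto (fun x : ℂ => x / (x - conj ξ)) atInf (𝓝 1) :=
        (tendsto_div_sub (conj ξ)).mono_left inf_le_left
      have h2 : Tendsto (fun x : ℂ => ∑ _p : Fin 1, 1 / (x - conj ζ)) atInf (𝓝 0) :=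
        (tendsto_sum_div (fun _ : Fin 1 => (1:ℂ)) (fun _ => conj ζ)).mono_left inf_le_left
      have := h1.mul h2
      rw [mul_zero] at this
      refine this.congr fun x => ?_
      simp [div_eq_mul_inv, mul_assoc]
  have h2 := (continuous_conj.tendsto _).comp h
  simp only [Function.comp_def, ← conj_integral] at h2
  simpa using h2

end BOScattering
end

/-! ### The Cauchy projection of the potential times a solution -/

noncomputable section
namespace BOScattering

theorem norm_inv_sub_le_div {y x : ℂ} (h : ‖y‖ + 1 ≤ ‖x‖) : ‖(x - y)⁻¹‖ ≤ (2 + ‖y‖) / ‖x‖ := by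
  have h0 : 0 ≤ ‖y‖ := norm_nonneg y
  have h1 : 1 ≤ ‖x - y‖ := by linarith [norm_sub_norm_le x y]
  refine (Datum.norm_inv_sub_le one_pos h1).trans ?_
  rw [div_one]
  have : 1 + (1 + ‖y‖) = 2 + ‖y‖ := by ring
  rw [this]
  have : 0 < ‖x‖ := by linarith
  gcongr
  linarith

namespace Datum
variable {P : ℕ} {D : Datum P} {w : ℂ → ℂ}

variable (D) in
/-- The projection of the product of the potential and `w` to the upper half-plane. -/
def proj (w : ℂ → ℂ) (y : ℂ) : ℂ := ∑ p, D.c p * dslope w (D.z p) y + D.Sbar D.c y * w y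

/-- On the upper side only the poles `z p` of the potential are singular. Replacing `w/(y - zₚ)` by
the difference quotient of `w` subtracts the principal part there and makes `proj w` analytic in the
half-plane. -/
theorem proj_eq (w : ℂ → ℂ) {y : ℂ} (h : ∀ p, y ≠ D.z p) :
    D.proj w y = D.u y * w y - ∑ p, D.c p * w (D.z p) / (y - D.z p) := by
  simp only [proj, u, Sbar, Finset.sum_add_distrib, add_mul, Finset.sum_mul]
  have : ∀ p, D.c p * dslope w (D.z p) y
      = D.c p / (y - D.z p) * w y - D.c p * w (D.z p) / (y - D.z p) := fun p => by
    rw [dslope_of_ne _ (h p), slope_def_field]; ring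
  simp only [this, Finset.sum_sub_distrib]
  ring

theorem continuousOn_proj (hc : ContinuousOn w closedUpper) (hd : DifferentiableOn ℂ w upper) :
    ContinuousOn (D.proj w) closedUpper := by
  refine (continuousOn_finsetSum _ fun p _ => continuousOn_const.mul
    ((continuousOn_dslope (closedUpper_mem_nhds (D.hz p))).mpr
      ⟨hc, hd.differentiableAt (isOpen_upper.mem_nhds (D.hz p))⟩)).add (ContinuousOn.mul ?_ hc)
  exact fun x hx => (D.differentiableAt_Sbar D.c
    (D.closedUpper_subset_dom hx)).continuousAt.continuousWithinAt

theorem differentiableOn_proj (hd : DifferentiableOn ℂ w upper) :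
    DifferentiableOn ℂ (D.proj w) upper := by
  refine (DifferentiableOn.fun_sum fun p _ => ((Complex.differentiableOn_dslope
    (isOpen_upper.mem_nhds (D.hz p))).mpr hd).const_mul _).add (DifferentiableOn.mul ?_ hd)
  exact fun x hx => (D.differentiableAt_Sbar D.c (upper_subset_dom hx)).differentiableWithinAt

variable (D) in
-- The subtracted multiple of `1/(y + I)` equals `proj w ζ` at `ζ`, so the difference quotient is
-- `(y - ζ)⁻¹` times a function that still decays at infinity. Subtracting the constant `proj w ζ`
-- would lose this decay.
def cauchyKernel (w : ℂ → ℂ) (ζ : ℂ) : ℂ → ℂ :=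
  dslope (fun y => D.proj w y - D.proj w ζ * (ζ + I) * (y - -I)⁻¹) ζ

theorem add_I_ne_zero {x : ℂ} (hx : x ∈ closedUpper) : x - -I ≠ 0 := fun h => by
  have h2 : 0 ≤ x.im := hx
  have := congrArg Complex.im h
  simp at this
  linarith

theorem cauchyKernel_of_ne {ζ y : ℂ} (hζ : ζ ∈ upper) (h : y ≠ ζ) : D.cauchyKernel w ζ y
    = (y - ζ)⁻¹ * (D.proj w y - D.proj w ζ * (ζ + I) * (y - -I)⁻¹) := by
  have h1 := add_I_ne_zero (upper_subset_closedUpper hζ)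
  rw [cauchyKernel, dslope_of_ne _ h, slope_def_field]
  have h2 : D.proj w ζ * (ζ + I) * (ζ - -I)⁻¹ = D.proj w ζ := by
    rw [sub_neg_eq_add] at h1 ⊢
    field_simp
  rw [h2]
  ring

theorem continuousOn_cauchyKernel (hw : Tame w) {ζ : ℂ} (hζ : ζ ∈ upper) :
    ContinuousOn (D.cauchyKernel w ζ) closedUpper := by
  refine (continuousOn_dslope (closedUpper_mem_nhds hζ)).mpr ⟨?_, ?_⟩
  · refine (continuousOn_proj hw.cont hw.diff).sub (continuousOn_const.mul fun x hx => ?_)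
    exact (differentiableAt_inv_sub (add_I_ne_zero hx)).continuousAt.continuousWithinAt
  · exact ((differentiableOn_proj hw.diff).differentiableAt (isOpen_upper.mem_nhds hζ)).sub
      ((differentiableAt_inv_sub (add_I_ne_zero (upper_subset_closedUpper hζ))).const_mul _)

theorem differentiableOn_cauchyKernel (hw : Tame w) {ζ : ℂ} (hζ : ζ ∈ upper) :
    DifferentiableOn ℂ (D.cauchyKernel w ζ) upper := by
  refine (Complex.differentiableOn_dslope (isOpen_upper.mem_nhds hζ)).mpr ?_
  refine (differentiableOn_proj hw.diff).sub (DifferentiableOn.const_mul (fun x hx => ?_) _)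
  exact (differentiableAt_inv_sub (add_I_ne_zero
    (upper_subset_closedUpper hx))).differentiableWithinAt

theorem exists_proj_bound (w : ℂ → ℂ) : ∃ A X : ℝ, 0 ≤ A ∧ 0 < X ∧ ∀ x ∈ closedUpper, X ≤ ‖x‖ →
    ‖D.proj w x‖ ≤ A / ‖x‖ * (1 + ‖w x‖) := by
  obtain ⟨C, hC, hu⟩ := D.exists_bound_u one_pos
  obtain ⟨X, hX⟩ : ∃ X : ℝ, ∀ p, ‖D.z p‖ ≤ X := by
    refine ⟨∑ p, ‖D.z p‖, fun p => Finset.single_le_sum (f := fun p => ‖D.z p‖)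
      (fun p _ => norm_nonneg _) (Finset.mem_univ p)⟩
  refine ⟨C + ∑ p, ‖D.c p * w (D.z p)‖ * (2 + ‖D.z p‖), max X 0 + 1, by positivity, by positivity,
    fun x hx hxX => ?_⟩
  have hp : ∀ p, ‖D.z p‖ + 1 ≤ ‖x‖ := fun p => by linarith [hX p, le_max_left X 0]
  have hp' : ∀ p, 1 ≤ ‖x - D.z p‖ := fun p => by linarith [hp p, norm_sub_norm_le x (D.z p)]
  have hne : ∀ p, x ≠ D.z p := fun p h => by have := hp' p; simp [h] at this; linarith
  have hx1 : 1 ≤ ‖x‖ := by linarith [le_max_right X 0]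
  have hx0 : 0 < ‖x‖ := by linarith
  rw [proj_eq w hne, add_div, add_mul]
  refine (norm_sub_le _ _).trans (add_le_add ?_ ?_)
  · rw [norm_mul]
    have h1 : ‖D.u x‖ ≤ C / ‖x‖ := by
      refine (hu x (D.closedUpper_subset_dom hx) hp').trans ?_
      gcongr
      nlinarith
    gcongr
    linarith
  · have h2 : ‖∑ p, D.c p * w (D.z p) / (x - D.z p)‖
        ≤ (∑ p, ‖D.c p * w (D.z p)‖ * (2 + ‖D.z p‖)) / ‖x‖ := by
      rw [Finset.sum_div]
      refine norm_sum_le_of_le _ fun p _ => ?_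
      rw [div_eq_mul_inv, norm_mul, mul_div_assoc]
      gcongr
      exact norm_inv_sub_le_div (hp p)
    exact h2.trans (le_mul_of_one_le_right (by positivity) (by linarith [norm_nonneg (w x)]))

theorem exists_cauchyKernel_bound (w : ℂ → ℂ) {ζ : ℂ} (hζ : ζ ∈ upper) : ∃ A X : ℝ, 0 ≤ A ∧
    ∀ x ∈ closedUpper, X ≤ ‖x‖ → ‖D.cauchyKernel w ζ x‖ ≤ A / ‖x‖ ^ 2 * (1 + ‖w x‖) := by
  obtain ⟨A, X, hA, hX, h⟩ := exists_proj_bound (D := D) w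
  refine ⟨(2 + ‖ζ‖) * (A + ‖D.proj w ζ * (ζ + I)‖ * 3), max X (max (‖ζ‖ + 1) 2), by positivity,
    fun x hx hxX => ?_⟩
  have h1 : X ≤ ‖x‖ := (le_max_left _ _).trans hxX
  have h2 : ‖ζ‖ + 1 ≤ ‖x‖ := (le_max_left _ _).trans ((le_max_right _ _).trans hxX)
  have h3 : 2 ≤ ‖x‖ := (le_max_right _ _).trans ((le_max_right _ _).trans hxX)
  have hx0 : 0 < ‖x‖ := by linarith
  have hne : x ≠ ζ := fun e => by rw [e] at h2; linarith
  have hI : ‖(x - -I)⁻¹‖ ≤ 3 / ‖x‖ := by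
    have := norm_inv_sub_le_div (y := -I) (x := x) (by simp; linarith)
    rw [norm_neg, norm_I] at this
    norm_num at this ⊢
    exact this
  rw [cauchyKernel_of_ne hζ hne, norm_mul]
  have hw0 := norm_nonneg (w x)
  have h4 : ‖D.proj w x - D.proj w ζ * (ζ + I) * (x - -I)⁻¹‖
      ≤ (A + ‖D.proj w ζ * (ζ + I)‖ * 3) / ‖x‖ * (1 + ‖w x‖) := by
    rw [add_div, add_mul]
    refine (norm_sub_le _ _).trans (add_le_add (h x hx h1) ?_)
    rw [norm_mul, mul_div_assoc]
    refine (mul_le_mul_of_nonneg_left hI (norm_nonneg _)).trans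
      (le_mul_of_one_le_right (by positivity) (by linarith))
  refine (mul_le_mul (norm_inv_sub_le_div h2) h4 (norm_nonneg _) (by positivity)).trans (le_of_eq ?_)
  field_simp

/-- The integrand splits into the kernel, whose integral vanishes by closing the contour, and
elementary fractions with known integrals. -/
theorem cauchyKernel_real {ζ : ℂ} (hζ : ζ ∈ upper) (t : ℝ) :
    D.u t * w t * ((t:ℂ) - ζ)⁻¹ = D.cauchyKernel w ζ t
      + ((∑ p, D.c p * w (D.z p) * (((t:ℂ) - D.z p)⁻¹ * ((t:ℂ) - ζ)⁻¹))
        + D.proj w ζ * (((t:ℂ) - ζ)⁻¹ - ((t:ℂ) + I)⁻¹)) := by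
  have hne : (t:ℂ) ≠ ζ := fun h => by
    have h2 : 0 < ζ.im := hζ
    rw [← h] at h2; simp at h2
  have h1 : (t:ℂ) - ζ ≠ 0 := sub_ne_zero.mpr hne
  have h2 : (t:ℂ) + I ≠ 0 := by simpa using add_I_ne_zero (ofReal_mem_closedUpper t)
  have h3 : D.proj w ζ * (((t:ℂ) - ζ)⁻¹ - ((t:ℂ) + I)⁻¹)
      = ((t:ℂ) - ζ)⁻¹ * (D.proj w ζ * (ζ + I) * ((t:ℂ) + I)⁻¹) := by
    field_simp; ring
  have h4 : ∑ p, D.c p * w (D.z p) * (((t:ℂ) - D.z p)⁻¹ * ((t:ℂ) - ζ)⁻¹)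
      = ((t:ℂ) - ζ)⁻¹ * ∑ p, D.c p * w (D.z p) / ((t:ℂ) - D.z p) := by
    rw [Finset.mul_sum]
    exact Finset.sum_congr rfl fun p _ => by ring
  rw [cauchyKernel_of_ne hζ hne, proj_eq w (D.ofReal_ne_pole t), h3, h4, sub_neg_eq_add]
  ring

theorem inv_continuous_real {ζ : ℂ} (h : ∀ t : ℝ, (t:ℂ) - ζ ≠ 0) :
    Continuous fun t : ℝ => ((t:ℂ) - ζ)⁻¹ :=
  Datum.continuous_real (k := fun x => (x - ζ)⁻¹) fun t => (differentiableAt_inv_sub (h t)).continuousAt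

theorem upper_sub_ne_zero {ζ : ℂ} (hζ : ζ ∈ upper) (t : ℝ) : (t:ℂ) - ζ ≠ 0 := fun h => by
  have h2 : 0 < ζ.im := hζ
  have := congrArg Complex.im h
  simp at this
  linarith

/-- The Cauchy integral of the product of the potential and a tame function. -/
theorem cauchy_integral (hw : Tame w) (hi : Integrable fun t : ℝ => D.u t * w t) {ζ : ℂ}
    (hζ : ζ ∈ upper) :
    ∫ t : ℝ, D.u t * w t * ((t:ℂ) - ζ)⁻¹ = 2 * Real.pi * I * D.proj w ζ := by
  obtain ⟨A, X₀, hA, hb⟩ := exists_cauchyKernel_bound (D := D) w hζ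
  obtain ⟨X, hX, hlim⟩ := hw.exists_seq (continuousOn_cauchyKernel (D := D) hw hζ)
    (differentiableOn_cauchyKernel hw hζ) hA hb
  have c1 : Continuous fun t : ℝ => D.cauchyKernel w ζ t :=
    (continuousOn_cauchyKernel (D := D) hw hζ).comp_continuous continuous_ofReal
      ofReal_mem_closedUpper
  have c2 := inv_continuous_real (upper_sub_ne_zero hζ)
  have c3 : ∀ p, Continuous fun t : ℝ => ((t:ℂ) - D.z p)⁻¹ := fun p =>
    inv_continuous_real (upper_sub_ne_zero (D.hz p))
  have c4 : Continuous fun t : ℝ => ((t:ℂ) + I)⁻¹ := by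
    have := inv_continuous_real (ζ := -I) fun t => add_I_ne_zero (ofReal_mem_closedUpper t)
    simpa only [sub_neg_eq_add] using this
  have c5 : Continuous fun t : ℝ => ∑ p, D.c p * w (D.z p) * (((t:ℂ) - D.z p)⁻¹ * ((t:ℂ) - ζ)⁻¹) :=
    continuous_finsetSum _ fun p _ => continuous_const.mul ((c3 p).mul c2)
  have c6 : Continuous fun t : ℝ => D.proj w ζ * (((t:ℂ) - ζ)⁻¹ - ((t:ℂ) + I)⁻¹) :=
    continuous_const.mul (c2.sub c4)
  have c7 : Continuous fun t : ℝ => (∑ p, D.c p * w (D.z p) * (((t:ℂ) - D.z p)⁻¹ * ((t:ℂ) - ζ)⁻¹))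
      + D.proj w ζ * (((t:ℂ) - ζ)⁻¹ - ((t:ℂ) + I)⁻¹) := c5.add c6
  have c8 : ∀ p, Continuous fun t : ℝ => D.c p * w (D.z p) * (((t:ℂ) - D.z p)⁻¹ * ((t:ℂ) - ζ)⁻¹) :=
    fun p => continuous_const.mul ((c3 p).mul c2)
  have hi' : Integrable fun t : ℝ => D.u t * w t * ((t:ℂ) - ζ)⁻¹ := by
    refine hi.mul_bdd (c := (ζ.im)⁻¹) c2.aestronglyMeasurable (Eventually.of_forall fun t => ?_)
    have h2 : 0 < ζ.im := hζ
    rw [norm_inv]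
    refine inv_anti₀ h2 ((abs_im_le_norm _).trans' ?_)
    simp [abs_of_pos h2]
  -- Integrability on the line allows the integral to be computed along the sequence of good
  -- abscissae.
  have e1 := intervalIntegral_tendsto_integral hi' (tendsto_neg_atTop_atBot.comp hX) hX
  have e2 : ∀ n, ∫ t in (-(X n))..X n, D.u t * w t * ((t:ℂ) - ζ)⁻¹
      = (∫ t in (-(X n))..X n, D.cauchyKernel w ζ t)
        + ((∑ p, D.c p * w (D.z p) * ∫ t in (-(X n))..X n, ((t:ℂ) - D.z p)⁻¹ * ((t:ℂ) - ζ)⁻¹)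
        + D.proj w ζ * ((∫ t in (-(X n))..X n, ((t:ℂ) - ζ)⁻¹) - ∫ t in (-(X n))..X n, ((t:ℂ) + I)⁻¹)) := by
    intro n
    rw [intervalIntegral.integral_congr fun t _ => cauchyKernel_real hζ t,
      intervalIntegral.integral_add (c1.intervalIntegrable _ _) (c7.intervalIntegrable _ _),
      intervalIntegral.integral_add (c5.intervalIntegrable _ _) (c6.intervalIntegrable _ _),
      intervalIntegral.integral_finsetSum fun p _ => (c8 p).intervalIntegrable _ _,
      intervalIntegral.integral_const_mul,
      intervalIntegral.integral_sub (c2.intervalIntegrable _ _) (c4.intervalIntegrable _ _)]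
    simp only [intervalIntegral.integral_const_mul]
  -- The products of two fractions integrate to zero; the last difference gives `Iπ - (-Iπ) = 2πI`.
  have l2 := tendsto_finsetSum Finset.univ fun p (_ : p ∈ Finset.univ) =>
    ((tendsto_integral_inv_mul hζ (D.hz p)).comp hX).const_mul (D.c p * w (D.z p))
  have l3 := (((tendsto_integral_inv_sub hζ).comp hX).sub
    (tendsto_integral_inv_add_I.comp hX)).const_mul (D.proj w ζ)
  have l4 := hlim.add (l2.add l3)
  refine (tendsto_nhds_unique (e1.congr fun n => e2 n) l4).trans ?_
  simp
  ring

theorem potential_eq (t : ℝ) : potential D.c D.z t = D.u t := by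
  simp [potential, u, Finset.sum_add_distrib]

theorem hasCauchyPlus (hw : Tame w) (hi : Integrable fun t : ℝ => D.u t * w t) (x : ℝ) :
    HasCauchyPlus (fun y : ℝ => potential D.c D.z y * w y) x (D.proj w x) := by
  have h1 : Tendsto (fun δ : ℝ => (x:ℂ) + δ * I) (𝓝[>] 0) (𝓝[closedUpper] (x:ℂ)) := by
    refine tendsto_nhdsWithin_of_tendsto_nhds_of_eventually_within _ ?_ ?_
    · have : Continuous fun δ : ℝ => (x:ℂ) + δ * I := by fun_prop
      simpa using (this.tendsto 0).mono_left nhdsWithin_le_nhds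
    · filter_upwards [self_mem_nhdsWithin] with δ hδ
      exact add_mul_I_mem_closedUpper x (le_of_lt hδ)
  have h2 := (continuousOn_proj (D := D) hw.cont hw.diff x (ofReal_mem_closedUpper x)).tendsto.comp h1
  refine h2.congr' ?_
  filter_upwards [self_mem_nhdsWithin] with δ hδ
  have hζ : (x:ℂ) + δ * I ∈ upper := by
    have : 0 < δ := hδ
    simpa [upper] using this
  have := cauchy_integral hw hi hζ
  simp only [potential_eq, div_eq_mul_inv, Function.comp_apply] at this ⊢
  rw [this]
  have : (Real.pi : ℂ) ≠ 0 := by exact_mod_cast Real.pi_ne_zero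
  field_simp

theorem continuous_u_real : Continuous fun t : ℝ => D.u t :=
  Datum.continuous_real fun t => (D.differentiableAt_u (real_mem_dom t) (D.ofReal_ne_pole t)).continuousAt

theorem exists_u_real_bound : ∃ C : ℝ, 0 ≤ C ∧ ∀ t : ℝ, ‖D.u t‖ ≤ C * (1 + t ^ 2)⁻¹ := by
  obtain ⟨C, hC, hu⟩ := D.exists_bound_u D.b_pos
  refine ⟨C, hC, fun t => (hu t (real_mem_dom t) fun p => ?_).trans ?_⟩
  · refine (abs_im_le_norm _).trans' ?_
    simp [abs_of_pos (D.hz p)]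
    linarith [D.b_le p, D.b_pos]
  · rw [div_eq_mul_inv, norm_real, Real.norm_eq_abs]
    gcongr
    nlinarith [abs_nonneg t, sq_abs t]

theorem integrable_of_bounded (hc : ContinuousOn w closedUpper) {C : ℝ}
    (hC : ∀ x ∈ closedUpper, ‖w x‖ ≤ C) : Integrable fun t : ℝ => D.u t * w t := by
  obtain ⟨K, hK, hu⟩ := exists_u_real_bound (D := D)
  have hw : Continuous fun t : ℝ => w t := hc.comp_continuous continuous_ofReal ofReal_mem_closedUpper
  refine (integrable_inv_one_add_sq.const_mul (K * C)).mono'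
    (continuous_u_real.mul hw).aestronglyMeasurable (Eventually.of_forall fun t => ?_)
  rw [norm_mul, mul_right_comm]
  exact mul_le_mul (hu t) (hC _ (ofReal_mem_closedUpper t)) (norm_nonneg _) (by positivity)

theorem integrable_of_memHardy (h : MemHardy w) : Integrable fun t : ℝ => D.u t * w t := by
  obtain ⟨K, hK, hu⟩ := exists_u_real_bound (D := D)
  have hw : Continuous fun t : ℝ => w t :=
    h.continuousOn.comp_continuous continuous_ofReal ofReal_mem_closedUpper
  obtain ⟨C, hC⟩ := h.bounded
  have h1 : Integrable fun t : ℝ => ‖w t‖ ^ 2 := by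
    refine ⟨(hw.norm.pow 2).aestronglyMeasurable, ?_⟩
    have := hC 0 le_rfl
    simp only [ofReal_zero, zero_mul, add_zero] at this
    refine lt_of_le_of_lt (le_trans (le_of_eq ?_) this) ENNReal.coe_lt_top
    refine lintegral_congr fun t => ?_
    rw [enorm_pow, enorm_norm]
  refine ((integrable_inv_one_add_sq.add h1).const_mul K).mono'
    (continuous_u_real.mul hw).aestronglyMeasurable (Eventually.of_forall fun t => ?_)
  rw [norm_mul]
  refine (mul_le_mul_of_nonneg_right (hu t) (norm_nonneg _)).trans ?_
  rw [mul_assoc]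
  refine mul_le_mul_of_nonneg_left ?_ hK
  have hb : 0 ≤ (1 + t ^ 2)⁻¹ := by positivity
  have hb1 : (1 + t ^ 2)⁻¹ ≤ 1 := inv_le_one_of_one_le₀ (by nlinarith)
  simp only [Pi.add_apply]
  nlinarith [sq_nonneg (‖w t‖ - (1 + t ^ 2)⁻¹), norm_nonneg (w t), mul_nonneg hb (norm_nonneg (w t)),
    mul_le_mul_of_nonneg_left hb1 hb]

end Datum
end BOScattering
end

/-! ### From the equation on the real line to the half-plane -/

noncomputable section
namespace BOScattering

/-- A function on a closed upper half-neighbourhood that vanishes on a real interval vanishes. -/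
theorem eqOn_zero_of_real {S : Set ℂ} (hS : IsOpen S) (hp : IsPreconnected (S ∩ upper)) {F : ℂ → ℂ}
    (hc : ContinuousOn F (S ∩ closedUpper)) (hd : DifferentiableOn ℂ F (S ∩ upper)) {s : ℝ}
    (hs : (s : ℂ) ∈ S) (h0 : ∀ᶠ t : ℝ in 𝓝 s, F t = 0) {x : ℂ} (hx : x ∈ S ∩ closedUpper) :
    F x = 0 := by
  obtain ⟨r₁, hr₁, hb₁⟩ := Metric.isOpen_iff.mp hS s hs
  obtain ⟨r₂, hr₂, hb₂⟩ := Metric.eventually_nhds_iff.mp h0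
  set r := min r₁ r₂ with hr
  have hr0 : 0 < r := lt_min hr₁ hr₂
  have hSr : ∀ y : ℂ, |y.re - s| ≤ r / 4 → |y.im| ≤ r / 4 → y ∈ S := by
    intro y h1 h2
    refine hb₁ ?_
    rw [mem_ball_iff_norm]
    refine (norm_le_abs_re_add_abs_im _).trans_lt ?_
    simp only [sub_re, sub_im, ofReal_re, ofReal_im, sub_zero]
    linarith [min_le_left r₁ r₂]
  have hO : IsOpen (S ∩ upper) := hS.inter isOpen_upper
  -- The square centred at `p` with half-side `p.im` has its bottom side on the real line, where `F`
  -- vanishes.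
  have hsmall : ∀ p : ℂ, |p.re - s| < r / 8 → 0 < p.im → p.im < r / 8 → F p = 0 := by
    intro p h1 h2 h3
    have hbox : ∀ y : ℂ, |(y - p).re| ≤ p.im → |(y - p).im| ≤ p.im → y ∈ S ∩ closedUpper := by
      intro y h4 h5
      rw [sub_re, abs_le] at h4
      rw [sub_im, abs_le] at h5
      have h1' := abs_lt.mp h1
      refine ⟨hSr y ?_ ?_, ?_⟩
      · rw [abs_le]; constructor <;> linarith [h1'.1, h1'.2, h4.1, h4.2]
      · rw [abs_le]; constructor <;> linarith [h5.1, h5.2]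
      · show 0 ≤ y.im
        linarith [h5.1]
    refine eq_zero_of_eq_zero_on_bottom (ρ := p.im) h2 (fun ζ hζ1 hζ2 => ?_) (fun ζ hζ1 hζ2 => ?_)
      fun ζ hζ1 hζ2 => ?_
    · exact (hc _ (hbox _ (by simpa using hζ1) (by simpa using hζ2))).mono fun y hy => hbox y hy.1 hy.2
    · refine hd.differentiableAt (hO.mem_nhds ⟨(hbox _ (by simpa using hζ1.le) (by simpa using hζ2.le)).1, ?_⟩)
      show 0 < (p + ζ).im
      rw [add_im]
      linarith [(abs_lt.mp hζ2).1]
    · have e : p + ζ = ((p.re + ζ.re : ℝ) : ℂ) := by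
        apply Complex.ext <;> simp [hζ2]
      rw [e]
      refine hb₂ ?_
      rw [Real.dist_eq]
      have e2 : p.re + ζ.re - s = (p.re - s) + ζ.re := by ring
      rw [e2]
      refine (abs_add_le _ _).trans_lt ?_
      linarith [min_le_right r₁ r₂]
  have hz : EqOn F 0 (S ∩ upper) := by
    set p : ℂ := s + (r / 16 : ℝ) * I with hpdef
    have hpre : p.re = s := by simp [hpdef]
    have hpim : p.im = r / 16 := by simp [hpdef]
    have hpS : p ∈ S ∩ upper := by
      refine ⟨hSr p ?_ ?_, ?_⟩
      · rw [hpre]; simp; positivity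
      · rw [hpim, abs_of_pos (by positivity)]; linarith
      · show 0 < p.im
        rw [hpim]; positivity
    refine (hd.analyticOnNhd hO).eqOn_zero_of_preconnected_of_eventuallyEq_zero hp hpS ?_
    have o1 : IsOpen {y : ℂ | |y.re - s| < r / 8 ∧ 0 < y.im ∧ y.im < r / 8} :=
      (isOpen_lt (f := fun y : ℂ => |y.re - s|) (continuous_re.sub continuous_const).abs
        continuous_const).inter
        ((isOpen_lt continuous_const continuous_im).inter (isOpen_lt continuous_im continuous_const))
    filter_upwards [o1.mem_nhds (show p ∈ _ by
      refine ⟨?_, ?_, ?_⟩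
      · rw [hpre]; simp; positivity
      · rw [hpim]; positivity
      · rw [hpim]; linarith)] with y hy using hsmall y hy.1 hy.2.1 hy.2.2
  have ht : Tendsto (fun t : ℝ => x + t * I) (𝓝[>] 0) (𝓝[S ∩ closedUpper] x) ∧
      ∀ᶠ t : ℝ in 𝓝[>] 0, x + t * I ∈ S ∩ upper := by
    have hx2 : 0 ≤ x.im := hx.2
    have hcont : Continuous fun t : ℝ => x + t * I := by fun_prop
    have hl : Tendsto (fun t : ℝ => x + t * I) (𝓝[>] 0) (𝓝 x) := by
      simpa using (hcont.tendsto 0).mono_left nhdsWithin_le_nhds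
    have hmem : ∀ᶠ t : ℝ in 𝓝[>] 0, x + t * I ∈ S ∩ upper := by
      filter_upwards [hl (hS.mem_nhds hx.1), self_mem_nhdsWithin] with t h1 h2
      refine ⟨h1, ?_⟩
      have : 0 < t := h2
      show 0 < (x + t * I).im
      simp; linarith
    refine ⟨tendsto_nhdsWithin_of_tendsto_nhds_of_eventually_within _ hl ?_, hmem⟩
    filter_upwards [hmem] with t h using ⟨h.1, upper_subset_closedUpper h.2⟩
  have hl := (hc x hx).tendsto.comp ht.1
  refine tendsto_nhds_unique hl (tendsto_const_nhds.congr' ?_)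
  filter_upwards [ht.2] with t h using (hz h).symm

/-- Only the derivative along the real line is known. It makes `F` locally constant there, and
boundary uniqueness carries the constant into the half-plane. -/
theorem eq_of_real_hasDerivAt_zero {S : Set ℂ} (hS : IsOpen S) (hp : IsPreconnected (S ∩ upper))
    {F : ℂ → ℂ} (hc : ContinuousOn F (S ∩ closedUpper)) (hd : DifferentiableOn ℂ F (S ∩ upper))
    {s : ℝ} (hs : (s : ℂ) ∈ S) (h0 : ∀ t : ℝ, (t : ℂ) ∈ S → HasDerivAt (fun t : ℝ => F t) 0 t) {x : ℂ}
    (hx : x ∈ S ∩ closedUpper) : F x = F s := by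
  have := eqOn_zero_of_real (F := fun x => F x - F s) hS hp (hc.sub continuousOn_const)
    (hd.sub_const _) hs ?_ hx
  · exact sub_eq_zero.mp this
  · have hS' : {t : ℝ | (t : ℂ) ∈ S} ∈ 𝓝 s := continuous_ofReal.continuousAt (hS.mem_nhds hs)
    obtain ⟨r, hr, hb⟩ := Metric.mem_nhds_iff.mp hS'
    filter_upwards [Metric.ball_mem_nhds s hr] with t ht
    refine sub_eq_zero.mpr ?_
    exact (convex_ball s r).is_const_of_fderivWithin_eq_zero (𝕜 := ℝ) (f := fun t : ℝ => F t)
      (fun y hy => (h0 y (hb hy)).differentiableAt.differentiableWithinAt)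
      (fun y hy => by
        rw [fderivWithin_of_isOpen (Metric.isOpen_ball : IsOpen (Metric.ball s r)) hy]
        ext
        simpa using (h0 y (hb hy)).deriv)
      ht (Metric.mem_ball_self hr)

namespace Datum
variable {P : ℕ} {D : Datum P} {d μ w₀ : ℂ} {φ : Fin P → ℂ} {w : ℂ → ℂ}

variable (D) in
/-- Solutions of the differential equation on the real line. -/
structure RealSol (μ w₀ : ℂ) (φ : Fin P → ℂ) (w : ℂ → ℂ) : Prop where
  cont : ContinuousOn w closedUpper
  diff : DifferentiableOn ℂ w upper
  solves : ∀ t : ℝ, HasDerivAt (fun t : ℝ => w t)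
    ((I / D.ε) * ((μ + D.u t) * w t - D.src μ w₀ φ t)) t
  value : ∀ p, D.c p * w (D.z p) = φ p

theorem GlobalSol.realSol (hw : D.GlobalSol μ w₀ φ w) : D.RealSol μ w₀ φ w :=
  ⟨hw.continuousOn, hw.diff.mono fun _ hx => upper_subset_dom hx, hw.hasDerivAt_real, hw.value⟩

/-- The limit defining the Cauchy operator is unique and equals `proj w`; with `proj_eq` the
spectral problem becomes the differential equation with `φₚ = cₚ w(zₚ)`. -/
theorem realSol_of_solvesSpectral (hw : Tame w) (hi : Integrable fun t : ℝ => D.u t * w t)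
    (h : SolvesSpectral D.ε D.c D.z μ w₀ w) : D.RealSol μ w₀ (fun p => D.c p * w (D.z p)) w := by
  refine ⟨hw.cont, hw.diff, fun t => ?_, fun p => rfl⟩
  obtain ⟨w', hw', hC⟩ := h t
  refine hw'.congr_deriv ?_
  have e := tendsto_nhds_unique hC (hasCauchyPlus hw hi t)
  rw [proj_eq w (D.ofReal_ne_pole t)] at e
  rw [src]
  have hε := D.εc_ne
  have hI : I * I = -1 := I_mul_I
  have e2 : w' = (I / D.ε) * (-(I * D.ε * w')) := by
    field_simp
    linear_combination w' * hI
  rw [e2]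
  congr 1
  linear_combination e

theorem RealSol.solvesSpectral (hw : D.RealSol μ w₀ φ w) (ht : Tame w)
    (hi : Integrable fun t : ℝ => D.u t * w t) : SolvesSpectral D.ε D.c D.z μ w₀ w := by
  intro t
  refine ⟨_, hw.solves t, ?_⟩
  have := hasCauchyPlus ht hi t
  convert this using 1
  rw [proj_eq w (D.ofReal_ne_pole t), src]
  simp only [hw.value]
  have hε := D.εc_ne
  have hI : I * I = -1 := I_mul_I
  field_simp
  linear_combination (-((μ + D.u t) * w t - (μ * w₀ + ∑ p, φ p / ((t:ℂ) - D.z p)))) * hI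

theorem isPreconnected_Gd_inter_upper : IsPreconnected (D.Gd ∩ upper) := by
  refine isPreconnected_of_up (H := D.H) ?_ fun x hx t ht => ⟨D.add_mem_Gd hx.1 ht, ?_⟩
  · have : D.Gd ∩ upper ∩ {x | D.H < x.im} = {x | D.H < x.im} := by
      ext x
      refine ⟨fun h => h.2, fun h => ⟨⟨(D.high_of_H_le (le_of_lt h)).1, ?_⟩, h⟩⟩
      have h1 : D.H < x.im := h
      show 0 < x.im
      linarith [D.one_le_H]
    rw [this]
    exact convex_halfSpace_im_gt _
  · have h1 : 0 < x.im := hx.2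
    show 0 < (x + t * I).im
    simp; linarith

theorem RealSol.exists_eq_add (hw : D.RealSol μ w₀ φ w) (hd : IsDir d) (hμ : (μ * d).im ≤ 0)
    (hμ0 : μ ≠ 0) : ∃ K : ℂ, ∀ x ∈ D.Gd ∩ closedUpper,
      w x = D.wsol d μ w₀ φ x + K * (D.fac D.Ld μ x)⁻¹ := by
  have hv : ∀ x ∈ D.Gd, D.SolvesAt μ w₀ φ (D.wsol d μ w₀ φ) x := fun x hx =>
    D.solvesAt_wsol hd hμ hμ0 w₀ φ hx
  have hf : ∀ x ∈ D.Gd, HasDerivAt (D.fac D.Ld μ) (-(I / D.ε) * (μ + D.u x) * D.fac D.Ld μ x) x :=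
    fun x hx => D.hasDerivAt_fac (D.hasDerivAt_Ld hx) μ
  set F : ℂ → ℂ := fun x => D.fac D.Ld μ x * (w x - D.wsol d μ w₀ φ x) with hF
  refine ⟨F (D.a 0), fun x hx => ?_⟩
  have key : F x = F (D.a 0) := by
    refine eq_of_real_hasDerivAt_zero D.isOpen_Gd isPreconnected_Gd_inter_upper ?_ ?_ (D.a_mem_Gd 0)
      ?_ hx
    · exact ContinuousOn.mul (fun y hy => (hf y hy.1).continuousAt.continuousWithinAt)
        ((hw.cont.mono inter_subset_right).sub fun y hy => (hv y hy.1).continuousAt.continuousWithinAt)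
    · exact DifferentiableOn.mul (fun y hy => (hf y hy.1).differentiableAt.differentiableWithinAt)
        ((hw.diff.mono inter_subset_right).sub fun y hy =>
          (hv y hy.1).differentiableAt.differentiableWithinAt)
    · intro t ht
      refine ((hf t ht).comp_ofReal.mul ((hw.solves t).sub (hv t ht).comp_ofReal)).congr_deriv ?_
      simp only [Pi.sub_apply]
      ring
  rw [← key, hF]
  have := D.fac_ne_zero D.Ld μ x
  field_simp
  ring

theorem RealSol.integral_eq (hw : D.RealSol μ w₀ φ w) (s t : ℝ) :
    (I / D.ε) * ∫ r in s..t, D.Eu μ r * D.src μ w₀ φ r = D.Eu μ s * w s - D.Eu μ t * w t := by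
  have h : ∀ r : ℝ, HasDerivAt (fun r : ℝ => D.Eu μ r * w r)
      (-((I / D.ε) * (D.Eu μ r * D.src μ w₀ φ r))) r := fun r => by
    refine ((D.hasDerivAt_Eu (D.ofReal_mem_Gu r) μ).comp_ofReal.mul (hw.solves r)).congr_deriv ?_
    ring
  have := intervalIntegral.integral_eq_sub_of_hasDerivAt (a := s) (b := t) (fun r _ => h r)
    ((D.intervalIntegrable_Eu_src μ w₀ φ s t).const_mul _).neg
  rw [intervalIntegral.integral_neg, intervalIntegral.integral_const_mul] at this
  linear_combination -this

/-- The linear conditions are necessary. At a pole with negative integer exponent `EuReg w + (I/ε)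
Q` is constant on the strip, and `EuReg` vanishes at `z m`, where `w` is finite. At the other poles
the condition is the integrated equation on the real line. -/
theorem RealSol.row_eq_zero (hw : D.RealSol μ w₀ φ w)
    (he : ∀ x ∈ D.Gd ∩ closedUpper, w x = D.wsol d μ w₀ φ x) (m : Fin P) :
    D.row d μ w₀ φ m = 0 := by
  have ha : ∀ i, D.wsol d μ w₀ φ (D.a i) = w (D.a i) := fun i =>
    (he _ ⟨D.a_mem_Gd i, ofReal_mem_closedUpper _⟩).symm
  by_cases hm : D.IsNeg m
  · rw [D.row_of_isNeg hm, ha]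
    obtain ⟨n, h0, hn⟩ := hm
    obtain ⟨Q, hQ⟩ := D.exists_primitive_facSrc m n μ w₀ φ
    have e1 := hw.integral_eq (D.a 0) (D.z m).re
    have e2 := D.integral_facSrc_vert h0 hn hQ
    rw [pathInt, e2, mul_add, e1]
    have hre : ((D.z m).re : ℂ) ∈ D.col m := by
      have := D.vert_mem_col m (t := 0) left_mem_uIcc
      simpa using this
    have hreg : ∀ x ∈ D.col m, DifferentiableAt ℂ (D.EuReg m n μ) x := fun x hx => by
      have := D.differentiableAt_facReg μ hx
      unfold EuReg
      fun_prop
    have key := eq_of_real_hasDerivAt_zero (F := fun x => D.EuReg m n μ x * w x + (I / D.ε) * Q x)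
      (D.isOpen_col m) ((D.convex_col m).inter (convex_halfSpace_im_gt 0)).isPreconnected
      (ContinuousOn.add (ContinuousOn.mul (fun y hy => (hreg y hy.1).continuousAt.continuousWithinAt)
        (hw.cont.mono inter_subset_right)) (continuousOn_const.mul fun y hy =>
          (hQ y hy.1).continuousAt.continuousWithinAt))
      (DifferentiableOn.add (DifferentiableOn.mul (fun y hy => (hreg y hy.1).differentiableWithinAt)
        (hw.diff.mono inter_subset_right)) (DifferentiableOn.const_mul (fun y hy =>
          (hQ y hy.1).differentiableAt.differentiableWithinAt) _)) hre ?_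
      ⟨D.pole_mem_col m, upper_subset_closedUpper (D.hz m)⟩
    · have hz : D.EuReg m n μ (D.z m) = 0 := by
        simp [EuReg, h0.ne']
      have hr : D.EuReg m n μ (D.z m).re = D.Eu μ (D.z m).re := by
        rw [D.Eu_eq hn μ (D.ofReal_ne_pole _ m), EuReg]
      simp only [hz, hr] at key
      linear_combination key
    · intro t ht
      have h1 := (D.hasDerivAt_EuReg hn μ ht (D.ofReal_ne_pole t m)).comp_ofReal
      refine ((h1.mul (hw.solves t)).add ((hQ t ht).comp_ofReal.const_mul (I / D.ε))).congr_deriv ?_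
      rw [← D.Eu_mul_src h0 hn μ w₀ φ (D.ofReal_ne_pole t m), D.Eu_eq hn μ (D.ofReal_ne_pole t m),
        EuReg]
      ring
  · rw [D.row_of_not_isNeg hm, ha, ha, hw.integral_eq]
    ring

end Datum
end BOScattering
end

/-! ### Jost solutions and eigenfunctions in terms of the linear system -/

noncomputable section
namespace BOScattering

theorem isClosed_closedUpper : IsClosed closedUpper := isClosed_le continuous_const continuous_im

theorem exists_bound_of_tail {w : ℂ → ℂ} (hc : ContinuousOn w closedUpper) {X C : ℝ}
    (h : ∀ x ∈ closedUpper, X ≤ ‖x‖ → ‖w x‖ ≤ C) : ∃ C' : ℝ, 0 ≤ C' ∧ ∀ x ∈ closedUpper, ‖w x‖ ≤ C' := by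
  obtain ⟨B, hB⟩ := ((isCompact_closedBall (0:ℂ) X).inter_right
    isClosed_closedUpper).exists_bound_of_continuousOn (hc.mono inter_subset_right)
  refine ⟨max 0 (max B C), le_max_left _ _, fun x hx => ?_⟩
  rcases le_total X ‖x‖ with h1 | h1
  · exact (h x hx h1).trans ((le_max_right _ _).trans (le_max_right _ _))
  · exact (hB x ⟨by simpa using h1, hx⟩).trans ((le_max_left _ _).trans (le_max_right _ _))

theorem Datum.Dec.exists_bound {w : ℂ → ℂ} (hd : Datum.Dec w) (hc : ContinuousOn w closedUpper) :
    ∃ C : ℝ, 0 ≤ C ∧ ∀ x ∈ closedUpper, ‖w x‖ ≤ C / (1 + ‖x‖) := by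
  obtain ⟨X, C, h⟩ := hd
  have hn : ∀ x : ℂ, ‖((1 + ‖x‖ : ℝ) : ℂ)‖ = 1 + ‖x‖ := fun x => by
    rw [norm_real, Real.norm_of_nonneg (by positivity)]
  obtain ⟨C', hC', h'⟩ := exists_bound_of_tail (w := fun x => ((1 + ‖x‖ : ℝ) : ℂ) * w x) (X := X) (C := C)
    (ContinuousOn.mul (Continuous.continuousOn (by fun_prop)) hc) fun x hx hX => by
      rw [norm_mul, hn, mul_comm, ← le_div_iff₀ (by positivity)]
      exact h x hx hX
  refine ⟨C', hC', fun x hx => ?_⟩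
  rw [le_div_iff₀ (by positivity), mul_comm, ← hn, ← norm_mul]
  exact h' x hx

theorem memHardy_of_dec {w : ℂ → ℂ} (hc : ContinuousOn w closedUpper)
    (hd : DifferentiableOn ℂ w upper) (h : Datum.Dec w) : MemHardy w := by
  obtain ⟨C, hC, hb⟩ := h.exists_bound hc
  refine ⟨hc, hd, (C ^ 2 * Real.pi).toNNReal, fun y hy => ?_⟩
  have h1 : ∀ x : ℝ, ‖w (x + y * I)‖ₑ ^ 2 ≤ ENNReal.ofReal (C ^ 2 * (1 + x ^ 2)⁻¹) := by
    intro x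
    rw [← ofReal_norm, ← ENNReal.ofReal_pow (norm_nonneg _)]
    refine ENNReal.ofReal_le_ofReal ?_
    have hx := hb _ (add_mul_I_mem_closedUpper x hy)
    have h2 : |x| ≤ ‖(x:ℂ) + y * I‖ := by simpa using abs_re_le_norm ((x : ℂ) + y * I)
    refine (pow_le_pow_left₀ (norm_nonneg _) hx 2).trans ?_
    rw [div_pow, div_eq_mul_inv]
    gcongr
    nlinarith [abs_nonneg x, sq_abs x]
  refine (lintegral_mono h1).trans ?_
  rw [← ofReal_integral_eq_lintegral_ofReal (integrable_inv_one_add_sq.const_mul _)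
    (Eventually.of_forall fun x => by positivity), integral_const_mul, integral_univ_inv_one_add_sq]
  rfl

namespace Datum
variable {P : ℕ} {D : Datum P} {d μ w₀ : ℂ} {φ ψ : Fin P → ℂ} {w v : ℂ → ℂ}

theorem eqOn_closedUpper (hw : ContinuousOn w closedUpper) (hv : ContinuousOn v closedUpper)
    (h : ∀ x ∈ D.Gd ∩ closedUpper, w x = v x) : EqOn w v closedUpper := by
  intro x hx
  have hmem : ∀ t : ℝ, x + t ∈ closedUpper := fun t => by
    have : 0 ≤ x.im := hx
    simpa [closedUpper] using this
  have ht : Tendsto (fun t : ℝ => x + t) (𝓝[>] 0) (𝓝[closedUpper] x) :=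
    tendsto_nhdsWithin_of_tendsto_nhds_of_eventually_within _ (tendsto_add_ofReal x)
      (Eventually.of_forall hmem)
  refine tendsto_nhds_unique ((hw x hx).tendsto.comp ht) (((hv x hx).tendsto.comp ht).congr' ?_)
  filter_upwards [D.eventually_add_mem_Gd (D.closedUpper_subset_dom hx)] with t h1
  exact (h _ ⟨h1, hmem t⟩).symm

theorem mulVec_eq_of_row (h : ∀ m, D.row d μ w₀ φ m = 0) : D.Mat d μ *ᵥ φ = w₀ • D.vec d μ := by
  funext m
  have := h m
  rw [D.row_eq] at this
  simpa using sub_eq_zero.mp this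

/-! ### Jost solutions -/

/-- The reciprocal integrating factor has modulus bounded below far out on the real line. Since both
functions tend to 1 at `-∞`, its coefficient must vanish. -/
theorem RealSol.eq_wsol_of_pos {lam : ℝ} (hl : 0 < lam) (hw : D.RealSol lam 1 φ w)
    (h1 : Tendsto (fun x : ℝ => w x) atBot (𝓝 1)) :
    ∀ x ∈ D.Gd ∩ closedUpper, w x = D.wsol (-1) lam 1 φ x := by
  obtain ⟨K, hK⟩ := hw.exists_eq_add (d := -1) (Or.inr (Or.inr rfl)) (by simp)
    (by exact_mod_cast hl.ne')
  obtain ⟨C, C₁, C₀, hC, hC₁, h2, -, h3⟩ := D.exists_wsol_neg_one_bound hl 1 φ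
  have hev : ∀ᶠ t : ℝ in atBot, t ≤ 0 ∧ D.X₀ ≤ ‖(t:ℂ)‖ := by
    filter_upwards [eventually_le_atBot 0, eventually_le_atBot (-D.X₀)] with t h4 h5
    refine ⟨h4, ?_⟩
    rw [norm_real, Real.norm_eq_abs, abs_of_nonpos h4]
    linarith
  have hb : Tendsto (fun t : ℝ => C₁ * (‖w t - 1‖ + C / (1 + ‖(t:ℂ)‖))) atBot (𝓝 0) := by
    have e1 : Tendsto (fun t : ℝ => ‖w t - 1‖) atBot (𝓝 0) := by
      have := (h1.sub_const 1).norm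
      simpa using this
    have e2 : Tendsto (fun t : ℝ => C / (1 + ‖(t:ℂ)‖)) atBot (𝓝 0) := by
      refine (tendsto_atTop_add_const_left _ 1 ?_).const_div_atTop C
      simpa using tendsto_abs_atBot_atTop
    simpa using (e1.add e2).const_mul C₁
  have hK0 : ‖K‖ ≤ 0 := by
    refine ge_of_tendsto hb ?_
    filter_upwards [hev] with t ht
    have hcl := ofReal_mem_closedUpper t
    have e := hK t ⟨D.mem_Gd_of_X₀_le hcl ht.2, hcl⟩
    have h4 := (h3 t hcl ht.2).2
    have h5 := h2 t hcl ht.2 (by simpa using ht.1)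
    simp only [ofReal_im, mul_zero, Real.exp_zero, mul_one] at h4
    calc ‖K‖ ≤ ‖K‖ * (C₁ * ‖(D.fac D.Ld lam t)⁻¹‖) := le_mul_of_one_le_right (norm_nonneg _) h4
      _ = C₁ * ‖K * (D.fac D.Ld lam t)⁻¹‖ := by rw [norm_mul]; ring
      _ = C₁ * ‖(w t - 1) - (D.wsol (-1) lam 1 φ t - 1)‖ := by rw [e]; congr 2; ring
      _ ≤ _ := by
        gcongr
        exact (norm_sub_le _ _).trans (add_le_add_right h5 _)
  intro x hx
  rw [hK x hx, norm_le_zero_iff.mp hK0]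
  simp

theorem _root_.BOScattering.IsJostM.realSol {lam : ℝ} (h : IsJostM D.ε D.c D.z lam w) :
    D.RealSol lam 1 (fun p => D.c p * w (D.z p)) w := by
  obtain ⟨C, hC⟩ := h.bounded
  exact realSol_of_solvesSpectral (tame_of_bounded h.continuousOn h.differentiableOn hC)
    (integrable_of_bounded h.continuousOn hC) h.solves

/-- The coefficient vectors of two Jost solutions solve the same linear system, whose kernel is
trivial; equal coefficients give equal solutions. -/
theorem jost_unique {lam : ℝ} (hl : 0 < lam) (hw : IsJostM D.ε D.c D.z lam w)
    (hv : IsJostM D.ε D.c D.z lam v) : EqOn w v closedUpper := by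
  have ew := hw.realSol.eq_wsol_of_pos hl hw.tendsto_one
  have ev := hv.realSol.eq_wsol_of_pos hl hv.tendsto_one
  have mw := mulVec_eq_of_row (hw.realSol.row_eq_zero ew)
  have mv := mulVec_eq_of_row (hv.realSol.row_eq_zero ev)
  have := ker_eq_zero_of_pos (D := D)
    (φ := (fun p => D.c p * w (D.z p)) - fun p => D.c p * v (D.z p)) hl
    (by rw [Matrix.mulVec_sub, mw, mv, sub_self])
  rw [sub_eq_zero] at this
  refine eqOn_closedUpper (D := D) hw.continuousOn hv.continuousOn fun x hx => ?_
  rw [ew x hx, ev x hx, this]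

theorem GlobalSol.isJostM {lam : ℝ} (hl : 0 < lam) (hw : D.GlobalSol lam 1 φ w)
    (he : EqOn w (D.wsol (-1) lam 1 φ) D.Gd) : IsJostM D.ε D.c D.z lam w := by
  obtain ⟨C, C₁, C₀, hC, hC₁, h1, h2, h3⟩ := D.exists_wsol_neg_one_bound hl 1 φ
  have hε := D.hε
  have hdiff : DifferentiableOn ℂ w upper := hw.diff.mono fun _ hx => upper_subset_dom hx
  have heq : ∀ x ∈ closedUpper, D.X₀ ≤ ‖x‖ → w x = D.wsol (-1) lam 1 φ x := fun x hx hX =>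
    he (D.mem_Gd_of_X₀_le hx hX)
  have hCx : ∀ x : ℂ, C / (1 + ‖x‖) ≤ C := fun x =>
    div_le_self hC (by linarith [norm_nonneg x])
  obtain ⟨B, -, hB⟩ := exists_bound_of_tail hw.continuousOn (X := D.X₀) (C := 1 + C + ‖C₀‖ * C₁)
    fun x hx hX => by
      rw [heq x hx hX]
      rcases le_total x.re 0 with h | h
      · have h4 := (h1 x hx hX h).trans (hCx x)
        have h5 := norm_add_le (D.wsol (-1) lam 1 φ x - 1) 1
        rw [sub_add_cancel, norm_one] at h5
        have : 0 ≤ ‖C₀‖ * C₁ := by positivity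
        linarith
      · have h4 := (h2 x hx hX h).trans (hCx x)
        have h5 : ‖(D.fac D.Ld lam x)⁻¹‖ ≤ C₁ := by
          refine (h3 x hx hX).1.trans (mul_le_of_le_one_right hC₁ (Real.exp_le_one_iff.mpr ?_))
          have hx0 : 0 ≤ x.im := hx
          rw [neg_mul, neg_nonpos]
          positivity
        have e : D.wsol (-1) lam 1 φ x = (D.wsol (-1) lam 1 φ x - 1 - C₀ * (D.fac D.Ld lam x)⁻¹)
          + 1 + C₀ * (D.fac D.Ld lam x)⁻¹ := by ring
        rw [e]
        refine (norm_add₃_le).trans ?_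
        rw [norm_one, norm_mul]
        have := mul_le_mul_of_nonneg_left h5 (norm_nonneg C₀)
        linarith
  refine ⟨hw.continuousOn, hdiff, ⟨B, hB⟩, hw.realSol.solvesSpectral
    (tame_of_bounded hw.continuousOn hdiff hB) (integrable_of_bounded hw.continuousOn hB), ?_⟩
  have hlim : Tendsto (fun t : ℝ => w t - 1) atBot (𝓝 0) := by
    have e2 : Tendsto (fun t : ℝ => C / (1 + ‖(t:ℂ)‖)) atBot (𝓝 0) := by
      refine (tendsto_atTop_add_const_left _ 1 ?_).const_div_atTop C
      simpa using tendsto_abs_atBot_atTop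
    refine squeeze_zero_norm' ?_ e2
    filter_upwards [eventually_le_atBot 0, eventually_le_atBot (-D.X₀)] with t h4 h5
    have h6 : D.X₀ ≤ ‖(t:ℂ)‖ := by
      rw [norm_real, Real.norm_eq_abs, abs_of_nonpos h4]
      linarith
    rw [heq t (ofReal_mem_closedUpper t) h6]
    exact h1 t (ofReal_mem_closedUpper t) h6 (by simpa using h4)
  simpa using hlim.add_const 1

/-! ### Eigenfunctions -/

theorem im_mul_I_neg {lam : ℝ} (hl : lam < 0) : ((lam : ℂ) * I).im < 0 := by simpa using hl

/-- The integrating factor is bounded far out on the real line. Square integrability of `w` and of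
the tail of `wsol` would make the constant `‖K‖²` integrable over a half-line, so `K = 0`. -/
theorem RealSol.eq_wsol_of_neg {lam : ℝ} (hl : lam < 0) (hw : D.RealSol lam 0 φ w)
    (h : MemHardy w) : ∀ x ∈ D.Gd ∩ closedUpper, w x = D.wsol I lam 0 φ x := by
  obtain ⟨K, hK⟩ := hw.exists_eq_add (d := I) (Or.inl rfl) (im_mul_I_neg hl).le
    (by exact_mod_cast hl.ne)
  obtain ⟨X, C, hC⟩ := dec_wsol (D := D) (d := I) (φ := φ) (Or.inl rfl) (im_mul_I_neg hl)
    fun _ _ => rfl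
  obtain ⟨L, hL⟩ := D.exists_bound_Ld one_pos
  set C₁ := Real.exp (L / D.ε) with hC₁
  have hwc : Continuous fun t : ℝ => w t :=
    h.continuousOn.comp_continuous continuous_ofReal ofReal_mem_closedUpper
  obtain ⟨B, hB⟩ := h.bounded
  have hi : Integrable fun t : ℝ => ‖w t‖ ^ 2 := by
    refine ⟨(hwc.norm.pow 2).aestronglyMeasurable, ?_⟩
    have := hB 0 le_rfl
    simp only [ofReal_zero, zero_mul, add_zero] at this
    refine lt_of_le_of_lt (le_trans (le_of_eq ?_) this) ENNReal.coe_lt_top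
    refine lintegral_congr fun t => ?_
    rw [enorm_pow, enorm_norm]
  have hK0 : ‖K‖ ^ 2 = 0 := by
    have hint : Integrable (fun _ : ℝ => ‖K‖ ^ 2) (volume.restrict (Ioi (max (max X D.X₀) 0))) := by
      refine (((hi.add (integrable_inv_one_add_sq.const_mul (C ^ 2))).const_mul
        (2 * C₁ ^ 2)).restrict).mono' aestronglyMeasurable_const ?_
      filter_upwards [ae_restrict_mem measurableSet_Ioi] with t ht
      have ht1 : max (max X D.X₀) 0 < t := ht
      have ht0 : 0 < t := (le_max_right _ _).trans_lt ht1
      have hX : X ≤ ‖(t:ℂ)‖ := by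
        rw [norm_real, Real.norm_of_nonneg ht0.le]
        exact ((le_max_left _ _).trans (le_max_left _ _)).trans ht1.le
      have hX₀ : D.X₀ ≤ ‖(t:ℂ)‖ := by
        rw [norm_real, Real.norm_of_nonneg ht0.le]
        exact ((le_max_right _ _).trans (le_max_left _ _)).trans ht1.le
      have hcl := ofReal_mem_closedUpper t
      have hG := D.mem_Gd_of_X₀_le hcl hX₀
      have e := hK t ⟨hG, hcl⟩
      have hfac := D.norm_fac_le (hL t hG.1 fun p => D.one_le_of_X₀_le hX₀ p) (lam : ℂ)
      have him : ((lam : ℂ) * t).im = 0 := by simp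
      rw [him, zero_div, Real.exp_zero, mul_one] at hfac
      have hfac0 := D.fac_ne_zero D.Ld lam t
      have hv := hC t hcl hX
      have h1 : ‖K‖ ≤ C₁ * (‖w t‖ + ‖D.wsol I lam 0 φ t‖) := by
        have e2 : K = D.fac D.Ld lam t * (w t - D.wsol I lam 0 φ t) := by
          rw [e]; field_simp; ring
        rw [e2, norm_mul]
        gcongr
        exact norm_sub_le _ _
      have h2 : ‖D.wsol I lam 0 φ t‖ ^ 2 ≤ C ^ 2 * (1 + t ^ 2)⁻¹ := by
        refine (pow_le_pow_left₀ (norm_nonneg _) hv 2).trans ?_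
        rw [div_pow, div_eq_mul_inv, norm_real, Real.norm_of_nonneg ht0.le]
        gcongr
        nlinarith
      rw [norm_pow, norm_norm]
      simp only [Pi.add_apply]
      have h3 : ‖K‖ ^ 2 ≤ (C₁ * (‖w t‖ + ‖D.wsol I lam 0 φ t‖)) ^ 2 :=
        pow_le_pow_left₀ (norm_nonneg _) h1 2
      have h4 : (‖w t‖ + ‖D.wsol I lam 0 φ t‖) ^ 2 ≤ 2 * (‖w t‖ ^ 2 + ‖D.wsol I lam 0 φ t‖ ^ 2) := by
        nlinarith [sq_nonneg (‖w t‖ - ‖D.wsol I lam 0 φ t‖)]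
      rw [mul_pow] at h3
      have h5 : 0 ≤ C₁ ^ 2 := by positivity
      nlinarith [mul_le_mul_of_nonneg_left h4 h5, mul_le_mul_of_nonneg_left h2 h5]
    by_contra hne
    have := (integrable_const_iff.mp hint).resolve_left hne
    have h6 := this.measure_univ_lt_top
    rw [Measure.restrict_apply_univ, Real.volume_Ioi] at h6
    exact lt_irrefl _ h6
  intro x hx
  rw [hK x hx, norm_eq_zero.mp (pow_eq_zero_iff two_ne_zero |>.mp hK0)]
  simp

theorem exists_ker_of_isEigenfunction {lam : ℝ} (hl : lam < 0)
    (h : IsEigenfunction D.ε D.c D.z lam w) : ∃ φ : Fin P → ℂ, φ ≠ 0 ∧ D.Mat I lam *ᵥ φ = 0 := by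
  have hr : D.RealSol lam 0 (fun p => D.c p * w (D.z p)) w :=
    realSol_of_solvesSpectral h.memHardy.tame (integrable_of_memHardy h.memHardy) h.solves
  have he := hr.eq_wsol_of_neg hl h.memHardy
  refine ⟨_, fun h0 => ?_, by
    rw [mulVec_eq_of_row (hr.row_eq_zero he), zero_smul]⟩
  obtain ⟨x, hx, hne⟩ := h.nontrivial
  refine hne (eqOn_closedUpper (D := D) (v := 0) h.memHardy.continuousOn continuousOn_const
    (fun y hy => ?_) hx)
  rw [he y hy, h0]
  simp [wsol]

theorem GlobalSol.isEigenfunction {lam : ℝ} (hl : lam < 0) (hw : D.GlobalSol lam 0 φ w)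
    (he : EqOn w (D.wsol I lam 0 φ) D.Gd) (h0 : φ ≠ 0) : IsEigenfunction D.ε D.c D.z lam w := by
  have hd := dec_wsol (Or.inl rfl) (im_mul_I_neg hl) he
  have hdiff : DifferentiableOn ℂ w upper := hw.diff.mono fun _ hx => upper_subset_dom hx
  have hm := memHardy_of_dec hw.continuousOn hdiff hd
  refine ⟨hm, ?_, hw.realSol.solvesSpectral hm.tame (integrable_of_memHardy hm)⟩
  by_contra! hcon
  refine h0 (funext fun p => ?_)
  rw [← hw.value p, hcon _ (upper_subset_closedUpper (D.hz p))]
  simp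

theorem mem_eigenvalues_iff {lam : ℝ} : lam ∈ eigenvalues D.ε D.c D.z ↔
    lam < 0 ∧ ∃ φ : Fin P → ℂ, φ ≠ 0 ∧ D.Mat I lam *ᵥ φ = 0 := by
  refine ⟨fun ⟨hl, Φ, h⟩ => ⟨hl, exists_ker_of_isEigenfunction hl h⟩, fun ⟨hl, φ, h0, h⟩ => ?_⟩
  obtain ⟨w, hw, he⟩ := exists_globalSol_of_mulVec (w₀ := 0) (d := I) (Or.inl rfl) (im_mul_I_neg hl).le
    (by exact_mod_cast hl.ne) (by rw [h, zero_smul])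
  exact ⟨hl, w, hw.isEigenfunction hl he h0⟩

end Datum
end BOScattering
end

/-! ### Values of the solutions as functions of the spectral parameter -/

noncomputable section
namespace BOScattering
namespace Datum
variable {P : ℕ} {D : Datum P} {d μ w₀ v₀ : ℂ} {φ ψ : Fin P → ℂ} {w v : ℂ → ℂ} {x : ℂ}

theorem mem_Gd_or_mem_Gu (hx : x ∈ closedUpper) : x ∈ D.Gd ∨ x ∈ D.Gu ∨ ∃ p, x = D.z p := by
  by_cases h : ∃ p, x.re = (D.z p).re ∧ x.im ≤ (D.z p).im
  · obtain ⟨p, h1, h2⟩ := h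
    rcases h2.eq_or_lt with h2 | h2
    · exact Or.inr (Or.inr ⟨p, Complex.ext h1 h2⟩)
    · refine Or.inr (Or.inl ⟨D.closedUpper_subset_dom hx, fun q => ?_⟩)
      by_cases hq : q = p
      · exact Or.inr (hq ▸ h2)
      · exact Or.inl fun h3 => hq (D.hre.injective (h3.symm.trans h1))
  · push Not at h
    refine Or.inl ⟨D.closedUpper_subset_dom hx, fun p => ?_⟩
    by_cases h1 : x.re = (D.z p).re
    · exact Or.inr (h p h1)
    · exact Or.inl h1

variable (D) in
open Classical in
/-- The values of the solutions of the differential equation, by continuation along the paths. -/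
def evalAt (d x μ w₀ : ℂ) (φ : Fin P → ℂ) : ℂ :=
  if x ∈ D.Gd then D.wsol d μ w₀ φ x
  else if x ∈ D.Gu then (D.Eu μ x)⁻¹ * (D.Eu μ (D.a 0) * D.wsol d μ w₀ φ (D.a 0)
    - (I / D.ε) * (μ * w₀ * D.pathInt (fun y => D.Eu μ y * 1) x
      + ∑ p, φ p * D.pathInt (fun y => D.Eu μ y * (y - D.z p)⁻¹) x))
  else ∑ p, if x = D.z p then φ p / D.c p else 0

theorem evalAt_of_mem_Gd (hx : x ∈ D.Gd) : D.evalAt d x μ w₀ φ = D.wsol d μ w₀ φ x := by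
  rw [evalAt, if_pos hx]

theorem evalAt_of_mem_Gu (hx : x ∉ D.Gd) (hx' : x ∈ D.Gu) : D.evalAt d x μ w₀ φ
    = (D.Eu μ x)⁻¹ * (D.Eu μ (D.a 0) * D.wsol d μ w₀ φ (D.a 0)
      - (I / D.ε) * D.pathInt (fun y => D.Eu μ y * D.src μ w₀ φ y) x) := by
  rw [evalAt, if_neg hx, if_pos hx', D.pathInt_src (D.pathReg_src_of_mem hx')]

theorem evalAt_pole (p : Fin P) : D.evalAt d (D.z p) μ w₀ φ = φ p / D.c p := by
  rw [evalAt, if_neg fun h => D.ne_pole_of_mem_Gd h p rfl, if_neg fun h => D.ne_pole_of_mem_Gu h p rfl,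
    Finset.sum_eq_single p, if_pos rfl]
  · intro q _ hq
    exact if_neg fun h => hq (D.hre.injective (congrArg Complex.re h)).symm
  · simp

theorem evalAt_eq (d x μ w₀ : ℂ) (φ : Fin P → ℂ) : D.evalAt d x μ w₀ φ
    = w₀ * D.evalAt d x μ 1 0 + ∑ p, φ p * D.evalAt d x μ 0 (Pi.single p 1) := by
  simp only [evalAt]
  split_ifs with h1 h2
  · exact D.wsol_linear d μ w₀ φ x
  · rw [D.wsol_linear d μ w₀ φ (D.a 0)]
    simp only [Pi.single_apply, Pi.zero_apply, ite_mul, zero_mul, one_mul, mul_zero, mul_one,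
      Finset.sum_ite_eq', Finset.mem_univ, if_true, Finset.sum_const_zero, add_zero, zero_add]
    have : ∀ p, φ p * ((D.Eu μ x)⁻¹ * (D.Eu μ (D.a 0) * D.wsol d μ 0 (Pi.single p 1) (D.a 0)
          - I / D.ε * D.pathInt (fun y => D.Eu μ y * (y - D.z p)⁻¹) x))
        = (D.Eu μ x)⁻¹ * D.Eu μ (D.a 0) * (φ p * D.wsol d μ 0 (Pi.single p 1) (D.a 0))
          - (D.Eu μ x)⁻¹ * (I / D.ε) * (φ p * D.pathInt (fun y => D.Eu μ y * (y - D.z p)⁻¹) x) :=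
      fun p => by ring
    simp only [this, Finset.sum_sub_distrib, ← Finset.mul_sum]
    ring
  · simp only [Pi.zero_apply, zero_div, ite_self, Finset.sum_const_zero, mul_zero, zero_add,
      Pi.single_apply, Finset.mul_sum]
    rw [Finset.sum_comm]
    refine Finset.sum_congr rfl fun p _ => ?_
    rw [Finset.sum_eq_single p]
    · split_ifs <;> simp_all [div_eq_mul_inv]
    · intro q _ hq
      rw [if_neg hq.symm]
      simp
    · simp

/-- Glued solutions exist only for data satisfying the linear conditions, which vary with `μ`. The
explicit values `evalAt` make sense for all data and so can be studied for fixed data as functions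
of `μ`. -/
theorem nice_evalAt (hd : IsDir d) (x w₀ : ℂ) (φ : Fin P → ℂ) :
    Nice d (fun μ => D.evalAt d x μ w₀ φ) := by
  by_cases h1 : x ∈ D.Gd
  · simp only [evalAt, if_pos h1]
    exact D.nice_wsol hd w₀ φ h1
  by_cases h2 : x ∈ D.Gu
  · simp only [evalAt, if_neg h1, if_pos h2]
    have hr := D.pathReg_src_of_mem h2
    have i1 : Nice d (fun μ => D.pathInt (fun y => D.Eu μ y * 1) x) := by
      have := hr 1 1 0
      rw [src_one_eq] at this
      exact nice_of_differentiable fun μ => (this.hasDerivAt μ).differentiableAt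
    have ip : ∀ p, Nice d (fun μ => D.pathInt (fun y => D.Eu μ y * (y - D.z p)⁻¹) x) := by
      intro p
      have := hr 0 0 (Pi.single p 1)
      rw [src_single_eq] at this
      exact nice_of_differentiable fun μ => (this.hasDerivAt μ).differentiableAt
    exact (nice_of_differentiable (D.differentiable_fac_inv_param _ x)).mul
      (((nice_of_differentiable (D.differentiable_Eu_param _)).mul
        (D.nice_wsol hd w₀ φ (D.a_mem_Gd 0))).sub ((nice_const _).mul
      ((((nice_of_differentiable differentiable_id).mul (nice_const _)).mul i1).add
        (nice_sum _ fun p _ => (nice_const _).mul (ip p)))))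
  · simp only [evalAt, if_neg h1, if_neg h2]
    exact nice_const _

theorem GlobalSol.pathInt_eq (hw : D.GlobalSol μ w₀ φ w) (hx : x ∈ D.Gu) :
    (I / D.ε) * D.pathInt (fun y => D.Eu μ y * D.src μ w₀ φ y) x
      = D.Eu μ (D.a 0) * w (D.a 0) - D.Eu μ x * w x := by
  have h : ∀ t ∈ uIcc 0 x.im, HasDerivAt (fun t : ℝ => D.Eu μ (x.re + t * I) * w (x.re + t * I))
      (-((I / D.ε) * (D.Eu μ (x.re + t * I) * D.src μ w₀ φ (x.re + t * I) * I))) t := by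
    intro t ht
    have hm := D.vert_mem_Gu hx ht
    refine ((D.hasDerivAt_fac_mul (D.hasDerivAt_f hm) (hw.solves _ hm.1
      fun p => D.ne_pole_of_mem_Gu hm p)).comp t (hasDerivAt_ray _ t)).congr_deriv ?_
    rw [Eu]
    ring
  have e1 := hw.realSol.integral_eq (D.a 0) x.re
  have e2 := intervalIntegral.integral_eq_sub_of_hasDerivAt h
    (((D.pathReg_src_of_mem hx μ w₀ φ).intervalIntegrable μ).2.const_mul _).neg
  rw [intervalIntegral.integral_neg, intervalIntegral.integral_const_mul] at e2
  rw [pathInt, mul_add, e1]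
  simp only [ofReal_zero, zero_mul, add_zero, re_add_im] at e2
  linear_combination -e2

theorem GlobalSol.eq_evalAt (hw : D.GlobalSol μ w₀ φ w) (he : EqOn w (D.wsol d μ w₀ φ) D.Gd)
    (hx : x ∈ closedUpper) : w x = D.evalAt d x μ w₀ φ := by
  by_cases h1 : x ∈ D.Gd
  · rw [evalAt_of_mem_Gd h1, he h1]
  · rcases (mem_Gd_or_mem_Gu (D := D) hx).resolve_left h1 with h2 | ⟨p, rfl⟩
    · rw [evalAt_of_mem_Gu h1 h2, hw.pathInt_eq h2, ← he (D.a_mem_Gd 0)]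
      have : D.Eu μ x ≠ 0 := D.fac_ne_zero _ _ _
      field_simp
      ring
    · rw [evalAt_pole, ← hw.value p]
      have := D.hc p
      field_simp

theorem GlobalSol.sub (hw : D.GlobalSol μ w₀ φ w) (hv : D.GlobalSol μ v₀ ψ v) :
    D.GlobalSol μ (w₀ - v₀) (φ - ψ) (fun x => w x - v x) := by
  refine ⟨hw.diff.sub hv.diff, fun x hx hne => ?_, fun p => ?_⟩
  · refine ((hw.solves x hx hne).sub (hv.solves x hx hne)).congr_deriv ?_
    simp only [src, Pi.sub_apply, sub_div, Finset.sum_sub_distrib]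
    ring
  · rw [Pi.sub_apply, ← hw.value p, ← hv.value p]
    ring

/-! ### Solutions of the linear systems by Cramer's rule -/

theorem nice_det {n : Type*} [Fintype n] [DecidableEq n] {A : ℂ → Matrix n n ℂ}
    (h : ∀ i j, Nice d (fun μ => A μ i j)) : Nice d (fun μ => (A μ).det) := by
  simp only [Matrix.det_apply, Units.smul_def, zsmul_eq_mul]
  exact nice_sum _ fun σ _ => (nice_const _).mul (nice_prod _ fun i _ => h _ _)

theorem nice_adjugate {n : Type*} [Fintype n] [DecidableEq n] {A : ℂ → Matrix n n ℂ}
    (h : ∀ i j, Nice d (fun μ => A μ i j)) (i j : n) : Nice d (fun μ => (A μ).adjugate i j) := by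
  simp only [Matrix.adjugate_apply]
  refine nice_det fun k l => ?_
  by_cases hk : k = j
  · subst hk
    simp only [Matrix.updateRow_self]
    exact nice_const _
  · simp only [Matrix.updateRow_ne hk]
    exact h k l

variable (D) in
/-- The numerator in Cramer's rule for the solution with `w₀ = 1`. -/
def num (d x μ : ℂ) : ℂ := (D.Mat d μ).det * D.evalAt d x μ 1 0
  + ∑ p, ((D.Mat d μ).adjugate *ᵥ D.vec d μ) p * D.evalAt d x μ 0 (Pi.single p 1)

variable (D) in
/-- The solution with `w₀ = 1`. -/
def sol (d x μ : ℂ) : ℂ := D.num d x μ / (D.Mat d μ).det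

theorem nice_detMat (hd : IsDir d) : Nice d (fun μ => (D.Mat d μ).det) := nice_det (D.nice_Mat hd)

theorem nice_num (hd : IsDir d) (x : ℂ) : Nice d (fun μ => D.num d x μ) := by
  unfold num
  refine ((nice_detMat hd).mul (nice_evalAt hd x 1 0)).add (nice_sum _ fun p _ => Nice.mul ?_
    (nice_evalAt hd x _ _))
  simp only [Matrix.mulVec, dotProduct]
  exact nice_sum _ fun q _ => (nice_adjugate (D.nice_Mat hd) p q).mul (D.nice_vec hd q)

theorem sol_eq_evalAt (hdet : (D.Mat d μ).det ≠ 0) (h : D.Mat d μ *ᵥ φ = D.vec d μ) :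
    D.sol d x μ = D.evalAt d x μ 1 φ := by
  have h1 : (D.Mat d μ).adjugate *ᵥ D.vec d μ = (D.Mat d μ).det • φ := by
    rw [← h, Matrix.mulVec_mulVec, Matrix.adjugate_mul, Matrix.smul_mulVec, Matrix.one_mulVec]
  rw [sol, num, h1, D.evalAt_eq d x μ 1 φ, div_eq_iff hdet]
  simp only [Pi.smul_apply, smul_eq_mul, mul_assoc, ← Finset.mul_sum]
  ring

theorem exists_globalSol_one (hd : IsDir d) (hμ : (μ * d).im ≤ 0) (hμ0 : μ ≠ 0)
    (hdet : (D.Mat d μ).det ≠ 0) : ∃ (φ : Fin P → ℂ) (w : ℂ → ℂ), D.Mat d μ *ᵥ φ = D.vec d μ ∧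
      D.GlobalSol μ 1 φ w ∧ EqOn w (D.wsol d μ 1 φ) D.Gd ∧ ∀ x ∈ closedUpper, w x = D.sol d x μ := by
  have h : D.Mat d μ *ᵥ ((D.Mat d μ)⁻¹ *ᵥ D.vec d μ) = D.vec d μ := by
    rw [Matrix.mulVec_mulVec, Matrix.mul_nonsing_inv _ (isUnit_iff_ne_zero.mpr hdet), Matrix.one_mulVec]
  obtain ⟨w, hw, he⟩ := exists_globalSol_of_mulVec (w₀ := 1) hd hμ hμ0 (by rw [h, one_smul])
  exact ⟨_, w, h, hw, he, fun x hx => by rw [hw.eq_evalAt he hx, sol_eq_evalAt hdet h]⟩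

/-- Both sides are values of solutions tending to 1 at infinity. Their difference solves the problem
with `w₀ = 0` and decays, hence vanishes for nonreal `μ`. -/
theorem sol_eq_sol {d' : ℂ} (hd : IsDir d) (hd' : IsDir d') (hμ : (μ * d).im < 0)
    (hμ' : (μ * d').im < 0) (him : μ.im ≠ 0) (hx : x ∈ closedUpper) : D.sol d x μ = D.sol d' x μ := by
  obtain ⟨φ, w, -, hw, he, hs⟩ := exists_globalSol_one (D := D) hd hμ.le (ne_zero_of_strict hμ)
    (det_ne_zero_of_ker fun φ => ker_eq_zero_of_im_ne_zero hd hμ him)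
  obtain ⟨φ', w', -, hw', he', hs'⟩ := exists_globalSol_one (D := D) hd' hμ'.le (ne_zero_of_strict hμ')
    (det_ne_zero_of_ker fun φ => ker_eq_zero_of_im_ne_zero hd' hμ' him)
  have h := hw.sub hw'
  rw [sub_self] at h
  have ht := (tendsto_wsol hd hμ he).sub (tendsto_wsol hd' hμ' he')
  rw [sub_self] at ht
  rw [← hs x hx, ← hs' x hx]
  exact sub_eq_zero.mp (h.eqOn_zero_of_im_ne_zero ht him (D.closedUpper_subset_dom hx))

theorem det_ne_zero_of_im_ne_zero (hd : IsDir d) (hμ : (μ * d).im < 0) (him : μ.im ≠ 0) :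
    (D.Mat d μ).det ≠ 0 := det_ne_zero_of_ker fun _ => ker_eq_zero_of_im_ne_zero hd hμ him

theorem det_ne_zero_of_pos {lam : ℝ} (hl : 0 < lam) : (D.Mat (-1) lam).det ≠ 0 :=
  det_ne_zero_of_ker fun _ => ker_eq_zero_of_pos hl

theorem det_ne_zero_of_neg {lam : ℝ} (hl : lam < 0) (h : lam ∉ eigenvalues D.ε D.c D.z) :
    (D.Mat I lam).det ≠ 0 := by
  refine det_ne_zero_of_ker fun φ hφ => ?_
  by_contra h0
  exact h (mem_eigenvalues_iff.mpr ⟨hl, φ, h0, hφ⟩)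

variable (D) in
/-- The Jost solution as a function of the spectral parameter in the cut plane. -/
def jostW (x μ : ℂ) : ℂ :=
  if 0 < μ.im then D.sol (-1) x μ else if μ.im < 0 then D.sol 1 x μ else D.sol I x μ

theorem jostW_of_pos (hμ : 0 < μ.im) : D.jostW x μ = D.sol (-1) x μ := by rw [jostW, if_pos hμ]
theorem jostW_of_neg (hμ : μ.im < 0) : D.jostW x μ = D.sol 1 x μ := by
  rw [jostW, if_neg hμ.not_gt, if_pos hμ]

/-- In the left half-plane the direction `I` alone describes the function, so it continues across
the negative half-line. -/
theorem jostW_of_re_neg (hx : x ∈ closedUpper) (hμ : μ.re < 0) : D.jostW x μ = D.sol I x μ := by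
  have hI : (μ * I).im < 0 := by simpa using hμ
  rcases lt_trichotomy μ.im 0 with h | h | h
  · rw [jostW_of_neg h]
    exact sol_eq_sol (Or.inr (Or.inl rfl)) (Or.inl rfl) (by simpa using h) hI h.ne hx
  · rw [jostW, if_neg (by simp [h]), if_neg (by simp [h])]
  · rw [jostW_of_pos h]
    exact sol_eq_sol (Or.inr (Or.inr rfl)) (Or.inl rfl) (by simpa using h) hI h.ne' hx

theorem analyticAt_sol (hd : IsDir d) (hμ : (μ * d).im < 0) (hdet : (D.Mat d μ).det ≠ 0) :
    AnalyticAt ℂ (D.sol d x) μ := by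
  have hO := (isOpen_region d).mem_nhds hμ
  exact ((nice_num hd x).1.analyticAt hO).div ((nice_detMat hd).1.analyticAt hO) hdet

theorem analyticAt_jostW_of_im_ne_zero (hμ : μ.im ≠ 0) : AnalyticAt ℂ (D.jostW x) μ := by
  rcases hμ.lt_or_gt with h | h
  · have hd : IsDir 1 := Or.inr (Or.inl rfl)
    have hs : (μ * 1).im < 0 := by simpa using h
    refine (analyticAt_sol (D := D) (x := x) hd hs (det_ne_zero_of_im_ne_zero hd hs hμ)).congr ?_
    filter_upwards [(isOpen_lt continuous_im continuous_const).mem_nhds h] with ν hν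
    exact (jostW_of_neg hν).symm
  · have hd : IsDir (-1) := Or.inr (Or.inr rfl)
    have hs : (μ * (-1)).im < 0 := by simpa using h
    refine (analyticAt_sol (D := D) (x := x) hd hs (det_ne_zero_of_im_ne_zero hd hs hμ)).congr ?_
    filter_upwards [(isOpen_lt continuous_const continuous_im).mem_nhds h] with ν hν
    exact (jostW_of_pos hν).symm

theorem jostW_eventuallyEq (hx : x ∈ closedUpper) (hμ : μ.re < 0) :
    D.jostW x =ᶠ[𝓝 μ] D.sol I x := by
  filter_upwards [(isOpen_lt continuous_re continuous_const).mem_nhds hμ] with ν hν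
  exact jostW_of_re_neg hx hν

theorem meromorphicOn_jostW (hx : x ∈ closedUpper) : MeromorphicOn (D.jostW x) cutPlane := by
  intro μ hμ
  by_cases him : μ.im = 0
  · have hre : μ.re < 0 := hμ.resolve_left (not_not.mpr him)
    have hI : (μ * I).im < 0 := by simpa using hre
    have hO := (isOpen_region I).mem_nhds hI
    have h1 := ((nice_num (D := D) (Or.inl rfl) x).1.analyticAt hO).meromorphicAt.div
      ((nice_detMat (D := D) (Or.inl rfl)).1.analyticAt hO).meromorphicAt
    exact h1.congr ((jostW_eventuallyEq hx hre).symm.filter_mono nhdsWithin_le_nhds)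
  · exact (analyticAt_jostW_of_im_ne_zero him).meromorphicAt

theorem analyticAt_jostW (hx : x ∈ closedUpper) (hμ : μ ∈ cutPlane)
    (h : ∀ lam ∈ eigenvalues D.ε D.c D.z, (lam : ℂ) ≠ μ) : AnalyticAt ℂ (D.jostW x) μ := by
  by_cases him : μ.im = 0
  · have hre : μ.re < 0 := hμ.resolve_left (not_not.mpr him)
    have hI : (μ * I).im < 0 := by simpa using hre
    have e : ((μ.re : ℝ) : ℂ) = μ := Complex.ext rfl (by simp [him])
    have hdet := det_ne_zero_of_neg (D := D) hre fun h' => h _ h' e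
    rw [e] at hdet
    exact (analyticAt_sol (Or.inl rfl) hI hdet).congr (jostW_eventuallyEq hx hre).symm
  · exact analyticAt_jostW_of_im_ne_zero him

theorem exists_jost {lam : ℝ} (hl : 0 < lam) : ∃ w : ℂ → ℂ, IsJostM D.ε D.c D.z lam w ∧
    ∀ x ∈ closedUpper, w x = D.sol (-1) x lam := by
  obtain ⟨φ, w, -, hw, he, hs⟩ := exists_globalSol_one (D := D) (d := -1) (μ := lam)
    (Or.inr (Or.inr rfl)) (by simp) (by exact_mod_cast hl.ne') (det_ne_zero_of_pos hl)
  exact ⟨w, hw.isJostM hl he, hs⟩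

/-- The numerator and the determinant for `d = -1` are continuous up to the positive half-line, and
the determinant does not vanish there. -/
theorem tendsto_jostW {lam : ℝ} (hl : 0 < lam) :
    Tendsto (D.jostW x) (𝓝[{μ : ℂ | 0 < μ.im}] (lam : ℂ)) (𝓝 (D.sol (-1) x lam)) := by
  have hd : IsDir (-1) := Or.inr (Or.inr rfl)
  have hmem : (lam : ℂ) ∈ {μ : ℂ | (μ * (-1)).im ≤ 0 ∧ μ ≠ 0} :=
    ⟨by simp, by exact_mod_cast hl.ne'⟩
  have h1 : ContinuousWithinAt (D.sol (-1) x) {μ : ℂ | (μ * (-1)).im ≤ 0 ∧ μ ≠ 0} lam :=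
    ((nice_num hd x).2 _ hmem).div ((nice_detMat hd).2 _ hmem) (det_ne_zero_of_pos hl)
  have h2 : {μ : ℂ | 0 < μ.im} ⊆ {μ : ℂ | (μ * (-1)).im ≤ 0 ∧ μ ≠ 0} := fun μ (hμ : 0 < μ.im) =>
    ⟨by simpa using hμ.le, fun h => by simp [h] at hμ⟩
  refine (h1.mono h2).tendsto.congr' ?_
  filter_upwards [self_mem_nhdsWithin] with μ hμ
  exact (jostW_of_pos hμ).symm

end Datum
end BOScattering
end

/-! ### Differentiation in the spectral parameter -/

noncomputable section
namespace BOScattering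
namespace Datum
variable {P : ℕ} {D : Datum P} {d μ w₀ v₀ : ℂ} {φ ψ : Fin P → ℂ} {w v : ℂ → ℂ} {x : ℂ}

variable (D) in
/-- The coefficients multiplied by the poles. -/
def zmul (φ : Fin P → ℂ) : Fin P → ℂ := fun p => D.z p * φ p

/-- Differentiating the integrating factor in `μ` multiplies the integrand by `y`. Division with
remainder turns the product into a source with data `((∑ φₚ)/μ, zφ)`, so that derivatives are again
solutions of the same family. -/
theorem mul_src {y : ℂ} (hμ : μ ≠ 0) (h : ∀ p, y ≠ D.z p) (φ : Fin P → ℂ) :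
    y * D.src 0 0 φ y = D.src μ ((∑ p, φ p) / μ) (D.zmul φ) y := by
  simp only [src, mul_zero, zero_add, zmul]
  rw [mul_div_cancel₀ _ hμ, Finset.mul_sum, ← Finset.sum_add_distrib]
  refine Finset.sum_congr rfl fun p _ => ?_
  have := sub_ne_zero.mpr (h p)
  field_simp
  ring

theorem src_zero (μ : ℂ) (φ : Fin P → ℂ) : D.src μ 0 φ = D.src 0 0 φ := by
  funext y; simp [src]

theorem hasDerivAt_fac_param (L : ℂ → ℂ) (y μ : ℂ) :
    HasDerivAt (fun μ => D.fac L μ y) (-(I / D.ε) * y * D.fac L μ y) μ := by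
  have := (((hasDerivAt_id μ).mul_const y).add_const (L y)).const_mul (-(I / D.ε))
  refine this.cexp.congr_deriv ?_
  simp [fac]
  ring

theorem hasDerivAt_tailInt_param {L : ℂ → ℂ} (hL : D.RayPrimitive L x) (hx : x ∈ D.Gd) (hμ : μ.re < 0)
    (φ : Fin P → ℂ) : HasDerivAt (fun μ => tailInt (fun y => D.fac L μ y * D.src 0 0 φ y) I x)
      (-(I / D.ε) * tailInt (fun y => D.fac L μ y
        * D.src μ ((∑ p, φ p) / μ) (D.zmul φ) y) I x) μ := by
  have hμ0 : μ ≠ 0 := by rintro rfl; simp at hμ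
  obtain ⟨C, hC, hf⟩ := D.ray_fac_le hL
  obtain ⟨K, hK, hs⟩ := D.exists_ray_bound_src hx 0 0 φ
  have hε := D.hε
  -- This radius keeps the ball in `Re ν ≤ -r`, where the exponential decay along the ray is
  -- uniform.
  set r : ℝ := -μ.re / 2 with hr
  have hr0 : 0 < r := by rw [hr]; linarith
  have hre : ∀ ν ∈ Metric.ball μ r, ν.re ≤ -r := fun ν hν => by
    have h1 := (abs_re_le_norm (ν - μ)).trans_lt (mem_ball_iff_norm.mp hν)
    rw [sub_re, abs_lt] at h1
    linarith [h1.2]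
  have hnorm : ∀ ν ∈ Metric.ball μ r, ‖ν‖ ≤ ‖μ‖ + r := fun ν hν => by
    have h1 := mem_ball_iff_norm.mp hν
    linarith [norm_sub_norm_le ν μ]
  have hκ : -r / D.ε < 0 := div_neg_of_neg_of_pos (by linarith) hε
  have hsc : ContinuousOn (fun t : ℝ => D.src 0 0 φ (x + t * I)) (Ici 0) :=
    continuousOn_ray fun t ht => D.continuousAt_src_ray hx 0 0 φ t ht
  have hfc : ∀ ν, ContinuousOn (fun t : ℝ => D.fac L ν (x + t * I)) (Ici 0) := fun ν =>
    continuousOn_ray fun t ht => (D.hasDerivAt_fac (hL.deriv t ht) ν).continuousAt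
  have key := (hasDerivAt_integral_of_holomorphic (ν := volume.restrict (Ioi (0:ℝ)))
    (F := fun ν t => D.fac L ν (x + t * I) * D.src 0 0 φ (x + t * I) * I) (x₀ := μ) hr0
    (bound := fun t => C * Real.exp ((‖μ‖ + r) * ‖x‖ / D.ε) * Real.exp (-r / D.ε * t) * K)
    (((integrableOn_exp_mul_Ioi hκ 0).const_mul _).mul_const K) (fun ν _ => ?_)
    (Eventually.of_forall fun t => ?_) ((ae_restrict_iff' measurableSet_Ioi).mpr
      (Eventually.of_forall fun t ht ν hν => ?_))).2
  · refine key.congr_deriv ?_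
    rw [tailInt, ← integral_const_mul]
    refine setIntegral_congr_fun measurableSet_Ioi fun t ht => ?_
    have hd := ((hasDerivAt_fac_param (D := D) L (x + t * I) μ).mul_const
      (D.src 0 0 φ (x + t * I))).mul_const I
    have hne : ∀ p, x + t * I ≠ D.z p := D.ne_pole_of_mem_Gd (D.add_mem_Gd hx (le_of_lt ht))
    rw [hd.deriv, ← mul_src hμ0 hne]
    ring
  · exact (((hfc ν).mul hsc).mul continuousOn_const |>.mono Ioi_subset_Ici_self).aestronglyMeasurable
      measurableSet_Ioi
  · exact (((D.differentiable_fac_param L _).mul_const _).mul_const _).differentiableOn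
  · have ht0 : (0:ℝ) ≤ t := le_of_lt ht
    rw [norm_mul, norm_I, mul_one, norm_mul]
    refine mul_le_mul ((hf ν t ht0).trans ?_) (hs t ht0) (norm_nonneg _) (by positivity)
    have h1 := hnorm ν hν
    have h2 := hre ν hν
    gcongr

theorem hasDerivAt_fac_mul_wsol {L : ℂ → ℂ} (hL : D.RayPrimitive L x) (hx : x ∈ D.Gd) (hμ : μ.re < 0)
    (φ : Fin P → ℂ) : HasDerivAt (fun μ => D.fac L μ x * D.wsol I μ 0 φ x)
      (-(I / D.ε) * (D.fac L μ x * D.wsol I μ ((∑ p, φ p) / μ) (D.zmul φ) x)) μ := by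
  rw [D.fac_mul_wsol hL hx hμ]
  refine (((hasDerivAt_tailInt_param hL hx hμ φ).const_mul (I / D.ε)).congr_of_eventuallyEq ?_).congr_deriv
    (by ring)
  filter_upwards [(isOpen_lt continuous_re continuous_const).mem_nhds hμ] with ν hν
  rw [D.fac_mul_wsol hL hx hν, src_zero]

theorem pathInt_congr {k k' : ℂ → ℂ} (h : ∀ y, (∀ p, y ≠ D.z p) → k y = k' y)
    (hx : ∀ t ∈ uIcc 0 x.im, t ≠ x.im → ∀ p, (x.re : ℂ) + t * I ≠ D.z p) :
    D.pathInt k x = D.pathInt k' x := by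
  rw [pathInt, pathInt]
  congr 1
  · exact intervalIntegral.integral_congr fun t _ => h _ (D.ofReal_ne_pole t)
  · refine intervalIntegral.integral_congr_ae (ae_ne_end fun t ht hne => ?_)
    rw [h _ (hx t ht hne)]

theorem hasDerivAt_pathInt (hr : ∀ μ w₀ φ, D.PathReg (D.src μ w₀ φ) x)
    (hx : ∀ t ∈ uIcc 0 x.im, t ≠ x.im → ∀ p, (x.re : ℂ) + t * I ≠ D.z p) (hμ : μ ≠ 0)
    (φ : Fin P → ℂ) : HasDerivAt (fun μ => D.pathInt (fun y => D.Eu μ y * D.src 0 0 φ y) x)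
      (-(I / D.ε) * D.pathInt (fun y => D.Eu μ y
        * D.src μ ((∑ p, φ p) / μ) (D.zmul φ) y) x) μ := by
  refine ((hr 0 0 φ).hasDerivAt μ).congr_deriv ?_
  rw [← D.pathInt_smul]
  refine pathInt_congr (fun y hy => ?_) hx
  rw [← mul_src hμ hy]
  ring

theorem ne_pole_vert (hx : x ∈ D.Gu) : ∀ t ∈ uIcc 0 x.im, t ≠ x.im → ∀ p, (x.re : ℂ) + t * I ≠ D.z p :=
  fun _ ht _ => D.ne_pole_of_mem_Gu (D.vert_mem_Gu hx ht)

theorem ne_pole_vert_pole (m : Fin P) : ∀ t ∈ uIcc 0 (D.z m).im, t ≠ (D.z m).im → ∀ p,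
    ((D.z m).re : ℂ) + t * I ≠ D.z p := by
  intro t _ hne p h
  have h1 : (D.z m).re = (D.z p).re := by simpa using congrArg Complex.re h
  rw [← D.hre.injective h1] at h
  exact D.vert_ne_pole m hne h

theorem rayPrimitive_a (i : Fin (P + 1)) : D.RayPrimitive (f D.c D.z) (D.a i) :=
  D.rayPrimitive_f (D.a_ne_re i)

theorem hasDerivAt_row (hμ : μ.re < 0) (φ : Fin P → ℂ) (m : Fin P) :
    HasDerivAt (fun μ => D.row I μ 0 φ m)
      (-(I / D.ε) * D.row I μ ((∑ p, φ p) / μ) (D.zmul φ) m) μ := by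
  have hμ0 : μ ≠ 0 := by rintro rfl; simp at hμ
  have ha : ∀ i, HasDerivAt (fun μ => D.Eu μ (D.a i) * D.wsol I μ 0 φ (D.a i))
      (-(I / D.ε) * (D.Eu μ (D.a i) * D.wsol I μ ((∑ p, φ p) / μ) (D.zmul φ) (D.a i))) μ := fun i =>
    hasDerivAt_fac_mul_wsol (rayPrimitive_a i) (D.a_mem_Gd i) hμ φ
  by_cases h : D.IsNeg m
  · simp only [D.row_of_isNeg h, src_zero]
    have hp := hasDerivAt_pathInt (D.pathReg_src_of_isNeg h) (ne_pole_vert_pole m) hμ0 φ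
    exact ((ha 0).neg.add (hp.const_mul _)).congr_deriv (by ring)
  · simp only [D.row_of_not_isNeg h, src_zero]
    have hp := hasDerivAt_pathInt (D.pathReg_src_of_mem (D.ofReal_mem_Gu (D.a m.succ)))
      (ne_pole_vert (D.ofReal_mem_Gu (D.a m.succ))) hμ0 φ
    simp only [pathInt_ofReal] at hp
    exact (((ha 0).neg.add (hp.const_mul _)).add (ha m.succ)).congr_deriv (by ring)

theorem hasDerivAt_mulVec (hμ : μ.re < 0) (φ : Fin P → ℂ) (m : Fin P) :
    HasDerivAt (fun μ => (D.Mat I μ *ᵥ φ) m)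
      (-(I / D.ε) * ((D.Mat I μ *ᵥ D.zmul φ) m - (∑ p, φ p) / μ * D.vec I μ m)) μ := by
  have := hasDerivAt_row (D := D) hμ φ m
  simpa only [D.row_eq, zero_mul, sub_zero] using this

/-- Removes the integrating factor, whose own derivative in `μ` supplies the term with `x`. -/
theorem hasDerivAt_of_fac_mul {L B : ℂ → ℂ} {A : ℂ}
    (h : HasDerivAt (fun μ => D.fac L μ x * B μ) (-(I / D.ε) * (D.fac L μ x * A)) μ) :
    HasDerivAt B ((I / D.ε) * (x * B μ - A)) μ := by
  have hne : ∀ ν, D.fac L ν x ≠ 0 := fun ν => D.fac_ne_zero L ν x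
  have := h.div (hasDerivAt_fac_param L x μ) (hne μ)
  refine (this.congr_of_eventuallyEq (Eventually.of_forall fun ν => ?_)).congr_deriv ?_
  · have := hne ν
    simp only [Pi.div_apply]
    field_simp
  · have := hne μ
    field_simp
    ring

theorem hasDerivAt_evalAt (hμ : μ.re < 0) (hx : x ∈ closedUpper) (φ : Fin P → ℂ) :
    HasDerivAt (fun μ => D.evalAt I x μ 0 φ)
      ((I / D.ε) * (x * D.evalAt I x μ 0 φ - D.evalAt I x μ ((∑ p, φ p) / μ) (D.zmul φ))) μ := by
  have hμ0 : μ ≠ 0 := by rintro rfl; simp at hμ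
  by_cases h1 : x ∈ D.Gd
  · simp only [evalAt_of_mem_Gd h1]
    exact hasDerivAt_of_fac_mul (hasDerivAt_fac_mul_wsol (D.rayPrimitive_Ld h1) h1 hμ φ)
  · rcases (mem_Gd_or_mem_Gu (D := D) hx).resolve_left h1 with h2 | ⟨p, rfl⟩
    · refine hasDerivAt_of_fac_mul (L := f D.c D.z) ?_
      have e : ∀ ν v₀ ψ, D.fac (f D.c D.z) ν x * D.evalAt I x ν v₀ ψ
          = D.Eu ν (D.a 0) * D.wsol I ν v₀ ψ (D.a 0)
            - (I / D.ε) * D.pathInt (fun y => D.Eu ν y * D.src ν v₀ ψ y) x := fun ν v₀ ψ => by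
        rw [evalAt_of_mem_Gu h1 h2, ← mul_assoc, Eu, mul_inv_cancel₀ (D.fac_ne_zero _ _ _), one_mul]
      simp only [e, src_zero]
      have ha := hasDerivAt_fac_mul_wsol (rayPrimitive_a (D := D) 0) (D.a_mem_Gd 0) hμ φ
      have hp := hasDerivAt_pathInt (D.pathReg_src_of_mem h2) (ne_pole_vert h2) hμ0 φ
      exact (ha.sub (hp.const_mul _)).congr_deriv (by rw [Eu]; ring)
    -- At a pole the value `φₚ/cₚ` does not depend on `μ`, and the two terms of the formula cancel
    -- because `zmul` multiplies by the pole itself.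
    · simp only [evalAt_pole]
      refine (hasDerivAt_const _ _).congr_deriv ?_
      rw [zmul]
      ring

end Datum
end BOScattering
end

/-! ### The algebra of the Laurent coefficients -/

noncomputable section
namespace BOScattering

theorem analyticAt_dslope {f : ℂ → ℂ} {a : ℂ} (hf : AnalyticAt ℂ f a) :
    AnalyticAt ℂ (dslope f a) a := by
  obtain ⟨s, hs, hd⟩ := hf.exists_mem_nhds_analyticOnNhd
  exact ((Complex.differentiableOn_dslope hs).mpr hd.differentiableOn).analyticAt hs

theorem eq_add_mul_dslope (f : ℂ → ℂ) (a x : ℂ) : f x = f a + (x - a) * dslope f a x := by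
  have := sub_smul_dslope f a x
  rw [smul_eq_mul] at this
  rw [this]; ring

theorem deriv_dslope {f : ℂ → ℂ} {a : ℂ} (hf : AnalyticAt ℂ f a) :
    deriv (dslope f a) a = deriv (deriv f) a / 2 := by
  have hg := analyticAt_dslope hf
  have h1 : deriv f =ᶠ[𝓝 a] fun x => dslope f a x + (x - a) * deriv (dslope f a) x := by
    filter_upwards [hg.eventually_analyticAt] with x hx
    have h2 : HasDerivAt (fun x => f a + (x - a) * dslope f a x)
        (1 * dslope f a x + (x - a) * deriv (dslope f a) x) x :=
      (((hasDerivAt_id x).sub_const a).mul hx.differentiableAt.hasDerivAt).const_add _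
    rw [one_mul] at h2
    rw [← h2.deriv]
    congr 1
    funext y
    exact eq_add_mul_dslope f a y
  rw [h1.deriv_eq]
  have h3 : HasDerivAt (fun x => dslope f a x + (x - a) * deriv (dslope f a) x)
      (deriv (dslope f a) a + (1 * deriv (dslope f a) a + (a - a) * deriv (deriv (dslope f a)) a)) a :=
    hg.differentiableAt.hasDerivAt.add
      (((hasDerivAt_id a).sub_const a).mul hg.deriv.differentiableAt.hasDerivAt)
  rw [h3.deriv]
  ring

/-- The Laurent expansion of a quotient with a simple pole. -/
theorem isBigO_inv_mul_sub {q : ℂ → ℂ} {a : ℂ} (hq : AnalyticAt ℂ q a) :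
    (fun x => (x - a)⁻¹ * q x - (q a / (x - a) + deriv q a)) =O[𝓝[≠] a] fun x => x - a := by
  have h1 := analyticAt_dslope hq
  have h2 := analyticAt_dslope h1
  have e : (fun x => (x - a)⁻¹ * q x - (q a / (x - a) + deriv q a)) =ᶠ[𝓝[≠] a]
      fun x => (x - a) * dslope (dslope q a) a x := by
    filter_upwards [self_mem_nhdsWithin] with x hx
    have hx' : x - a ≠ 0 := sub_ne_zero.mpr hx
    have e1 := eq_add_mul_dslope q a x
    have e2 := eq_add_mul_dslope (dslope q a) a x
    rw [dslope_same] at e2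
    rw [e1, e2]
    field_simp
    ring
  refine e.trans_isBigO ?_
  have h3 : (fun x => dslope (dslope q a) a x) =O[𝓝[≠] a] fun _ => (1:ℂ) :=
    (h2.continuousAt.tendsto.mono_left nhdsWithin_le_nhds).isBigO_one ℂ
  simpa using (Asymptotics.isBigO_refl (fun x : ℂ => x - a) (𝓝[≠] a)).mul h3

/-- With `τ = (x - a) g` and `g` the difference quotient of `τ`, one has `g a = τ'` and `g' a =
τ''/2`, and `q = (x - a) α + B/g`. -/
theorem exists_laurent {α B τ : ℂ → ℂ} {a : ℂ} (hα : AnalyticAt ℂ α a) (hB : AnalyticAt ℂ B a)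
    (hτ : AnalyticAt ℂ τ a) (h0 : τ a = 0) (h1 : deriv τ a ≠ 0) : ∃ q : ℂ → ℂ, AnalyticAt ℂ q a ∧
      q a = B a / deriv τ a ∧ deriv q a = α a + deriv B a / deriv τ a
        - B a * deriv (deriv τ) a / (2 * deriv τ a ^ 2) ∧
      ∀ᶠ x in 𝓝[≠] a, α x + B x / τ x = (x - a)⁻¹ * q x := by
  have hg := analyticAt_dslope hτ
  have hg0 : dslope τ a a ≠ 0 := by rwa [dslope_same]
  refine ⟨fun x => (x - a) * α x + B x / dslope τ a x, ?_, ?_, ?_, ?_⟩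
  · exact ((analyticAt_id.sub analyticAt_const).mul hα).add (hB.div hg hg0)
  · simp [dslope_same]
  · have := (((hasDerivAt_id a).sub_const a).mul hα.differentiableAt.hasDerivAt).add
      (hB.differentiableAt.hasDerivAt.div hg.differentiableAt.hasDerivAt hg0)
    rw [deriv_dslope hτ, dslope_same] at this
    refine this.deriv.trans ?_
    simp only [id]
    field_simp
    ring
  · have hne : ∀ᶠ x in 𝓝[≠] a, dslope τ a x ≠ 0 :=
      nhdsWithin_le_nhds (hg.continuousAt.eventually_ne hg0)
    filter_upwards [hne, self_mem_nhdsWithin] with x hx hxa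
    have hx' : x - a ≠ 0 := sub_ne_zero.mpr hxa
    rw [eq_add_mul_dslope τ a x, h0, zero_add]
    field_simp

/-- In the application `r` is a left null vector times the matrix, `β` its product with the
right-hand side, and `ψ` the perturbed solution. The identity `∑ rₚψₚ = τβ` is differentiated twice
at `a`. As `r` vanishes there and its derivative is the same for all `p`, the derivatives of `ψ`
enter only through their sum, which is `-τ'`. -/
theorem deriv_one_sub_sum {ι : Type*} [Fintype ι] {a e : ℂ} {r ψ : ι → ℂ → ℂ} {z : ι → ℂ} {β τ : ℂ → ℂ}
    (he : e ≠ 0) (ha : a ≠ 0)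
    (hψ : ∀ p, AnalyticAt ℂ (ψ p) a) (hβ : AnalyticAt ℂ β a) (hτ : AnalyticAt ℂ τ a)
    (hr : ∀ p, ∀ᶠ x in 𝓝 a, HasDerivAt (r p) (-(I / e) * (z p * r p x - β x / x)) x)
    (hr0 : ∀ p, r p a = 0) (hI : ∀ᶠ x in 𝓝 a, ∑ p, r p x * ψ p x = τ x * β x)
    (hσ : ∀ᶠ x in 𝓝 a, ∑ p, ψ p x = 1 - τ x) (h0 : τ a = 0) (hβ0 : β a ≠ 0) :
    deriv τ a = I / (e * a) ∧ deriv (deriv τ) a = deriv τ a * (-(I / e) * ∑ p, z p * ψ p a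
      - 2 * deriv τ a - deriv β a / β a - 1 / a) := by
  have ev : ∀ᶠ x in 𝓝 a, x ≠ 0 ∧ (∀ p, AnalyticAt ℂ (ψ p) x) ∧ AnalyticAt ℂ β x ∧ AnalyticAt ℂ τ x ∧
      (∀ p, HasDerivAt (r p) (-(I / e) * (z p * r p x - β x / x)) x) ∧ ∑ p, ψ p x = 1 - τ x :=
    (eventually_ne_nhds ha).and ((eventually_all.mpr fun p => (hψ p).eventually_analyticAt).and
      (hβ.eventually_analyticAt.and (hτ.eventually_analyticAt.and ((eventually_all.mpr hr).and hσ))))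
  -- The first derivative of the identity holds near `a`, not only at `a`, so that it can be
  -- differentiated again; `∑ ψₚ = 1 - τ` has been inserted.
  have first : ∀ᶠ x in 𝓝 a, ∑ p, (-(I / e) * (z p * r p x * ψ p x) + r p x * deriv (ψ p) x)
      + (I / e) * ((1 - τ x) * β x / x) = deriv τ x * β x + τ x * deriv β x := by
    have hd : ∀ᶠ x in 𝓝 a, (fun x => ∑ p, r p x * ψ p x) =ᶠ[𝓝 x] fun x => τ x * β x :=
      Filter.EventuallyEq.eventuallyEq_nhds hI
    filter_upwards [ev, hd] with x ⟨hx0, hx1, hx2, hx3, hx4, hx5⟩ hx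
    have e1 : HasDerivAt (fun x => ∑ p, r p x * ψ p x) (∑ p, (-(I / e) * (z p * r p x - β x / x) * ψ p x
        + r p x * deriv (ψ p) x)) x :=
      HasDerivAt.fun_sum fun p _ => (hx4 p).mul (hx1 p).differentiableAt.hasDerivAt
    have e2 : HasDerivAt (fun x => τ x * β x) (deriv τ x * β x + τ x * deriv β x) x :=
      hx3.differentiableAt.hasDerivAt.mul hx2.differentiableAt.hasDerivAt
    rw [e2.unique (e1.congr_of_eventuallyEq hx.symm), ← hx5]
    simp only [Finset.sum_mul, Finset.sum_div, Finset.mul_sum, ← Finset.sum_add_distrib]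
    refine Finset.sum_congr rfl fun p _ => ?_
    ring
  have d1 : deriv τ a = I / (e * a) := by
    have := first.self_of_nhds
    simp only [hr0, h0, mul_zero, zero_mul, add_zero, Finset.sum_const_zero, zero_add, sub_zero,
      one_mul] at this
    have h2 : (deriv τ a - I / (e * a)) * β a = 0 := by
      rw [sub_mul, ← this]
      field_simp
      ring
    exact sub_eq_zero.mp ((mul_eq_zero.mp h2).resolve_right hβ0)
  refine ⟨d1, ?_⟩
  obtain ⟨-, -, -, -, hra, -⟩ := ev.self_of_nhds
  have hr1 : ∀ p, HasDerivAt (r p) ((I / e) * (β a / a)) a := fun p => by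
    refine (hra p).congr_deriv ?_
    rw [hr0]; ring
  have hψ1 : ∀ p, HasDerivAt (ψ p) (deriv (ψ p) a) a := fun p => (hψ p).differentiableAt.hasDerivAt
  have hψ2 : ∀ p, HasDerivAt (deriv (ψ p)) (deriv (deriv (ψ p)) a) a := fun p =>
    (hψ p).deriv.differentiableAt.hasDerivAt
  have hτ1 := hτ.differentiableAt.hasDerivAt
  have hβ1 := hβ.differentiableAt.hasDerivAt
  have e1 : HasDerivAt (fun x => ∑ p, (-(I / e) * (z p * r p x * ψ p x) + r p x * deriv (ψ p) x)
      + (I / e) * ((1 - τ x) * β x / x)) (∑ p, (-(I / e) * ((z p * ((I / e) * (β a / a))) * ψ p a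
        + z p * r p a * deriv (ψ p) a) + ((I / e) * (β a / a) * deriv (ψ p) a
        + r p a * deriv (deriv (ψ p)) a)) + (I / e) * (((-deriv τ a * β a + (1 - τ a) * deriv β a) * a
        - (1 - τ a) * β a * 1) / a ^ 2)) a := by
    refine (HasDerivAt.fun_sum fun p _ => ?_).add ((((hτ1.const_sub 1).mul hβ1).div
      (hasDerivAt_id a) ha).const_mul _)
    exact ((((hr1 p).const_mul (z p)).mul (hψ1 p)).const_mul _).add ((hr1 p).mul (hψ2 p))
  have e2 : HasDerivAt (fun x => deriv τ x * β x + τ x * deriv β x)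
      (deriv (deriv τ) a * β a + deriv τ a * deriv β a + (deriv τ a * deriv β a
        + τ a * deriv (deriv β) a)) a :=
    (hτ.deriv.differentiableAt.hasDerivAt.mul hβ1).add
      (hτ1.mul hβ.deriv.differentiableAt.hasDerivAt)
  have key := (e1.congr_of_eventuallyEq (first.mono fun x hx => hx.symm)).unique e2
  have hσ1 : ∑ p, deriv (ψ p) a = -deriv τ a := by
    have e3 : HasDerivAt (fun x => ∑ p, ψ p x) (∑ p, deriv (ψ p) a) a :=
      HasDerivAt.fun_sum fun p _ => hψ1 p
    exact (e3.congr_of_eventuallyEq (hσ.mono fun x hx => hx.symm)).unique (hτ1.const_sub 1)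
  simp only [hr0, h0, mul_zero, zero_mul, add_zero, sub_zero, one_mul, mul_one,
    Finset.sum_add_distrib, ← Finset.mul_sum, hσ1] at key
  have hs : ∑ p, z p * (I / e * (β a / a)) * ψ p a = (I / e * (β a / a)) * ∑ p, z p * ψ p a := by
    rw [Finset.mul_sum]
    exact Finset.sum_congr rfl fun p _ => by ring
  rw [hs] at key
  have hi : I / e = deriv τ a * a := by rw [d1]; field_simp
  rw [hi] at key ⊢
  field_simp at key ⊢
  linear_combination -key

end BOScattering
end

/-! ### The matrix of the statement and its rank-one perturbation -/

noncomputable section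
namespace BOScattering
namespace Datum
variable {P : ℕ} {D : Datum P} {μ : ℂ} {φ ψ m : Fin P → ℂ} {w : ℂ → ℂ} {x : ℂ} {lam : ℝ}

/-! ### Comparison with `matA` and `vecb` -/

theorem rayInt_smul (k : ℂ) (g : ℂ → ℂ) (s : ℝ) : rayInt (fun y => k * g y) s = k * rayInt g s := by
  simp only [rayInt, mul_assoc, integral_const_mul]

theorem CInt_smul (k : ℂ) (g : ℂ → ℂ) (i : Fin P) :
    CInt D.ε D.c D.z D.a i (fun y => k * g y) = k * CInt D.ε D.c D.z D.a i g := by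
  simp only [CInt, ellInt, UInt, rayInt_smul, mul_assoc, intervalIntegral.integral_const_mul]
  split_ifs <;> ring

theorem Mat_I_eq (hl : lam < 0) : D.Mat I lam = (I / D.ε) • matA D.ε D.c D.z D.a lam := by
  ext i p
  simp only [Mat, Matrix.of_apply, Matrix.smul_apply, smul_eq_mul, matA]
  rw [D.row_I (by simpa using hl), src_zero]
  congr 2
  funext y
  rw [D.exp_eq_Eu, src_single_eq, div_eq_mul_inv]

theorem vec_I_eq (hl : lam < 0) : D.vec I lam = (I / D.ε) • vecb D.ε D.c D.z D.a lam := by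
  funext i
  simp only [vec, Pi.smul_apply, smul_eq_mul, vecb]
  rw [D.row_I (by simpa using hl)]
  have : (fun y => D.Eu lam y * D.src lam 1 0 y)
      = fun y => (lam : ℂ) * exp (-I * h D.c D.z lam y / D.ε) := by
    funext y
    rw [D.exp_eq_Eu]
    simp [src, mul_comm]
  rw [this, CInt_smul]
  ring

theorem I_div_ε_ne : (I / D.ε : ℂ) ≠ 0 := div_ne_zero I_ne_zero D.εc_ne

theorem Mat_mulVec_eq_zero_iff (hl : lam < 0) :
    D.Mat I lam *ᵥ φ = 0 ↔ matA D.ε D.c D.z D.a lam *ᵥ φ = 0 := by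
  rw [Mat_I_eq hl, Matrix.smul_mulVec, smul_eq_zero_iff_right I_div_ε_ne]

theorem vecMul_Mat_eq_zero_iff (hl : lam < 0) :
    m ᵥ* D.Mat I lam = 0 ↔ m ᵥ* matA D.ε D.c D.z D.a lam = 0 := by
  rw [Mat_I_eq hl, Matrix.vecMul_smul, smul_eq_zero_iff_right I_div_ε_ne]

theorem differentiableAt_vec (hl : lam < 0) (i : Fin P) :
    DifferentiableAt ℂ (fun μ => D.vec I μ i) lam :=
  (D.nice_vec (Or.inl rfl) i).1.differentiableAt ((isOpen_region I).mem_nhds (im_mul_I_neg hl))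

/-- The statement differentiates along real `lam`, the proof in the complex parameter; the two agree
because `vec` is analytic there. -/
theorem deriv_vec_I (hl : lam < 0) (i : Fin P) :
    deriv (fun μ => D.vec I μ i) lam = (I / D.ε) * vecb' D.ε D.c D.z D.a lam i := by
  have h1 := (differentiableAt_vec (D := D) hl i).hasDerivAt.comp_ofReal
  have h2 : (fun t : ℝ => D.vec I t i) =ᶠ[𝓝 lam] fun t => (I / D.ε) * vecb D.ε D.c D.z D.a t i := by
    filter_upwards [isOpen_Iio.mem_nhds hl] with t ht
    rw [vec_I_eq ht, Pi.smul_apply, smul_eq_mul]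
  rw [vecb', ← h1.deriv, h2.deriv_eq, deriv_const_mul_field]

theorem vecb_ratio (hl : lam < 0) (m : Fin P → ℂ) :
    (m ⬝ᵥ vecb' D.ε D.c D.z D.a lam) / (m ⬝ᵥ vecb D.ε D.c D.z D.a lam)
      = (∑ i, m i * deriv (fun μ => D.vec I μ i) lam) / (m ⬝ᵥ D.vec I lam) := by
  have h1 : ∑ i, m i * deriv (fun μ => D.vec I μ i) lam
      = (I / D.ε) * (m ⬝ᵥ vecb' D.ε D.c D.z D.a lam) := by
    simp only [deriv_vec_I hl, dotProduct, Finset.mul_sum]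
    exact Finset.sum_congr rfl fun p _ => by ring
  rw [h1, vec_I_eq hl, dotProduct_smul, smul_eq_mul, mul_div_mul_left _ _ I_div_ε_ne]

/-! ### Eigenvectors -/

theorem exists_globalSol_ker (hl : lam < 0) (h : D.Mat I lam *ᵥ φ = 0) :
    ∃ w, D.GlobalSol lam 0 φ w ∧ EqOn w (D.wsol I lam 0 φ) D.Gd :=
  exists_globalSol_of_mulVec (w₀ := 0) (d := I) (Or.inl rfl) (im_mul_I_neg hl).le
    (by exact_mod_cast hl.ne) (by rw [h, zero_smul])

theorem ker_eq_zero_of_sum (hl : lam < 0) (h : D.Mat I lam *ᵥ φ = 0) (hs : ∑ p, φ p = 0) : φ = 0 := by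
  obtain ⟨w, hw, he⟩ := exists_globalSol_ker hl h
  exact hw.eq_zero_of_sum (dec_wsol (Or.inl rfl) (im_mul_I_neg hl) he) hl.ne hs

/-- Otherwise there would be a solution tending to 1 at an eigenvalue; `GlobalSol.not_one` then
makes the null vector sum to zero, so that it vanishes. -/
theorem mulVec_ne_vec (hl : lam < 0) (h : D.Mat I lam *ᵥ φ = 0) (h0 : φ ≠ 0) :
    D.Mat I lam *ᵥ ψ ≠ D.vec I lam := fun hψ => by
  obtain ⟨v, hv, hev⟩ := exists_globalSol_ker hl h
  obtain ⟨w, hw, hew⟩ := exists_globalSol_of_mulVec (w₀ := 1) (d := I) (Or.inl rfl) (im_mul_I_neg hl).le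
    (by exact_mod_cast hl.ne) (by rw [hψ, one_smul])
  exact h0 (ker_eq_zero_of_sum hl h (hw.not_one (tendsto_wsol (Or.inl rfl) (im_mul_I_neg hl) hew) hv
    (tendsto_wsol (Or.inl rfl) (im_mul_I_neg hl) hev) hl.ne))

variable (D) in
/-- The rank-one perturbation of the matrix that is invertible at the eigenvalues. -/
def regMat (μ : ℂ) : Matrix (Fin P) (Fin P) ℂ := D.Mat I μ + Matrix.vecMulVec (D.vec I μ) 1

theorem regMat_mulVec (μ : ℂ) (φ : Fin P → ℂ) :
    D.regMat μ *ᵥ φ = D.Mat I μ *ᵥ φ + (∑ p, φ p) • D.vec I μ := by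
  rw [regMat, Matrix.add_mulVec, Matrix.vecMulVec_mulVec]
  congr 1
  funext i
  simp [dotProduct, mul_comm]

/-- A null vector of the perturbed matrix with nonzero sum would put `vec` in the range of `Mat`.
One with zero sum is a null vector of `Mat`, hence zero by the norm identity. -/
theorem det_regMat_ne_zero (hl : lam < 0) (h : D.Mat I lam *ᵥ φ = 0) (h0 : φ ≠ 0) :
    (D.regMat lam).det ≠ 0 := by
  refine det_ne_zero_of_ker fun ψ hψ => ?_
  rw [regMat_mulVec] at hψ
  by_cases hs : ∑ p, ψ p = 0
  · rw [hs, zero_smul, add_zero] at hψ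
    exact ker_eq_zero_of_sum hl hψ hs
  · refine absurd ?_ (mulVec_ne_vec (ψ := (-(∑ p, ψ p)⁻¹) • ψ) hl h h0)
    rw [Matrix.mulVec_smul, eq_neg_of_add_eq_zero_left hψ, neg_smul, smul_neg, neg_neg, smul_smul,
      inv_mul_cancel₀ hs, one_smul]

/-- If the product vanished, `m` would also annihilate the perturbed matrix from the left. -/
theorem left_null_dot_ne_zero (hl : lam < 0) (h : D.Mat I lam *ᵥ φ = 0) (h0 : φ ≠ 0) (hm : m ≠ 0)
    (hm0 : m ᵥ* D.Mat I lam = 0) : m ⬝ᵥ D.vec I lam ≠ 0 := fun hb => by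
  have : m ᵥ* D.regMat lam = 0 := by
    rw [regMat, Matrix.vecMul_add, hm0, zero_add, Matrix.vecMul_vecMulVec, hb, zero_smul]
  exact det_regMat_ne_zero hl h h0 (Matrix.exists_vecMul_eq_zero_iff.mp ⟨m, hm, this⟩)

theorem nice_regMat (i p : Fin P) : Nice I (fun μ => D.regMat μ i p) := by
  have := (D.nice_Mat (Or.inl rfl) i p).add (D.nice_vec (Or.inl rfl) i)
  simpa [regMat, Matrix.vecMulVec_apply] using this

variable (D) in
/-- The solution of the perturbed linear system. -/
def regSol (μ : ℂ) : Fin P → ℂ := (D.regMat μ)⁻¹ *ᵥ D.vec I μ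

theorem regMat_mulVec_regSol (h : (D.regMat μ).det ≠ 0) : D.regMat μ *ᵥ D.regSol μ = D.vec I μ := by
  rw [regSol, Matrix.mulVec_mulVec, Matrix.mul_nonsing_inv _ (isUnit_iff_ne_zero.mpr h),
    Matrix.one_mulVec]

theorem analyticAt_of_nice {F : ℂ → ℂ} (h : Nice I F) (hμ : μ.re < 0) : AnalyticAt ℂ F μ :=
  h.1.analyticAt ((isOpen_region I).mem_nhds (by simpa using hμ))

theorem analyticAt_regSol (hμ : μ.re < 0) (h : (D.regMat μ).det ≠ 0) (p : Fin P) :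
    AnalyticAt ℂ (fun μ => D.regSol μ p) μ := by
  have h1 : Nice I (fun μ => ((D.regMat μ).adjugate *ᵥ D.vec I μ) p) := by
    simp only [Matrix.mulVec, dotProduct]
    exact nice_sum _ fun q _ => (nice_adjugate nice_regMat p q).mul (D.nice_vec (Or.inl rfl) q)
  have h2 := (analyticAt_of_nice h1 hμ).div (analyticAt_of_nice (nice_det nice_regMat) hμ) h
  refine h2.congr (Eventually.of_forall fun ν => ?_)
  simp only [regSol, Matrix.inv_def, Ring.inverse_eq_inv', Matrix.smul_mulVec, Pi.smul_apply,
    smul_eq_mul, Pi.div_apply]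
  rw [div_eq_inv_mul]

variable (D) in
-- The scalar that carries the singularity: `Mat` sends `regSol` to `defectSum` times `vec`, so
-- `regSol / defectSum` solves the unperturbed system.
def defectSum (μ : ℂ) : ℂ := 1 - ∑ p, D.regSol μ p

theorem Mat_mulVec_regSol (h : (D.regMat μ).det ≠ 0) :
    D.Mat I μ *ᵥ D.regSol μ = D.defectSum μ • D.vec I μ := by
  have := regMat_mulVec_regSol h
  rw [regMat_mulVec] at this
  rw [defectSum, sub_smul, one_smul]
  exact eq_sub_of_add_eq this

theorem regSol_eq_of_ker (hl : lam < 0) (h : D.Mat I lam *ᵥ φ = 0) (hs : ∑ p, φ p = 1) :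
    D.regSol lam = φ := by
  have h0 : φ ≠ 0 := by rintro rfl; simp at hs
  have hdet := det_regMat_ne_zero hl h h0
  have : D.regMat lam *ᵥ φ = D.vec I lam := by rw [regMat_mulVec, h, hs, zero_add, one_smul]
  rw [regSol, ← this, Matrix.mulVec_mulVec, Matrix.nonsing_inv_mul _ (isUnit_iff_ne_zero.mpr hdet),
    Matrix.one_mulVec]

theorem sol_eq_regSol (h : (D.regMat μ).det ≠ 0) (h1 : D.defectSum μ ≠ 0) :
    D.sol I x μ = D.evalAt I x μ 1 0 + D.evalAt I x μ 0 (D.regSol μ) / D.defectSum μ := by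
  -- A null vector `e` of `Mat` is sent by `regMat` to `(∑ e) vec`, hence `e = (∑ e) regSol`.
  -- Summation gives `(∑ e) * defectSum = 0`.
  have hdet : (D.Mat I μ).det ≠ 0 := by
    refine det_ne_zero_of_ker fun e he => ?_
    have h2 : D.regMat μ *ᵥ (e - (∑ p, e p) • D.regSol μ) = 0 := by
      rw [Matrix.mulVec_sub, Matrix.mulVec_smul, regMat_mulVec_regSol h, regMat_mulVec, he, zero_add,
        sub_self]
    have h3 := Matrix.eq_zero_of_mulVec_eq_zero h h2
    rw [sub_eq_zero] at h3
    have h4 : ∑ p, e p = (∑ p, e p) * ∑ p, D.regSol μ p := by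
      conv_lhs => rw [h3]
      simp [Finset.mul_sum]
    have h5 : (∑ p, e p) * D.defectSum μ = 0 := by
      rw [defectSum, mul_sub, mul_one, ← h4, sub_self]
    rw [h3, (mul_eq_zero.mp h5).resolve_right h1, zero_smul]
  rw [sol_eq_evalAt (φ := (D.defectSum μ)⁻¹ • D.regSol μ) hdet, D.evalAt_eq I x μ 1,
    D.evalAt_eq I x μ 0 (D.regSol μ)]
  · simp only [Pi.smul_apply, smul_eq_mul, mul_assoc, ← Finset.mul_sum]
    ring
  · rw [Matrix.mulVec_smul, Mat_mulVec_regSol h, smul_smul, inv_mul_cancel₀ h1, one_smul]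

theorem hasDerivAt_Mat (hμ : μ.re < 0) (i p : Fin P) : HasDerivAt (fun μ => D.Mat I μ i p)
    (-(I / D.ε) * (D.z p * D.Mat I μ i p - D.vec I μ i / μ)) μ := by
  have e : ∀ ν, (D.Mat I ν *ᵥ Pi.single p 1) i = D.Mat I ν i p := fun ν => by simp
  have ez : D.zmul (Pi.single p 1) = D.z p • Pi.single p (1:ℂ) := by
    funext q
    by_cases hq : q = p
    · subst hq; simp [zmul]
    · simp [zmul, hq]
  have := hasDerivAt_mulVec (D := D) hμ (Pi.single p 1) i
  simp only [e, ez, Matrix.mulVec_smul, Pi.smul_apply, smul_eq_mul] at this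
  refine this.congr_deriv ?_
  have hs : ∑ q, (Pi.single p 1 : Fin P → ℂ) q = 1 := by simp
  rw [hs]
  ring

end Datum
end BOScattering
end

/-! ### The Laurent expansion at an eigenvalue -/

noncomputable section
namespace BOScattering
namespace Datum
variable {P : ℕ} {D : Datum P} {μ : ℂ} {φ ψ m : Fin P → ℂ} {w : ℂ → ℂ} {x : ℂ} {lam : ℝ}

variable (D) in
/-- Vectors spanning the kernel at an eigenvalue, normalized to have unit sum. -/
structure Eigenvector (lam : ℝ) (ψ : Fin P → ℂ) : Prop where
  neg : lam < 0
  ker : D.Mat I lam *ᵥ ψ = 0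
  sum : ∑ p, ψ p = 1

namespace Eigenvector

theorem ne_zero (h : D.Eigenvector lam ψ) : ψ ≠ 0 := by rintro rfl; simpa using h.sum

theorem re_neg (h : D.Eigenvector lam ψ) : (lam : ℂ).re < 0 := by simpa using h.neg

theorem det_ne_zero (h : D.Eigenvector lam ψ) : (D.regMat lam).det ≠ 0 :=
  det_regMat_ne_zero h.neg h.ker h.ne_zero

theorem regSol_eq (h : D.Eigenvector lam ψ) : D.regSol lam = ψ := regSol_eq_of_ker h.neg h.ker h.sum

theorem eventually (h : D.Eigenvector lam ψ) : ∀ᶠ μ in 𝓝 (lam : ℂ), μ.re < 0 ∧ (D.regMat μ).det ≠ 0 := by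
  have h1 : ∀ᶠ μ : ℂ in 𝓝 (lam : ℂ), μ.re < 0 :=
    (isOpen_lt continuous_re continuous_const).mem_nhds h.re_neg
  exact h1.and ((analyticAt_of_nice (nice_det nice_regMat) h.re_neg).continuousAt.eventually_ne
    h.det_ne_zero)

theorem analyticAt_regSol (h : D.Eigenvector lam ψ) (p : Fin P) :
    AnalyticAt ℂ (fun μ => D.regSol μ p) lam := Datum.analyticAt_regSol h.re_neg h.det_ne_zero p

theorem hasDerivAt_regSol (h : D.Eigenvector lam ψ) (p : Fin P) :
    HasDerivAt (fun μ => D.regSol μ p) (deriv (fun μ => D.regSol μ p) lam) lam :=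
  (h.analyticAt_regSol p).differentiableAt.hasDerivAt

theorem analyticAt_defectSum (h : D.Eigenvector lam ψ) : AnalyticAt ℂ D.defectSum lam :=
  analyticAt_const.sub (Finset.analyticAt_fun_sum _ fun p _ => h.analyticAt_regSol p)

theorem defectSum_eq_zero (h : D.Eigenvector lam ψ) : D.defectSum lam = 0 := by
  rw [defectSum, h.regSol_eq, h.sum, sub_self]

theorem sum_deriv (h : D.Eigenvector lam ψ) :
    ∑ p, deriv (fun μ => D.regSol μ p) lam = -deriv D.defectSum lam := by
  have : HasDerivAt D.defectSum (-∑ p, deriv (fun μ => D.regSol μ p) lam) lam :=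
    (HasDerivAt.fun_sum fun p _ => h.hasDerivAt_regSol p).const_sub 1
  rw [this.deriv, neg_neg]

theorem deriv_defectSum (h : D.Eigenvector lam ψ) (hm : m ≠ 0) (hm0 : m ᵥ* D.Mat I lam = 0) :
    deriv D.defectSum lam = I / (D.ε * lam) ∧ deriv (deriv D.defectSum) lam = deriv D.defectSum lam
      * (-(I / D.ε) * ∑ p, D.z p * ψ p - 2 * deriv D.defectSum lam
        - (∑ i, m i * deriv (fun μ => D.vec I μ i) lam) / (m ⬝ᵥ D.vec I lam) - 1 / lam) := by
  have hb := left_null_dot_ne_zero h.neg h.ker h.ne_zero hm hm0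
  have hvec : ∀ i, AnalyticAt ℂ (fun μ => D.vec I μ i) lam := fun i =>
    analyticAt_of_nice (D.nice_vec (Or.inl rfl) i) h.re_neg
  have hβ : AnalyticAt ℂ (fun μ => m ⬝ᵥ D.vec I μ) lam :=
    Finset.analyticAt_fun_sum _ fun i _ => analyticAt_const.mul (hvec i)
  have hβ' : deriv (fun μ => m ⬝ᵥ D.vec I μ) lam = ∑ i, m i * deriv (fun μ => D.vec I μ i) lam := by
    have : HasDerivAt (fun μ => m ⬝ᵥ D.vec I μ) (∑ i, m i * deriv (fun μ => D.vec I μ i) lam) lam :=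
      HasDerivAt.fun_sum fun i _ => (hvec i).differentiableAt.hasDerivAt.const_mul _
    exact this.deriv
  -- Pairing `Mat ψ = τ vec` with `m` makes the left side vanish at the eigenvalue for every `ψ`.
  have key := deriv_one_sub_sum (e := D.ε) (a := lam) (r := fun p μ => (m ᵥ* D.Mat I μ) p)
    (ψ := fun p μ => D.regSol μ p) (z := D.z) (β := fun μ => m ⬝ᵥ D.vec I μ) (τ := D.defectSum)
    D.εc_ne (by exact_mod_cast h.neg.ne) h.analyticAt_regSol hβ h.analyticAt_defectSum (fun p => ?_)
    (fun p => by simp [hm0]) ?_ (Eventually.of_forall fun μ => by simp [defectSum])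
    h.defectSum_eq_zero hb
  · simpa only [h.regSol_eq, hβ'] using key
  · filter_upwards [h.eventually] with μ hμ
    have : HasDerivAt (fun μ => ∑ i, m i * D.Mat I μ i p)
        (∑ i, m i * (-(I / D.ε) * (D.z p * D.Mat I μ i p - D.vec I μ i / μ))) μ :=
      HasDerivAt.fun_sum fun i _ => (hasDerivAt_Mat (D := D) hμ.1 i p).const_mul _
    change HasDerivAt (fun μ => ∑ i, m i * D.Mat I μ i p) _ μ
    refine this.congr_deriv ?_
    simp only [Matrix.vecMul, dotProduct, Finset.mul_sum, Finset.sum_div, ← Finset.sum_sub_distrib]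
    exact Finset.sum_congr rfl fun i _ => by ring
  · filter_upwards [h.eventually] with μ hμ
    have : ∑ p, (m ᵥ* D.Mat I μ) p * D.regSol μ p = m ⬝ᵥ (D.Mat I μ *ᵥ D.regSol μ) := by
      rw [Matrix.dotProduct_mulVec]; rfl
    rw [this, Mat_mulVec_regSol hμ.2, dotProduct_smul, smul_eq_mul]

/-- Differentiating `Mat ψ = τ vec` at the eigenvalue, where `τ' = I/(ελ)`, gives `Mat (ψ' - (I/ε)
zψ) = 0`. The kernel is spanned by `ψ`, and the coefficient is read off from the sum of the
components, as `∑ ψ'ₚ = -τ'`. -/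
theorem deriv_regSol (h : D.Eigenvector lam ψ) (h1 : deriv D.defectSum lam = I / (D.ε * lam)) :
    (fun p => deriv (fun μ => D.regSol μ p) lam)
      = (-deriv D.defectSum lam - (I / D.ε) * ∑ p, D.z p * ψ p) • ψ + (I / D.ε) • D.zmul ψ := by
  have hlam : (lam : ℂ) ≠ 0 := by exact_mod_cast h.neg.ne
  set ψ' : Fin P → ℂ := fun p => deriv (fun μ => D.regSol μ p) lam with hψ'
  set χ : Fin P → ℂ := ψ' - (I / D.ε) • D.zmul ψ with hχ
  have hker : D.Mat I lam *ᵥ χ = 0 := by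
    funext i
    have e1 : HasDerivAt (fun μ => ∑ p, D.Mat I μ i p * D.regSol μ p)
        (∑ p, (-(I / D.ε) * (D.z p * D.Mat I lam i p - D.vec I lam i / lam) * D.regSol lam p
          + D.Mat I lam i p * ψ' p)) lam :=
      HasDerivAt.fun_sum fun p _ => (hasDerivAt_Mat (D := D) h.re_neg i p).mul (h.hasDerivAt_regSol p)
    have e2 : HasDerivAt (fun μ => D.defectSum μ * D.vec I μ i)
        (deriv D.defectSum lam * D.vec I lam i
          + D.defectSum lam * deriv (fun μ => D.vec I μ i) lam) lam :=
      h.analyticAt_defectSum.differentiableAt.hasDerivAt.mul (differentiableAt_vec h.neg i).hasDerivAt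
    have e3 := e1.unique (e2.congr_of_eventuallyEq (h.eventually.mono fun μ hμ => by
      change (D.Mat I μ *ᵥ D.regSol μ) i = _
      rw [Mat_mulVec_regSol hμ.2, Pi.smul_apply, smul_eq_mul]))
    rw [h.regSol_eq, h.defectSum_eq_zero, zero_mul, add_zero, h1] at e3
    have e4 : ∑ p, (-(I / D.ε) * (D.z p * D.Mat I lam i p - D.vec I lam i / lam) * ψ p
        + D.Mat I lam i p * ψ' p)
        = (∑ p, D.Mat I lam i p * χ p) + (I / D.ε) * (D.vec I lam i / lam) * ∑ p, ψ p := by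
      rw [Finset.mul_sum, ← Finset.sum_add_distrib]
      refine Finset.sum_congr rfl fun p _ => ?_
      simp only [hχ, Pi.sub_apply, Pi.smul_apply, smul_eq_mul, zmul]
      ring
    rw [e4, h.sum, mul_one] at e3
    have e5 : ∑ p, D.Mat I lam i p * χ p = 0 := by
      have e6 : I / (D.ε * lam) * D.vec I lam i = (I / D.ε) * (D.vec I lam i / lam) := by ring
      rw [e6] at e3
      linear_combination e3
    exact e5
  have hsum : ∑ p, χ p = -deriv D.defectSum lam - (I / D.ε) * ∑ p, D.z p * ψ p := by
    simp only [hχ, Pi.sub_apply, Finset.sum_sub_distrib, Pi.smul_apply, smul_eq_mul, zmul,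
      ← Finset.mul_sum]
    rw [← h.sum_deriv]
  have h2 : χ - (∑ p, χ p) • ψ = 0 := by
    refine ker_eq_zero_of_sum (D := D) h.neg ?_ ?_
    · rw [Matrix.mulVec_sub, Matrix.mulVec_smul, hker, h.ker, smul_zero, sub_zero]
    · simp [← Finset.mul_sum, h.sum]
  rw [hsum, sub_eq_zero] at h2
  rw [← h2, hχ, sub_add_cancel]

theorem deriv_evalAt (h : D.Eigenvector lam ψ) (hx : x ∈ closedUpper)
    (h1 : deriv D.defectSum lam = I / (D.ε * lam)) :
    deriv (fun μ => D.evalAt I x μ 0 (D.regSol μ)) lam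
      = (-deriv D.defectSum lam - (I / D.ε) * ∑ p, D.z p * ψ p) * D.evalAt I x lam 0 ψ
        + (I / D.ε) * (x * D.evalAt I x lam 0 ψ - D.evalAt I x lam 1 0 / lam) := by
  have hlin : ∀ (μ : ℂ) (φ : Fin P → ℂ),
      D.evalAt I x μ 0 φ = ∑ p, φ p * D.evalAt I x μ 0 (Pi.single p 1) := fun μ φ => by
    rw [D.evalAt_eq I x μ 0 φ, zero_mul, zero_add]
  have hd : ∀ p, HasDerivAt (fun μ => D.evalAt I x μ 0 (Pi.single p 1))
      (deriv (fun μ => D.evalAt I x μ 0 (Pi.single p 1)) lam) lam := fun p =>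
    (hasDerivAt_evalAt h.re_neg hx _).differentiableAt.hasDerivAt
  have e1 : HasDerivAt (fun μ => D.evalAt I x μ 0 (D.regSol μ))
      (∑ p, (deriv (fun μ => D.regSol μ p) lam * D.evalAt I x lam 0 (Pi.single p 1)
        + D.regSol lam p * deriv (fun μ => D.evalAt I x μ 0 (Pi.single p 1)) lam)) lam := by
    have : HasDerivAt (fun μ => ∑ p, D.regSol μ p * D.evalAt I x μ 0 (Pi.single p 1)) _ lam :=
      HasDerivAt.fun_sum fun p _ => (h.hasDerivAt_regSol p).mul (hd p)
    exact this.congr_of_eventuallyEq (Eventually.of_forall fun μ => hlin μ _)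
  have e2 : HasDerivAt (fun μ => D.evalAt I x μ 0 ψ)
      (∑ p, ψ p * deriv (fun μ => D.evalAt I x μ 0 (Pi.single p 1)) lam) lam := by
    have : HasDerivAt (fun μ => ∑ p, ψ p * D.evalAt I x μ 0 (Pi.single p 1)) _ lam :=
      HasDerivAt.fun_sum fun p _ => (hd p).const_mul (ψ p)
    exact this.congr_of_eventuallyEq (Eventually.of_forall fun μ => hlin μ _)
  have e3 := e2.unique (hasDerivAt_evalAt h.re_neg hx ψ)
  rw [e1.deriv, Finset.sum_add_distrib, h.regSol_eq, e3, h.sum]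
  have e4 : ∑ p, deriv (fun μ => D.regSol μ p) lam * D.evalAt I x lam 0 (Pi.single p 1)
      = (-deriv D.defectSum lam - (I / D.ε) * ∑ p, D.z p * ψ p) * D.evalAt I x lam 0 ψ
        + (I / D.ε) * D.evalAt I x lam 0 (D.zmul ψ) := by
    have := hlin lam (fun p => deriv (fun μ => D.regSol μ p) lam)
    rw [← this, h.deriv_regSol h1, hlin lam, hlin lam ψ, hlin lam (D.zmul ψ)]
    simp only [Pi.add_apply, Pi.smul_apply, smul_eq_mul, add_mul, Finset.sum_add_distrib, mul_assoc,
      ← Finset.mul_sum]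
  rw [e4, D.evalAt_eq I x lam (1 / lam) (D.zmul ψ), ← hlin]
  ring

/-- The principal part and the constant term of the Jost solution at an eigenvalue. -/
theorem exists_laurent (h : D.Eigenvector lam ψ) (hx : x ∈ closedUpper) (hm : m ≠ 0)
    (hm0 : m ᵥ* D.Mat I lam = 0) : ∃ q : ℂ → ℂ, AnalyticAt ℂ q lam ∧
      q lam = -(I * D.ε) * (lam * D.evalAt I x lam 0 ψ) ∧
      deriv q lam = (x + (-(I * D.ε) / (2 * lam) - 1 / 2 * (∑ p, D.z p * ψ p)
        - I * D.ε / 2 * ((∑ i, m i * deriv (fun μ => D.vec I μ i) lam) / (m ⬝ᵥ D.vec I lam))))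
          * (lam * D.evalAt I x lam 0 ψ) ∧
      ∀ᶠ μ in 𝓝[≠] (lam : ℂ), D.jostW x μ = (μ - lam)⁻¹ * q μ := by
  have hlam : (lam : ℂ) ≠ 0 := by exact_mod_cast h.neg.ne
  have hε := D.εc_ne
  obtain ⟨h1, h2⟩ := h.deriv_defectSum hm hm0
  have hne : deriv D.defectSum lam ≠ 0 := by
    rw [h1]
    exact div_ne_zero I_ne_zero (mul_ne_zero hε hlam)
  have hα : AnalyticAt ℂ (fun μ => D.evalAt I x μ 1 0) lam :=
    analyticAt_of_nice (nice_evalAt (Or.inl rfl) x 1 0) h.re_neg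
  have hB : AnalyticAt ℂ (fun μ => D.evalAt I x μ 0 (D.regSol μ)) lam := by
    have : AnalyticAt ℂ (fun μ => ∑ p, D.regSol μ p * D.evalAt I x μ 0 (Pi.single p 1)) lam :=
      Finset.analyticAt_fun_sum _ fun p _ => (h.analyticAt_regSol p).mul
        (analyticAt_of_nice (nice_evalAt (Or.inl rfl) x 0 _) h.re_neg)
    refine this.congr (Eventually.of_forall fun μ => ?_)
    beta_reduce
    rw [D.evalAt_eq I x μ 0 (D.regSol μ), zero_mul, zero_add]
  obtain ⟨q, hq, hq0, hq1, hqe⟩ := BOScattering.exists_laurent hα hB h.analyticAt_defectSum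
    h.defectSum_eq_zero hne
  refine ⟨q, hq, ?_, ?_, ?_⟩
  · rw [hq0, h.regSol_eq, h1]
    field_simp
    linear_combination (D.evalAt I x lam 0 ψ) * I_mul_I
  -- The value `evalAt I x lam 1 0` cancels against its multiple in the derivative. With `I/ε = τ'
  -- λ` what remains is a rational identity in `τ'`.
  · rw [hq1, h.deriv_evalAt hx h1, h.regSol_eq, h2]
    set τ := deriv D.defectSum lam
    have hi : I / D.ε = τ * lam := by rw [h1]; field_simp
    have hi' : I * D.ε = -(τ * lam)⁻¹ := by
      rw [← hi]
      field_simp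
      linear_combination I_mul_I
    rw [hi, hi']
    field_simp
    ring
  · have hd : ∀ᶠ μ in 𝓝[≠] (lam : ℂ), D.defectSum μ ≠ 0 := by
      have := h.analyticAt_defectSum.differentiableAt.hasDerivAt.eventually_ne hne (c := 0)
      exact this
    filter_upwards [hqe, hd, h.eventually.filter_mono nhdsWithin_le_nhds] with μ e1 e2 e3
    rw [← e1, jostW_of_re_neg hx e3.1, sol_eq_regSol e3.2 e2]

end Eigenvector

end Datum
end BOScattering
end

/-! ### Uniqueness of the meromorphic continuation -/

noncomputable section
namespace BOScattering

/-- A meromorphic function that is bounded near a point has an analytic normal form there. -/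
theorem analyticAt_toMeromorphicNFOn_of_bounded {U : Set ℂ} {g : ℂ → ℂ} (hg : MeromorphicOn g U)
    {μ : ℂ} (hμ : μ ∈ U) {C : ℝ} (hb : ∀ᶠ ν in 𝓝[≠] μ, ‖g ν‖ ≤ C) :
    AnalyticAt ℂ (toMeromorphicNFOn g U) μ ∧ ‖toMeromorphicNFOn g U μ‖ ≤ C := by
  have he := hg.toMeromorphicNFOn_eq_self_on_nhdsNE hμ
  have h0 : 0 ≤ meromorphicOrderAt (toMeromorphicNFOn g U) μ := by
    rw [meromorphicOrderAt_congr he]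
    by_contra! hneg
    have h1 := tendsto_norm_cobounded_atTop.comp (tendsto_cobounded_of_meromorphicOrderAt_neg hneg)
    obtain ⟨ν, h2, h3⟩ := ((h1.eventually_gt_atTop C).and hb).exists
    exact absurd h3 (not_le.mpr h2)
  have ha := ((meromorphicNFOn_toMeromorphicNFOn g U) hμ).meromorphicOrderAt_nonneg_iff_analyticAt.mp h0
  refine ⟨ha, ?_⟩
  have ht : Tendsto (toMeromorphicNFOn g U) (𝓝[≠] μ) (𝓝 (toMeromorphicNFOn g U μ)) :=
    ha.continuousAt.tendsto.mono_left nhdsWithin_le_nhds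
  refine le_of_tendsto ht.norm ?_
  filter_upwards [he, hb] with ν h1 h2
  rwa [h1]

theorem isPreconnected_cutPlane : IsPreconnected cutPlane := by
  have h : StarConvex ℝ (-1 : ℂ) cutPlane := by
    intro y hy s t hs ht hst
    rcases ht.eq_or_lt with rfl | ht0
    · have : s = 1 := by linarith
      subst this
      exact Or.inr (by simp)
    · rcases hy with hy | hy
      · exact Or.inl (by simpa using ⟨ht0.ne', hy⟩)
      · refine Or.inr ?_
        simp only [smul_neg, real_smul, mul_one, add_re, neg_re, ofReal_re, mul_re, ofReal_im,
          zero_mul, sub_zero]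
        nlinarith [mul_neg_of_pos_of_neg ht0 hy]
  exact (h.isPathConnected (Or.inr (by simp))).isConnected.isPreconnected

theorem upper_subset_cutPlane : upper ⊆ cutPlane := fun _ h => Or.inl (ne_of_gt h)

/-- A meromorphic function on the cut plane is determined by its boundary values from above. -/
theorem eventually_eq_zero_of_tendsto_zero {g : ℂ → ℂ} (hg : MeromorphicOn g cutPlane)
    (h0 : ∀ lam : ℝ, 0 < lam → Tendsto g (𝓝[{μ : ℂ | 0 < μ.im}] (lam : ℂ)) (𝓝 0))
    {μ : ℂ} (hμ : μ ∈ cutPlane) : ∀ᶠ ν in 𝓝[≠] μ, g ν = 0 := by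
  set F := toMeromorphicNFOn g cutPlane with hF
  -- Any point of the positive half-line would do. Near 1 the boundary value zero bounds `g` above
  -- the axis, so the normal form has no poles there.
  obtain ⟨r, hr, hb⟩ : ∃ r > 0, ∀ ν ∈ Metric.ball (1 : ℂ) r ∩ upper, ‖g ν‖ ≤ 1 := by
    have h1 := (h0 1 one_pos).norm
    rw [norm_zero] at h1
    rw [ofReal_one] at h1
    have h2 : ∀ᶠ ν in 𝓝[upper] (1 : ℂ), ‖g ν‖ < 1 := h1.eventually (gt_mem_nhds one_pos)
    obtain ⟨r, hr, h3⟩ := Metric.mem_nhdsWithin_iff.mp h2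
    exact ⟨r, hr, fun ν hν => (show ‖g ν‖ < 1 from h3 hν).le⟩
  set S := Metric.ball (1 : ℂ) (min r 1) with hS
  have hSo : IsOpen S := Metric.isOpen_ball
  have hSr : S ⊆ Metric.ball (1 : ℂ) r := Metric.ball_subset_ball (min_le_left _ _)
  have hSpos : ∀ ν ∈ S, 0 < ν.re := fun ν hν => by
    have h1 : ‖ν - 1‖ < 1 := (mem_ball_iff_norm.mp hν).trans_le (min_le_right _ _)
    have h2 := (abs_re_le_norm (ν - 1)).trans_lt h1
    rw [sub_re, one_re, abs_lt] at h2
    linarith [h2.1]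
  have hFa : ∀ ν ∈ S ∩ upper, AnalyticAt ℂ F ν := fun ν hν =>
    (analyticAt_toMeromorphicNFOn_of_bounded hg (upper_subset_cutPlane hν.2) (C := 1) <|
      mem_nhdsWithin_of_mem_nhds <| mem_of_superset ((hSo.inter isOpen_upper).mem_nhds hν)
        fun ξ hξ => hb ξ ⟨hSr hξ.1, hξ.2⟩).1
  -- Bounds on `g` in open sets pass to the normal form, which may differ from `g` at isolated
  -- points; so the boundary values persist.
  have hFt : ∀ lam : ℝ, 0 < lam → Tendsto F (𝓝[upper] (lam : ℂ)) (𝓝 0) := fun lam hl => by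
    rw [Metric.nhds_basis_closedBall.tendsto_right_iff]
    intro δ hδ
    have h1 : ∀ᶠ ν in 𝓝[upper] (lam : ℂ), ‖g ν‖ ≤ δ := by
      have := (h0 lam hl).eventually (Metric.closedBall_mem_nhds 0 hδ)
      filter_upwards [this] with ν hν
      simpa using hν
    obtain ⟨V, hV, hlV, h2⟩ := mem_nhdsWithin.mp h1
    refine mem_nhdsWithin.mpr ⟨V, hV, hlV, fun ν hν => ?_⟩
    have := (analyticAt_toMeromorphicNFOn_of_bounded hg (upper_subset_cutPlane hν.2) (C := δ) <|
      mem_nhdsWithin_of_mem_nhds <| mem_of_superset ((hV.inter isOpen_upper).mem_nhds hν)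
        fun ξ hξ => h2 hξ).2
    simpa using this
  have hzero : ∀ ν ∈ S ∩ upper, F ν = 0 := fun ν hν => by
    have hp : IsPreconnected (S ∩ upper) :=
      ((convex_ball _ _).inter (convex_halfSpace_im_gt 0)).isPreconnected
    -- Set to zero on the real axis, the normal form is continuous on the closed side, because the
    -- boundary values vanish at every point of `S` on the axis; boundary uniqueness applies.
    have key := eqOn_zero_of_real (F := fun ξ => if 0 < ξ.im then F ξ else 0) (s := 1) hSo hp ?_ ?_
      (by simp [hS, hr]) (Eventually.of_forall fun t => by simp)
      ⟨hν.1, upper_subset_closedUpper hν.2⟩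
    · have h1 : 0 < ν.im := hν.2
      simpa [h1] using key
    · intro ξ hξ
      rcases (show 0 ≤ ξ.im from hξ.2).eq_or_lt with h1 | h1
      · have h2 : ((ξ.re : ℝ) : ℂ) = ξ := Complex.ext rfl (by simp [h1])
        have h3 := hFt ξ.re (hSpos ξ hξ.1)
        rw [h2] at h3
        have h4 : Tendsto (fun ξ => if 0 < ξ.im then F ξ else 0) (𝓝 ξ) (𝓝 0) := by
          refine tendsto_def.mpr fun T hT => ?_
          filter_upwards [mem_nhdsWithin_iff_eventually.mp (h3 hT)] with y hy
          by_cases hy0 : 0 < y.im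
          · simpa [hy0] using hy hy0
          · simpa [hy0] using mem_of_mem_nhds hT
        refine Tendsto.mono_left ?_ nhdsWithin_le_nhds
        beta_reduce
        rwa [if_neg h1.ge.not_gt]
      · refine ContinuousAt.continuousWithinAt ?_
        refine (hFa ξ ⟨hξ.1, h1⟩).continuousAt.congr ?_
        filter_upwards [isOpen_upper.mem_nhds h1] with y hy
        exact (if_pos hy).symm
    · intro ξ hξ
      refine ((hFa ξ hξ).differentiableAt.congr_of_eventuallyEq ?_).differentiableWithinAt
      filter_upwards [isOpen_upper.mem_nhds hξ.2] with y hy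
      exact if_pos hy
  obtain ⟨ν, hν⟩ : (S ∩ upper).Nonempty := by
    refine ⟨1 + (min r 1 / 2 : ℝ) * I, ?_, ?_⟩
    · have : 0 < min r 1 := lt_min hr one_pos
      rw [hS, mem_ball_iff_norm, add_sub_cancel_left, norm_mul, norm_I, mul_one, norm_real,
        Real.norm_of_nonneg (by positivity)]
      linarith
    · have : 0 < min r 1 := lt_min hr one_pos
      change 0 < (1 + (min r 1 / 2 : ℝ) * I : ℂ).im
      simpa using this
  have htop : meromorphicOrderAt g ν = ⊤ := by
    rw [meromorphicOrderAt_eq_top_iff]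
    have h1 : ∀ᶠ ξ in 𝓝[≠] ν, ξ ∈ S ∩ upper :=
      mem_nhdsWithin_of_mem_nhds ((hSo.inter isOpen_upper).mem_nhds hν)
    filter_upwards [h1, hg.toMeromorphicNFOn_eq_self_on_nhdsNE (upper_subset_cutPlane hν.2)]
      with ξ h2 h3
    rw [← h3]
    exact hzero ξ h2
  -- Infinite order at one point spreads over the connected cut plane.
  rw [← meromorphicOrderAt_eq_top_iff]
  by_contra hne
  exact hg.meromorphicOrderAt_ne_top_of_isPreconnected isPreconnected_cutPlane hμ
    (upper_subset_cutPlane hν.2) hne htop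

namespace Datum
variable {P : ℕ} {D : Datum P} {x : ℂ}

/-- The continuation of the Jost solution is determined by its boundary values. -/
theorem eq_jostW_of_tendsto (hx : x ∈ closedUpper) {V : ℂ → ℂ} (hV : MeromorphicOn V cutPlane)
    (h : ∀ lam : ℝ, 0 < lam →
      Tendsto V (𝓝[{μ : ℂ | 0 < μ.im}] (lam : ℂ)) (𝓝 (D.sol (-1) x lam)))
    {μ : ℂ} (hμ : μ ∈ cutPlane) : ∀ᶠ ν in 𝓝[≠] μ, V ν = D.jostW x ν := by
  have hm : MeromorphicOn (fun ν => V ν - D.jostW x ν) cutPlane :=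
    hV.sub (meromorphicOn_jostW hx)
  filter_upwards [eventually_eq_zero_of_tendsto_zero hm
    (fun lam hl => by simpa using (h lam hl).sub (tendsto_jostW (D := D) (x := x) hl)) hμ] with ν hν
  exact sub_eq_zero.mp hν

end Datum
end BOScattering
end

/-! ### Normalized eigenvectors, eigenfunctions and the assembled expansion -/

noncomputable section
namespace BOScattering
namespace Datum
variable {P : ℕ} {D : Datum P} {φ ψ m : Fin P → ℂ} {w : ℂ → ℂ} {x : ℂ} {lam : ℝ}

theorem exists_eigenvector (h : lam ∈ eigenvalues D.ε D.c D.z) : ∃ ψ, D.Eigenvector lam ψ := by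
  obtain ⟨hl, v, hv, hker⟩ := mem_eigenvalues_iff.mp h
  have hs : ∑ p, v p ≠ 0 := fun hs => hv (ker_eq_zero_of_sum hl hker hs)
  refine ⟨(∑ p, v p)⁻¹ • v, hl, by rw [Matrix.mulVec_smul, hker, smul_zero], ?_⟩
  simp only [Pi.smul_apply, smul_eq_mul, ← Finset.mul_sum]
  exact inv_mul_cancel₀ hs

/-- The value at `a 0` is the integral along the ray that comes from infinity, and the integrated
equation carries it along the rest of the contour to `x`. -/
theorem GlobalSol.eq_PhiFormula (hl : lam < 0) (hw : D.GlobalSol lam 0 φ w)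
    (he : EqOn w (D.wsol I lam 0 φ) D.Gd) (hx : x ∈ closedUpper ∩ G D.z) :
    w x = PhiFormula D.ε D.c D.z D.a lam φ x := by
  have hxu : x ∈ D.Gu := by
    refine ⟨D.closedUpper_subset_dom hx.1, fun p => ?_⟩
    by_contra! hp
    exact hx.2 p ⟨hp.1, hp.2.trans (le_abs_self _)⟩
  have e1 : (fun y => exp (-I * h D.c D.z lam y / D.ε) * ∑ p, φ p / (y - D.z p))
      = fun y => D.Eu lam y * D.src lam 0 φ y := by
    funext y
    rw [exp_eq_Eu, src, mul_zero, zero_add]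
  have e2 : exp (I * h D.c D.z lam x / D.ε) = (D.Eu lam x)⁻¹ := by
    rw [← exp_eq_Eu, ← Complex.exp_neg]
    congr 1
    ring
  have e3 : D.Eu lam (D.a 0) * D.wsol I lam 0 φ (D.a 0)
      = (I / D.ε) * rayInt (fun y => D.Eu lam y * D.src lam 0 φ y) (D.a 0) :=
    D.fac_mul_wsol (D.rayPrimitive_a 0) (D.a_mem_Gd 0) (by simpa using hl) 0 φ
  have e4 := hw.pathInt_eq hxu
  rw [he (D.a_mem_Gd 0), e3] at e4
  have hE := D.Eu_ne_zero lam x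
  rw [PhiFormula, e1, e2, ellInt_eq]
  have e5 : -(I / D.ε) * (D.Eu lam x)⁻¹ * (-rayInt (fun y => D.Eu lam y * D.src lam 0 φ y) (D.a 0)
      + D.pathInt (fun y => D.Eu lam y * D.src lam 0 φ y) x)
      = (D.Eu lam x)⁻¹ * ((I / D.ε) * rayInt (fun y => D.Eu lam y * D.src lam 0 φ y) (D.a 0)
        - (I / D.ε) * D.pathInt (fun y => D.Eu lam y * D.src lam 0 φ y) x) := by ring
  rw [e5, e4, sub_sub_cancel, inv_mul_cancel_left₀ hE]

namespace Eigenvector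

theorem ker_smul (h : D.Eigenvector lam ψ) : D.Mat I lam *ᵥ ((lam : ℂ) • ψ) = 0 := by
  rw [Matrix.mulVec_smul, h.ker, smul_zero]

theorem sum_smul (h : D.Eigenvector lam ψ) : ∑ p, ((lam : ℂ) • ψ) p = lam := by
  simp only [Pi.smul_apply, smul_eq_mul, ← Finset.mul_sum, h.sum, mul_one]

theorem eq_smul (h : D.Eigenvector lam ψ) (hφ : D.Mat I lam *ᵥ φ = 0) (hs : ∑ p, φ p = lam) :
    φ = (lam : ℂ) • ψ := by
  refine sub_eq_zero.mp (ker_eq_zero_of_sum (D := D) h.neg ?_ ?_)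
  · rw [Matrix.mulVec_sub, hφ, h.ker_smul, sub_zero]
  · simp only [Pi.sub_apply, Finset.sum_sub_distrib, hs, h.sum_smul, sub_self]

theorem exists_left_null (h : D.Eigenvector lam ψ) : ∃ m, m ≠ 0 ∧ m ᵥ* D.Mat I lam = 0 :=
  Matrix.exists_vecMul_eq_zero_iff.mpr (Matrix.exists_mulVec_eq_zero_iff.mp ⟨ψ, h.ne_zero, h.ker⟩)

theorem evalAt_smul : D.evalAt I x lam 0 ((lam : ℂ) • ψ) = lam * D.evalAt I x lam 0 ψ := by
  rw [D.evalAt_eq I x lam 0 ((lam : ℂ) • ψ), D.evalAt_eq I x lam 0 ψ]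
  simp only [Pi.smul_apply, smul_eq_mul, zero_mul, zero_add, mul_assoc, Finset.mul_sum]

theorem phaseConst_eq (h : D.Eigenvector lam ψ) :
    phaseConst D.ε D.c D.z D.a lam ((lam : ℂ) • ψ) m
      = -(I * D.ε) / (2 * lam) - 1 / 2 * (∑ p, D.z p * ψ p) - I * D.ε / 2
        * ((∑ i, m i * deriv (fun μ => D.vec I μ i) lam) / (m ⬝ᵥ D.vec I lam)) := by
  have hlam : (lam : ℂ) ≠ 0 := by exact_mod_cast h.neg.ne
  have e : ∑ p, D.z p * ((lam : ℂ) • ψ) p = lam * ∑ p, D.z p * ψ p := by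
    simp only [Pi.smul_apply, smul_eq_mul, Finset.mul_sum, mul_left_comm]
  rw [phaseConst, vecb_ratio h.neg, e]
  congr 2
  field_simp

theorem isBigO_jostW (h : D.Eigenvector lam ψ) (hx : x ∈ closedUpper) (hm : m ≠ 0)
    (hm0 : m ᵥ* D.Mat I lam = 0) :
    (fun μ : ℂ => D.jostW x μ - (-(I * D.ε) * D.evalAt I x lam 0 ((lam : ℂ) • ψ) / (μ - lam)
      + (x + phaseConst D.ε D.c D.z D.a lam ((lam : ℂ) • ψ) m)
        * D.evalAt I x lam 0 ((lam : ℂ) • ψ))) =O[𝓝[≠] (lam : ℂ)] fun μ : ℂ => μ - lam := by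
  obtain ⟨q, hq, hq0, hq1, hqe⟩ := h.exists_laurent hx hm hm0
  rw [h.phaseConst_eq, evalAt_smul, ← hq0, ← hq1]
  refine (isBigO_inv_mul_sub hq).congr' ?_ EventuallyEq.rfl
  filter_upwards [hqe] with μ hμ
  rw [hμ]

/-- The numerator `q` of the expansion has the value `-iεΦ(x)` at the eigenvalue, so the order is
read off wherever the eigenfunction does not vanish. -/
theorem meromorphicOrderAt_jostW (h : D.Eigenvector lam ψ) (hx : x ∈ closedUpper)
    (h0 : D.evalAt I x lam 0 ((lam : ℂ) • ψ) ≠ 0) :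
    meromorphicOrderAt (D.jostW x) (lam : ℂ) = -1 := by
  obtain ⟨m, hm, hm0⟩ := h.exists_left_null
  obtain ⟨q, hq, hq0, -, hqe⟩ := h.exists_laurent hx hm hm0
  have hmer := meromorphicOn_jostW (D := D) hx lam (Or.inr h.re_neg)
  refine (meromorphicOrderAt_eq_int_iff (n := -1) hmer).mpr ⟨q, hq, ?_, ?_⟩
  · rw [hq0, ← evalAt_smul]
    exact mul_ne_zero (neg_ne_zero.mpr (mul_ne_zero I_ne_zero D.εc_ne)) h0
  · filter_upwards [hqe] with μ hμ
    rw [hμ, zpow_neg_one, smul_eq_mul]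

theorem exists_eigenfunction (h : D.Eigenvector lam ψ) : ∃ Φ : ℂ → ℂ,
    IsEigenfunction D.ε D.c D.z lam Φ ∧ IsNormalized Φ ∧
    (∀ x ∈ closedUpper ∩ G D.z, Φ x = PhiFormula D.ε D.c D.z D.a lam ((lam : ℂ) • ψ) x) ∧
    ∀ x ∈ closedUpper, Φ x = D.evalAt I x lam 0 ((lam : ℂ) • ψ) := by
  have hlam : (lam : ℂ) ≠ 0 := by exact_mod_cast h.neg.ne
  obtain ⟨w, hw, he⟩ := exists_globalSol_ker h.neg h.ker_smul
  refine ⟨w, hw.isEigenfunction h.neg he (smul_ne_zero hlam h.ne_zero), ?_,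
    fun x hx => hw.eq_PhiFormula h.neg he hx, fun x hx => hw.eq_evalAt he hx⟩
  have := tendsto_mul_wsol (Or.inl rfl) (im_mul_I_neg h.neg) he
  rwa [h.sum_smul, div_self hlam] at this

end Eigenvector

end Datum
end BOScattering
end
theorem corollary3p5 {P : ℕ} (ε : ℝ) (hε : 0 < ε) (c z : Fin P → ℂ)
    (hc : ∀ p, c p ≠ 0) (hz : ∀ p, 0 < (z p).im) (hre : StrictMono fun p => (z p).re)
    (hsum : ∑ p, (c p + conj (c p)) = 0)
    -- abscissae of the vertical ends of the contours, interlacing the branch cuts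
    (a : Fin (P + 1) → ℝ) (ha : ∀ p : Fin P, a p.castSucc < (z p).re ∧ (z p).re < a p.succ) :
    ∃ (M : ℝ → ℂ → ℂ) (W : ℂ → ℂ → ℂ),
      -- `M lam` is the Jost solution, for every `lam > 0`
      (∀ lam : ℝ, 0 < lam → BOScattering.IsJostM ε c z lam (M lam) ∧
        ∀ w : ℂ → ℂ, BOScattering.IsJostM ε c z lam w →
          EqOn w (M lam) BOScattering.closedUpper) ∧
      (∀ x ∈ BOScattering.closedUpper,
        -- `W(x; ·)` is meromorphic on the cut plane, with boundary value `M(x; ·)` from above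
        MeromorphicOn (W x) BOScattering.cutPlane ∧
        (∀ lam : ℝ, 0 < lam →
          Tendsto (W x) (𝓝[{μ : ℂ | 0 < μ.im}] (lam : ℂ)) (𝓝 (M lam x))) ∧
        -- and it is the only such function
        (∀ V : ℂ → ℂ, MeromorphicOn V BOScattering.cutPlane →
          (∀ lam : ℝ, 0 < lam →
            Tendsto V (𝓝[{μ : ℂ | 0 < μ.im}] (lam : ℂ)) (𝓝 (M lam x))) →
          ∀ μ ∈ BOScattering.cutPlane, ∀ᶠ ν in 𝓝[≠] μ, V ν = W x ν) ∧
        -- no singularities other than the eigenvalues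
        (∀ μ ∈ BOScattering.cutPlane,
          (∀ lam ∈ BOScattering.eigenvalues ε c z, (lam : ℂ) ≠ μ) → AnalyticAt ℂ (W x) μ)) ∧
      -- the Laurent expansion at each eigenvalue
      (∀ lam ∈ BOScattering.eigenvalues ε c z, ∃ (φ : Fin P → ℂ) (Φ : ℂ → ℂ),
        (BOScattering.matA ε c z a lam *ᵥ φ = 0 ∧ ∑ p, φ p = (lam : ℂ)) ∧
        (∀ φ' : Fin P → ℂ, BOScattering.matA ε c z a lam *ᵥ φ' = 0 → ∑ p, φ' p = (lam : ℂ) →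
          φ' = φ) ∧
        BOScattering.IsEigenfunction ε c z lam Φ ∧ BOScattering.IsNormalized Φ ∧
        (∀ x ∈ BOScattering.closedUpper ∩ BOScattering.G z,
          Φ x = BOScattering.PhiFormula ε c z a lam φ x) ∧
        (∃ m : Fin P → ℂ, m ≠ 0 ∧ m ᵥ* BOScattering.matA ε c z a lam = 0) ∧
        (∀ m : Fin P → ℂ, m ≠ 0 → m ᵥ* BOScattering.matA ε c z a lam = 0 →
          m ⬝ᵥ BOScattering.vecb ε c z a lam ≠ 0 ∧
          ∀ x ∈ BOScattering.closedUpper,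
            (fun μ : ℂ => W x μ - (-(I * (ε : ℂ)) * Φ x / (μ - (lam : ℂ))
              + (x + BOScattering.phaseConst ε c z a lam φ m) * Φ x))
              =O[𝓝[≠] (lam : ℂ)] (fun μ : ℂ => μ - (lam : ℂ))) ∧
        (∀ x ∈ BOScattering.closedUpper, Φ x ≠ 0 →
          meromorphicOrderAt (W x) (lam : ℂ) = -1)) := by
  let D : BOScattering.Datum P := ⟨ε, c, z, a, hε, hc, hz, hre, hsum, ha⟩
  -- The family is indexed by all real numbers; its members for `lam ≤ 0` are arbitrary.
  have hM : ∀ lam : ℝ, ∃ w : ℂ → ℂ, 0 < lam → BOScattering.IsJostM ε c z lam w ∧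
      ∀ x ∈ BOScattering.closedUpper, w x = D.sol (-1) x lam := fun lam => by
    by_cases hl : 0 < lam
    · obtain ⟨w, hw⟩ := BOScattering.Datum.exists_jost (D := D) hl
      exact ⟨w, fun _ => hw⟩
    · exact ⟨0, fun h => absurd h hl⟩
  choose M hM using hM
  refine ⟨M, D.jostW, fun lam hl => ⟨(hM lam hl).1, fun w hw =>
    BOScattering.Datum.jost_unique (D := D) hl hw (hM lam hl).1⟩, fun x hx => ?_, fun lam hlam => ?_⟩
  · refine ⟨BOScattering.Datum.meromorphicOn_jostW hx, fun lam hl => ?_, fun V hV hVt μ hμ => ?_,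
      fun μ hμ h => BOScattering.Datum.analyticAt_jostW (D := D) hx hμ h⟩
    · rw [(hM lam hl).2 x hx]
      exact BOScattering.Datum.tendsto_jostW hl
    · refine BOScattering.Datum.eq_jostW_of_tendsto hx hV (fun lam hl => ?_) hμ
      rw [← (hM lam hl).2 x hx]
      exact hVt lam hl
  · obtain ⟨ψ, h⟩ := BOScattering.Datum.exists_eigenvector (D := D) hlam
    obtain ⟨Φ, hΦ, hnorm, hform, heval⟩ := h.exists_eigenfunction
    have hR := fun φ => BOScattering.Datum.Mat_mulVec_eq_zero_iff (D := D) (φ := φ) h.neg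
    have hL := fun m => BOScattering.Datum.vecMul_Mat_eq_zero_iff (D := D) (m := m) h.neg
    refine ⟨(lam : ℂ) • ψ, Φ, ⟨(hR _).mp h.ker_smul, h.sum_smul⟩,
      fun φ' h1 h2 => h.eq_smul ((hR _).mpr h1) h2, hΦ, hnorm, hform, ?_, fun m hm hm0 => ⟨?_, ?_⟩, ?_⟩
    · obtain ⟨m, hm, hm0⟩ := h.exists_left_null
      exact ⟨m, hm, (hL m).mp hm0⟩
    · have := BOScattering.Datum.left_null_dot_ne_zero h.neg h.ker h.ne_zero hm ((hL m).mpr hm0)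
      rw [BOScattering.Datum.vec_I_eq h.neg, dotProduct_smul] at this
      exact right_ne_zero_of_smul this
    · intro x hx
      rw [heval x hx]
      exact h.isBigO_jostW hx hm ((hL m).mpr hm0)
    · intro x hx h0
      rw [heval x hx] at h0
      exact h.meromorphicOrderAt_jostW hx h0
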